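/- **Setting.** Let $n\ge 1$, and let $X$ be a smooth $n$-dimensional manifold with boundary. Near a boundary point fix local coordinates $x\ge 0$, $y\in\mathbb R^{n-1}$; write $x,y$ and $x',y'$ for their lifts to the left and right factor of $X^2$. Let $X^2_0=[X^2;\operatorname{diag}_{\partial X}]$ be the real blow-up of $X^2$ along the boundary diagonal $\{(p,p):p\in\partial X\}$, with boundary hypersurfaces $\mathrm{lb}$, $\mathrm{rb}$ (the lifts of $\partial X\times X$, $X\times\partial X$) and $\mathrm{ff}$ (the front face), and let $\operatorname{diag}_0\subset X^2_0$ be the lifted diagonal. For $m\in\mathbb R$, $\Psi_0^m(X)$ is the space of operators $P$ on 0-half-densities whose Schwartz kernel $$K_P(x,y,x',y')\,\Bigl|\tfrac{dx}{x}\tfrac{dy}{x^{n-1}}\tfrac{dx'}{x'}\tfrac{dy'}{x'^{\,n-1}}\Bigr|^{1/2}$$ lifts to $X_0^2$ to be conormal of order $m$ to $\operatorname{diag}_0$ (with symbols of type $(1,0)$), smoothly down to $\mathrm{ff}$, and vanishes to infinite order at $\mathrm{lb}\cup\mathrm{rb}$. Its principal symbol is an element of $S^m/S^{m-1}$ on the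 0-cotangent bundle ${}^0T^*X$, whose local frame is $\frac{dx}{x},\frac{dy^j}{x}$. With $s=x/x'$ and $\Upsilon=(y-y')/x'$, write $K_P=K_P^0(s,\Upsilon,x',y')$ and let $\widehat{K_P^0}(s,\eta,0,y_0)=\int e^{-i\Upsilon\cdot\eta}K_P^0(s,\Upsilon,0,y_0)\,d\Upsilon$ be the Fourier transform in $\Upsilon$ of the restriction of $K_P^0$ to the fiber of $\mathrm{ff}$ over the boundary point $(0,y_0)$. For $\hat\eta\in\mathbb S^{n-2}$, the *reduced normal operator* is the operator on b-half-densities on $[0,\infty]_t$ with Schwartz kernel $$\hat N(P,y_0,\hat\eta)(t,t')=\widehat{K_P^0}\Bigl(\frac t{t'},t'\hat\eta,0,y_0\Bigr)\Bigl|\frac{dt}{t}\frac{dt'}{t'}\Bigr|^{1/2}.$$ For $m,r\in\mathbb R$, let $S^{m,(0,r)}$ be the space of symbols $b(t,\sigma)$ of order $m$ in $\sigma$ which are smooth down to $t=0$ and conormal with weight $(t^{-1})^{-r}$ at $t=\infty$: for all $j,k$, $|\partial_t^j\partial_\sigma^k b|\lesssim(1+t)^{r-j}(1+|\sigma|)^{m-k}$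 on $t>0$; here $\sigma$ is the fiber coordinate of the b-scattering cotangent bundle relative to the frame $(1+t)\frac{dt}{t}$. The space $\Psi_{\mathrm b,\mathrm{sc}}^{m,(0,r)}([0,\infty])$ consists of the operators with kernels $$\Bigl(\chi(v)\,\frac{1+t'}{2\pi}\int_{\mathbb R} e^{i(1+t')v\sigma}b(t',\sigma)\,d\sigma+R(t,t')\Bigr)\Bigl|\frac{dt}{t}\frac{dt'}{t'}\Bigr|^{1/2},\qquad v=\frac{t-t'}{t'},$$ where $b\in S^{m,(0,r)}$, $\chi\in C_c^\infty((-1,\infty))$ equals $1$ near $0$, and $R$ is a smooth function of $(\tau,\rho)=\bigl(\frac{t-t'}{t+t'},t+t'\bigr)\in[-1,1]\times[0,\infty)$ vanishing to infinite order, with all derivatives, at $\tau=\pm1$ and as $\rho\to\infty$. (Equivalently: on the b-scattering double space the kernel is conormal of order $m$ to the lifted diagonal, smoothly down to the b-front face and with conormal behavior of weight $-r-1$ at the scattering front face, and it vanishes to infinite order at all other boundary hypersurfaces.) The principal symbol is the class of $b$ in $S^{m,(0,r)}/S^{m-1,(0,r-1)}$. The *indicial operator* is the operator whose kernel is the dilation-invariant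 extension $J(t/t')|\frac{dt}{t}\frac{dt'}{t'}|^{1/2}$ of the restriction $J$ of the kernel to the b-front face over $t=t'=0$, i.e. the value at $t'=0$ of the kernel as a function of $(t/t',t')$. **Proposition 2.9** (Reduced normal operator for the small 0-calculus). Let $P\in\Psi_0^m(X)$. Then, for $y_0$ in the boundary part of the coordinate chart and $\hat\eta\in\mathbb S^{n-2}$: 1. $\hat N(P,y_0,\hat\eta)$ is well-defined and lies in $\Psi_{\mathrm b,\mathrm{sc}}^{m,(0,m)}([0,\infty])$, with smooth dependence on $(y_0,\hat\eta)$; that is, locally in the parameters, the data $b$ and $R$ can be chosen to depend smoothly on $(y_0,\hat\eta)$ with respect to the seminorms of the spaces above. 2. If the principal symbol of $P$ is elliptic on the fiber ${}^0T^*_{(0,y_0)}X$, then $\hat N(P,y_0,\hat\eta)$ is elliptic for every $\hat\eta$, including at $t=\infty$: its principal symbol in $S^{m,(0,m)}/S^{m-1,(0,m-1)}$ has an inverse in $S^{-m,(0,-m)}/S^{-m-1,(0,-m-1)}$. 3. The indicial operator of $\hat N(P,y_0,\hat\eta)$ at $t=0$ is independent of $\hat\eta\in\mathbb S^{n-2}$.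 -/

import Mathlib

open Set Filter Topology MeasureTheory
open scoped ContDiff Manifold Distributions

noncomputable section

namespace ZeroCalculus

/-! ## Distributions and coordinates -/

section Distributions

variable {W : Type*} [NormedAddCommGroup W] [NormedSpace ℝ W]

/-- Complex distributions on an open set: continuous `ℂ`-linear functionals on the space of
smooth, compactly supported, complex-valued functions (with its LF topology). -/
abbrev CDistr (Ω : TopologicalSpace.Opens W) : Type _ := 𝓓(Ω, ℂ) →L[ℂ] ℂ

open Classical in
/-- The pairing of a distribution on `Ω` with a plain function. It is the honest pairing if the
function is a test function on `Ω`; otherwise the value is `0` and has no significance. -/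
def CDistr.pair {Ω : TopologicalSpace.Opens W} (T : CDistr Ω) (f : W → ℂ) : ℂ :=
  if h : ContDiff ℝ ∞ f ∧ HasCompactSupport f ∧ tsupport f ⊆ Ω then
    T ⟨f, h.1, h.2.1, h.2.2⟩ else 0

end Distributions

/-- `ℝ^d`, in which the tangential variables `y` and the dual variables `η` live. -/
abbrev Tan (d : ℕ) : Type := EuclideanSpace ℝ (Fin d)

/-- `ℝ^n` with `n = d + 1`; a point `z` has coordinates `x = z 0` and `y = tail z`. -/
abbrev Amb (d : ℕ) : Type := EuclideanSpace ℝ (Fin (d + 1))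

/-- The point `(x, y)` of `ℝ × ℝ^d = ℝ^n`. -/
def pt {d : ℕ} (x : ℝ) (y : Tan d) : Amb d :=
  WithLp.toLp 2 (Fin.cons (α := fun _ => ℝ) x (fun j => y j))

/-- The tangential component `y` of `z = (x, y)`. -/
def tail {d : ℕ} (z : Amb d) : Tan d := WithLp.toLp 2 (fun j => z j.succ)

/-- The open half line `(0, ∞)`. -/
def posLine : TopologicalSpace.Opens ℝ := ⟨Ioi 0, isOpen_Ioi⟩

/-- The open quadrant `(0, ∞) × (0, ∞)`, the interior of the square of `[0, ∞]`. -/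
def quadrant : TopologicalSpace.Opens (ℝ × ℝ) := ⟨Ioi 0 ×ˢ Ioi 0, isOpen_Ioi.prod isOpen_Ioi⟩

/-- The open half space `{(s, Υ) : s > 0}`: the interior of a fiber of the 0-front face in the
coordinates `s = x / x'`, `Υ = (y - y') / x'`. -/
def openHalf (d : ℕ) : TopologicalSpace.Opens (Amb d) :=
  ⟨{v | 0 < v 0}, isOpen_lt continuous_const (by fun_prop)⟩

/-! ## 0-half-density kernels on a manifold with boundary -/

section Manifold

variable (d : ℕ) (X : Type*) [TopologicalSpace X] [ChartedSpace (EuclideanHalfSpace (d + 1)) X]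

/-- The smooth local coordinate systems `(x, y)`, `x ≥ 0`, `y ∈ ℝ^d`, on `X`. -/
abbrev Coords : Type _ :=
  {φ : OpenPartialHomeomorph X (EuclideanHalfSpace (d + 1)) //
    φ ∈ IsManifold.maximalAtlas (𝓡∂ (d + 1)) ∞ X}

variable {d X}

/-- The coordinate map, as a partial bijection between `X` and `ℝ^n`. -/
def Coords.ext (φ : Coords d X) : PartialEquiv X (Amb d) := φ.1.extend (𝓡∂ (d + 1))

/-- The coordinate image of the interior of `X`: the points of the target with `x > 0`. -/
def Coords.inter (φ : Coords d X) : TopologicalSpace.Opens (Amb d) :=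
  ⟨interior φ.ext.target, isOpen_interior⟩

/-- The coordinate image, in `X° × X°`, of a product of two coordinate systems. -/
def Coords.inter₂ (φ ψ : Coords d X) : TopologicalSpace.Opens (Amb d × Amb d) :=
  ⟨(φ.inter : Set (Amb d)) ×ˢ (ψ.inter : Set (Amb d)), φ.inter.isOpen.prod ψ.inter.isOpen⟩

/-- The points `y ∈ ℝ^d` such that `(0, y)` are the coordinates of a point of `∂X`. -/
def Coords.bdry (φ : Coords d X) : Set (Tan d) := {y | pt 0 y ∈ φ.ext.target}

/-- The change of coordinates `z' ↦ z` from the coordinates `φ'` to the coordinates `φ`. -/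
def transition (φ φ' : Coords d X) : Amb d → Amb d := φ.ext ∘ φ'.ext.symm

/-- The factor `(|∂z / ∂z'| (x / x')^n)^{1/2}`, where `z = (x, y)` and `z' = (x', y')` are the
coordinates of a point in the systems `φ` and `φ'`. -/
def halfDensityFactor (φ φ' : Coords d X) (z' : Amb d) : ℝ :=
  Real.sqrt (|(fderiv ℝ (transition φ φ') z').det| * (transition φ φ' z' 0 / z' 0) ^ (d + 1))

variable (d X)

/-- A distributional section over `X° × X°` of the bundle `π_L^*(⁰Ω^{1/2}) ⊗ π_R^*(⁰Ω^{1/2})`,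
i.e. the Schwartz kernel of an operator acting on 0-half-densities on `X`. For coordinates `φ` on
the left and `ψ` on the right factor, with `n = d + 1`, it is
`K(x, y, x', y') |dx/x dy/x^(n-1) dx'/x' dy'/x'^(n-1)|^{1/2}`; the distribution `dist φ ψ` is the
coefficient `K`, paired with test functions as `∫ K f dx dy dx' dy'`. The field `compat` is the
transformation law of the coefficients of such a section: when the left coordinates change
from `φ` to `φ'`, the coefficient is multiplied by `(|∂z / ∂z'| (x' / x)^n)^{1/2}`, which is
written here on the side of the test functions; likewise on the right. -/
structure ZeroKernel where
  dist : ∀ φ ψ : Coords d X, CDistr (φ.inter₂ ψ)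
  compat : ∀ (φ φ' ψ ψ' : Coords d X) (f : 𝓓(φ.inter₂ ψ, ℂ)) (f' : 𝓓(φ'.inter₂ ψ', ℂ)),
    (∀ p ∈ tsupport f, φ.ext.symm p.1 ∈ φ'.1.source ∧ ψ.ext.symm p.2 ∈ ψ'.1.source) →
    (∀ p ∈ tsupport f', φ'.ext.symm p.1 ∈ φ.1.source ∧ ψ'.ext.symm p.2 ∈ ψ.1.source) →
    (∀ p ∈ φ'.inter₂ ψ', φ'.ext.symm p.1 ∈ φ.1.source → ψ'.ext.symm p.2 ∈ ψ.1.source →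
      f' p = (halfDensityFactor φ φ' p.1 * halfDensityFactor ψ ψ' p.2 : ℝ) *
        f (transition φ φ' p.1, transition ψ ψ' p.2)) →
    dist φ' ψ' f' = dist φ ψ f

end Manifold

/-! ## 0-pseudodifferential operators -/

section ZeroPsdo

variable {d : ℕ}

/-- Symbols `a(w, ζ)` of order `m` (of type `(1, 0)`), with smooth dependence on `w`. -/
def IsSymbol (m : ℝ) (a : Amb d × Amb d → ℂ) : Prop :=
  ContDiff ℝ ∞ a ∧ ∀ j k : ℕ, ∃ C : ℝ, ∀ w ζ : Amb d,
    ‖iteratedFDeriv ℝ k (fun ζ' => iteratedFDeriv ℝ j (fun w' => a (w', ζ')) w) ζ‖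
      ≤ C * (1 + ‖ζ‖) ^ (m - k)

/-- For `z = (x, y)` and `w = (x', y')`, the defining function
`r = (x² + |y - y'|² + x'²)^{1/2}` of the front face of the 0-double space, which is the real
blow-up of `X²` along `∂diag = {x = x' = 0, y = y'}`. -/
def radius (z w : Amb d) : ℝ := Real.sqrt (‖z - pt 0 (tail w)‖ ^ 2 + w 0 ^ 2)

/-- A function written in polar coordinates around the boundary diagonal:
`H(r, y', (x, y - y') / r, x' / r)`. If `H` is smooth, this is a smooth function on the 0-double
space, in a neighborhood of the front face and of the 0-diagonal, and every smooth function
there is locally of this form. -/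
def polarFun (H : ℝ × Tan d × Amb d × ℝ → ℂ) (z w : Amb d) : ℂ :=
  H (radius z w, tail w, (radius z w)⁻¹ • (z - pt 0 (tail w)), w 0 / radius z w)

/-- `H` is smooth, and vanishes to infinite order at `lb` (where `x / r = 0`) and at `rb`
(where `x' / r = 0`); the latter is expressed by saying that the extension by `0` across
`x / r = 0` and across `x' / r = 0` is smooth. -/
def IsSmoothVanishing (H : ℝ × Tan d × Amb d × ℝ → ℂ) : Prop :=
  ContDiff ℝ ∞ H ∧ ∀ (r : ℝ) (y : Tan d) (p : Amb d) (p' : ℝ),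
    (p 0 ≤ 0 ∨ p' ≤ 0) → H (r, y, p, p') = 0

/-- The distribution `T` on an open subset of `{(z, w) : x, x' > 0}` is, over a neighborhood of
the diagonal point `(w₀, w₀)`, an element of `I^m` for the 0-diagonal with symbol `a`, and vanishes
to infinite order at `lb ∪ rb`. Near the 0-diagonal one has the coordinates
`w = (x', y')` and `u = (z - w) / x' = (x / x' - 1, (y - y') / x')` on the 0-double space, in which
the 0-diagonal is `{u = 0}`. The condition is that over this neighborhood
`T = (2π)^(-n) χ(u) ∫ exp(i u·ζ) a(w, ζ) dζ + G`, where `χ` is a cutoff (near `u = 0`, supported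
away from `lb` and from infinity) and `G` is smooth on the 0-double space, all the way down to
the front face, and vanishes to infinite order at `lb ∪ rb`. If `w₀` is a boundary point, this is
a condition over a neighborhood of the whole (compact) fiber of the front face over `w₀`. -/
def IsConormalNear (m : ℝ) {Ω : TopologicalSpace.Opens (Amb d × Amb d)} (T : CDistr Ω)
    (w₀ : Amb d) (a : Amb d × Amb d → ℂ) : Prop :=
  IsSymbol m a ∧
  ∃ ε > (0 : ℝ), ∃ (χ : Amb d → ℝ) (H : ℝ × Tan d × Amb d × ℝ → ℂ),
    (ContDiff ℝ ∞ χ ∧ HasCompactSupport χ ∧ tsupport χ ⊆ {u | -1 < u 0} ∧ χ =ᶠ[𝓝 0] 1) ∧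
    IsSmoothVanishing H ∧
    ∀ f : 𝓓(Ω, ℂ), tsupport f ⊆ Metric.ball w₀ ε ×ˢ Metric.ball w₀ ε →
      T f = ((2 * Real.pi : ℝ) : ℂ)⁻¹ ^ (d + 1) *
          (∫ w : Amb d, ((w 0 ^ (d + 1) : ℝ) : ℂ) *
            ∫ ζ : Amb d, a (w, ζ) *
              ∫ u : Amb d, Complex.exp (Complex.I * (inner ℝ u ζ : ℝ)) * (χ u : ℂ) *
                f (w + w 0 • u, w))
        + ∫ p : Amb d × Amb d, polarFun H p.1 p.2 * f p

/-- Near the point `(z₀, w₀)`, away from the diagonal, the distribution `T` is a smooth function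
which vanishes to infinite order at `x = 0` and at `x' = 0` (i.e. its extension by `0` to
`x ≤ 0` and to `x' ≤ 0` is smooth). -/
def IsSmoothVanishingNear {Ω : TopologicalSpace.Opens (Amb d × Amb d)} (T : CDistr Ω)
    (z₀ w₀ : Amb d) : Prop :=
  ∃ ε > (0 : ℝ), ∃ k : Amb d × Amb d → ℂ, ContDiff ℝ ∞ k ∧
    (∀ z w : Amb d, (z 0 ≤ 0 ∨ w 0 ≤ 0) → k (z, w) = 0) ∧
    ∀ f : 𝓓(Ω, ℂ), tsupport f ⊆ Metric.ball z₀ ε ×ˢ Metric.ball w₀ ε →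
      T f = ∫ p : Amb d × Amb d, k p * f p

variable {X : Type*} [TopologicalSpace X] [ChartedSpace (EuclideanHalfSpace (d + 1)) X]

/-- Membership in the small 0-calculus of order `m`: the Schwartz kernel is conormal of
order `m` to the 0-diagonal of the 0-double space, smoothly down to the front face, and vanishes to
infinite order at `lb ∪ rb`. -/
def ZeroKernel.IsZeroPsdo (m : ℝ) (P : ZeroKernel d X) : Prop :=
  (∀ (φ : Coords d X), ∀ w₀ ∈ φ.ext.target,
    ∃ a, IsConormalNear m (P.dist φ φ) w₀ a) ∧
  (∀ (φ ψ : Coords d X), ∀ p ∈ φ.1.source, ∀ q ∈ ψ.1.source, p ≠ q →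
    IsSmoothVanishingNear (P.dist φ ψ) (φ.ext p) (ψ.ext q))

/-- Ellipticity of the principal symbol on the fiber of the 0-cotangent bundle over the boundary
point with coordinates `(0, y₀)`: the class of `ζ ↦ a((0, y₀), ζ)` in `S^m / S^(m-1)` is
elliptic. Here `ζ = (ξ, η)` stands for the covector `ξ dx/x + η·dy/x`. -/
def ZeroKernel.IsEllipticAt (m : ℝ) (P : ZeroKernel d X) (φ : Coords d X) (y₀ : Tan d) : Prop :=
  ∃ a, IsConormalNear m (P.dist φ φ) (pt 0 y₀) a ∧
    ∃ c > (0 : ℝ), ∃ C : ℝ, ∀ ζ : Amb d, C ≤ ‖ζ‖ → c * (1 + ‖ζ‖) ^ m ≤ ‖a (pt 0 y₀, ζ)‖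

end ZeroPsdo

/-! ## The reduced normal operator -/

section Normal

variable {d : ℕ} {X : Type*} [TopologicalSpace X] [ChartedSpace (EuclideanHalfSpace (d + 1)) X]

/-- `N` is the restriction of the Schwartz kernel `K` of `P` (in the coordinates `φ`) to the fiber
of the front face over the boundary point `(0, y₀)`. In the coordinates
`s = x / x'`, `Υ = (y - y') / x'`, `x'`, `y'`, the kernel is `K⁰(s, Υ, x', y')`, and `N` is
`K⁰(s, Υ, 0, y₀)`: tested against `g(s, Υ)`, it is the limit of the averages
`∫ K⁰(s, Υ, x', y') g(s, Υ) h(x', y') ds dΥ dx' dy'` as the support of the nonnegative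
function `h` on `{x' > 0}`, of total integral `1`, shrinks to the point `(0, y₀)`. (The factor
`x'^(-n)` is the Jacobian in `ds dΥ = x'^(-n) dx dy`.) -/
def IsNormalKernel (P : ZeroKernel d X) (φ : Coords d X) (y₀ : Tan d)
    (N : CDistr (openHalf d)) : Prop :=
  ∀ g : 𝓓(openHalf d, ℂ), ∀ ε > (0 : ℝ), ∃ δ > (0 : ℝ), ∀ h : Amb d → ℝ,
    ContDiff ℝ ∞ h → HasCompactSupport h → (∀ w, 0 ≤ h w) → ∫ w, h w = 1 →
    tsupport h ⊆ Metric.ball (pt 0 y₀) δ ∩ {w | 0 < w 0} →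
    ‖(P.dist φ φ).pair (fun p =>
        g (pt (p.1 0 / p.2 0) ((p.2 0)⁻¹ • (tail p.1 - tail p.2))) *
          (h p.2 * (p.2 0)⁻¹ ^ (d + 1) : ℝ)) - N g‖ < ε

/-- `F` is the Fourier transform in `Υ` of the distribution `N(s, Υ)`, at the frequency `η`:
`F(s) = ∫ exp(-i Υ·η) N(s, Υ) dΥ`. The integral is over all of `ℝ^d`, and defined as the
limit obtained from cutoffs `χ(Υ / R)` as `R → ∞`. -/
def IsFiberFourier (N : CDistr (openHalf d)) (η : Tan d) (F : CDistr posLine) : Prop :=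
  ∀ (g : 𝓓(posLine, ℂ)) (χ : Tan d → ℝ), ContDiff ℝ ∞ χ → HasCompactSupport χ → χ =ᶠ[𝓝 0] 1 →
    Tendsto (fun R : ℝ => N.pair (fun v =>
      g (v 0) * Complex.exp (-Complex.I * (inner ℝ (tail v) η : ℝ)) * (χ (R⁻¹ • tail v) : ℂ)))
      atTop (𝓝 (F g))

/-- `κ` is the distribution `F_{t'}(t / t')` on `(0, ∞)²`, where `F_{t'}` are distributions
of `s ∈ (0, ∞)` depending on the parameter `t'`. -/
def IsRatioKernel (F : ℝ → CDistr posLine) (κ : CDistr quadrant) : Prop :=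
  ∀ ψ : 𝓓(quadrant, ℂ),
    κ ψ = ∫ t' in Ioi (0 : ℝ), (t' : ℂ) * (F t').pair (fun s => ψ (s * t', t'))

/-- `κ(t, t') |dt/t dt'/t'|^{1/2}` is the Schwartz kernel of the reduced normal operator of `P` at
`(y₀, η)`: if `K̂(s, η)` denotes the Fourier transform in `Υ` of the restriction
`N(s, Υ)` of the kernel of `P` to the fiber of the front face over `(0, y₀)`,
then `κ(t, t') = K̂(t / t', t' η)`. -/
def IsReducedNormalOperator (P : ZeroKernel d X) (φ : Coords d X) (y₀ η : Tan d)
    (κ : CDistr quadrant) : Prop :=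
  ∃ N : CDistr (openHalf d), IsNormalKernel P φ y₀ N ∧
    ∃ F : ℝ → CDistr posLine, (∀ t' > 0, IsFiberFourier N (t' • η) (F t')) ∧ IsRatioKernel F κ

end Normal

/-! ## b-scattering pseudodifferential operators on `[0, ∞]`

Distributions `κ` on `(0, ∞)²` represent the operators on b-half-densities on `[0, ∞]` with
Schwartz kernels `κ(t, t') |dt/t dt'/t'|^{1/2}`. -/

section BSc

/-- Symbols of class `S^{m,(0,r)}` on the b-scattering cotangent bundle of `[0, ∞]`: of order `m` in
the fiber variable `σ`, smooth down to `t = 0`, and conormal with weight `(1/t)^(-r)` at `t = ∞`.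
Here `σ` is the fiber coordinate with respect to the frame `(1 + t) dt/t`, which is a smooth
positive multiple of `dt/t` near `t = 0` and of `dt` near `t = ∞`. (Smoothness down to `t = 0`
amounts to the boundedness of all `t`-derivatives as `t → 0`.) -/
def IsBscSymbol (m r : ℝ) (b : ℝ → ℝ → ℂ) : Prop :=
  ContDiffOn ℝ ∞ (fun q : ℝ × ℝ => b q.1 q.2) (Ioi 0 ×ˢ univ) ∧
  ∀ j k : ℕ, ∃ C : ℝ, ∀ t > 0, ∀ σ : ℝ,
    ‖iteratedDeriv j (fun t' => iteratedDeriv k (b t') σ) t‖ * (1 + t) ^ j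
      ≤ C * ((1 + t) ^ r * (1 + |σ|) ^ (m - k))

/-- A function on `(0, ∞)²` in the coordinates `τ = (t - t') / (t + t')`, `ρ = t + t'`. -/
def inTauRho (R : ℝ → ℝ → ℂ) (τ ρ : ℝ) : ℂ := R (ρ * (1 + τ) / 2) (ρ * (1 - τ) / 2)

/-- Smooth kernels on the b-scattering double space vanishing to infinite order at all boundary
hypersurfaces except the b-front face over `(0, 0)`, down to which they are smooth. Equivalently,
they are smooth functions of `(τ, ρ) ∈ [-1, 1] × [0, ∞)` vanishing to infinite order at
`τ = ±1` and as `ρ → ∞`. -/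
def IsBscResidual (R : ℝ → ℝ → ℂ) : Prop :=
  ContDiffOn ℝ ∞ (fun q : ℝ × ℝ => inTauRho R q.1 q.2) (Ioo (-1) 1 ×ˢ Ioi 0) ∧
  ∀ j N : ℕ, ∃ C : ℝ, ∀ τ ∈ Ioo (-1 : ℝ) 1, ∀ ρ > 0,
    ‖iteratedFDeriv ℝ j (fun q : ℝ × ℝ => inTauRho R q.1 q.2) (τ, ρ)‖
      ≤ C * ((1 - τ ^ 2) / (1 + ρ)) ^ N

/-- Cutoff functions of `v = (t - t') / t'`, localizing near the diagonal `v = 0`. -/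
def IsRatioCutoff (χ : ℝ → ℝ) : Prop :=
  ContDiff ℝ ∞ χ ∧ HasCompactSupport χ ∧ tsupport χ ⊆ Ioi (-1) ∧ χ =ᶠ[𝓝 0] 1

/-- `κ(t, t') = χ(v) (1 + t') (2π)⁻¹ ∫ exp(i (1 + t') v σ) b(t', σ) dσ + R(t, t')`, where
`v = (t - t') / t'`, as distributions on `(0, ∞)²`. (Note that `(1 + t') v = (t - t')(1 + t') / t'`
is the variable dual to `σ`; it is comparable to `(t - t') / t'` near the b-front face and to
`t - t'` near the scattering front face. The factor `1 + t'` comes from comparing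
`|dt/t dt'/t'|^{1/2}` with the b-scattering half-densities; in the integral below there
is another factor `t'`, since `dt = t' dv`.) -/
def IsBscQuantization (χ : ℝ → ℝ) (b : ℝ → ℝ → ℂ) (R : ℝ → ℝ → ℂ) (κ : CDistr quadrant) : Prop :=
  ∀ ψ : 𝓓(quadrant, ℂ),
    κ ψ = ((2 * Real.pi : ℝ) : ℂ)⁻¹ *
        (∫ t' in Ioi (0 : ℝ), ((t' * (1 + t') : ℝ) : ℂ) *
          ∫ σ : ℝ, b t' σ *
            ∫ v : ℝ, Complex.exp (Complex.I * ((1 + t') * v * σ : ℝ)) * (χ v : ℂ) *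
              ψ (t' + t' * v, t'))
      + ∫ q in (Ioi 0 ×ˢ Ioi 0 : Set (ℝ × ℝ)), R q.1 q.2 * ψ q

/-- `κ` is a weighted b-scattering pseudodifferential operator of class `Ψ_{b,sc}^{m,(0,r)}` with
full symbol `b`; the class of `b` in `S^{m,(0,r)} / S^{m-1,(0,r-1)}` is its principal symbol. -/
def HasBscSymbol (m r : ℝ) (κ : CDistr quadrant) (b : ℝ → ℝ → ℂ) : Prop :=
  IsBscSymbol m r b ∧
    ∃ χ R, IsRatioCutoff χ ∧ IsBscResidual R ∧ IsBscQuantization χ b R κ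

/-- Membership in `Ψ_{b,sc}^{m,(0,r)}([0, ∞])`: on the b-scattering double space, the kernel is
conormal of order `m` to the lifted diagonal, smoothly down to the b-front face and with conormal
behavior of weight `-r-1` at the scattering front face, and it vanishes to infinite order at the
remaining boundary hypersurfaces. -/
def IsBscPsdo (m r : ℝ) (κ : CDistr quadrant) : Prop := ∃ b, HasBscSymbol m r κ b

/-- Ellipticity in `Ψ_{b,sc}^{m,(0,r)}`: the principal symbol is invertible, i.e. its
class in `S^{m,(0,r)} / S^{m-1,(0,r-1)}` has an inverse in `S^{-m,(0,-r)} / S^{-m-1,(0,-r-1)}`.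
This includes ellipticity at `t = ∞`, for all (finite) `σ`. -/
def IsBscElliptic (m r : ℝ) (κ : CDistr quadrant) : Prop :=
  ∃ b, HasBscSymbol m r κ b ∧
    ∃ e, IsBscSymbol (-m) (-r) e ∧ IsBscSymbol (-1) (-1) (fun t σ => b t σ * e t σ - 1)

variable {Θ : Type*} [NormedAddCommGroup Θ] [NormedSpace ℝ Θ]

/-- Families of symbols of class `S^{m,(0,r)}` depending smoothly on `θ ∈ O`, uniformly. -/
def IsBscSymbolFamily (m r : ℝ) (O : Set Θ) (b : Θ → ℝ → ℝ → ℂ) : Prop :=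
  ContDiffOn ℝ ∞ (fun q : Θ × ℝ × ℝ => b q.1 q.2.1 q.2.2) (O ×ˢ (Ioi 0 ×ˢ univ)) ∧
  ∀ i j k : ℕ, ∃ C : ℝ, ∀ θ ∈ O, ∀ t > 0, ∀ σ : ℝ,
    ‖iteratedFDeriv ℝ i
        (fun θ' => iteratedDeriv j (fun t' => iteratedDeriv k (b θ' t') σ) t) θ‖ * (1 + t) ^ j
      ≤ C * ((1 + t) ^ r * (1 + |σ|) ^ (m - k))

/-- Families of residual kernels depending smoothly on `θ ∈ O`, uniformly. -/
def IsBscResidualFamily (O : Set Θ) (R : Θ → ℝ → ℝ → ℂ) : Prop :=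
  ContDiffOn ℝ ∞ (fun q : Θ × ℝ × ℝ => inTauRho (R q.1) q.2.1 q.2.2)
    (O ×ˢ (Ioo (-1) 1 ×ˢ Ioi 0)) ∧
  ∀ j N : ℕ, ∃ C : ℝ, ∀ θ ∈ O, ∀ τ ∈ Ioo (-1 : ℝ) 1, ∀ ρ > 0,
    ‖iteratedFDeriv ℝ j (fun q : Θ × ℝ × ℝ => inTauRho (R q.1) q.2.1 q.2.2) (θ, τ, ρ)‖
      ≤ C * ((1 - τ ^ 2) / (1 + ρ)) ^ N

/-- The operators `κ θ ∈ Ψ_{b,sc}^{m,(0,r)}` depend smoothly on the parameter `θ` ranging over a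
submanifold `A` of a vector space: near every point of `A` they are the restriction to `A` of
a smooth family defined in an open subset of the vector space, smoothness being measured in
the topology of `Ψ_{b,sc}^{m,(0,r)}`, i.e. by the seminorms of symbols and residual kernels. -/
def IsSmoothBscFamily (m r : ℝ) (A : Set Θ) (κ : Θ → CDistr quadrant) : Prop :=
  ∀ θ₀ ∈ A, ∃ O : Set Θ, IsOpen O ∧ θ₀ ∈ O ∧
    ∃ (χ : ℝ → ℝ) (b : Θ → ℝ → ℝ → ℂ) (R : Θ → ℝ → ℝ → ℂ),
      IsRatioCutoff χ ∧ IsBscSymbolFamily m r O b ∧ IsBscResidualFamily O R ∧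
      ∀ θ ∈ O ∩ A, IsBscQuantization χ (b θ) (R θ) (κ θ)

/-- `J` is the restriction of `κ` to the b-front face over `(0, 0)`. In the coordinates
`s = t / t'`, `t'`, the kernel is `k(s, t')`, and `J` is `k(s, 0)`: tested against `g(s)`, it is
the limit of the averages `∫ k(s, t') g(s) h(t') ds dt'` as the support of the nonnegative
function `h` on `(0, ∞)`, of total integral `1`, shrinks to `0`. -/
def IsBFrontFaceRestriction (κ : CDistr quadrant) (J : CDistr posLine) : Prop :=
  ∀ g : 𝓓(posLine, ℂ), ∀ ε > (0 : ℝ), ∃ δ > (0 : ℝ), ∀ h : ℝ → ℝ,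
    ContDiff ℝ ∞ h → HasCompactSupport h → (∀ t, 0 ≤ h t) → ∫ t, h t = 1 →
    tsupport h ⊆ Ioo 0 δ →
    ‖κ.pair (fun q => g (q.1 / q.2) * (h q.2 * q.2⁻¹ : ℝ)) - J g‖ < ε

/-- `I` is (the kernel of) the indicial operator of `κ`: the dilation-invariant extension `J(t / t')`
of the restriction `J` of `κ` to the b-front face. -/
def IsIndicialOperator (κ I : CDistr quadrant) : Prop :=
  ∃ J : CDistr posLine, IsBFrontFaceRestriction κ J ∧ IsRatioKernel (fun _ => J) I

end BSc

end ZeroCalculus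

end

open ZeroCalculus

set_option maxSynthPendingDepth 3

namespace ZeroCalculus

/-! ### Symbol estimates with variable units of length -/

section SymbolClass

variable {E E' F F' G : Type*} [NormedAddCommGroup E] [NormedSpace ℝ E]
  [NormedAddCommGroup E'] [NormedSpace ℝ E'] [NormedAddCommGroup F] [NormedSpace ℝ F]
  [NormedAddCommGroup F'] [NormedSpace ℝ F'] [NormedAddCommGroup G] [NormedSpace ℝ G]

/-! Over a boundary point (0, y), with v = (s, Υ), u = v - (1, 0) and ⟨v⟩ = (1 + |v|²)^{1/2}, the
kernel on the fiber of the front face is N(v) = (2π)⁻ⁿ χ(u) ∫ exp(i u·ζ) a((0, y), ζ) dζ + k(v),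
where k(v) = H(0, y, v/⟨v⟩, 1/⟨v⟩). It is the value at w = (0, y) of a family of distributions in v
which is continuous in w, so averages over w near (0, y) converge to it
(`isNormalKernel_of_frontPairing`). Every step in the definition of the reduced normal operator is a
limit or an integral, hence the operator is unique.

Now take the Fourier transform in Υ at the frequency η. Multiplication by χ averages the symbol: if
A is the average of the translates of a against (2π)⁻ⁿ times the Fourier transform of χ
(`avgSymbol`), the first term becomes (2π)⁻¹ ∫ exp(i (s - 1) ξ) A((0, y), (ξ, η)) dξ
(`integral_symbol_oscInt_cutoff`), and a cutoff χ₁(s - 1) equal to 1 on the projection of the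
support of χ can be inserted for free. Replacing η by t'η and substituting ξ = (1 + t')σ gives the
full symbol b(t', σ) = A((0, y), ((1 + t')σ, t'η)).

As long as |η| is bounded above and below, 1 + |((1 + t)σ, tη)| is comparable to (1 + t)(1 + |σ|).
Thus order m in ζ turns into order m in σ and weight m at t = ∞. Moreover, steps of size 1 + t in t,
1 + |σ| in σ and 1 in (y, η) move ζ by O((1 + t)(1 + |σ|)), which gives all symbol estimates,
smoothly in the parameters (`IsJointSymbol.symbolOn_reducedSymbol`).

The remainder is the partial Fourier transform of k at s = t/t', with frequency t'η. In the
variables τ, ρ, and with Υ = 2V/(1 - τ), it is a power of 2/(1 - τ) times ∫ K exp(-i ρ V·η) dV. The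
vanishing of H at lb and rb makes the amplitude K vanish to infinite order at τ = ±1 and as V → ∞.
Nothing happens at ρ = 0, and integration by parts along η·∂_V gains powers of ρ⁻¹ because η ≠ 0
(`rho_mul_flatIntegral`, `IsFlatAmplitude.isBscResidualFamily`).

For ellipticity, χ(0) = 1 forces A - a to have order m - 1, so A is elliptic over (0, y) if a is. It
has a parametrix E with AE - 1 of order -1 (`IsJointSymbol.exists_parametrix`), and the substitution
that produces b from A produces from E an inverse of b. Finally, at t' = 0 the frequency t'η is 0
whatever η is, so the indicial operator does not see η. -/

theorem iteratedFDeriv_comp_affine {f : E → F} {x : E} {n : ℕ} (hf : ContDiffAt ℝ n f x)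
    (S : E' →L[ℝ] E) :
    iteratedFDeriv ℝ n (fun z => f (x + S z)) 0 =
      (iteratedFDeriv ℝ n f x).compContinuousLinearMap fun _ => S := by
  obtain ⟨u, hu, hfu⟩ := hf.contDiffOn le_rfl (by simp)
  obtain ⟨v, hvu, hv, hxv⟩ := mem_nhds_iff.1 hu
  set s : Set E := (fun z => x + z) ⁻¹' v with hs
  have hso : IsOpen s := hv.preimage (by fun_prop)
  have hfs : ContDiffOn ℝ n (fun z => f (x + z)) s :=
    (hfu.mono hvu).comp (by fun_prop) (fun z hz => hz)
  have h0 : (S 0 : E) ∈ s := by simpa [hs] using hxv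
  have hs' : IsOpen (S ⁻¹' s) := hso.preimage S.continuous
  have key := S.iteratedFDerivWithin_comp_right hfs hso.uniqueDiffOn hs'.uniqueDiffOn h0 le_rfl
  rw [iteratedFDerivWithin_of_isOpen n hso h0, iteratedFDerivWithin_of_isOpen n hs' h0,
    iteratedFDeriv_comp_add_left] at key
  simpa [Function.comp_def] using key

theorem compContinuousLinearMap_const_id {k : ℕ} (T : E [×k]→L[ℝ] F) :
    T.compContinuousLinearMap (fun _ => ContinuousLinearMap.id ℝ E) = T := by
  ext; rfl

/-- Derivative bounds in a variable unit of length: `f` is smooth on `U`, and its derivatives at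
`x ∈ U`, evaluated on the images under `S x` of unit vectors, are bounded by multiples of `w x`. -/
structure SymbolOn (U : Set E) (S : E → E →L[ℝ] E) (w : E → ℝ) (f : E → F) : Prop where
  contDiffOn : ContDiffOn ℝ ∞ f U
  bound : ∀ n : ℕ, ∃ C : ℝ, ∀ x ∈ U,
    ‖(iteratedFDeriv ℝ n f x).compContinuousLinearMap fun _ => S x‖ ≤ C * w x

variable {U : Set E} {S : E → E →L[ℝ] E} {w w' : E → ℝ}

theorem _root_.ContDiffOn.contDiffAt_of_isOpen {f : E → F} (hf : ContDiffOn ℝ ∞ f U)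
    (hU : IsOpen U) {x : E} (hx : x ∈ U) (n : ℕ) : ContDiffAt ℝ n f x :=
  (hf.contDiffAt (hU.mem_nhds hx)).of_le (mod_cast le_top)

theorem norm_iteratedFDeriv_bilinear_le (B : F →L[ℝ] F' →L[ℝ] G) {f : E → F} {g : E → F'} {x : E}
    {n : ℕ} (hf : ContDiffAt ℝ n f x) (hg : ContDiffAt ℝ n g x) :
    ‖iteratedFDeriv ℝ n (fun y => B (f y) (g y)) x‖ ≤
      ‖B‖ * ∑ i ∈ Finset.range (n + 1), (n.choose i : ℝ) * ‖iteratedFDeriv ℝ i f x‖ *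
        ‖iteratedFDeriv ℝ (n - i) g x‖ := by
  obtain ⟨u, hu, hfu⟩ := hf.contDiffOn le_rfl (by simp)
  obtain ⟨u', hu', hgu⟩ := hg.contDiffOn le_rfl (by simp)
  obtain ⟨v, hvu, hv, hxv⟩ := mem_nhds_iff.1 (inter_mem hu hu')
  have := B.norm_iteratedFDerivWithin_le_of_bilinear (hfu.mono (hvu.trans inter_subset_left))
    (hgu.mono (hvu.trans inter_subset_right)) hv.uniqueDiffOn hxv (n := n) le_rfl
  simpa only [iteratedFDerivWithin_of_isOpen _ hv hxv] using this

namespace SymbolOn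

variable {f f₁ : E → F} {g : E → F'}

/-- The closure properties below rest on this reformulation: composition with z ↦ x + S x z turns
the weighted bounds at x into ordinary derivative bounds at the origin, to which the Leibniz and
composition estimates apply. -/
theorem bound_affine (hf : SymbolOn U S w f) (hU : IsOpen U) (n : ℕ) :
    ∃ C : ℝ, ∀ x ∈ U, ‖iteratedFDeriv ℝ n (fun z => f (x + S x z)) 0‖ ≤ C * w x := by
  obtain ⟨C, hC⟩ := hf.bound n
  refine ⟨C, fun x hx => ?_⟩
  rw [iteratedFDeriv_comp_affine (hf.contDiffOn.contDiffAt_of_isOpen hU hx n)]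
  exact hC x hx

theorem bound_uniform (hf : SymbolOn U S w f) (hU : IsOpen U) (hw : ∀ x ∈ U, 0 ≤ w x) (n : ℕ) :
    ∃ C : ℝ, 1 ≤ C ∧ ∀ i ≤ n, ∀ x ∈ U,
      ‖iteratedFDeriv ℝ i (fun z => f (x + S x z)) 0‖ ≤ C * w x := by
  choose C hC using hf.bound_affine hU
  refine ⟨1 + ∑ i ∈ Finset.range (n + 1), |C i|, ?_, fun i hi x hx => (hC i x hx).trans ?_⟩
  · linarith [Finset.sum_nonneg fun i (_ : i ∈ Finset.range (n + 1)) => abs_nonneg (C i)]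
  · refine mul_le_mul_of_nonneg_right ?_ (hw x hx)
    have := Finset.single_le_sum (f := fun i => |C i|) (fun i _ => abs_nonneg _)
      (Finset.mem_range.2 (Nat.lt_succ_of_le hi))
    linarith [le_abs_self (C i)]

theorem of_affine (hU : IsOpen U) (hf : ContDiffOn ℝ ∞ f U)
    (h : ∀ n : ℕ, ∃ C : ℝ, ∀ x ∈ U, ‖iteratedFDeriv ℝ n (fun z => f (x + S x z)) 0‖ ≤ C * w x) :
    SymbolOn U S w f := by
  refine ⟨hf, fun n => ?_⟩
  obtain ⟨C, hC⟩ := h n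
  refine ⟨C, fun x hx => ?_⟩
  rw [← iteratedFDeriv_comp_affine (hf.contDiffAt_of_isOpen hU hx n)]
  exact hC x hx

theorem mono (hf : SymbolOn U S w f) (hw : ∀ x ∈ U, 0 ≤ w x) (C : ℝ)
    (h : ∀ x ∈ U, w x ≤ C * w' x) : SymbolOn U S w' f := by
  refine ⟨hf.contDiffOn, fun n => ?_⟩
  obtain ⟨C', hC'⟩ := hf.bound n
  refine ⟨|C'| * C, fun x hx => (hC' x hx).trans ?_⟩
  calc C' * w x ≤ |C'| * w x := mul_le_mul_of_nonneg_right (le_abs_self _) (hw x hx)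
    _ ≤ |C'| * (C * w' x) := mul_le_mul_of_nonneg_left (h x hx) (abs_nonneg _)
    _ = |C'| * C * w' x := by ring

theorem congr (hf : SymbolOn U S w f) (hU : IsOpen U) (h : EqOn f₁ f U) : SymbolOn U S w f₁ := by
  refine ⟨hf.contDiffOn.congr h, fun n => (hf.bound n).imp fun C hC x hx => ?_⟩
  have : f₁ =ᶠ[𝓝 x] f := h.eventuallyEq_of_mem (hU.mem_nhds hx)
  rw [(this.iteratedFDeriv ℝ n).eq_of_nhds]
  exact hC x hx

theorem congr_weight (hf : SymbolOn U S w f) (h : ∀ x ∈ U, w x = w' x) : SymbolOn U S w' f :=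
  ⟨hf.contDiffOn, fun n => (hf.bound n).imp fun _ hC x hx => (h x hx) ▸ hC x hx⟩

theorem norm_le (hf : SymbolOn U S w f) : ∃ C : ℝ, ∀ x ∈ U, ‖f x‖ ≤ C * w x := by
  obtain ⟨C, hC⟩ := hf.bound 0
  refine ⟨C, fun x hx => le_trans (le_of_eq ?_) (hC x hx)⟩
  rw [← norm_iteratedFDeriv_zero (𝕜 := ℝ)]
  congr 1

theorem add (hf : SymbolOn U S w f) (hf₁ : SymbolOn U S w f₁) (hU : IsOpen U) :
    SymbolOn U S w (fun x => f x + f₁ x) := by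
  refine ⟨hf.contDiffOn.add hf₁.contDiffOn, fun n => ?_⟩
  obtain ⟨C, hC⟩ := hf.bound n
  obtain ⟨C₁, hC₁⟩ := hf₁.bound n
  refine ⟨C + C₁, fun x hx => ?_⟩
  have h : iteratedFDeriv ℝ n (fun x => f x + f₁ x) x =
      iteratedFDeriv ℝ n f x + iteratedFDeriv ℝ n f₁ x :=
    iteratedFDeriv_add_apply (hf.contDiffOn.contDiffAt_of_isOpen hU hx n)
      (hf₁.contDiffOn.contDiffAt_of_isOpen hU hx n)
  have h' : (iteratedFDeriv ℝ n (fun x => f x + f₁ x) x).compContinuousLinearMap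
        (fun _ => S x) =
      (iteratedFDeriv ℝ n f x).compContinuousLinearMap (fun _ => S x) +
        (iteratedFDeriv ℝ n f₁ x).compContinuousLinearMap (fun _ => S x) := by
    rw [h]; rfl
  rw [h', add_mul]
  exact (norm_add_le _ _).trans (add_le_add (hC x hx) (hC₁ x hx))

theorem bilinear (hf : SymbolOn U S w f) (hg : SymbolOn U S w' g) (hU : IsOpen U)
    (B : F →L[ℝ] F' →L[ℝ] G) : SymbolOn U S (fun x => w x * w' x) (fun x => B (f x) (g x)) := by
  refine of_affine hU (B.isBoundedBilinearMap.contDiff.comp_contDiffOn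
    (hf.contDiffOn.prodMk hg.contDiffOn)) fun n => ?_
  choose C hC using hf.bound_affine hU
  choose C' hC' using hg.bound_affine hU
  refine ⟨‖B‖ * ∑ i ∈ Finset.range (n + 1), (n.choose i : ℝ) * C i * C' (n - i), fun x hx => ?_⟩
  have hA : ContDiffAt ℝ n (fun z : E => x + S x z) 0 := by fun_prop
  have hf' : ContDiffAt ℝ n (fun z => f (x + S x z)) 0 :=
    ContDiffAt.comp (g := f) 0 (by simpa using hf.contDiffOn.contDiffAt_of_isOpen hU hx n) hA
  have hg' : ContDiffAt ℝ n (fun z => g (x + S x z)) 0 :=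
    ContDiffAt.comp (g := g) 0 (by simpa using hg.contDiffOn.contDiffAt_of_isOpen hU hx n) hA
  refine (norm_iteratedFDeriv_bilinear_le B hf' hg').trans ?_
  rw [mul_assoc]
  refine mul_le_mul_of_nonneg_left ?_ (norm_nonneg B)
  rw [Finset.sum_mul]
  refine Finset.sum_le_sum fun i _ => ?_
  have h1 := hC i x hx
  have h2 := hC' (n - i) x hx
  calc _ = (n.choose i : ℝ) * (‖iteratedFDeriv ℝ i (fun z => f (x + S x z)) 0‖ *
        ‖iteratedFDeriv ℝ (n - i) (fun z => g (x + S x z)) 0‖) := by ring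
    _ ≤ (n.choose i : ℝ) * ((C i * w x) * (C' (n - i) * w' x)) :=
        mul_le_mul_of_nonneg_left
          (mul_le_mul h1 h2 (norm_nonneg _) ((norm_nonneg _).trans h1)) (Nat.cast_nonneg _)
    _ = _ := by ring

theorem clm (hf : SymbolOn U S w f) (hU : IsOpen U) (L : F →L[ℝ] F') :
    SymbolOn U S w (fun x => L (f x)) := by
  refine ⟨L.contDiff.comp_contDiffOn hf.contDiffOn, fun n => ?_⟩
  obtain ⟨C, hC⟩ := hf.bound n
  refine ⟨‖L‖ * C, fun x hx => ?_⟩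
  have h : iteratedFDeriv ℝ n (fun x => L (f x)) x =
      L.compContinuousMultilinearMap (iteratedFDeriv ℝ n f x) :=
    L.iteratedFDeriv_comp_left (hf.contDiffOn.contDiffAt_of_isOpen hU hx n) le_rfl
  have h' : (iteratedFDeriv ℝ n (fun x => L (f x)) x).compContinuousLinearMap (fun _ => S x) =
      L.compContinuousMultilinearMap
        ((iteratedFDeriv ℝ n f x).compContinuousLinearMap (fun _ => S x)) := by
    rw [h]; rfl
  rw [h', mul_assoc]
  exact (ContinuousLinearMap.norm_compContinuousMultilinearMap_le _ _).trans
    (mul_le_mul_of_nonneg_left (hC x hx) (norm_nonneg _))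

theorem const (hU : IsOpen U) (c : F) (C : ℝ) (h : ∀ x ∈ U, ‖c‖ ≤ C * w x) :
    SymbolOn U S w (fun _ => c) := by
  refine of_affine hU contDiffOn_const fun n => ?_
  refine ⟨C, fun x hx => ?_⟩
  rcases Nat.eq_zero_or_pos n with rfl | hn
  · simpa using h x hx
  · rw [iteratedFDeriv_const_of_ne hn.ne']
    simpa using (norm_nonneg _).trans (h x hx)

theorem affine (hU : IsOpen U) (c : F) (L : E →L[ℝ] F) (C : ℝ) (h : ∀ x ∈ U, ‖c + L x‖ ≤ C * w x)
    (h' : ∀ x ∈ U, ‖L.comp (S x)‖ ≤ C * w x) : SymbolOn U S w (fun x => c + L x) := by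
  refine of_affine hU (contDiff_const.add L.contDiff).contDiffOn fun n => ⟨C, fun x hx => ?_⟩
  have hfun : (fun z => c + L (x + S x z)) = fun z => (c + L x) + (L.comp (S x)) z := by
    ext z; simp [add_assoc]
  rw [hfun]
  rcases n with _ | n
  · simpa using h x hx
  · rw [← norm_iteratedFDeriv_fderiv]
    have : fderiv ℝ (fun z => (c + L x) + (L.comp (S x)) z) = fun _ => L.comp (S x) := by
      ext1 z
      rw [fderiv_const_add, ContinuousLinearMap.fderiv]
    rw [this]
    rcases n with _ | n
    · simpa using h' x hx
    · rw [iteratedFDeriv_const_of_ne (Nat.succ_ne_zero n)]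
      simpa using (norm_nonneg _).trans (h x hx)

theorem linear (hU : IsOpen U) (L : E →L[ℝ] F) (C : ℝ) (h : ∀ x ∈ U, ‖L x‖ ≤ C * w x)
    (h' : ∀ x ∈ U, ‖L.comp (S x)‖ ≤ C * w x) : SymbolOn U S w (fun x => L x) := by
  simpa using affine hU 0 L C (by simpa using h) h'

/-- The hypothesis on `M` says that π carries unit steps at x to at most K unit steps at π x, so
each derivative costs at most a factor K. -/
theorem pullback {U' : Set E'} {S' : E' → E' →L[ℝ] E'} (hf : SymbolOn U S w f) (hU : IsOpen U)
    (hw : ∀ x ∈ U, 0 ≤ w x) (π : E' →L[ℝ] E) (hπ : ∀ x ∈ U', π x ∈ U) (K : ℝ)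
    (hS : ∀ x ∈ U', ∃ M : E' →L[ℝ] E, ‖M‖ ≤ K ∧ π.comp (S' x) = (S (π x)).comp M)
    (hU' : IsOpen U') :
    SymbolOn U' S' (fun x => w (π x)) (fun x => f (π x)) := by
  refine of_affine hU' (hf.contDiffOn.comp π.contDiff.contDiffOn hπ) fun n => ?_
  obtain ⟨C, hC⟩ := hf.bound n
  refine ⟨|C| * (max K 0) ^ n, fun x hx => ?_⟩
  obtain ⟨M, hM, hMS⟩ := hS x hx
  have hfun : (fun z => f (π (x + S' x z))) = fun z => f (π x + ((S (π x)).comp M) z) := by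
    ext z
    rw [← hMS]; simp
  rw [hfun, iteratedFDeriv_comp_affine (hf.contDiffOn.contDiffAt_of_isOpen hU (hπ x hx) n)]
  have h1 : (iteratedFDeriv ℝ n f (π x)).compContinuousLinearMap
      (fun _ => (S (π x)).comp M) = ((iteratedFDeriv ℝ n f (π x)).compContinuousLinearMap
        (fun _ => S (π x))).compContinuousLinearMap (fun _ => M) := by
    ext; rfl
  rw [h1]
  refine (ContinuousMultilinearMap.norm_compContinuousLinearMap_le _ _).trans ?_
  have h2 : ∏ _i : Fin n, ‖M‖ ≤ (max K 0) ^ n := by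
    simpa using pow_le_pow_left₀ (norm_nonneg M) (hM.trans (le_max_left _ _)) n
  calc _ ≤ (|C| * w (π x)) * (max K 0) ^ n := by
        refine mul_le_mul ((hC _ (hπ x hx)).trans (mul_le_mul_of_nonneg_right (le_abs_self _)
          (hw _ (hπ x hx)))) h2 (Finset.prod_nonneg fun _ _ => norm_nonneg _)
          (mul_nonneg (abs_nonneg _) (hw _ (hπ x hx)))
    _ = _ := by ring

/-- The vector v is the image under S x of a vector v' of length at most μ x. Inserting v' in the
last slot of the derivative of order n + 1 gains the factor μ x. -/
theorem fderiv_apply (hf : SymbolOn U S w f) (hU : IsOpen U) (v : E) (μ : E → ℝ)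
    (hμ : ∀ x ∈ U, ∃ v', ‖v'‖ ≤ μ x ∧ S x v' = v) :
    SymbolOn U S (fun x => w x * μ x) (fun x => fderiv ℝ f x v) := by
  have hd : ContDiffOn ℝ ∞ (fderiv ℝ f) U := hf.contDiffOn.fderiv_of_isOpen hU (by simp)
  refine ⟨hd.clm_apply contDiffOn_const, fun n => ?_⟩
  obtain ⟨C, hC⟩ := hf.bound (n + 1)
  refine ⟨C, fun x hx => ?_⟩
  obtain ⟨v', hv', hSv⟩ := hμ x hx
  have hCx := (norm_nonneg _).trans (hC x hx)
  refine ContinuousMultilinearMap.opNorm_le_bound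
    (by rw [← mul_assoc]; exact mul_nonneg hCx ((norm_nonneg _).trans hv')) fun m => ?_
  have h1 : iteratedFDeriv ℝ n (fun x => fderiv ℝ f x v) x =
      (ContinuousLinearMap.apply ℝ F v).compContinuousMultilinearMap
        (iteratedFDeriv ℝ n (fderiv ℝ f) x) :=
    (ContinuousLinearMap.apply ℝ F v).iteratedFDeriv_comp_left
      (hd.contDiffAt_of_isOpen hU hx n) le_rfl
  have h2 : (iteratedFDeriv ℝ n (fun x => fderiv ℝ f x v) x).compContinuousLinearMap
      (fun _ => S x) m = (iteratedFDeriv ℝ (n + 1) f x).compContinuousLinearMap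
      (fun _ => S x) (Fin.snoc m v') := by
    rw [h1]
    simp only [ContinuousMultilinearMap.compContinuousLinearMap_apply,
      iteratedFDeriv_succ_apply_right]
    simp only [ContinuousLinearMap.compContinuousMultilinearMap_coe, Function.comp_apply,
      ContinuousLinearMap.apply_apply, Fin.snoc_last, hSv]
    congr 2
    ext i
    simp [Fin.init]
  rw [h2]
  refine (ContinuousMultilinearMap.le_opNorm _ _).trans ?_
  rw [Fin.prod_univ_castSucc]
  simp only [Fin.snoc_castSucc, Fin.snoc_last]
  calc _ ≤ (C * w x) * ((∏ i, ‖m i‖) * μ x) := by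
        gcongr
        exact hC x hx
    _ = _ := by ring

theorem fderiv_id (hf : SymbolOn U (fun _ => ContinuousLinearMap.id ℝ E) w f) (hU : IsOpen U) :
    SymbolOn U (fun _ => ContinuousLinearMap.id ℝ E) w (fderiv ℝ f) := by
  refine ⟨hf.contDiffOn.fderiv_of_isOpen hU (by simp), fun n => ?_⟩
  obtain ⟨C, hC⟩ := hf.bound (n + 1)
  refine ⟨C, fun x hx => ?_⟩
  have := hC x hx
  rw [compContinuousLinearMap_const_id] at this ⊢
  rwa [norm_iteratedFDeriv_fderiv]

/-- The rescaled function z ↦ f(x + S x z) / w x has bounded derivatives at 0, and its value there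
lies in a compact interval [c, C] inside (0, ∞), on which all derivatives of s ↦ s^p are bounded.
The composition estimate then applies, and the factor w x ^ p splits off by homogeneity. -/
theorem rpow {f : E → ℝ} (hf : SymbolOn U S w f) (hU : IsOpen U) {c : ℝ} (hc : 0 < c)
    (hw : ∀ x ∈ U, 0 < w x) (h : ∀ x ∈ U, c * w x ≤ f x) (p : ℝ) :
    SymbolOn U S (fun x => w x ^ p) (fun x => f x ^ p) := by
  have hpos : ∀ x ∈ U, 0 < f x := fun x hx => (mul_pos hc (hw x hx)).trans_le (h x hx)
  have hG : ContDiffOn ℝ ∞ (fun s : ℝ => s ^ p) (Ioi 0) := fun s hs =>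
    (Real.contDiffAt_rpow_const_of_ne (ne_of_gt hs)).contDiffWithinAt
  refine of_affine hU (hG.comp hf.contDiffOn hpos) fun n => ?_
  obtain ⟨C, hC1, hC⟩ := hf.bound_uniform hU (fun x hx => (hw x hx).le) n
  have hcpt : ∀ i : ℕ, ∃ D : ℝ, ∀ s ∈ Icc c C,
      ‖iteratedFDerivWithin ℝ i (fun s : ℝ => s ^ p) (Ioi 0) s‖ ≤ D := fun i =>
    isCompact_Icc.exists_bound_of_continuousOn
      ((hG.continuousOn_iteratedFDerivWithin (m := i) (mod_cast le_top)
        isOpen_Ioi.uniqueDiffOn).mono fun s hs => hc.trans_le hs.1)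
  choose D hD using hcpt
  set D' := ∑ i ∈ Finset.range (n + 1), |D i| with hD'
  refine ⟨n.factorial * D' * C ^ n, fun x hx => ?_⟩
  set s : Set E := (fun z => x + S x z) ⁻¹' (U ∩ f ⁻¹' Ioi 0) with hs
  have hso : IsOpen s :=
    (hf.contDiffOn.continuousOn.isOpen_inter_preimage hU isOpen_Ioi).preimage (by fun_prop)
  have h0s : (0 : E) ∈ s := by simpa [hs] using ⟨hx, hpos x hx⟩
  set k : E → ℝ := fun z => (w x)⁻¹ * f (x + S x z) with hk
  have hks : ContDiffOn ℝ ∞ k s := contDiffOn_const.mul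
    (hf.contDiffOn.comp (by fun_prop) (fun z hz => hz.1))
  have hmaps : MapsTo k s (Ioi 0) := fun z hz => mul_pos (inv_pos.2 (hw x hx)) hz.2
  have hki : ∀ i ≤ n, ‖iteratedFDerivWithin ℝ i k s 0‖ ≤ C := fun i hi => by
    rw [iteratedFDerivWithin_of_isOpen i hso h0s]
    have hfz : ContDiffAt ℝ i (fun z => f (x + S x z)) 0 :=
      ContDiffAt.comp (g := f) 0 (by simpa using hf.contDiffOn.contDiffAt_of_isOpen hU hx i)
        (by fun_prop)
    have : iteratedFDeriv ℝ i k 0 =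
        (w x)⁻¹ • iteratedFDeriv ℝ i (fun z => f (x + S x z)) 0 := by
      exact iteratedFDeriv_const_smul_apply' (a := (w x)⁻¹) hfz
    rw [this, norm_smul, norm_inv, Real.norm_of_nonneg (hw x hx).le, inv_mul_le_iff₀ (hw x hx),
      mul_comm]
    exact hC i hi x hx
  have hk0 : k 0 ∈ Icc c C := by
    constructor
    · rw [hk]
      simp only [map_zero, add_zero]
      rw [le_inv_mul_iff₀ (hw x hx), mul_comm]
      exact h x hx
    · have := hki 0 (Nat.zero_le _)
      rw [norm_iteratedFDerivWithin_zero] at this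
      exact (le_abs_self _).trans this
  have key := norm_iteratedFDerivWithin_comp_le (n := n) (C := D') (D := C) hG hks
    (mod_cast le_top) isOpen_Ioi.uniqueDiffOn hso.uniqueDiffOn hmaps h0s
    (fun i hi => (hD i _ hk0).trans ((le_abs_self _).trans
      (Finset.single_le_sum (f := fun i => |D i|) (fun i _ => abs_nonneg _)
        (Finset.mem_range.2 (Nat.lt_succ_of_le hi)))))
    -- The composition estimate asks for the bound `C ^ i` at order i ≥ 1; this is why C was
    -- arranged to be at least 1.
    (fun i hi hin => (hki i hin).trans (le_self_pow₀ hC1 (by omega)))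
  rw [iteratedFDerivWithin_of_isOpen n hso h0s] at key
  have hcomp : ContDiffAt ℝ n ((fun s : ℝ => s ^ p) ∘ k) 0 :=
    (hG.comp hks hmaps).contDiffAt_of_isOpen hso h0s n
  have hfun : (fun z => f (x + S x z) ^ p) =ᶠ[𝓝 0]
      fun z => (w x ^ p) • ((fun s : ℝ => s ^ p) ∘ k) z := by
    filter_upwards [hso.mem_nhds h0s] with z hz
    simp only [hk, Function.comp_apply, smul_eq_mul]
    rw [Real.mul_rpow (inv_pos.2 (hw x hx)).le (le_of_lt hz.2), Real.inv_rpow (hw x hx).le,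
      ← mul_assoc, mul_inv_cancel₀ (Real.rpow_pos_of_pos (hw x hx) p).ne', one_mul]
  rw [(hfun.iteratedFDeriv ℝ n).eq_of_nhds, iteratedFDeriv_const_smul_apply' hcomp, norm_smul,
    Real.norm_of_nonneg (Real.rpow_pos_of_pos (hw x hx) p).le, mul_comm]
  exact mul_le_mul_of_nonneg_right key (Real.rpow_pos_of_pos (hw x hx) p).le

end SymbolOn

end SymbolClass

/-! ### Differentiation under the integral sign to all orders -/

section ParametricIntegral

variable {E F V : Type*} [NormedAddCommGroup E] [NormedSpace ℝ E]
  [NormedAddCommGroup F] [NormedSpace ℝ F]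
  [MeasurableSpace V] {μ : Measure V} {U : Set E}

/-- The local bound at order n + 1 dominates the derivative of the integrand of order n, so
differentiation under the integral can be repeated; currying identifies the derivative of the n-th
derivative with the next one. -/
theorem iteratedFDeriv_integral [CompleteSpace F] (hU : IsOpen U) {Φ : E → V → F}
    (hΦ : ∀ v, ContDiffOn ℝ ∞ (fun x => Φ x v) U)
    (hmeas : ∀ n : ℕ, ∀ x ∈ U,
      AEStronglyMeasurable (fun v => iteratedFDeriv ℝ n (fun x => Φ x v) x) μ)
    (hbound : ∀ n : ℕ, ∀ x₀ ∈ U, ∃ B : V → ℝ, Integrable B μ ∧ ∀ᶠ x in 𝓝 x₀, ∀ v,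
      ‖iteratedFDeriv ℝ n (fun x => Φ x v) x‖ ≤ B v) :
    ContDiffOn ℝ ∞ (fun x => ∫ v, Φ x v ∂μ) U ∧ ∀ n : ℕ, ∀ x ∈ U,
      iteratedFDeriv ℝ n (fun x => ∫ v, Φ x v ∂μ) x =
        ∫ v, iteratedFDeriv ℝ n (fun x => Φ x v) x ∂μ := by
  have hint : ∀ n : ℕ, ∀ x ∈ U,
      Integrable (fun v => iteratedFDeriv ℝ n (fun x => Φ x v) x) μ := fun n x hx => by
    obtain ⟨B, hB, hle⟩ := hbound n x hx
    exact hB.mono' (hmeas n x hx) (Eventually.of_forall hle.self_of_nhds)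
  have hder : ∀ n : ℕ, ∀ x ∈ U, HasFDerivAt
      (fun x => ∫ v, iteratedFDeriv ℝ n (fun x => Φ x v) x ∂μ)
      (∫ v, fderiv ℝ (iteratedFDeriv ℝ n (fun x => Φ x v)) x ∂μ) x := fun n x hx => by
    obtain ⟨B, hB, hle⟩ := hbound (n + 1) x hx
    obtain ⟨ε, hε, hball⟩ := Metric.eventually_nhds_iff_ball.1
      (hle.and (hU.eventually_mem hx))
    have hfd : ∀ v y, fderiv ℝ (iteratedFDeriv ℝ n (fun x => Φ x v)) y =
        continuousMultilinearCurryLeftEquiv ℝ (fun _ : Fin (n + 1) => E) F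
          (iteratedFDeriv ℝ (n + 1) (fun x => Φ x v) y) := fun v y => by
      rw [iteratedFDeriv_succ_eq_comp_left]; simp
    refine hasFDerivAt_integral_of_dominated_of_fderiv_le (𝕜 := ℝ)
      (F := fun x v => iteratedFDeriv ℝ n (fun x => Φ x v) x)
      (F' := fun x v => fderiv ℝ (iteratedFDeriv ℝ n (fun x => Φ x v)) x)
      (Metric.ball_mem_nhds x hε) (bound := B) ?_ (hint n x hx) ?_ ?_ hB ?_
    · filter_upwards [hU.mem_nhds hx] with y hy using hmeas n y hy
    · simp_rw [hfd]
      exact (LinearIsometryEquiv.continuous _).comp_aestronglyMeasurable (hmeas (n + 1) x hx)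
    · refine Eventually.of_forall fun v y hy => ?_
      rw [norm_fderiv_iteratedFDeriv]
      exact (hball y hy).1 v
    · refine Eventually.of_forall fun v y hy => ?_
      have hc := (hΦ v).contDiffAt_of_isOpen hU (hball y hy).2 (n + 1)
      exact (hc.differentiableAt_iteratedFDeriv (by norm_cast; omega)).hasFDerivAt
  have heq : ∀ n : ℕ, ∀ x ∈ U, iteratedFDeriv ℝ n (fun x => ∫ v, Φ x v ∂μ) x =
        ∫ v, iteratedFDeriv ℝ n (fun x => Φ x v) x ∂μ := by
    intro n
    induction n with
    | zero =>
      intro x hx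
      simp only [iteratedFDeriv_zero_eq_comp, Function.comp_apply]
      exact ((continuousMultilinearCurryFin0 ℝ E F).symm.toContinuousLinearEquiv.integral_comp_comm
        (fun v => Φ x v)).symm
    | succ n ih =>
      intro x hx
      have hev : iteratedFDeriv ℝ n (fun x => ∫ v, Φ x v ∂μ) =ᶠ[𝓝 x]
          fun x => ∫ v, iteratedFDeriv ℝ n (fun x => Φ x v) x ∂μ := by
        filter_upwards [hU.mem_nhds hx] with y hy using ih y hy
      have hint' : Integrable (fun v => fderiv ℝ (iteratedFDeriv ℝ n (fun x => Φ x v)) x) μ := by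
        have := (continuousMultilinearCurryLeftEquiv ℝ (fun _ : Fin (n + 1) => E)
          F).toContinuousLinearEquiv.toContinuousLinearMap.integrable_comp (hint (n + 1) x hx)
        refine this.congr (Eventually.of_forall fun v => ?_)
        simp [iteratedFDeriv_succ_eq_comp_left]
      ext m
      rw [ContinuousMultilinearMap.integral_apply (hint (n + 1) x hx),
        iteratedFDeriv_succ_apply_left, hev.fderiv_eq, (hder n x hx).fderiv,
        ContinuousLinearMap.integral_apply hint',
        ContinuousMultilinearMap.integral_apply (hint'.apply_continuousLinearMap _)]
      rfl
  refine ⟨?_, heq⟩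
  refine contDiffOn_of_differentiableOn fun n _ => ?_
  intro x hx
  have hev : ∀ y ∈ U, iteratedFDerivWithin ℝ n (fun x => ∫ v, Φ x v ∂μ) U y =
      ∫ v, iteratedFDeriv ℝ n (fun x => Φ x v) y ∂μ := fun y hy => by
    rw [iteratedFDerivWithin_of_isOpen n hU hy, heq n y hy]
  exact ((hder n x hx).differentiableAt.differentiableWithinAt).congr hev (hev x hx)

end ParametricIntegral

/-! ### From iterated partial derivatives to joint symbol estimates -/

section JointSymbol

variable {Y Z F G : Type} [NormedAddCommGroup Y] [NormedSpace ℝ Y]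
  [NormedAddCommGroup Z] [NormedSpace ℝ Z] [NormedAddCommGroup F] [NormedSpace ℝ F]
  [NormedAddCommGroup G] [NormedSpace ℝ G]

/-- The map `(y, z) ↦ (y, l z)`. -/
def jointScale (l : ℝ) : (Y × Z) →L[ℝ] (Y × Z) :=
  (ContinuousLinearMap.id ℝ Y).prodMap (l • ContinuousLinearMap.id ℝ Z)

@[simp] theorem jointScale_apply (l : ℝ) (p : Y × Z) : jointScale l p = (p.1, l • p.2) := rfl

theorem norm_jointScale_le (l : ℝ) : ‖(jointScale l : (Y × Z) →L[ℝ] (Y × Z))‖ ≤ max 1 |l| := by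
  refine ContinuousLinearMap.opNorm_le_bound _ (le_max_of_le_left zero_le_one) fun p => ?_
  rw [jointScale_apply, Prod.norm_def]
  refine max_le ?_ ?_
  · calc ‖p.1‖ ≤ 1 * ‖p‖ := by rw [one_mul]; exact norm_fst_le p
      _ ≤ _ := by gcongr; exact le_max_left _ _
  · calc ‖l • p.2‖ = |l| * ‖p.2‖ := by rw [norm_smul, Real.norm_eq_abs]
      _ ≤ _ := by gcongr; exacts [le_max_right _ _, norm_snd_le p]

/-- Symbols `A(y, z)` of order `m` in `z`, in terms of joint derivatives in `(y, z)`. -/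
abbrev IsJointSymbol (m : ℝ) (A : Y × Z → F) : Prop :=
  SymbolOn univ (fun p : Y × Z => jointScale (1 + ‖p.2‖)) (fun p => (1 + ‖p.2‖) ^ m) A

/-- Symbols `A(y, z)` of order `m` in `z`, in terms of iterated partial derivatives. -/
def IsPartialSymbol (m : ℝ) (a : Y × Z → F) : Prop :=
  ContDiff ℝ ∞ a ∧ ∀ j k : ℕ, ∃ C : ℝ, ∀ (w : Y) (ζ : Z),
    ‖iteratedFDeriv ℝ k (fun ζ' => iteratedFDeriv ℝ j (fun w' => a (w', ζ')) w) ζ‖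
      ≤ C * (1 + ‖ζ‖) ^ (m - k)

theorem iteratedFDeriv_slice_left {a : Y × Z → F} (ha : ContDiff ℝ ∞ a) (j : ℕ) (w : Y) (ζ : Z) :
    iteratedFDeriv ℝ j (fun w' => a (w', ζ)) w =
      (iteratedFDeriv ℝ j a (w, ζ)).compContinuousLinearMap
        (fun _ => ContinuousLinearMap.inl ℝ Y Z) := by
  rw [← iteratedFDeriv_comp_affine (ha.contDiffAt.of_le (mod_cast le_top))]
  have := iteratedFDeriv_comp_add_left (𝕜 := ℝ) (f := fun w' => a (w', ζ)) j w 0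
  rw [add_zero] at this
  rw [← this]
  congr 1
  ext z
  simp

theorem fderiv_slice_left {a : Y × Z → F} {p : Y × Z} (ha : DifferentiableAt ℝ a p) :
    fderiv ℝ (fun w' => a (w', p.2)) p.1 = (fderiv ℝ a p).comp (ContinuousLinearMap.inl ℝ Y Z) :=
  (ha.hasFDerivAt.comp p.1 (hasFDerivAt_prodMk_left p.1 p.2)).fderiv

theorem fderiv_slice_right {a : Y × Z → F} {p : Y × Z} (ha : DifferentiableAt ℝ a p) :
    fderiv ℝ (fun z' => a (p.1, z')) p.2 = (fderiv ℝ a p).comp (ContinuousLinearMap.inr ℝ Y Z) :=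
  (ha.hasFDerivAt.comp p.2 (hasFDerivAt_prodMk_right p.1 p.2)).fderiv

/-- Both sides are the second derivative of a in the directions (u, 0) and (0, v), which is
symmetric. -/
theorem fderiv_fderiv_comm {a : Y × Z → F} (ha : ContDiff ℝ ∞ a) (w u : Y) (ζ v : Z) :
    fderiv ℝ (fun w' => fderiv ℝ (fun ζ' => a (w', ζ')) ζ) w u v =
      fderiv ℝ (fun ζ' => fderiv ℝ (fun w' => a (w', ζ')) w) ζ v u := by
  have hd : Differentiable ℝ a := ha.differentiable (by simp)
  have hdd : Differentiable ℝ (fderiv ℝ a) :=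
    (ha.fderiv_right (m := ∞) (by simp)).differentiable (by simp)
  have h1 : (fun w' => fderiv ℝ (fun ζ' => a (w', ζ')) ζ) = fun w' =>
      (fderiv ℝ a (w', ζ)).comp (ContinuousLinearMap.inr ℝ Y Z) := by
    ext1 w'; exact fderiv_slice_right (p := (w', ζ)) (hd _)
  have h2 : (fun ζ' => fderiv ℝ (fun w' => a (w', ζ')) w) = fun ζ' =>
      (fderiv ℝ a (w, ζ')).comp (ContinuousLinearMap.inl ℝ Y Z) := by
    ext1 ζ'; exact fderiv_slice_left (p := (w, ζ')) (hd _)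
  have e1 := HasFDerivAt.comp (f := fun w' => (w', ζ)) w
    ((((ContinuousLinearMap.compL ℝ Z (Y × Z) F).flip
      (ContinuousLinearMap.inr ℝ Y Z)).hasFDerivAt).comp (w, ζ) (hdd (w, ζ)).hasFDerivAt)
    (hasFDerivAt_prodMk_left w ζ)
  have e2 := HasFDerivAt.comp (f := fun ζ' => (w, ζ')) ζ
    ((((ContinuousLinearMap.compL ℝ Y (Y × Z) F).flip
      (ContinuousLinearMap.inl ℝ Y Z)).hasFDerivAt).comp (w, ζ) (hdd (w, ζ)).hasFDerivAt)
    (hasFDerivAt_prodMk_right w ζ)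
  rw [h1, h2]
  refine (DFunLike.congr_fun (DFunLike.congr_fun e1.fderiv u) v).trans
    (Eq.trans ?_ (DFunLike.congr_fun (DFunLike.congr_fun e2.fderiv v) u).symm)
  have hs : IsSymmSndFDerivAt ℝ a (w, ζ) :=
    (ha.contDiffAt (x := (w, ζ))).isSymmSndFDerivAt (by simp; exact WithTop.coe_le_coe.2 le_top)
  exact hs (u, 0) (0, v)

theorem contDiff_iteratedFDeriv_slice {a : Y × Z → F} (ha : ContDiff ℝ ∞ a) (j : ℕ) :
    ContDiff ℝ ∞ (fun p : Y × Z => iteratedFDeriv ℝ j (fun w' => a (w', p.2)) p.1) := by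
  have h : (fun p : Y × Z => iteratedFDeriv ℝ j (fun w' => a (w', p.2)) p.1) = fun p =>
      ContinuousMultilinearMap.compContinuousLinearMapL (F := F)
        (fun _ : Fin j => ContinuousLinearMap.inl ℝ Y Z) (iteratedFDeriv ℝ j a p) := by
    ext1 p
    exact iteratedFDeriv_slice_left ha j p.1 p.2
  rw [h]
  exact (ContinuousLinearMap.contDiff _).comp (ha.iteratedFDeriv_right (m := ∞) (mod_cast le_top))

/-- Symbols are defined by taking the y-derivatives first and the ζ-derivatives afterwards. To see
that a ζ-derivative is again a symbol, it has to be moved past all y-derivatives; the induction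
moves it past one at a time by symmetry of second derivatives. -/
theorem iteratedFDeriv_fderiv_comm {a : Y × Z → F} (ha : ContDiff ℝ ∞ a) (j : ℕ) (ζ v : Z) :
    ∀ (w : Y) (m : Fin j → Y),
      iteratedFDeriv ℝ j (fun w' => fderiv ℝ (fun ζ' => a (w', ζ')) ζ) w m v =
      fderiv ℝ (fun ζ' => iteratedFDeriv ℝ j (fun w' => a (w', ζ')) w) ζ v m := by
  have hd : Differentiable ℝ a := ha.differentiable (by simp)
  have hs : ContDiff ℝ ∞ (fun w' => fderiv ℝ (fun ζ' => a (w', ζ')) ζ) := by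
    have h1 : (fun w' => fderiv ℝ (fun ζ' => a (w', ζ')) ζ) = fun w' =>
        (fderiv ℝ a (w', ζ)).comp (ContinuousLinearMap.inr ℝ Y Z) := by
      ext1 w'; exact fderiv_slice_right (p := (w', ζ)) (hd _)
    rw [h1]
    exact ((ha.fderiv_right (m := ∞) (by simp)).comp
      (contDiff_id.prodMk contDiff_const)).clm_comp contDiff_const
  have hsl := fun j w => ((contDiff_iteratedFDeriv_slice ha j).comp
    ((contDiff_const (c := w)).prodMk contDiff_id)).differentiable (by simp)
  simp only [Function.comp_def, id] at hsl
  induction j with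
  | zero =>
    intro w m
    rw [iteratedFDeriv_zero_apply]
    have h := (ContinuousMultilinearMap.apply ℝ (fun _ : Fin 0 => Y) F m).hasFDerivAt.comp ζ
      (hsl 0 w ζ).hasFDerivAt
    have h' : (ContinuousMultilinearMap.apply ℝ (fun _ : Fin 0 => Y) F m) ∘
        (fun ζ' => iteratedFDeriv ℝ 0 (fun w' => a (w', ζ')) w) = fun ζ' => a (w, ζ') := by
      ext ζ'; simp
    rw [h'] at h
    rw [h.fderiv]
    rfl
  | succ j ih =>
    intro w m
    have hF : ContDiff ℝ ∞ (fun p : Y × Z => iteratedFDeriv ℝ j (fun w' => a (w', p.2)) p.1) :=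
      contDiff_iteratedFDeriv_slice ha j
    have hF' : ∀ ζ' : Z, Differentiable ℝ
        (fun w' => iteratedFDeriv ℝ j (fun w' => a (w', ζ')) w') := fun ζ' =>
      (hF.comp (contDiff_id.prodMk (contDiff_const (c := ζ')))).differentiable (by simp)
    have hdw : Differentiable ℝ (iteratedFDeriv ℝ j (fun w' => fderiv ℝ (fun ζ' => a (w', ζ')) ζ)) :=
      (hs.iteratedFDeriv_right (m := ∞) (mod_cast le_top)).differentiable (by simp)
    have hdz : Differentiable ℝ (fun w' => fderiv ℝ
        (fun ζ' => iteratedFDeriv ℝ j (fun w' => a (w', ζ')) w') ζ) := by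
      have h1 : (fun w' => fderiv ℝ (fun ζ' => iteratedFDeriv ℝ j (fun w' => a (w', ζ')) w') ζ) =
          fun w' => (fderiv ℝ (fun p : Y × Z => iteratedFDeriv ℝ j (fun w' => a (w', p.2)) p.1)
            (w', ζ)).comp (ContinuousLinearMap.inr ℝ Y Z) := by
        ext1 w'
        exact fderiv_slice_right
          (a := fun p : Y × Z => iteratedFDeriv ℝ j (fun w' => a (w', p.2)) p.1) (p := (w', ζ))
          (hF.differentiable (by simp) _)
      rw [h1]
      exact (((hF.fderiv_right (m := ∞) (by simp)).comp
        (contDiff_id.prodMk contDiff_const)).clm_comp contDiff_const).differentiable (by simp)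
    rw [iteratedFDeriv_succ_apply_left]
    have h1 : fderiv ℝ (iteratedFDeriv ℝ j (fun w' => fderiv ℝ (fun ζ' => a (w', ζ')) ζ)) w (m 0)
        (Fin.tail m) v = fderiv ℝ (fun w' => fderiv ℝ
          (fun ζ' => iteratedFDeriv ℝ j (fun w' => a (w', ζ')) w') ζ) w (m 0) v (Fin.tail m) := by
      have e1 := ((ContinuousLinearMap.apply ℝ F v).comp (ContinuousMultilinearMap.apply ℝ
        (fun _ : Fin j => Y) (Z →L[ℝ] F) (Fin.tail m))).hasFDerivAt.comp w (hdw w).hasFDerivAt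
      have e2 := ((ContinuousMultilinearMap.apply ℝ (fun _ : Fin j => Y) F (Fin.tail m)).comp
        (ContinuousLinearMap.apply ℝ (Y [×j]→L[ℝ] F) v)).hasFDerivAt.comp w (hdz w).hasFDerivAt
      have : (((ContinuousLinearMap.apply ℝ F v).comp (ContinuousMultilinearMap.apply ℝ
          (fun _ : Fin j => Y) (Z →L[ℝ] F) (Fin.tail m))) ∘
          iteratedFDeriv ℝ j (fun w' => fderiv ℝ (fun ζ' => a (w', ζ')) ζ)) =
          ((ContinuousMultilinearMap.apply ℝ (fun _ : Fin j => Y) F (Fin.tail m)).comp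
            (ContinuousLinearMap.apply ℝ (Y [×j]→L[ℝ] F) v)) ∘ (fun w' => fderiv ℝ
          (fun ζ' => iteratedFDeriv ℝ j (fun w' => a (w', ζ')) w') ζ) := by
        ext w'
        exact ih w' (Fin.tail m)
      rw [this] at e1
      exact DFunLike.congr_fun (e1.unique e2) (m 0)
    rw [h1, fderiv_fderiv_comm hF]
    have e3 := (ContinuousMultilinearMap.apply ℝ (fun _ : Fin (j + 1) => Y) F m).hasFDerivAt.comp ζ
      (hsl (j + 1) w ζ).hasFDerivAt
    have hdz' : Differentiable ℝ (fun ζ' => fderiv ℝ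
        (fun w' => iteratedFDeriv ℝ j (fun w' => a (w', ζ')) w') w) := by
      have h1 : (fun ζ' => fderiv ℝ (fun w' => iteratedFDeriv ℝ j (fun w' => a (w', ζ')) w') w) =
          fun ζ' => (fderiv ℝ (fun p : Y × Z => iteratedFDeriv ℝ j (fun w' => a (w', p.2)) p.1)
            (w, ζ')).comp (ContinuousLinearMap.inl ℝ Y Z) := by
        ext1 ζ'
        exact fderiv_slice_left
          (a := fun p : Y × Z => iteratedFDeriv ℝ j (fun w' => a (w', p.2)) p.1) (p := (w, ζ'))
          (hF.differentiable (by simp) _)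
      rw [h1]
      exact (((hF.fderiv_right (m := ∞) (by simp)).comp
        (contDiff_const.prodMk contDiff_id)).clm_comp contDiff_const).differentiable (by simp)
    have e4 := ((ContinuousMultilinearMap.apply ℝ (fun _ : Fin j => Y) F (Fin.tail m)).comp
      (ContinuousLinearMap.apply ℝ (Y [×j]→L[ℝ] F) (m 0))).hasFDerivAt.comp ζ (hdz' ζ).hasFDerivAt
    have : (ContinuousMultilinearMap.apply ℝ (fun _ : Fin (j + 1) => Y) F m) ∘
        (fun ζ' => iteratedFDeriv ℝ (j + 1) (fun w' => a (w', ζ')) w) =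
        ((ContinuousMultilinearMap.apply ℝ (fun _ : Fin j => Y) F (Fin.tail m)).comp
          (ContinuousLinearMap.apply ℝ (Y [×j]→L[ℝ] F) (m 0))) ∘ (fun ζ' => fderiv ℝ
          (fun w' => iteratedFDeriv ℝ j (fun w' => a (w', ζ')) w') w) := by
      ext ζ'
      simp only [Function.comp_apply, ContinuousMultilinearMap.apply_apply,
        iteratedFDeriv_succ_apply_left]
      rfl
    rw [this] at e3
    exact DFunLike.congr_fun (e4.unique e3) v

namespace IsPartialSymbol

variable {m : ℝ} {a : Y × Z → F}

theorem fderiv_left (ha : IsPartialSymbol m a) :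
    IsPartialSymbol m (fun p => (fderiv ℝ a p).comp (ContinuousLinearMap.inl ℝ Y Z)) := by
  have hd : Differentiable ℝ a := ha.1.differentiable (by simp)
  refine ⟨(ha.1.fderiv_right (m := ∞) (by simp)).clm_comp contDiff_const, fun j k => ?_⟩
  obtain ⟨C, hC⟩ := ha.2 (j + 1) k
  refine ⟨C, fun w ζ => ?_⟩
  have h : (fun ζ' => iteratedFDeriv ℝ j
      (fun w' => (fderiv ℝ a (w', ζ')).comp (ContinuousLinearMap.inl ℝ Y Z)) w) =
      (continuousMultilinearCurryRightEquiv' ℝ j Y F) ∘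
        fun ζ' => iteratedFDeriv ℝ (j + 1) (fun w' => a (w', ζ')) w := by
    ext1 ζ'
    have : (fun w' => (fderiv ℝ a (w', ζ')).comp (ContinuousLinearMap.inl ℝ Y Z)) =
        fderiv ℝ (fun w' => a (w', ζ')) := by
      ext1 w'; exact (fderiv_slice_left (p := (w', ζ')) (hd _)).symm
    simp only [this, Function.comp_apply, iteratedFDeriv_succ_eq_comp_right,
      LinearIsometryEquiv.apply_symm_apply]
  rw [h, LinearIsometryEquiv.norm_iteratedFDeriv_comp_left]
  exact hC w ζ

theorem fderiv_right (ha : IsPartialSymbol m a) :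
    IsPartialSymbol (m - 1) (fun p => (fderiv ℝ a p).comp (ContinuousLinearMap.inr ℝ Y Z)) := by
  have hd : Differentiable ℝ a := ha.1.differentiable (by simp)
  refine ⟨(ha.1.fderiv_right (m := ∞) (by simp)).clm_comp contDiff_const, fun j k => ?_⟩
  obtain ⟨C, hC⟩ := ha.2 j (k + 1)
  let Fl := (ContinuousLinearMap.flipMultilinearEquiv ℝ (fun _ : Fin j => Y) Z F
    ).toContinuousLinearMap
  refine ⟨‖Fl‖ * C, fun w ζ => ?_⟩
  have h : (fun ζ' => iteratedFDeriv ℝ j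
      (fun w' => (fderiv ℝ a (w', ζ')).comp (ContinuousLinearMap.inr ℝ Y Z)) w) =
      Fl ∘ fun ζ' => fderiv ℝ (fun ζ' => iteratedFDeriv ℝ j (fun w' => a (w', ζ')) w) ζ' := by
    ext ζ' v u
    have : (fun w' => (fderiv ℝ a (w', ζ')).comp (ContinuousLinearMap.inr ℝ Y Z)) =
        fun w' => fderiv ℝ (fun ζ' => a (w', ζ')) ζ' := by
      ext1 w'; exact (fderiv_slice_right (p := (w', ζ')) (hd _)).symm
    rw [this, iteratedFDeriv_fderiv_comm ha.1]
    rfl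
  have hsm : ContDiff ℝ ∞ (fderiv ℝ fun ζ' => iteratedFDeriv ℝ j (fun w' => a (w', ζ')) w) :=
    ((contDiff_iteratedFDeriv_slice ha.1 j).comp
      (contDiff_const.prodMk contDiff_id)).fderiv_right (m := ∞) (by simp)
  rw [h]
  refine (Fl.norm_iteratedFDeriv_comp_left (hsm.contDiffAt (x := ζ)) (mod_cast le_top)).trans ?_
  rw [mul_assoc]
  refine mul_le_mul_of_nonneg_left ?_ (norm_nonneg Fl)
  have := hC w ζ
  rw [← norm_iteratedFDeriv_fderiv] at this
  refine this.trans (le_of_eq ?_)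
  push_cast
  ring_nf

/-- The first derivative splits into a y-part, again of order m, and a ζ-part, of order m - 1. The
unit 1 + ‖ζ‖ attached to ζ-directions compensates the loss of one order, and the induction
hypothesis applies to both parts. The target space varies because these parts are operator-valued.
-/
theorem joint_bound (n : ℕ) : ∀ {F : Type} [NormedAddCommGroup F] [NormedSpace ℝ F] {m : ℝ}
    {a : Y × Z → F}, IsPartialSymbol m a → ∃ C : ℝ, ∀ p : Y × Z,
      ‖(iteratedFDeriv ℝ n a p).compContinuousLinearMap fun _ => jointScale (1 + ‖p.2‖)‖
        ≤ C * (1 + ‖p.2‖) ^ m := by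
  induction n with
  | zero =>
    intro F _ _ m a ha
    obtain ⟨C, hC⟩ := ha.2 0 0
    refine ⟨C, fun p => le_trans (le_of_eq ?_) ((hC p.1 p.2).trans_eq (by simp))⟩
    simp only [norm_iteratedFDeriv_zero]
    change _ = ‖a p‖
    rw [← norm_iteratedFDeriv_zero (𝕜 := ℝ) (f := a) (x := p)]
    congr 1
  | succ n ih =>
    intro F _ _ m a ha
    obtain ⟨C₁, hC₁⟩ := ih ha.fderiv_left
    obtain ⟨C₂, hC₂⟩ := ih ha.fderiv_right
    refine ⟨C₁ + C₂, fun p => ?_⟩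
    have hl : 0 < 1 + ‖p.2‖ := by positivity
    have h1 := hC₁ p
    have h2 := hC₂ p
    have hn1 := (norm_nonneg _).trans h1
    have hn2 := (norm_nonneg _).trans h2
    have hm2 : C₂ * (1 + ‖p.2‖) ^ m = C₂ * (1 + ‖p.2‖) ^ (m - 1) * (1 + ‖p.2‖) := by
      rw [mul_assoc, ← Real.rpow_add_one hl.ne']; simp
    refine ContinuousMultilinearMap.opNorm_le_bound ?_ fun v => ?_
    · rw [add_mul, hm2]; positivity
    set S : (Y × Z) →L[ℝ] (Y × Z) := jointScale (1 + ‖p.2‖) with hS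
    set T := iteratedFDeriv ℝ n (fderiv ℝ a) p with hT
    have hsm := ha.1.fderiv_right (m := ∞) (by simp)
    have e1 : iteratedFDeriv ℝ n
        (fun p => (fderiv ℝ a p).comp (ContinuousLinearMap.inl ℝ Y Z)) p =
        ((ContinuousLinearMap.compL ℝ Y (Y × Z) F).flip
          (ContinuousLinearMap.inl ℝ Y Z)).compContinuousMultilinearMap T :=
      ((ContinuousLinearMap.compL ℝ Y (Y × Z) F).flip
        (ContinuousLinearMap.inl ℝ Y Z)).iteratedFDeriv_comp_left
        (hsm.contDiffAt (x := p)) (mod_cast le_top)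
    have e2 : iteratedFDeriv ℝ n
        (fun p => (fderiv ℝ a p).comp (ContinuousLinearMap.inr ℝ Y Z)) p =
        ((ContinuousLinearMap.compL ℝ Z (Y × Z) F).flip
          (ContinuousLinearMap.inr ℝ Y Z)).compContinuousMultilinearMap T :=
      ((ContinuousLinearMap.compL ℝ Z (Y × Z) F).flip
        (ContinuousLinearMap.inr ℝ Y Z)).iteratedFDeriv_comp_left
        (hsm.contDiffAt (x := p)) (mod_cast le_top)
    have b1 := ((iteratedFDeriv ℝ n (fun p => (fderiv ℝ a p).comp
      (ContinuousLinearMap.inl ℝ Y Z)) p).compContinuousLinearMap fun _ => S).le_opNorm (Fin.init v)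
    have b2 := ((iteratedFDeriv ℝ n (fun p => (fderiv ℝ a p).comp
      (ContinuousLinearMap.inr ℝ Y Z)) p).compContinuousLinearMap fun _ => S).le_opNorm (Fin.init v)
    rw [e1] at h1 b1
    rw [e2] at h2 b2
    rw [ContinuousMultilinearMap.compContinuousLinearMap_apply] at b1 b2
    set M : Fin n → Y × Z := fun i => S (Fin.init v i) with hM
    have hmain : (iteratedFDeriv ℝ (n + 1) a p).compContinuousLinearMap (fun _ => S) v =
        (T M).comp (ContinuousLinearMap.inl ℝ Y Z) (v (Fin.last n)).1 +
        (1 + ‖p.2‖) • (T M).comp (ContinuousLinearMap.inr ℝ Y Z) (v (Fin.last n)).2 := by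
      rw [ContinuousMultilinearMap.compContinuousLinearMap_apply, iteratedFDeriv_succ_apply_right]
      change T M (S (v (Fin.last n))) = _
      rw [← map_smul, ContinuousLinearMap.comp_apply, ContinuousLinearMap.comp_apply, ← map_add]
      congr 1
      simp [hS]
    rw [hmain]
    have hvl1 := norm_fst_le (v (Fin.last n))
    have hvl2 := norm_snd_le (v (Fin.last n))
    rw [Fin.prod_univ_castSucc]
    have hP : (∏ i, ‖Fin.init v i‖) = ∏ i : Fin n, ‖v i.castSucc‖ := rfl
    have hPn : 0 ≤ ∏ i : Fin n, ‖v i.castSucc‖ := Finset.prod_nonneg fun _ _ => norm_nonneg _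
    have b1' : ‖(T M).comp (ContinuousLinearMap.inl ℝ Y Z)‖ ≤
        C₁ * (1 + ‖p.2‖) ^ m * ∏ i : Fin n, ‖v i.castSucc‖ :=
      b1.trans (mul_le_mul_of_nonneg_right h1 hPn)
    have b2' : ‖(T M).comp (ContinuousLinearMap.inr ℝ Y Z)‖ ≤
        C₂ * (1 + ‖p.2‖) ^ (m - 1) * ∏ i : Fin n, ‖v i.castSucc‖ :=
      b2.trans (mul_le_mul_of_nonneg_right h2 hPn)
    refine (norm_add_le _ _).trans ?_
    rw [norm_smul, Real.norm_of_nonneg hl.le]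
    calc _ ≤ (C₁ * (1 + ‖p.2‖) ^ m * ∏ i : Fin n, ‖v i.castSucc‖) * ‖v (Fin.last n)‖ +
          (1 + ‖p.2‖) * ((C₂ * (1 + ‖p.2‖) ^ (m - 1) * ∏ i : Fin n, ‖v i.castSucc‖) *
            ‖v (Fin.last n)‖) := by
          refine add_le_add ?_ (mul_le_mul_of_nonneg_left ?_ hl.le)
          · exact (ContinuousLinearMap.le_opNorm _ _).trans
              (mul_le_mul b1' hvl1 (norm_nonneg _) (mul_nonneg hn1 hPn))
          · exact (ContinuousLinearMap.le_opNorm _ _).trans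
              (mul_le_mul b2' hvl2 (norm_nonneg _) (mul_nonneg hn2 hPn))
      _ = _ := by rw [add_mul C₁ C₂, hm2]; ring

theorem isJointSymbol (ha : IsPartialSymbol m a) : IsJointSymbol m a :=
  ⟨ha.1.contDiffOn, fun n => (joint_bound n ha).imp fun _ hC p _ => hC p⟩

end IsPartialSymbol

end JointSymbol

/-! ### Averages of translates of a symbol -/

section Convolution

variable {Y Z : Type} [NormedAddCommGroup Y] [NormedSpace ℝ Y]
  [NormedAddCommGroup Z] [NormedSpace ℝ Z]

/-- Peetre's inequality. For negative m it is the inequality for -m with the roles of x and x + v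
exchanged. -/
theorem one_add_norm_add_rpow_le (m : ℝ) (x v : Z) :
    (1 + ‖x + v‖) ^ m ≤ (1 + ‖v‖) ^ |m| * (1 + ‖x‖) ^ m := by
  have hx : 0 < 1 + ‖x‖ := by positivity
  have hv : 0 < 1 + ‖v‖ := by positivity
  have hxv : 0 < 1 + ‖x + v‖ := by positivity
  rcases le_or_gt 0 m with hm | hm
  · rw [abs_of_nonneg hm, ← Real.mul_rpow hv.le hx.le]
    refine Real.rpow_le_rpow hxv.le ?_ hm
    nlinarith [norm_add_le x v, norm_nonneg x, norm_nonneg v]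
  · rw [abs_of_neg hm]
    have h : 1 + ‖x‖ ≤ (1 + ‖v‖) * (1 + ‖x + v‖) := by
      have : ‖x‖ ≤ ‖x + v‖ + ‖v‖ := by
        simpa using norm_sub_le (x + v) v
      nlinarith [norm_nonneg (x + v), norm_nonneg v]
    have h2 := Real.rpow_le_rpow_of_nonpos hx h hm.le
    rw [Real.mul_rpow hv.le hxv.le] at h2
    calc (1 + ‖x + v‖) ^ m = (1 + ‖v‖) ^ (-m) * ((1 + ‖v‖) ^ m * (1 + ‖x + v‖) ^ m) := by
          rw [← mul_assoc, ← Real.rpow_add hv]; simp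
      _ ≤ _ := by gcongr

theorem norm_compContinuousLinearMap_jointScale_le {F : Type} [NormedAddCommGroup F]
    [NormedSpace ℝ F] {n : ℕ} (T : (Y × Z) [×n]→L[ℝ] F) (l : ℝ) {l' : ℝ} (hl' : l' ≠ 0) :
    ‖T.compContinuousLinearMap fun _ => jointScale l‖ ≤
      ‖T.compContinuousLinearMap fun _ => jointScale l'‖ * (max 1 |l / l'|) ^ n := by
  have h : T.compContinuousLinearMap (fun _ => jointScale l) =
      (T.compContinuousLinearMap fun _ => jointScale l').compContinuousLinearMap
        (fun _ => jointScale (l / l')) := by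
    ext v
    simp only [ContinuousMultilinearMap.compContinuousLinearMap_apply, jointScale_apply, smul_smul,
      mul_div_cancel₀ l hl']
  rw [h]
  refine (ContinuousMultilinearMap.norm_compContinuousLinearMap_le _ _).trans ?_
  refine mul_le_mul_of_nonneg_left ?_ (norm_nonneg _)
  simpa using pow_le_pow_left₀ (norm_nonneg _)
    (norm_jointScale_le (Y := Y) (Z := Z) (l / l')) n

theorem IsJointSymbol.norm_iteratedFDeriv_le {F : Type} [NormedAddCommGroup F]
    [NormedSpace ℝ F] {m : ℝ} {a : Y × Z → F} (ha : IsJointSymbol m a) (n : ℕ) :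
    ∃ C : ℝ, ∀ p, ‖iteratedFDeriv ℝ n a p‖ ≤ C * (1 + ‖p.2‖) ^ m := by
  obtain ⟨C, hC⟩ := ha.bound n
  refine ⟨C, fun p => ?_⟩
  have hl : 0 < 1 + ‖p.2‖ := by positivity
  have h1 : (jointScale 1 : (Y × Z) →L[ℝ] (Y × Z)) = ContinuousLinearMap.id ℝ _ := by
    ext <;> simp
  have := norm_compContinuousLinearMap_jointScale_le (iteratedFDeriv ℝ n a p) 1 hl.ne'
  rw [h1, compContinuousLinearMap_const_id] at this
  refine this.trans (le_trans (le_of_eq ?_) (hC p (mem_univ _)))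
  have h2 : |1 / (1 + ‖p.2‖)| ≤ 1 := by
    rw [abs_of_pos (by positivity), div_le_one hl]
    linarith [norm_nonneg p.2]
  rw [max_eq_left h2, one_pow, mul_one]

variable [MeasurableSpace Z] [BorelSpace Z] {μ : Measure Z}

/-- Averages of translates of a symbol in the fiber variable. -/
noncomputable def symbolConv (μ : Measure Z) (X : Z → ℂ) (a : Y × Z → ℂ) (p : Y × Z) : ℂ :=
  ∫ v, X v * a (p.1, p.2 + v) ∂μ

/-- Continuous functions all of whose moments are finite. -/
def HasMoments (μ : Measure Z) (X : Z → ℂ) : Prop :=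
  Continuous X ∧ ∀ N : ℕ, Integrable (fun v => (1 + ‖v‖) ^ N * ‖X v‖) μ

theorem HasMoments.integrable_rpow {X : Z → ℂ} [SecondCountableTopology Z] (hX : HasMoments μ X)
    (s : ℝ) : Integrable (fun v => (1 + ‖v‖) ^ s * ‖X v‖) μ := by
  obtain ⟨N, hN⟩ := exists_nat_ge s
  have hc : Continuous fun v : Z => (1 + ‖v‖) ^ s :=
    (continuous_const.add continuous_norm).rpow_const fun v => Or.inl (show 1 + ‖v‖ ≠ 0 by positivity)
  refine (hX.2 N).mono' ((hc.mul hX.1.norm).aestronglyMeasurable) (Eventually.of_forall fun v => ?_)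
  rw [Real.norm_of_nonneg (by positivity), ← Real.rpow_natCast]
  gcongr
  linarith [norm_nonneg v]

variable [SecondCountableTopology Z]

theorem HasMoments.integrable {X : Z → ℂ} (hX : HasMoments μ X) : Integrable X μ := by
  have := hX.2 0
  simp only [pow_zero, one_mul] at this
  exact (integrable_norm_iff hX.1.aestronglyMeasurable).1 this

theorem iteratedFDeriv_translate {a : Y × Z → ℂ} (ha : ContDiff ℝ ∞ a) (c : ℂ) (v : Z) (n : ℕ)
    (p : Y × Z) : iteratedFDeriv ℝ n (fun p : Y × Z => c * a (p.1, p.2 + v)) p =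
      c • iteratedFDeriv ℝ n a (p + (0, v)) := by
  have h : (fun p : Y × Z => c * a (p.1, p.2 + v)) = fun p => c • (fun q => a (q + (0, v))) p := by
    ext p
    simp [show p + (0, v) = (p.1, p.2 + v) by ext <;> simp]
  have hsm : ContDiff ℝ n (fun q : Y × Z => a (q + (0, v))) :=
    (ha.comp (contDiff_id.add contDiff_const)).of_le (mod_cast le_top)
  rw [h, iteratedFDeriv_const_smul_apply' hsm.contDiffAt, iteratedFDeriv_comp_add_right]

/-- By Peetre's inequality a translation by v changes the weight by at most (1 + ‖v‖)^|m|, and it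
changes the unit of length by at most a factor 1 + ‖v‖ per derivative. The moments of X absorb both.
-/
theorem IsJointSymbol.symbolConv {m : ℝ} {a : Y × Z → ℂ} (ha : IsJointSymbol m a) {X : Z → ℂ}
    (hX : HasMoments μ X) : IsJointSymbol m (symbolConv μ X a) := by
  have hsm : ContDiff ℝ ∞ a := contDiffOn_univ.1 ha.contDiffOn
  have hmeas : ∀ (n : ℕ) (p : Y × Z), Continuous (fun v =>
      iteratedFDeriv ℝ n (fun p : Y × Z => X v * a (p.1, p.2 + v)) p) := fun n p => by
    simp_rw [iteratedFDeriv_translate hsm]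
    exact hX.1.smul ((hsm.continuous_iteratedFDeriv (m := n) (mod_cast le_top)).comp (by fun_prop))
  have hpos : ∀ p : Y × Z, 0 < 1 + ‖p.2‖ := fun p => by positivity
  have hwc : Continuous fun p : Y × Z => (1 + ‖p.2‖) ^ m :=
    (continuous_const.add continuous_snd.norm).rpow_const fun p => Or.inl (hpos p).ne'
  obtain ⟨hd, hD⟩ := iteratedFDeriv_integral (μ := μ) isOpen_univ
    (Φ := fun (p : Y × Z) v => X v * a (p.1, p.2 + v))
    (fun v => by
      have : ContDiff ℝ ∞ (fun p : Y × Z => X v * a (p.1, p.2 + v)) := by fun_prop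
      exact this.contDiffOn)
    (fun n p _ => (hmeas n p).aestronglyMeasurable)
    (fun n p₀ _ => by
      obtain ⟨C, hC⟩ := ha.norm_iteratedFDeriv_le n
      refine ⟨fun v => (|C| * ((1 + ‖p₀.2‖) ^ m + 1)) * ((1 + ‖v‖) ^ |m| * ‖X v‖),
        (hX.integrable_rpow |m|).const_mul _, ?_⟩
      filter_upwards [hwc.continuousAt.eventually (gt_mem_nhds (lt_add_one _))] with p hp v
      rw [iteratedFDeriv_translate hsm, norm_smul]
      have h1 := (hC (p + (0, v))).trans (mul_le_mul_of_nonneg_right (le_abs_self C)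
        (Real.rpow_nonneg (hpos _).le m))
      have h2 := one_add_norm_add_rpow_le m p.2 v
      calc ‖X v‖ * ‖iteratedFDeriv ℝ n a (p + (0, v))‖
          ≤ ‖X v‖ * (|C| * ((1 + ‖v‖) ^ |m| * ((1 + ‖p₀.2‖) ^ m + 1))) := by
            gcongr
            refine h1.trans ?_
            gcongr
            exact h2.trans (by gcongr)
        _ = _ := by ring)
  refine ⟨hd, fun n => ?_⟩
  obtain ⟨C, hC⟩ := ha.bound n
  refine ⟨|C| * ∫ v, (1 + ‖v‖) ^ (n + |m|) * ‖X v‖ ∂μ, fun p _ => ?_⟩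
  have hi : Integrable (fun v => iteratedFDeriv ℝ n
      (fun p : Y × Z => X v * a (p.1, p.2 + v)) p) μ := by
    obtain ⟨C, hC⟩ := ha.norm_iteratedFDeriv_le n
    refine ((hX.integrable_rpow |m|).const_mul (|C| * (1 + ‖p.2‖) ^ m)).mono'
      (hmeas n p).aestronglyMeasurable (Eventually.of_forall fun v => ?_)
    rw [iteratedFDeriv_translate hsm, norm_smul]
    have h1 := (hC (p + (0, v))).trans (mul_le_mul_of_nonneg_right (le_abs_self C)
      (Real.rpow_nonneg (hpos _).le m))
    calc ‖X v‖ * ‖iteratedFDeriv ℝ n a (p + (0, v))‖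
        ≤ ‖X v‖ * (|C| * ((1 + ‖v‖) ^ |m| * (1 + ‖p.2‖) ^ m)) := by
          gcongr
          refine h1.trans ?_
          gcongr
          exact one_add_norm_add_rpow_le m p.2 v
      _ = _ := by ring
  set L := ContinuousMultilinearMap.compContinuousLinearMapL (F := ℂ)
    (fun _ : Fin n => (jointScale (1 + ‖p.2‖) : (Y × Z) →L[ℝ] (Y × Z)))
  have e : (iteratedFDeriv ℝ n (ZeroCalculus.symbolConv μ X a) p).compContinuousLinearMap
      (fun _ => jointScale (1 + ‖p.2‖)) =
      ∫ v, L (iteratedFDeriv ℝ n (fun p : Y × Z => X v * a (p.1, p.2 + v)) p) ∂μ := by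
    rw [L.integral_comp_comm hi, ← hD n p (mem_univ _)]
    rfl
  rw [e]
  have hbd : ∀ v, ‖L (iteratedFDeriv ℝ n (fun p : Y × Z => X v * a (p.1, p.2 + v)) p)‖ ≤
      (|C| * (1 + ‖p.2‖) ^ m) * ((1 + ‖v‖) ^ (n + |m|) * ‖X v‖) := fun v => by
    rw [iteratedFDeriv_translate hsm]
    have e1 : ‖L (X v • iteratedFDeriv ℝ n a (p + (0, v)))‖ = ‖X v‖ *
        ‖(iteratedFDeriv ℝ n a (p + (0, v))).compContinuousLinearMap
          fun _ => jointScale (1 + ‖p.2‖)‖ := by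
      rw [← norm_smul]; rfl
    rw [e1]
    have h1 := hC (p + (0, v)) (mem_univ _)
    have h2 := norm_compContinuousLinearMap_jointScale_le (iteratedFDeriv ℝ n a (p + (0, v)))
      (1 + ‖p.2‖) (hpos (p + (0, v))).ne'
    have h3 : max 1 |(1 + ‖p.2‖) / (1 + ‖(p + (0, v)).2‖)| ≤ 1 + ‖v‖ := by
      refine max_le (by linarith [norm_nonneg v]) ?_
      rw [abs_of_pos (by positivity), div_le_iff₀ (hpos _)]
      have : ‖p.2‖ ≤ ‖p.2 + v‖ + ‖v‖ := by simpa using norm_sub_le (p.2 + v) v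
      simp only [Prod.snd_add]
      nlinarith [norm_nonneg (p.2 + v), norm_nonneg v]
    have h4 := one_add_norm_add_rpow_le m p.2 v
    have h5 : (1 + ‖v‖) ^ (n + |m|) = (1 + ‖v‖) ^ |m| * (1 + ‖v‖) ^ n := by
      rw [Real.rpow_add (by positivity), Real.rpow_natCast, mul_comm]
    calc _ ≤ ‖X v‖ * ((|C| * ((1 + ‖v‖) ^ |m| * (1 + ‖p.2‖) ^ m)) * (1 + ‖v‖) ^ n) := by
          gcongr
          refine h2.trans ?_
          refine mul_le_mul (h1.trans ?_) (pow_le_pow_left₀ (by positivity) h3 n)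
            (by positivity) (by positivity)
          exact mul_le_mul (le_abs_self C) h4 (Real.rpow_nonneg (hpos _).le m) (abs_nonneg _)
      _ = _ := by rw [h5]; ring
  refine (norm_integral_le_of_norm_le ((hX.integrable_rpow _).const_mul _)
    (Eventually.of_forall hbd)).trans (le_of_eq ?_)
  rw [integral_const_mul]
  ring

/-- By the mean value theorem a(y, ζ + v) - a(y, ζ) is ‖v‖ times a ζ-derivative of a, which has
order m - 1, up to powers of 1 + ‖v‖. Hence averaging preserves the principal symbol up to the total
mass of X. -/
theorem IsJointSymbol.symbolConv_sub {m : ℝ} {a : Y × Z → ℂ} (ha : IsJointSymbol m a) {X : Z → ℂ}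
    (hX : HasMoments μ X) : ∃ C : ℝ, ∀ p : Y × Z,
      ‖ZeroCalculus.symbolConv μ X a p - (∫ v, X v ∂μ) * a p‖ ≤ C * (1 + ‖p.2‖) ^ (m - 1) := by
  have hsm : ContDiff ℝ ∞ a := contDiffOn_univ.1 ha.contDiffOn
  have hdiff : Differentiable ℝ a := hsm.differentiable (by simp)
  have hpos : ∀ p : Y × Z, 0 < 1 + ‖p.2‖ := fun p => by positivity
  obtain ⟨C, hC⟩ := ha.bound 1
  obtain ⟨C₀, hC₀⟩ := ha.norm_iteratedFDeriv_le 0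
  have hder : ∀ (q : Y × Z) (v : Z), ‖fderiv ℝ a q (0, v)‖ ≤
      |C| * (1 + ‖q.2‖) ^ (m - 1) * ‖v‖ := fun q v => by
    have hl := hpos q
    have h1 := ((iteratedFDeriv ℝ 1 a q).compContinuousLinearMap
      fun _ => jointScale (1 + ‖q.2‖)).le_opNorm (fun _ => ((0 : Y), (1 + ‖q.2‖)⁻¹ • v))
    rw [ContinuousMultilinearMap.compContinuousLinearMap_apply, iteratedFDeriv_one_apply] at h1
    simp only [jointScale_apply, smul_smul, mul_inv_cancel₀ hl.ne', one_smul,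
      Finset.prod_const, Finset.card_univ, Fintype.card_fin, pow_one] at h1
    have h2 : ‖((0 : Y), (1 + ‖q.2‖)⁻¹ • v)‖ = (1 + ‖q.2‖)⁻¹ * ‖v‖ := by
      rw [Prod.norm_def]
      simp only [norm_zero, norm_smul, norm_inv, Real.norm_of_nonneg hl.le]
      exact max_eq_right (by positivity)
    rw [h2] at h1
    refine h1.trans ?_
    have h3 := (hC q (mem_univ _)).trans (mul_le_mul_of_nonneg_right (le_abs_self C)
      (Real.rpow_nonneg hl.le m))
    calc _ ≤ (|C| * (1 + ‖q.2‖) ^ m) * ((1 + ‖q.2‖)⁻¹ * ‖v‖) := by gcongr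
      _ = _ := by rw [Real.rpow_sub_one hl.ne']; field_simp
  have hincr : ∀ (p : Y × Z) (v : Z), ‖a (p.1, p.2 + v) - a p‖ ≤
      |C| * (1 + ‖p.2‖) ^ (m - 1) * (1 + ‖v‖) ^ (|m - 1| + 1) := fun p v => by
    have hf : ∀ s ∈ Icc (0 : ℝ) 1, HasDerivWithinAt (fun s : ℝ => a (p + s • ((0 : Y), v)))
        (fderiv ℝ a (p + s • ((0 : Y), v)) (0, v)) (Icc 0 1) s := fun s _ => by
      have h1 : HasDerivAt (fun s : ℝ => p + s • ((0 : Y), v)) ((0 : Y), v) s := by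
        simpa using ((hasDerivAt_id s).smul_const ((0 : Y), v)).const_add p
      exact ((hdiff _).hasFDerivAt.comp_hasDerivAt s h1).hasDerivWithinAt
    have := norm_image_sub_le_of_norm_deriv_le_segment_01' hf
      (C := |C| * (1 + ‖p.2‖) ^ (m - 1) * (1 + ‖v‖) ^ (|m - 1| + 1)) (fun s hs => by
        refine (hder _ v).trans ?_
        have h1 := one_add_norm_add_rpow_le (m - 1) p.2 (s • v)
        have h2 : (1 + ‖s • v‖) ≤ 1 + ‖v‖ := by
          rw [norm_smul, Real.norm_of_nonneg hs.1]
          nlinarith [norm_nonneg v, hs.2]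
        rw [Real.rpow_add_one (by positivity)]
        calc _ ≤ |C| * ((1 + ‖v‖) ^ |m - 1| * (1 + ‖p.2‖) ^ (m - 1)) * (1 + ‖v‖) := by
              gcongr
              · refine h1.trans ?_
                gcongr
              · linarith [norm_nonneg v]
          _ = _ := by ring)
    simpa [show p + ((0 : Y), v) = (p.1, p.2 + v) by ext <;> simp] using this
  refine ⟨|C| * ∫ v, (1 + ‖v‖) ^ (|m - 1| + 1) * ‖X v‖ ∂μ, fun p => ?_⟩
  have hi1 : Integrable (fun v => X v * a (p.1, p.2 + v)) μ := by
    refine ((hX.integrable_rpow |m|).const_mul (|C₀| * (1 + ‖p.2‖) ^ m)).mono'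
      ((hX.1.mul (hsm.continuous.comp (by fun_prop))).aestronglyMeasurable)
      (Eventually.of_forall fun v => ?_)
    have h1 := hC₀ (p.1, p.2 + v)
    rw [norm_iteratedFDeriv_zero] at h1
    rw [norm_mul]
    calc ‖X v‖ * ‖a (p.1, p.2 + v)‖
        ≤ ‖X v‖ * (|C₀| * ((1 + ‖v‖) ^ |m| * (1 + ‖p.2‖) ^ m)) := by
          gcongr
          exact h1.trans (mul_le_mul (le_abs_self _) (one_add_norm_add_rpow_le m p.2 v)
            (by positivity) (abs_nonneg _))
      _ = _ := by ring
  have e : ZeroCalculus.symbolConv μ X a p - (∫ v, X v ∂μ) * a p =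
      ∫ v, X v * (a (p.1, p.2 + v) - a p) ∂μ := by
    simp_rw [mul_sub]
    rw [integral_sub hi1 (hX.integrable.mul_const _), integral_mul_const]
    rfl
  rw [e]
  refine (norm_integral_le_of_norm_le ((hX.integrable_rpow (|m - 1| + 1)).const_mul
    (|C| * (1 + ‖p.2‖) ^ (m - 1))) (Eventually.of_forall fun v => ?_)).trans (le_of_eq ?_)
  · rw [norm_mul]
    calc _ ≤ ‖X v‖ * (|C| * (1 + ‖p.2‖) ^ (m - 1) * (1 + ‖v‖) ^ (|m - 1| + 1)) := by
          gcongr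
          exact hincr p v
      _ = _ := by ring
  · rw [integral_const_mul]; ring

end Convolution

/-! ### Fourier integrals: decay and inversion -/

section Oscillatory

open scoped FourierTransform

variable {E : Type*} [NormedAddCommGroup E] [InnerProductSpace ℝ E] [FiniteDimensional ℝ E]
  [MeasurableSpace E] [BorelSpace E]

/-- The Fourier integral `∫ exp(i u·ζ) G(u) du`. -/
noncomputable def oscInt (G : E → ℂ) (ζ : E) : ℂ :=
  ∫ u, Complex.exp (Complex.I * (inner ℝ u ζ : ℝ)) * G u

theorem norm_exp_I_mul (x : ℝ) : ‖Complex.exp (Complex.I * x)‖ = 1 := by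
  rw [mul_comm, Complex.norm_exp_ofReal_mul_I]

theorem oscInt_eq_fourier (G : E → ℂ) (ζ : E) : oscInt G ζ = 𝓕 G (-((2 * Real.pi)⁻¹ • ζ)) := by
  rw [Real.fourier_eq']
  refine integral_congr_ae (Eventually.of_forall fun u => ?_)
  simp only [smul_eq_mul, inner_neg_right, inner_smul_right]
  congr 2
  rw [mul_comm]
  congr 2
  field_simp

/-- The usual decay from M integrations by parts. What matters is the uniformity: the constant
depends only on the radius of the support and on M, so that G may vary with parameters. -/
theorem exists_norm_oscInt_le (r : ℝ) (M : ℕ) : ∃ C : ℝ, 0 ≤ C ∧ ∀ (G : E → ℂ) (B : ℝ),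
    ContDiff ℝ ∞ G → (∀ u, u ∉ Metric.closedBall (0 : E) r → G u = 0) →
    (∀ j ≤ M, ∀ u, ‖iteratedFDeriv ℝ j G u‖ ≤ B) →
    ∀ ζ, ‖oscInt G ζ‖ ≤ C * B * (1 + ‖ζ‖) ^ (-(M : ℝ)) := by
  set V := (volume (Metric.closedBall (0 : E) r)).toReal with hV
  refine ⟨2 ^ M * (V + (2 * Real.pi) ^ M * (2 ^ M * ((M + 1) * V))), by positivity,
    fun G B hG hs hB ζ => ?_⟩
  have hB0 : 0 ≤ B := (norm_nonneg _).trans (hB 0 (Nat.zero_le _) 0)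
  have hcs : HasCompactSupport G :=
    HasCompactSupport.intro (isCompact_closedBall (0 : E) r) hs
  have hDs : ∀ j u, u ∉ Metric.closedBall (0 : E) r → iteratedFDeriv ℝ j G u = 0 := fun j u hu => by
    have : G =ᶠ[𝓝 u] fun _ => 0 :=
      Filter.eventuallyEq_of_mem (Metric.isClosed_closedBall.isOpen_compl.mem_nhds hu)
        fun x hx => hs x hx
    rw [(this.iteratedFDeriv ℝ j).eq_of_nhds]
    simp
  have hDc : ∀ j : ℕ, Continuous (iteratedFDeriv ℝ j G) := fun j =>
    hG.continuous_iteratedFDeriv (mod_cast le_top)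
  have hint : ∀ k n : ℕ, Integrable (fun v => ‖v‖ ^ k * ‖iteratedFDeriv ℝ n G v‖) := fun k n =>
    ((continuous_norm.pow k).mul (hDc n).norm).integrable_of_hasCompactSupport
      ((hcs.iteratedFDeriv n).norm.mul_left)
  have hI : ∀ j ≤ M, ∫ v, ‖iteratedFDeriv ℝ j G v‖ ≤ V * B := fun j hj => by
    rw [← setIntegral_eq_integral_of_forall_compl_eq_zero (s := Metric.closedBall (0 : E) r)
      (fun x hx => by rw [hDs j x hx, norm_zero])]
    have := setIntegral_mono_on (μ := volume) (s := Metric.closedBall (0 : E) r)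
      (f := fun v => ‖iteratedFDeriv ℝ j G v‖) (g := fun _ => B)
      ((hDc j).norm.continuousOn.integrableOn_compact (isCompact_closedBall _ _))
      (continuous_const.continuousOn.integrableOn_compact (isCompact_closedBall _ _))
      measurableSet_closedBall (fun v _ => hB j hj v)
    refine this.trans (le_of_eq ?_)
    rw [setIntegral_const, smul_eq_mul]; rfl
  have key : ∀ n ≤ M, ∀ w, ‖w‖ ^ n * ‖𝓕 G w‖ ≤ 2 ^ n * ((n + 1) * (V * B)) := fun n hn w => by
    have := Real.pow_mul_norm_iteratedFDeriv_fourier_le (f := G) (K := ⊤) (N := ⊤)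
      hG (fun k n _ _ => hint k n) (k := 0) (n := n) le_top (mod_cast le_top) w
    rw [norm_iteratedFDeriv_zero] at this
    refine this.trans ?_
    simp only [pow_zero, one_mul, Nat.cast_zero, mul_zero, zero_add]
    gcongr
    have h2 : ∑ p ∈ Finset.range 1 ×ˢ Finset.range (n + 1),
        ∫ v, ‖v‖ ^ p.1 * ‖iteratedFDeriv ℝ p.2 G v‖ ≤
        ∑ p ∈ Finset.range 1 ×ˢ Finset.range (n + 1), V * B := by
      refine Finset.sum_le_sum fun p hp => ?_
      simp only [Finset.mem_product, Finset.mem_range, Nat.lt_one_iff] at hp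
      simp only [hp.1, pow_zero, one_mul]
      exact hI _ (by omega)
    refine h2.trans (le_of_eq ?_)
    simp
  set w := -((2 * Real.pi)⁻¹ • ζ) with hw
  have hζ : ‖ζ‖ = 2 * Real.pi * ‖w‖ := by
    rw [hw, norm_neg, norm_smul, norm_inv, Real.norm_of_nonneg (by positivity)]
    field_simp
  have h0 := key 0 (Nat.zero_le _) w
  have hM := key M le_rfl w
  rw [Real.rpow_neg (by positivity), Real.rpow_natCast, ← div_eq_mul_inv,
    le_div_iff₀ (by positivity), oscInt_eq_fourier, ← hw]
  have h3 : (1 + ‖ζ‖) ^ M ≤ 2 ^ M * (1 + ‖ζ‖ ^ M) := by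
    refine (add_pow_le zero_le_one (norm_nonneg _) M).trans ?_
    rw [one_pow]
    gcongr
    · norm_num
    · omega
  simp only [pow_zero, one_mul, Nat.cast_zero, zero_add] at h0
  calc ‖𝓕 G w‖ * (1 + ‖ζ‖) ^ M ≤ ‖𝓕 G w‖ * (2 ^ M * (1 + ‖ζ‖ ^ M)) := by gcongr
    _ = 2 ^ M * (‖𝓕 G w‖ + (2 * Real.pi) ^ M * (‖w‖ ^ M * ‖𝓕 G w‖)) := by rw [hζ, mul_pow]; ring
    _ ≤ 2 ^ M * (V * B + (2 * Real.pi) ^ M * (2 ^ M * ((M + 1) * (V * B)))) := by gcongr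
    _ = _ := by ring

/-- Fourier inversion for smooth functions of compact support. -/
theorem integral_exp_mul_oscInt {G : E → ℂ} (hG : ContDiff ℝ ∞ G) (hs : HasCompactSupport G)
    (x : E) :
    ∫ ζ, Complex.exp (Complex.I * (-(inner ℝ x ζ) : ℝ)) * oscInt G ζ =
      ((2 * Real.pi : ℝ) : ℂ) ^ Module.finrank ℝ E * G x := by
  have hint : Integrable (𝓕 G) :=
    (𝓕 (hs.toSchwartzMap hG)).integrable (μ := volume)
  have hinv : 𝓕⁻ (𝓕 G) x = G x :=
    (hG.continuous.integrable_of_hasCompactSupport hs).fourierInv_fourier_eq hint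
      hG.continuous.continuousAt
  rw [Real.fourierInv_eq'] at hinv
  have h1 := Measure.integral_comp_smul (volume : Measure E)
    (fun v => Complex.exp (((2 * Real.pi * inner ℝ v x : ℝ) : ℂ) * Complex.I) • 𝓕 G v)
    (-(2 * Real.pi)⁻¹)
  rw [hinv] at h1
  have h2 : (fun ζ => Complex.exp (Complex.I * (-(inner ℝ x ζ) : ℝ)) * oscInt G ζ) =
      fun v : E => Complex.exp (((2 * Real.pi * inner ℝ (-(2 * Real.pi)⁻¹ • v) x : ℝ) : ℂ) *
        Complex.I) • 𝓕 G (-(2 * Real.pi)⁻¹ • v) := by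
    ext ζ
    rw [oscInt_eq_fourier, neg_smul, smul_eq_mul]
    congr 2
    rw [mul_comm, inner_neg_left, inner_smul_left, real_inner_comm]
    congr 2
    simp
    field_simp
  rw [h2, h1, ← inv_pow, inv_neg, inv_inv, abs_pow, abs_neg, abs_of_pos (by positivity),
    Complex.real_smul]
  push_cast
  ring

end Oscillatory

/-! ### Rapid decay, uniformly in parameters -/

section Decay

variable {E : Type} [NormedAddCommGroup E] [InnerProductSpace ℝ E] [FiniteDimensional ℝ E]
  [MeasurableSpace E] [BorelSpace E]

theorem integrable_one_add_norm_rpow {s : ℝ} (hs : s < -Module.finrank ℝ E) :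
    Integrable (fun v : E => (1 + ‖v‖) ^ s) := by
  have := integrable_one_add_norm (E := E) (μ := volume) (r := -s) (by linarith)
  simpa using this

theorem HasMoments.of_decay {X : E → ℂ} (hX : Continuous X)
    (h : ∀ M : ℕ, ∃ C : ℝ, ∀ v, ‖X v‖ ≤ C * (1 + ‖v‖) ^ (-(M : ℝ))) : HasMoments volume X := by
  refine ⟨hX, fun N => ?_⟩
  obtain ⟨C, hC⟩ := h (N + (Module.finrank ℝ E + 1))
  have hi : Integrable (fun v : E => C * (1 + ‖v‖) ^ (-(Module.finrank ℝ E + 1 : ℝ))) :=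
    (integrable_one_add_norm_rpow (by linarith)).const_mul C
  refine hi.mono' (by fun_prop) (Eventually.of_forall fun v => ?_)
  rw [norm_mul, norm_norm, Real.norm_of_nonneg (by positivity)]
  calc (1 + ‖v‖) ^ N * ‖X v‖
      ≤ (1 + ‖v‖) ^ N * (C * (1 + ‖v‖) ^ (-((N + (Module.finrank ℝ E + 1) : ℕ) : ℝ))) := by
        gcongr; exact hC v
    _ = C * ((1 + ‖v‖) ^ N * (1 + ‖v‖) ^ (-((N + (Module.finrank ℝ E + 1) : ℕ) : ℝ))) := by ring
    _ = _ := by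
      rw [← Real.rpow_natCast, ← Real.rpow_add (by positivity)]
      congr 2
      push_cast; ring

/-- Fourier integrals of compactly supported functions depend continuously on parameters. -/
theorem continuous_oscInt_param {V : Type*} [TopologicalSpace V] [FirstCountableTopology V]
    [LocallyCompactSpace V] {G : V → E → ℂ} (hG : Continuous fun p : V × E => G p.1 p.2)
    {K : Set E} (hK : IsCompact K) (hs : ∀ v, ∀ u ∉ K, G v u = 0) {ζ : V → E} (hζ : Continuous ζ) :
    Continuous fun v => oscInt (G v) (ζ v) := by
  have h := continuous_parametric_integral_of_continuous (μ := (volume : Measure E))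
    (f := fun v u => Complex.exp (Complex.I * (inner ℝ u (ζ v) : ℝ)) * G v u) (by
      have : Continuous fun p : V × E => inner ℝ p.2 (ζ p.1) := by fun_prop
      exact ((Complex.continuous_exp.comp (by fun_prop)).mul hG)) hK
  refine h.congr fun v => ?_
  exact setIntegral_eq_integral_of_forall_compl_eq_zero fun u hu => by rw [hs v u hu, mul_zero]

theorem continuous_oscInt {G : E → ℂ} (hG : Continuous G) (hs : HasCompactSupport G) :
    Continuous (oscInt G) :=
  continuous_oscInt_param (V := E) (G := fun _ => G) (by fun_prop) hs
    (fun _ u hu => image_eq_zero_of_notMem_tsupport hu) continuous_id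

theorem _root_.HasCompactSupport.exists_norm_iteratedFDeriv_le {W : Type*} [NormedAddCommGroup W]
    [NormedSpace ℝ W] {f : W → ℂ} (hs : HasCompactSupport f) (hf : ContDiff ℝ ∞ f) (M : ℕ) :
    ∃ B : ℝ, 0 ≤ B ∧ ∀ j ≤ M, ∀ x, ‖iteratedFDeriv ℝ j f x‖ ≤ B := by
  choose B hB using fun j : ℕ => (hs.iteratedFDeriv (𝕜 := ℝ) j).exists_bound_of_continuous
    (hf.continuous_iteratedFDeriv (mod_cast le_top))
  refine ⟨∑ j ∈ Finset.range (M + 1), |B j|, by positivity, fun j hj x => (hB j x).trans ?_⟩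
  exact (le_abs_self _).trans (Finset.single_le_sum (f := fun j => |B j|)
    (fun i _ => abs_nonneg _) (Finset.mem_range.2 (Nat.lt_succ_of_le hj)))

/-- Rapid decay of `ζ ↦ ∫ exp(i u·ζ) χ(u) f(c + S u) du`, uniformly in the affine map. -/
theorem exists_norm_oscInt_affine_le {W : Type*} [NormedAddCommGroup W] [NormedSpace ℝ W]
    {χ : E → ℂ} (hχ : ContDiff ℝ ∞ χ) (hs : HasCompactSupport χ) (M : ℕ) :
    ∃ C : ℝ, 0 ≤ C ∧ ∀ (f : W → ℂ) (B : ℝ), ContDiff ℝ ∞ f →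
      (∀ j ≤ M, ∀ x, ‖iteratedFDeriv ℝ j f x‖ ≤ B) → ∀ (c : W) (S : E →L[ℝ] W) (ζ : E),
        ‖oscInt (fun u => χ u * f (c + S u)) ζ‖ ≤
          C * B * (1 + ‖S‖) ^ M * (1 + ‖ζ‖) ^ (-(M : ℝ)) := by
  obtain ⟨r, hr⟩ := hs.isBounded.subset_closedBall (0 : E)
  obtain ⟨C, hC0, hC⟩ := exists_norm_oscInt_le (E := E) r M
  obtain ⟨D, hD0, hD⟩ := hs.exists_norm_iteratedFDeriv_le hχ M
  refine ⟨C * (2 ^ M * D), by positivity, fun f B hf hB c S ζ => ?_⟩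
  have hB0 : 0 ≤ B := (norm_nonneg _).trans (hB 0 (Nat.zero_le _) 0)
  have hfa : ContDiff ℝ ∞ fun u => f (c + S u) := hf.comp (by fun_prop)
  have h1 : ∀ j ≤ M, ∀ u, ‖iteratedFDeriv ℝ j (fun u => f (c + S u)) u‖ ≤ B * (1 + ‖S‖) ^ M := by
    intro j hj u
    have h := iteratedFDeriv_comp_affine (f := f) (x := c + S u) (n := j)
      ((hf.of_le (mod_cast le_top)).contDiffAt) S
    have h' : iteratedFDeriv ℝ j (fun z => f (c + S u + S z)) 0 =
        iteratedFDeriv ℝ j (fun u => f (c + S u)) u := by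
      have := iteratedFDeriv_comp_add_left (𝕜 := ℝ) (f := fun u => f (c + S u)) j u (x := 0)
      rw [add_zero] at this
      rw [← this]
      congr 1
      ext z
      rw [map_add, add_assoc]
    rw [← h', h]
    refine (ContinuousMultilinearMap.norm_compContinuousLinearMap_le _ _).trans ?_
    rw [Finset.prod_const, Finset.card_univ, Fintype.card_fin]
    gcongr
    · exact hB j hj _
    · calc ‖S‖ ^ j ≤ (1 + ‖S‖) ^ j := by gcongr; linarith
        _ ≤ (1 + ‖S‖) ^ M := pow_le_pow_right₀ (by linarith [norm_nonneg S]) hj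
  have h2 : ∀ j ≤ M, ∀ u, ‖iteratedFDeriv ℝ j (fun u => χ u * f (c + S u)) u‖ ≤
      2 ^ M * D * (B * (1 + ‖S‖) ^ M) := by
    intro j hj u
    refine (norm_iteratedFDeriv_mul_le (𝕜 := ℝ) (N := ∞) hχ hfa u
      (mod_cast le_top)).trans ?_
    calc _ ≤ ∑ i ∈ Finset.range (j + 1), (j.choose i : ℝ) * D * (B * (1 + ‖S‖) ^ M) := by
          refine Finset.sum_le_sum fun i hi => ?_
          have hi' : i ≤ j := Nat.lt_succ_iff.1 (Finset.mem_range.1 hi)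
          gcongr
          · exact hD i (hi'.trans hj) u
          · exact h1 _ (by omega) u
      _ = 2 ^ j * D * (B * (1 + ‖S‖) ^ M) := by
          rw [← Finset.sum_mul, ← Finset.sum_mul]
          congr 2
          exact_mod_cast Nat.sum_range_choose j
      _ ≤ _ := by
          gcongr
          · norm_num
  refine (hC _ _ (hχ.mul hfa) (fun u hu => ?_) h2 ζ).trans (le_of_eq (by ring))
  rw [image_eq_zero_of_notMem_tsupport (fun h => hu (hr h)), zero_mul]

theorem hasMoments_oscInt {χ : E → ℂ} (hχ : ContDiff ℝ ∞ χ) (hs : HasCompactSupport χ) :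
    HasMoments volume (oscInt χ) := by
  refine HasMoments.of_decay (continuous_oscInt hχ.continuous hs) fun M => ?_
  obtain ⟨r, hr⟩ := hs.isBounded.subset_closedBall (0 : E)
  obtain ⟨C, hC0, hC⟩ := exists_norm_oscInt_le (E := E) r M
  obtain ⟨D, hD0, hD⟩ := hs.exists_norm_iteratedFDeriv_le hχ M
  exact ⟨C * D, hC χ D hχ (fun u hu => image_eq_zero_of_notMem_tsupport fun h => hu (hr h)) hD⟩

theorem integral_oscInt {χ : E → ℂ} (hχ : ContDiff ℝ ∞ χ) (hs : HasCompactSupport χ) :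
    ∫ ζ, oscInt χ ζ = ((2 * Real.pi : ℝ) : ℂ) ^ Module.finrank ℝ E * χ 0 := by
  rw [← integral_exp_mul_oscInt hχ hs 0]
  simp

end Decay

/-! ### Construction of distributions from integrals -/

section MakeDistribution

variable {W : Type*} [NormedAddCommGroup W] [NormedSpace ℝ W]

/-- A distribution given by integrals `∫ T f v dμ(v)`, where `T f v` is linear in `f` and bounded
in terms of finitely many derivatives of `f`. -/
theorem exists_distr_eq_integral {Ω : TopologicalSpace.Opens W} {V : Type*} [MeasurableSpace V]
    (μ : Measure V) (T : 𝓓(Ω, ℂ) → V → ℂ) (hadd : ∀ f g v, T (f + g) v = T f v + T g v)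
    (hsmul : ∀ (c : ℂ) f v, T (c • f) v = c * T f v)
    (hmeas : ∀ f, AEStronglyMeasurable (T f) μ)
    (hbound : ∀ K : TopologicalSpace.Compacts W, (K : Set W) ⊆ Ω →
      ∃ (M : ℕ) (β : V → ℝ), Integrable β μ ∧ ∀ (f : 𝓓(Ω, ℂ)) (B : ℝ), (∀ x ∉ K, f x = 0) →
        (∀ j ≤ M, ∀ x, ‖iteratedFDeriv ℝ j f x‖ ≤ B) → ∀ᵐ v ∂μ, ‖T f v‖ ≤ B * β v) :
    ∃ L : CDistr Ω, ∀ f, Integrable (T f) μ ∧ L f = ∫ v, T f v ∂μ := by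
  have hint : ∀ f, Integrable (T f) μ := fun f => by
    obtain ⟨M, β, hβ, h⟩ := hbound ⟨tsupport f, f.hasCompactSupport⟩ f.tsupport_subset
    obtain ⟨B, -, hB⟩ := f.hasCompactSupport.exists_norm_iteratedFDeriv_le f.contDiff M
    exact (hβ.const_mul B).mono' (hmeas f)
      (h f B (fun x hx => image_eq_zero_of_notMem_tsupport hx) hB)
  have ha : ∀ f g, ∫ v, T (f + g) v ∂μ = ∫ v, T f v ∂μ + ∫ v, T g v ∂μ := fun f g => by
    rw [← integral_add (hint f) (hint g)]
    simp only [hadd]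
  have hc : ∀ (c : ℂ) f, ∫ v, T (c • f) v ∂μ = c • ∫ v, T f v ∂μ := fun c f => by
    rw [← integral_smul]
    simp only [hsmul, smul_eq_mul]
  -- Continuity in the LF topology is checked on the functions supported in a fixed compact set K,
  -- where it is a bound by finitely many seminorms.
  refine ⟨TestFunction.mkCLM ℂ (fun f => ∫ v, T f v ∂μ) ha hc fun K hK => ?_,
    fun f => ⟨hint f, rfl⟩⟩
  obtain ⟨M, β, hβ, h⟩ := hbound K hK
  refine (ContDiffMapSupportedIn.mkCLMtoNormedSpace ℂ
    (fun f : 𝓓^{⊤}_{K}(W, ℂ) => ∫ v, T (TestFunction.ofSupportedIn hK f) v ∂μ)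
    (fun f g => ha (TestFunction.ofSupportedIn hK f) (TestFunction.ofSupportedIn hK g))
    (fun c f => hc c (TestFunction.ofSupportedIn hK f))
    ⟨Finset.range (M + 1), |∫ v, β v ∂μ|, abs_nonneg _, fun f => ?_⟩).continuous
  set B := ((Finset.range (M + 1)).sup fun i =>
    ContDiffMapSupportedIn.seminorm ℂ W ℂ ⊤ K i) f with hB
  have hBf : ∀ j ≤ M, ∀ x, ‖iteratedFDeriv ℝ j f x‖ ≤ B := fun j hj x =>
    (ContDiffMapSupportedIn.norm_iteratedFDeriv_apply_le_seminorm_top ℂ).trans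
      (Seminorm.le_finset_sup_apply (p := fun i => ContDiffMapSupportedIn.seminorm ℂ W ℂ ⊤ K i)
        (Finset.mem_range.2 (Nat.lt_succ_of_le hj)))
  have hle := h (TestFunction.ofSupportedIn hK f) B (fun x hx => f.zero_on_compl hx) hBf
  have hB0 : 0 ≤ B := (norm_nonneg _).trans (hBf 0 (Nat.zero_le _) 0)
  calc _ ≤ ∫ v, B * β v ∂μ := norm_integral_le_of_norm_le (hβ.const_mul B) hle
    _ = (∫ v, β v ∂μ) * B := by rw [integral_const_mul, mul_comm]
    _ ≤ _ := mul_le_mul_of_nonneg_right (le_abs_self _) hB0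

end MakeDistribution

/-! ### The splitting z = (x, y) -/

section Coordinates

variable {d : ℕ}

@[simp] theorem pt_apply_zero (x : ℝ) (y : Tan d) : pt x y 0 = x := rfl

@[simp] theorem tail_pt (x : ℝ) (y : Tan d) : tail (pt x y) = y := by ext j; rfl

@[simp] theorem pt_tail (z : Amb d) : pt (z 0) (tail z) = z := by
  ext j
  refine Fin.cases rfl (fun i => rfl) j

theorem pt_add (x x' : ℝ) (y y' : Tan d) : pt (x + x') (y + y') = pt x y + pt x' y' := by
  ext j
  refine Fin.cases rfl (fun i => rfl) j

theorem pt_smul (c x : ℝ) (y : Tan d) : pt (c * x) (c • y) = c • pt x y := by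
  ext j
  refine Fin.cases rfl (fun i => rfl) j

theorem tail_add (z w : Amb d) : tail (z + w) = tail z + tail w := by ext j; rfl

theorem tail_sub (z w : Amb d) : tail (z - w) = tail z - tail w := by ext j; rfl

theorem tail_smul (c : ℝ) (z : Amb d) : tail (c • z) = c • tail z := by ext j; rfl

theorem inner_pt (x x' : ℝ) (y y' : Tan d) :
    inner ℝ (pt x y) (pt x' y') = x * x' + inner ℝ y y' := by
  simp only [PiLp.inner_apply, Fin.sum_univ_succ]
  congr 1
  change x' * x = _
  ring

theorem inner_pt_right (z : Amb d) (x : ℝ) (y : Tan d) :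
    inner ℝ z (pt x y) = z 0 * x + inner ℝ (tail z) y := by
  rw [← inner_pt, pt_tail]

theorem norm_pt_sq (x : ℝ) (y : Tan d) : ‖pt x y‖ ^ 2 = x ^ 2 + ‖y‖ ^ 2 := by
  rw [← real_inner_self_eq_norm_sq, inner_pt, real_inner_self_eq_norm_sq]
  ring

@[simp] theorem norm_pt_zero_left (y : Tan d) : ‖pt 0 y‖ = ‖y‖ := by
  have := norm_pt_sq 0 y
  rw [← Real.sqrt_sq (norm_nonneg (pt 0 y)), this]
  simp

theorem abs_apply_zero_le (z : Amb d) : |z 0| ≤ ‖z‖ := by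
  rw [← Real.norm_eq_abs]; exact PiLp.norm_apply_le z 0

theorem norm_tail_le (z : Amb d) : ‖tail z‖ ≤ ‖z‖ := by
  have := norm_pt_sq (z 0) (tail z)
  rw [pt_tail] at this
  exact le_of_sq_le_sq (by nlinarith) (norm_nonneg _)

/-- The inverse `(x, y) ↦ pt x y` of the coordinates, as a continuous linear map. -/
noncomputable def ptL (d : ℕ) : ℝ × Tan d →L[ℝ] Amb d :=
  LinearMap.toContinuousLinearMap
    { toFun := fun p => pt p.1 p.2
      map_add' := fun _ _ => pt_add _ _ _ _
      map_smul' := fun _ _ => pt_smul _ _ _ }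

/-- The tangential component, as a continuous linear map. -/
noncomputable def tailL (d : ℕ) : Amb d →L[ℝ] Tan d :=
  LinearMap.toContinuousLinearMap
    { toFun := tail
      map_add' := tail_add
      map_smul' := tail_smul }

@[simp] theorem ptL_apply (p : ℝ × Tan d) : ptL d p = pt p.1 p.2 := rfl

@[fun_prop]
theorem continuous_tail : Continuous (tail : Amb d → Tan d) := (tailL d).continuous

@[fun_prop]
theorem contDiff_tail {n : ℕ∞ω} : ContDiff ℝ n (tail : Amb d → Tan d) := (tailL d).contDiff

@[fun_prop]
theorem Continuous.pt {α : Type*} [TopologicalSpace α] {f : α → ℝ} {g : α → Tan d}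
    (hf : Continuous f) (hg : Continuous g) : Continuous fun x => pt (f x) (g x) :=
  (ptL d).continuous.comp (hf.prodMk hg)

theorem ContDiffAt.pt {α : Type*} [NormedAddCommGroup α] [NormedSpace ℝ α] {n : ℕ∞ω} {f : α → ℝ}
    {g : α → Tan d} {x : α} (hf : ContDiffAt ℝ n f x) (hg : ContDiffAt ℝ n g x) :
    ContDiffAt ℝ n (fun x => pt (f x) (g x)) x :=
  (ptL d).contDiff.contDiffAt.comp x (hf.prodMk hg)

theorem ContDiff.pt {α : Type*} [NormedAddCommGroup α] [NormedSpace ℝ α] {n : ℕ∞ω} {f : α → ℝ}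
    {g : α → Tan d} (hf : ContDiff ℝ n f) (hg : ContDiff ℝ n g) :
    ContDiff ℝ n (fun x => pt (f x) (g x)) :=
  (ptL d).contDiff.comp (hf.prodMk hg)

theorem contDiff_apply_zero {n : ℕ∞ω} : ContDiff ℝ n (fun z : Amb d => z 0) :=
  (EuclideanSpace.proj (𝕜 := ℝ) (0 : Fin (d + 1))).contDiff

end Coordinates

/-! ### The kernel in coordinates near the front face -/

section FrontFace

variable {d : ℕ}

/-- The length `(1 + |v|²)^{1/2}` of `(v, 1)`. -/
noncomputable def bracket (v : Amb d) : ℝ := Real.sqrt (‖v‖ ^ 2 + 1)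

theorem bracket_pos (v : Amb d) : 0 < bracket v := Real.sqrt_pos.2 (by positivity)

theorem continuous_bracket : Continuous (bracket : Amb d → ℝ) := by
  unfold bracket; fun_prop

/-- The function `polarFun H` in the coordinates `v = (s, Υ)` and `w = (x', y')`. -/
noncomputable def frontFun (H : ℝ × Tan d × Amb d × ℝ → ℂ) (w v : Amb d) : ℂ :=
  H (w 0 * bracket v, tail w, (bracket v)⁻¹ • v, (bracket v)⁻¹)

theorem continuous_frontFun {H : ℝ × Tan d × Amb d × ℝ → ℂ} (hH : Continuous H) :
    Continuous fun p : Amb d × Amb d => frontFun H p.1 p.2 := by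
  have h1 : Continuous fun p : Amb d × Amb d => bracket p.2 := continuous_bracket.comp continuous_snd
  have h2 : Continuous fun p : Amb d × Amb d => (bracket p.2)⁻¹ :=
    h1.inv₀ fun p => (bracket_pos p.2).ne'
  unfold frontFun
  exact hH.comp (by fun_prop)

/-- With z = (0, y') + x' v the radius is x' ⟨v⟩, so the polar variables are (x' ⟨v⟩, y', v/⟨v⟩,
1/⟨v⟩). In this form the function extends to x' = 0. -/
theorem polarFun_eq_frontFun (H : ℝ × Tan d × Amb d × ℝ → ℂ) {w : Amb d} (hw : 0 < w 0)
    (v : Amb d) : polarFun H (pt 0 (tail w) + w 0 • v) w = frontFun H w v := by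
  have hr : radius (pt 0 (tail w) + w 0 • v) w = w 0 * bracket v := by
    rw [radius, bracket, add_sub_cancel_left, norm_smul, Real.norm_of_nonneg hw.le,
      ← Real.sqrt_sq hw.le, ← Real.sqrt_mul (by positivity), Real.sqrt_sq hw.le]
    congr 1; ring
  have h1 : (w 0 * bracket v)⁻¹ • w 0 • v = (bracket v)⁻¹ • v := by
    rw [smul_smul, mul_inv, mul_right_comm, inv_mul_cancel₀ hw.ne', one_mul]
  have h2 : w 0 / (w 0 * bracket v) = (bracket v)⁻¹ := by
    rw [div_mul_eq_div_div, div_self hw.ne', one_div]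
  rw [polarFun, frontFun, hr, add_sub_cancel_left, h1, h2]

/-- The pairing of the kernel with data `a`, `χ`, `H` over the point `w = (x', y')`, as a
distribution in `v = (s, Υ)`, with a function `G`. -/
noncomputable def frontPairing (a : Amb d × Amb d → ℂ) (χ : Amb d → ℝ)
    (H : ℝ × Tan d × Amb d × ℝ → ℂ) (w : Amb d) (G : Amb d → ℂ) : ℂ :=
  ((2 * Real.pi : ℝ) : ℂ)⁻¹ ^ (d + 1) *
      (∫ ζ, a (w, ζ) * oscInt (fun u => (χ u : ℂ) * G (pt 1 0 + u)) ζ) +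
    ∫ v, frontFun H w v * G v

theorem IsSymbol.exists_norm_le {m : ℝ} {a : Amb d × Amb d → ℂ} (ha : IsSymbol m a) :
    ∃ C : ℝ, 0 ≤ C ∧ ∀ p, ‖a p‖ ≤ C * (1 + ‖p.2‖) ^ m := by
  obtain ⟨C, hC⟩ := ha.2 0 0
  refine ⟨|C|, abs_nonneg _, fun p => ?_⟩
  have := hC p.1 p.2
  rw [norm_iteratedFDeriv_zero, norm_iteratedFDeriv_zero, Nat.cast_zero, sub_zero] at this
  exact this.trans (mul_le_mul_of_nonneg_right (le_abs_self _) (by positivity))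

theorem ofReal_comp_smooth {E : Type*} [NormedAddCommGroup E] [NormedSpace ℝ E] {χ : E → ℝ}
    (hχ : ContDiff ℝ ∞ χ) (hs : HasCompactSupport χ) :
    ContDiff ℝ ∞ (fun u => (χ u : ℂ)) ∧ HasCompactSupport (fun u => (χ u : ℂ)) :=
  ⟨Complex.ofRealCLM.contDiff.comp hχ, hs.comp_left Complex.ofReal_zero⟩

/-- Rapid decay of Fourier integrals of cut off test functions. -/
theorem exists_norm_oscInt_cutoff_le {χ : Amb d → ℝ} (hχ : ContDiff ℝ ∞ χ)
    (hs : HasCompactSupport χ) (M : ℕ) : ∃ C : ℝ, 0 ≤ C ∧ ∀ (f : Amb d → ℂ) (B : ℝ),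
      ContDiff ℝ ∞ f → (∀ j ≤ M, ∀ x, ‖iteratedFDeriv ℝ j f x‖ ≤ B) → ∀ ζ,
        ‖oscInt (fun u => (χ u : ℂ) * f (pt 1 0 + u)) ζ‖ ≤ C * B * (1 + ‖ζ‖) ^ (-(M : ℝ)) := by
  obtain ⟨hχ', hs'⟩ := ofReal_comp_smooth hχ hs
  obtain ⟨C, hC0, hC⟩ := exists_norm_oscInt_affine_le (W := Amb d) hχ' hs' M
  refine ⟨C * (1 + ‖ContinuousLinearMap.id ℝ (Amb d)‖) ^ M, by positivity,
    fun f B hf hB ζ => ?_⟩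
  refine (hC f B hf hB (pt 1 0) (ContinuousLinearMap.id ℝ _) ζ).trans (le_of_eq (by ring))

/-- M is the number of derivatives of a test function which suffices for absolute convergence of its
pairing with a symbol of order m. -/
theorem exists_nat_decay (d : ℕ) (m : ℝ) :
    ∃ M : ℕ, m - (M : ℝ) < -(Module.finrank ℝ (Amb d) : ℝ) := by
  obtain ⟨M, hM⟩ := exists_nat_gt (m + Module.finrank ℝ (Amb d))
  exact ⟨M, by linarith⟩

theorem exists_distr_of_continuousOn {W : Type*} [NormedAddCommGroup W] [NormedSpace ℝ W]
    [FiniteDimensional ℝ W] [MeasurableSpace W] [BorelSpace W] (μ : Measure W)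
    [IsLocallyFiniteMeasure μ] (Ω : TopologicalSpace.Opens W) {k : W → ℂ}
    (hk : ContinuousOn k Ω) : ∃ L : CDistr Ω, ∀ f, L f = ∫ x, k x * f x ∂μ := by
  have := FiniteDimensional.proper_real W
  have hloc : LocallyIntegrableOn k Ω μ :=
    hk.locallyIntegrableOn Ω.isOpen.measurableSet
  refine ⟨TestFunction.integralAgainstBilinCLM (ContinuousLinearMap.mul ℂ ℂ) μ k, fun f => ?_⟩
  rw [TestFunction.integralAgainstBilinCLM_eq_integral hloc]
  simp only [ContinuousLinearMap.mul_apply', mul_comm]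

theorem exists_distr_frontPairing {m : ℝ} {a : Amb d × Amb d → ℂ} (ha : IsSymbol m a)
    {χ : Amb d → ℝ} (hχ : ContDiff ℝ ∞ χ) (hs : HasCompactSupport χ)
    {H : ℝ × Tan d × Amb d × ℝ → ℂ} (hH : Continuous H) (w : Amb d) :
    ∃ N : CDistr (openHalf d), ∀ g, N g = frontPairing a χ H w g := by
  obtain ⟨Ca, hCa0, hCa⟩ := ha.exists_norm_le
  obtain ⟨M, hM⟩ := exists_nat_decay d m
  obtain ⟨C, hC0, hC⟩ := exists_norm_oscInt_cutoff_le hχ hs M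
  obtain ⟨hχ', hs'⟩ := ofReal_comp_smooth hχ hs
  have hcont : ∀ f : 𝓓(openHalf d, ℂ), Continuous fun ζ =>
      oscInt (fun u => (χ u : ℂ) * f (pt 1 0 + u)) ζ := fun f =>
    continuous_oscInt (hχ'.continuous.mul (f.continuous.comp (by fun_prop))) hs'.mul_right
  have hint : ∀ (f : 𝓓(openHalf d, ℂ)) ζ, Integrable fun u =>
      Complex.exp (Complex.I * (inner ℝ u ζ : ℝ)) * ((χ u : ℂ) * f (pt 1 0 + u)) := fun f ζ => by
    refine Continuous.integrable_of_hasCompactSupport ?_ (hs'.mul_right.mul_left)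
    have : Continuous f := f.continuous
    have := hχ'.continuous
    fun_prop
  obtain ⟨N₁, hN₁⟩ := exists_distr_eq_integral (Ω := openHalf d) (volume : Measure (Amb d))
    (fun f ζ => a (w, ζ) * oscInt (fun u => (χ u : ℂ) * f (pt 1 0 + u)) ζ)
    (fun f g ζ => by
      rw [← mul_add, oscInt, oscInt, oscInt, ← integral_add (hint f ζ) (hint g ζ)]
      congr 2
      ext u
      rw [FunLike.coe_add, Pi.add_apply]
      ring)
    (fun c f ζ => by
      rw [oscInt, oscInt, mul_left_comm c (a (w, ζ)), ← integral_const_mul c]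
      refine congrArg (a (w, ζ) * ·) (integral_congr_ae (Eventually.of_forall fun u => ?_))
      change _ * (_ * (c * f _)) = c * _
      ring)
    (fun f => ((ha.1.continuous.comp (by fun_prop)).mul (hcont f)).aestronglyMeasurable)
    (fun K _ => ⟨M, fun ζ => Ca * C * (1 + ‖ζ‖) ^ (m - M),
      (integrable_one_add_norm_rpow hM).const_mul _, fun f B _ hB =>
        Eventually.of_forall fun ζ => by
          rw [norm_mul]
          calc _ ≤ (Ca * (1 + ‖ζ‖) ^ m) * (C * B * (1 + ‖ζ‖) ^ (-(M : ℝ))) := by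
                gcongr
                · exact hCa (w, ζ)
                · exact hC f B f.contDiff hB ζ
            _ = B * (Ca * C * ((1 + ‖ζ‖) ^ m * (1 + ‖ζ‖) ^ (-(M : ℝ)))) := by ring
            _ = _ := by rw [← Real.rpow_add (by positivity), sub_eq_add_neg]⟩)
  obtain ⟨N₂, hN₂⟩ := exists_distr_of_continuousOn (volume : Measure (Amb d)) (openHalf d)
    (k := fun v => frontFun H w v)
    ((continuous_frontFun hH).comp (by fun_prop : Continuous fun v => (w, v))).continuousOn
  refine ⟨((2 * Real.pi : ℝ) : ℂ)⁻¹ ^ (d + 1) • N₁ + N₂, fun g => ?_⟩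
  rw [add_apply, smul_apply, (hN₁ g).2, hN₂, smul_eq_mul, frontPairing]

end FrontFace

/-! ### Restriction of the kernel to the front face: change of variables -/

section NormalKernel

variable {d : ℕ}

theorem continuous_frontPairing_symbol {m : ℝ} {a : Amb d × Amb d → ℂ} (ha : IsSymbol m a)
    {χ : Amb d → ℝ} (hχ : ContDiff ℝ ∞ χ) (hs : HasCompactSupport χ)
    {g : Amb d → ℂ} (hg : ContDiff ℝ ∞ g) (hgs : HasCompactSupport g) :
    Continuous fun w => ∫ ζ, a (w, ζ) * oscInt (fun u => (χ u : ℂ) * g (pt 1 0 + u)) ζ := by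
  obtain ⟨Ca, hCa0, hCa⟩ := ha.exists_norm_le
  obtain ⟨M, hM⟩ := exists_nat_decay d m
  obtain ⟨C, hC0, hC⟩ := exists_norm_oscInt_cutoff_le hχ hs M
  obtain ⟨hχ', hs'⟩ := ofReal_comp_smooth hχ hs
  obtain ⟨B, hB0, hB⟩ := hgs.exists_norm_iteratedFDeriv_le hg M
  have hosc : Continuous fun ζ => oscInt (fun u => (χ u : ℂ) * g (pt 1 0 + u)) ζ :=
    continuous_oscInt (hχ'.continuous.mul (hg.continuous.comp (by fun_prop))) hs'.mul_right
  refine continuous_of_dominated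
    (bound := fun ζ => (Ca * (1 + ‖ζ‖) ^ m) * (C * B * (1 + ‖ζ‖) ^ (-(M : ℝ))))
    (fun w => ((ha.1.continuous.comp (by fun_prop)).mul hosc).aestronglyMeasurable)
    (fun w => Eventually.of_forall fun ζ => ?_) ?_
    (Eventually.of_forall fun ζ => (ha.1.continuous.comp (by fun_prop)).mul continuous_const)
  · rw [norm_mul]
    gcongr
    · exact hCa (w, ζ)
    · exact hC g B hg hB ζ
  · refine ((integrable_one_add_norm_rpow hM).const_mul (Ca * C * B)).congr
      (Eventually.of_forall fun ζ => ?_)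
    change Ca * C * B * (1 + ‖ζ‖) ^ (m - M) =
      (Ca * (1 + ‖ζ‖) ^ m) * (C * B * (1 + ‖ζ‖) ^ (-(M : ℝ)))
    rw [sub_eq_add_neg, Real.rpow_add (by positivity)]
    ring

theorem continuous_frontPairing_frontFun {H : ℝ × Tan d × Amb d × ℝ → ℂ} (hH : Continuous H)
    {g : Amb d → ℂ} (hg : Continuous g) (hgs : HasCompactSupport g) :
    Continuous fun w => ∫ v, frontFun H w v * g v := by
  have h := continuous_parametric_integral_of_continuous (μ := (volume : Measure (Amb d)))
    (f := fun w v => frontFun H w v * g v)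
    ((continuous_frontFun hH).mul (hg.comp continuous_snd)) hgs.isCompact
  exact h.congr fun w => setIntegral_eq_integral_of_forall_compl_eq_zero fun u hu => by
    rw [image_eq_zero_of_notMem_tsupport hu, mul_zero]

/-- Continuity in w up to and across x' = 0 is what makes the averages that define the restriction
to the front face converge. -/
theorem continuous_frontPairing {m : ℝ} {a : Amb d × Amb d → ℂ} (ha : IsSymbol m a)
    {χ : Amb d → ℝ} (hχ : ContDiff ℝ ∞ χ) (hs : HasCompactSupport χ)
    {H : ℝ × Tan d × Amb d × ℝ → ℂ} (hH : Continuous H) {g : Amb d → ℂ} (hg : ContDiff ℝ ∞ g)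
    (hgs : HasCompactSupport g) : Continuous fun w => frontPairing a χ H w g :=
  (continuous_const.mul (continuous_frontPairing_symbol ha hχ hs hg hgs)).add
    (continuous_frontPairing_frontFun hH hg.continuous hgs)

/-- The test function `g(v) h(w) x'^(-n)` in the coordinates `(z, w)`. -/
noncomputable def frontTest (g : Amb d → ℂ) (h : Amb d → ℝ) (p : Amb d × Amb d) : ℂ :=
  g (pt (p.1 0 / p.2 0) ((p.2 0)⁻¹ • (tail p.1 - tail p.2))) * (h p.2 * (p.2 0)⁻¹ ^ (d + 1) : ℝ)

theorem frontTest_arg (p : Amb d × Amb d) :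
    pt (p.1 0 / p.2 0) ((p.2 0)⁻¹ • (tail p.1 - tail p.2)) =
      (p.2 0)⁻¹ • (p.1 - pt 0 (tail p.2)) := by
  conv_rhs => rw [← pt_tail (p.1 - pt 0 (tail p.2)), ← pt_smul, tail_sub, tail_pt]
  congr 1
  simp [div_eq_inv_mul]

theorem frontTest_front (g : Amb d → ℂ) (h : Amb d → ℝ) {w : Amb d} (hw : w 0 ≠ 0) (v : Amb d) :
    frontTest g h (pt 0 (tail w) + w 0 • v, w) = g v * (h w * (w 0)⁻¹ ^ (d + 1) : ℝ) := by
  rw [frontTest, frontTest_arg, add_sub_cancel_left, smul_smul, inv_mul_cancel₀ hw, one_smul]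

theorem eq_front_point (p : Amb d × Amb d) (hw : p.2 0 ≠ 0) :
    p.1 = pt 0 (tail p.2) + p.2 0 • ((p.2 0)⁻¹ • (p.1 - pt 0 (tail p.2))) := by
  rw [smul_smul, mul_inv_cancel₀ hw, one_smul, add_sub_cancel]

/-- The variable u is centered at the 0-diagonal, which is the point v = (1, 0) of each fiber; hence
v = (1, 0) + u. -/
theorem add_smul_eq_front_point (w u : Amb d) :
    w + w 0 • u = pt 0 (tail w) + w 0 • (pt 1 0 + u) := by
  rw [smul_add, ← add_assoc]
  congr 1
  rw [← pt_smul, ← pt_add]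
  simp

variable {g : Amb d → ℂ} {h : Amb d → ℝ}

theorem contDiffAt_frontTest_arg {p : Amb d × Amb d} (hp : p.2 0 ≠ 0) :
    ContDiffAt ℝ ∞ (fun p : Amb d × Amb d =>
      pt (p.1 0 / p.2 0) ((p.2 0)⁻¹ • (tail p.1 - tail p.2))) p := by
  have h1 : ContDiffAt ℝ ∞ (fun p : Amb d × Amb d => p.1 0) p :=
    (contDiff_apply_zero.comp contDiff_fst).contDiffAt
  have h2 : ContDiffAt ℝ ∞ (fun p : Amb d × Amb d => p.2 0) p :=
    (contDiff_apply_zero.comp contDiff_snd).contDiffAt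
  have h3 : ContDiffAt ℝ ∞ (fun p : Amb d × Amb d => tail p.1 - tail p.2) p :=
    ((contDiff_tail.comp contDiff_fst).sub (contDiff_tail.comp contDiff_snd)).contDiffAt
  exact (h1.div h2 hp).pt ((h2.inv hp).smul h3)

theorem eventually_frontTest_eq_zero {p : Amb d × Amb d} (hp : p.2 ∉ tsupport h) :
    frontTest g h =ᶠ[𝓝 p] fun _ => 0 := by
  have : ∀ᶠ q in 𝓝 p, q.2 ∉ tsupport h :=
    continuous_snd.continuousAt.eventually ((isClosed_tsupport h).isOpen_compl.mem_nhds hp)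
  filter_upwards [this] with q hq
  rw [frontTest, image_eq_zero_of_notMem_tsupport hq]
  simp

theorem contDiff_frontTest (hg : ContDiff ℝ ∞ g) (hh : ContDiff ℝ ∞ h)
    (hsupp : tsupport h ⊆ {w | 0 < w 0}) : ContDiff ℝ ∞ (frontTest g h) := by
  refine contDiff_iff_contDiffAt.2 fun p => ?_
  by_cases hp : p.2 ∈ tsupport h
  · have hp0 : p.2 0 ≠ 0 := (show 0 < p.2 0 from hsupp hp).ne'
    have h2 : ContDiffAt ℝ ∞ (fun p : Amb d × Amb d => p.2 0) p :=
      (contDiff_apply_zero.comp contDiff_snd).contDiffAt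
    refine ContDiffAt.mul (hg.contDiffAt.comp p (contDiffAt_frontTest_arg hp0)) ?_
    exact Complex.ofRealCLM.contDiff.contDiffAt.comp p
      ((hh.comp contDiff_snd).contDiffAt.mul ((h2.inv hp0).pow (d + 1)))
  · exact contDiffAt_const.congr_of_eventuallyEq (eventually_frontTest_eq_zero hp)

theorem tsupport_frontTest_subset (hgs : HasCompactSupport g) (hhs : HasCompactSupport h)
    (hsupp : tsupport h ⊆ {w | 0 < w 0}) :
    HasCompactSupport (frontTest g h) ∧ tsupport (frontTest g h) ⊆
      (fun q : Amb d × Amb d => (pt 0 (tail q.2) + q.2 0 • q.1, q.2)) ''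
        (tsupport g ×ˢ tsupport h) := by
  have hK : IsCompact ((fun q : Amb d × Amb d => (pt 0 (tail q.2) + q.2 0 • q.1, q.2)) ''
      (tsupport g ×ˢ tsupport h)) := (hgs.isCompact.prod hhs.isCompact).image (by fun_prop)
  have hsub : ∀ p, frontTest g h p ≠ 0 → p ∈ (fun q : Amb d × Amb d =>
      (pt 0 (tail q.2) + q.2 0 • q.1, q.2)) '' (tsupport g ×ˢ tsupport h) := fun p hp => by
    have h1 : h p.2 ≠ 0 := fun h0 => hp (by simp [frontTest, h0])
    have hw : p.2 ∈ tsupport h := subset_tsupport h h1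
    have hw0 : p.2 0 ≠ 0 := (show 0 < p.2 0 from hsupp hw).ne'
    have h2 : g ((p.2 0)⁻¹ • (p.1 - pt 0 (tail p.2))) ≠ 0 := fun h0 => hp (by
      rw [frontTest, frontTest_arg, h0, zero_mul])
    exact ⟨((p.2 0)⁻¹ • (p.1 - pt 0 (tail p.2)), p.2), ⟨subset_tsupport g h2, hw⟩,
      Prod.ext (eq_front_point p hw0).symm rfl⟩
  exact ⟨HasCompactSupport.of_support_subset_isCompact hK fun p hp => hsub p hp,
    closure_minimal (fun p hp => hsub p hp) hK.isClosed⟩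

/-- The Jacobian x^n obtained here cancels the factor x'^(-n) in the test function `frontTest`. -/
theorem integral_front (F : Amb d → ℂ) (c : Amb d) {x : ℝ} (hx : 0 < x) :
    ∫ z, F z = ((x ^ (d + 1) : ℝ) : ℂ) * ∫ v, F (c + x • v) := by
  have h1 := Measure.integral_comp_smul (volume : Measure (Amb d)) (fun v => F (c + v)) x
  rw [integral_add_left_eq_self] at h1
  rw [h1, finrank_euclideanSpace_fin, abs_of_pos (by positivity), Complex.real_smul, ← mul_assoc,
    ← Complex.ofReal_mul, mul_inv_cancel₀ (by positivity), Complex.ofReal_one, one_mul]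

theorem integral_polarFun_mul_frontTest {H : ℝ × Tan d × Amb d × ℝ → ℂ} (hH : Continuous H)
    (hg : ContDiff ℝ ∞ g) (hh : ContDiff ℝ ∞ h) (hgs : HasCompactSupport g)
    (hhs : HasCompactSupport h) (hsupp : tsupport h ⊆ {w | 0 < w 0}) :
    ∫ p : Amb d × Amb d, polarFun H p.1 p.2 * frontTest g h p =
      ∫ w, (h w : ℂ) * ∫ v, frontFun H w v * g v := by
  have hcont : Continuous fun p : Amb d × Amb d => polarFun H p.1 p.2 * frontTest g h p := by
    refine continuous_iff_continuousAt.2 fun p => ?_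
    by_cases hp : p.2 ∈ tsupport h
    · have hp0 : 0 < p.2 0 := hsupp hp
      have hrc : Continuous fun p : Amb d × Amb d => radius p.1 p.2 := by
        unfold radius; fun_prop
      have hr : radius p.1 p.2 ≠ 0 := (Real.sqrt_pos.2 (by positivity)).ne'
      have hri : ContinuousAt (fun p : Amb d × Amb d => (radius p.1 p.2)⁻¹) p :=
        hrc.continuousAt.inv₀ hr
      have h0 : ContinuousAt (fun p : Amb d × Amb d => p.2 0 / radius p.1 p.2) p :=
        (show Continuous fun p : Amb d × Amb d => p.2 0 by fun_prop).continuousAt.div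
          hrc.continuousAt hr
      have h1 : ContinuousAt (fun p : Amb d × Amb d =>
          (radius p.1 p.2)⁻¹ • (p.1 - pt 0 (tail p.2))) p :=
        hri.smul (show Continuous fun p : Amb d × Amb d => p.1 - pt 0 (tail p.2) by
          fun_prop).continuousAt
      have h2 : ContinuousAt (fun p : Amb d × Amb d => tail p.2) p :=
        (continuous_tail.comp continuous_snd).continuousAt
      exact (ContinuousAt.comp (g := H) hH.continuousAt
        (hrc.continuousAt.prodMk (h2.prodMk (h1.prodMk h0)))).mul
        (contDiff_frontTest hg hh hsupp).continuous.continuousAt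
    · refine (continuousAt_const (y := (0 : ℂ))).congr ?_
      filter_upwards [eventually_frontTest_eq_zero (g := g) hp] with q hq
      rw [hq, mul_zero]
  have hint : Integrable (fun p : Amb d × Amb d => polarFun H p.1 p.2 * frontTest g h p)
      (volume.prod volume) :=
    hcont.integrable_of_hasCompactSupport
      (tsupport_frontTest_subset hgs hhs hsupp).1.mul_left
  rw [Measure.volume_eq_prod, integral_prod_symm _ hint]
  refine integral_congr_ae (Eventually.of_forall fun w => ?_)
  by_cases hw : w ∈ tsupport h
  · have hw0 : 0 < w 0 := hsupp hw
    change ∫ z, polarFun H z w * frontTest g h (z, w) = (h w : ℂ) * ∫ v, frontFun H w v * g v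
    rw [integral_front _ (pt 0 (tail w)) hw0, ← integral_const_mul, ← integral_const_mul]
    refine integral_congr_ae (Eventually.of_forall fun v => ?_)
    change _ * (_ * _) = _
    rw [polarFun_eq_frontFun H hw0, frontTest_front g h hw0.ne']
    have : ((w 0 ^ (d + 1) : ℝ) : ℂ) * (((w 0)⁻¹ ^ (d + 1) : ℝ) : ℂ) = 1 := by
      rw [← Complex.ofReal_mul, ← mul_pow, mul_inv_cancel₀ hw0.ne', one_pow, Complex.ofReal_one]
    rw [Complex.ofReal_mul]
    linear_combination (frontFun H w v * g v * h w) * this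
  · have h0 : h w = 0 := image_eq_zero_of_notMem_tsupport hw
    change ∫ z, polarFun H z w * frontTest g h (z, w) = _
    simp [frontTest, h0]

theorem integral_symbol_frontTest {a : Amb d × Amb d → ℂ} {χ : Amb d → ℝ}
    (hsupp : tsupport h ⊆ {w | 0 < w 0}) :
    ∫ w : Amb d, ((w 0 ^ (d + 1) : ℝ) : ℂ) * ∫ ζ : Amb d, a (w, ζ) *
        ∫ u : Amb d, Complex.exp (Complex.I * (inner ℝ u ζ : ℝ)) * (χ u : ℂ) *
          frontTest g h (w + w 0 • u, w) =
      ∫ w, (h w : ℂ) * ∫ ζ, a (w, ζ) * oscInt (fun u => (χ u : ℂ) * g (pt 1 0 + u)) ζ := by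
  refine integral_congr_ae (Eventually.of_forall fun w => ?_)
  by_cases hw : w ∈ tsupport h
  · have hw0 : 0 < w 0 := hsupp hw
    have : ((w 0 ^ (d + 1) : ℝ) : ℂ) * (((w 0)⁻¹ ^ (d + 1) : ℝ) : ℂ) = 1 := by
      rw [← Complex.ofReal_mul, ← mul_pow, mul_inv_cancel₀ hw0.ne', one_pow, Complex.ofReal_one]
    change _ * _ = _ * _
    rw [← integral_const_mul, ← integral_const_mul]
    refine integral_congr_ae (Eventually.of_forall fun ζ => ?_)
    change _ * (_ * _) = _ * (_ * _)
    rw [oscInt, mul_left_comm, mul_left_comm (h w : ℂ), ← integral_const_mul (h w : ℂ),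
      ← integral_const_mul ((w 0 ^ (d + 1) : ℝ) : ℂ)]
    congr 1
    refine integral_congr_ae (Eventually.of_forall fun u => ?_)
    change _ * (_ * _ * _) = _ * (_ * (_ * _))
    rw [add_smul_eq_front_point, frontTest_front g h hw0.ne', Complex.ofReal_mul]
    linear_combination (Complex.exp (Complex.I * (inner ℝ u ζ : ℝ)) * χ u * g (pt 1 0 + u) *
      h w) * this
  · have h0 : h w = 0 := image_eq_zero_of_notMem_tsupport hw
    simp [frontTest, h0]

end NormalKernel

/-! ### Existence and uniqueness of the restriction to the front face -/

section Manifold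

variable {d : ℕ} {X : Type*} [TopologicalSpace X] [ChartedSpace (EuclideanHalfSpace (d + 1)) X]

theorem Coords.exists_ball_subset_inter (φ : Coords d X) {y : Tan d} (hy : y ∈ φ.bdry) :
    ∃ δ > 0, Metric.ball (pt 0 y) δ ∩ {w | 0 < w 0} ⊆ (φ.inter : Set (Amb d)) := by
  have hy' : pt 0 y ∈ φ.ext.target := hy
  rw [Coords.ext, OpenPartialHomeomorph.extend_target] at hy'
  set O := (𝓡∂ (d + 1)).symm ⁻¹' φ.1.target with hO
  have hOo : IsOpen O := φ.1.open_target.preimage (𝓡∂ (d + 1)).continuous_symm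
  obtain ⟨δ, hδ, hball⟩ := Metric.isOpen_iff.1 hOo _ hy'.1
  refine ⟨δ, hδ, ?_⟩
  have hopen : IsOpen (Metric.ball (pt 0 y) δ ∩ {w : Amb d | 0 < w 0}) :=
    Metric.isOpen_ball.inter (isOpen_lt continuous_const (by fun_prop))
  refine interior_maximal (fun z hz => ?_) hopen
  rw [Coords.ext, OpenPartialHomeomorph.extend_target]
  refine ⟨hball hz.1, ?_⟩
  rw [range_modelWithCornersEuclideanHalfSpace]
  exact le_of_lt (show 0 < z 0 from hz.2)

/-- The identity in the definition of `IsConormalNear`. -/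
def IsConormalFormula {Ω : TopologicalSpace.Opens (Amb d × Amb d)} (T : CDistr Ω) (w₀ : Amb d)
    (ε : ℝ) (a : Amb d × Amb d → ℂ) (χ : Amb d → ℝ) (H : ℝ × Tan d × Amb d × ℝ → ℂ) : Prop :=
  ∀ f : 𝓓(Ω, ℂ), tsupport f ⊆ Metric.ball w₀ ε ×ˢ Metric.ball w₀ ε →
    T f = ((2 * Real.pi : ℝ) : ℂ)⁻¹ ^ (d + 1) *
        (∫ w : Amb d, ((w 0 ^ (d + 1) : ℝ) : ℂ) *
          ∫ ζ : Amb d, a (w, ζ) *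
            ∫ u : Amb d, Complex.exp (Complex.I * (inner ℝ u ζ : ℝ)) * (χ u : ℂ) *
              f (w + w 0 • u, w))
      + ∫ p : Amb d × Amb d, polarFun H p.1 p.2 * f p

/-- In the coordinates (v, w) the pairing with g(v) h(w) x'^(-n) is the integral of h(w) times the
pairing over w with g. This is an average, with weight h, of a continuous function of w, and so it
tends to the value at (0, y). -/
theorem isNormalKernel_of_frontPairing {P : ZeroKernel d X} {φ : Coords d X} {y : Tan d}
    (hy : y ∈ φ.bdry) {w₀ : Amb d} {ε : ℝ} (hyε : pt 0 y ∈ Metric.ball w₀ ε) {m : ℝ}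
    {a : Amb d × Amb d → ℂ} (ha : IsSymbol m a) {χ : Amb d → ℝ} (hχ : ContDiff ℝ ∞ χ)
    (hs : HasCompactSupport χ) {H : ℝ × Tan d × Amb d × ℝ → ℂ} (hH : Continuous H)
    (hP : IsConormalFormula (P.dist φ φ) w₀ ε a χ H) {N : CDistr (openHalf d)}
    (hN : ∀ g, N g = frontPairing a χ H (pt 0 y) g) : IsNormalKernel P φ y N := by
  intro g ε' hε'
  obtain ⟨δ₁, hδ₁, hball⟩ := φ.exists_ball_subset_inter hy
  obtain ⟨δ₂, hδ₂, hball₂⟩ := Metric.isOpen_iff.1 Metric.isOpen_ball _ hyε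
  have hcont := continuous_frontPairing ha hχ hs hH g.contDiff g.hasCompactSupport
  obtain ⟨δ₃, hδ₃, hclose⟩ := Metric.continuous_iff.1 hcont (pt 0 y) (ε' / 2) (half_pos hε')
  obtain ⟨r, hr⟩ := g.hasCompactSupport.isCompact.isBounded.subset_closedBall (0 : Amb d)
  set r' := max r 0
  -- For w within δ of (0, y) and |v| ≤ r', the point z = (0, y') + x' v is within δ(1 + r') of (0,
  -- y). Dividing by 2 + r' keeps both z and w strictly inside the half ball contained in the chart
  -- and inside the ball in which the conormal representation holds.
  set δ := min δ₃ (min δ₁ δ₂ / (2 + r')) with hδ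
  have hr'0 : 0 ≤ r' := le_max_right _ _
  have hδ0 : 0 < δ := lt_min hδ₃ (by positivity)
  refine ⟨δ, hδ0, fun h hh hhs hh0 hh1 hsupp => ?_⟩
  have hpos : tsupport h ⊆ {w | 0 < w 0} := fun w hw => (hsupp hw).2
  obtain ⟨hcs, hts⟩ := tsupport_frontTest_subset (g := g) g.hasCompactSupport hhs hpos
  have hnear : ∀ w ∈ tsupport h, ∀ v ∈ tsupport g,
      dist w (pt 0 y) < min δ₁ δ₂ ∧ dist (pt 0 (tail w) + w 0 • v) (pt 0 y) < min δ₁ δ₂ := by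
    intro w hw v hv
    have h1 : ‖w - pt 0 y‖ < δ := by rw [← dist_eq_norm]; exact (hsupp hw).1
    have h2 : |w 0| ≤ ‖w - pt 0 y‖ := by simpa using abs_apply_zero_le (w - pt 0 y)
    have h3 : ‖tail w - y‖ ≤ ‖w - pt 0 y‖ := by
      simpa [tail_sub] using norm_tail_le (w - pt 0 y)
    have h4 : ‖v‖ ≤ r' := (by simpa using hr hv : ‖v‖ ≤ r).trans (le_max_left _ _)
    have h5 : δ * (2 + r') ≤ min δ₁ δ₂ := by
      rw [← le_div_iff₀ (by positivity)]; exact min_le_right _ _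
    constructor
    · rw [dist_eq_norm]
      nlinarith
    · rw [dist_eq_norm, add_sub_right_comm]
      have h6 : pt 0 (tail w) - pt 0 y = pt 0 (tail w - y) := by
        rw [sub_eq_iff_eq_add, ← pt_add]; simp
      have h7 : ‖w 0 • v‖ ≤ δ * r' := by
        rw [norm_smul, Real.norm_eq_abs]
        exact mul_le_mul (h2.trans h1.le) h4 (norm_nonneg _) hδ0.le
      calc _ ≤ ‖pt 0 (tail w) - pt 0 y‖ + ‖w 0 • v‖ := norm_add_le _ _
        _ ≤ δ + δ * r' := by
          rw [h6, norm_pt_zero_left]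
          exact add_le_add (h3.trans h1.le) h7
        _ < min δ₁ δ₂ := by nlinarith
  have hin : tsupport (frontTest g h) ⊆ (φ.inter₂ φ : Set (Amb d × Amb d)) := fun p hp => by
    obtain ⟨⟨v, w⟩, ⟨hv, hw⟩, rfl⟩ := hts hp
    obtain ⟨h1, h2⟩ := hnear w hw v hv
    refine ⟨hball ⟨h2.trans_le (min_le_left _ _), ?_⟩,
      hball ⟨h1.trans_le (min_le_left _ _), hpos hw⟩⟩
    have hv0 : 0 < v 0 := g.tsupport_subset hv
    have hw0 : 0 < w 0 := hpos hw
    change 0 < (pt 0 (tail w) + w 0 • v) 0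
    simpa using mul_pos hw0 hv0
  have hin' : tsupport (frontTest g h) ⊆ Metric.ball w₀ ε ×ˢ Metric.ball w₀ ε := fun p hp => by
    obtain ⟨⟨v, w⟩, ⟨hv, hw⟩, rfl⟩ := hts hp
    obtain ⟨h1, h2⟩ := hnear w hw v hv
    exact ⟨hball₂ (h2.trans_le (min_le_right _ _)), hball₂ (h1.trans_le (min_le_right _ _))⟩
  have hsm : ContDiff ℝ ∞ (frontTest g h) := contDiff_frontTest g.contDiff hh hpos
  have hint : ∀ k : Amb d → ℂ, Continuous k → Integrable fun w => (h w : ℂ) * k w := fun k hk =>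
    ((Complex.continuous_ofReal.comp hh.continuous).mul hk).integrable_of_hasCompactSupport
      ((hhs.comp_left (g := fun x : ℝ => (x : ℂ)) Complex.ofReal_zero).mul_right)
  have hpair : (P.dist φ φ).pair (frontTest g h) = ∫ w, (h w : ℂ) * frontPairing a χ H w g := by
    rw [CDistr.pair, dif_pos ⟨hsm, hcs, hin⟩, hP _ hin']
    change _ * (∫ w : Amb d, _ * ∫ ζ : Amb d, a (w, ζ) * ∫ u : Amb d, _ * _ *
      frontTest g h (w + w 0 • u, w)) + ∫ p : Amb d × Amb d, _ * frontTest g h p = _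
    rw [integral_symbol_frontTest hpos, integral_polarFun_mul_frontTest hH g.contDiff hh
      g.hasCompactSupport hhs hpos, ← integral_const_mul, ← integral_add]
    · refine integral_congr_ae (Eventually.of_forall fun w => ?_)
      simp only [frontPairing]
      ring
    · exact (hint _ (continuous_frontPairing_symbol ha hχ hs g.contDiff
        g.hasCompactSupport)).const_mul _
    · exact hint _ (continuous_frontPairing_frontFun hH g.continuous g.hasCompactSupport)
  change ‖(P.dist φ φ).pair (frontTest g h) - N g‖ < ε'
  have h1 : (1 : ℂ) = ∫ w, (h w : ℂ) := by rw [integral_complex_ofReal, hh1, Complex.ofReal_one]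
  rw [hpair, hN, ← one_mul (frontPairing a χ H (pt 0 y) g), h1, ← integral_mul_const,
    ← integral_sub (hint _ hcont) (hint _ continuous_const)]
  have hle : ∀ w, ‖(h w : ℂ) * frontPairing a χ H w g - h w * frontPairing a χ H (pt 0 y) g‖ ≤
      h w * (ε' / 2) := fun w => by
    rw [← mul_sub, norm_mul, Complex.norm_real, Real.norm_of_nonneg (hh0 w)]
    by_cases hw : w ∈ tsupport h
    · refine mul_le_mul_of_nonneg_left ?_ (hh0 w)
      rw [← dist_eq_norm]
      exact (hclose w ((hsupp hw).1.trans_le (min_le_left _ _))).le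
    · rw [image_eq_zero_of_notMem_tsupport hw]; simp
  have := norm_integral_le_of_norm_le (μ := volume)
    ((hh.continuous.integrable_of_hasCompactSupport hhs).mul_const (ε' / 2))
    (Eventually.of_forall hle)
  rw [integral_mul_const, hh1, one_mul] at this
  linarith

/-- Bump functions in the half space concentrated near a boundary point. -/
theorem exists_bump_halfSpace (y : Tan d) {δ : ℝ} (hδ : 0 < δ) : ∃ h : Amb d → ℝ,
    ContDiff ℝ ∞ h ∧ HasCompactSupport h ∧ (∀ w, 0 ≤ h w) ∧ ∫ w, h w = 1 ∧
      tsupport h ⊆ Metric.ball (pt 0 y) δ ∩ {w | 0 < w 0} := by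
  let b : ContDiffBump (pt (δ / 2) y) := ⟨δ / 8, δ / 4, by positivity, by linarith⟩
  refine ⟨b.normed volume, b.contDiff_normed, b.hasCompactSupport_normed, b.nonneg_normed,
    b.integral_normed, ?_⟩
  rw [b.tsupport_normed_eq]
  intro w hw
  have hw' : ‖w - pt (δ / 2) y‖ ≤ δ / 4 := by rw [← dist_eq_norm]; exact hw
  have h1 : ‖pt (δ / 2) y - pt 0 y‖ = δ / 2 := by
    have : pt (δ / 2) y - pt 0 y = pt (δ / 2) 0 := by
      rw [sub_eq_iff_eq_add, ← pt_add]; simp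
    have h2 := norm_pt_sq (d := d) (δ / 2) 0
    rw [this, ← Real.sqrt_sq (norm_nonneg _), h2, norm_zero, zero_pow two_ne_zero, add_zero,
      Real.sqrt_sq (by positivity)]
  constructor
  · rw [Metric.mem_ball, dist_eq_norm, ← sub_add_sub_cancel w (pt (δ / 2) y) (pt 0 y)]
    exact (norm_add_le _ _).trans_lt (by linarith)
  · have := abs_apply_zero_le (w - pt (δ / 2) y)
    have h3 : |w 0 - δ / 2| ≤ δ / 4 := le_trans (by simpa using this) hw'
    have := (abs_le.1 h3).1
    change 0 < w 0
    linarith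

/-- Admissible averaging functions exist in every neighborhood of (0, y), so the limit that defines
the restriction is not vacuous. -/
theorem IsNormalKernel.unique {P : ZeroKernel d X} {φ : Coords d X} {y : Tan d}
    {N N' : CDistr (openHalf d)} (hN : IsNormalKernel P φ y N) (hN' : IsNormalKernel P φ y N') :
    N = N' := by
  ext g
  refine eq_of_forall_dist_le fun ε hε => ?_
  obtain ⟨δ, hδ, h⟩ := hN g (ε / 2) (half_pos hε)
  obtain ⟨δ', hδ', h'⟩ := hN' g (ε / 2) (half_pos hε)
  obtain ⟨b, hb, hbs, hb0, hb1, hsupp⟩ := exists_bump_halfSpace y (lt_min hδ hδ')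
  have h1 := h b hb hbs hb0 hb1 (hsupp.trans (inter_subset_inter_left _
    (Metric.ball_subset_ball (min_le_left _ _))))
  have h2 := h' b hb hbs hb0 hb1 (hsupp.trans (inter_subset_inter_left _
    (Metric.ball_subset_ball (min_le_right _ _))))
  rw [← dist_eq_norm] at h1 h2
  rw [dist_comm] at h1
  exact (dist_triangle _ _ _).trans (by linarith)

end Manifold

/-! ### Smooth functions vanishing on a half space -/

section Flat

variable {E : Type} [NormedAddCommGroup E] [NormedSpace ℝ E] {ℓ : E →L[ℝ] ℝ} {e : E}

theorem eq_zero_of_forall_neg {F : Type} [NormedAddCommGroup F] {f : E → F} (hf : Continuous f)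
    (he : ℓ e = 1) (h : ∀ x, ℓ x < 0 → f x = 0) {x : E} (hx : ℓ x ≤ 0) : f x = 0 := by
  have hcl : IsClosed {z | f z = 0} := isClosed_eq hf continuous_const
  have ht : Tendsto (fun t : ℝ => x - t • e) (𝓝[>] 0) (𝓝 x) := by
    have : Continuous fun t : ℝ => x - t • e := by fun_prop
    simpa using (this.tendsto 0).mono_left nhdsWithin_le_nhds
  refine hcl.mem_of_tendsto ht ?_
  filter_upwards [self_mem_nhdsWithin] with t ht
  refine h _ ?_
  simp only [map_sub, map_smul, he, smul_eq_mul, mul_one]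
  linarith [show (0 : ℝ) < t from ht]

theorem iteratedFDeriv_eq_zero_of_flat {F : Type} [NormedAddCommGroup F] [NormedSpace ℝ F]
    {f : E → F} (hf : ContDiff ℝ ∞ f) (he : ℓ e = 1) (h : ∀ x, ℓ x ≤ 0 → f x = 0) (n : ℕ) {x : E}
    (hx : ℓ x ≤ 0) : iteratedFDeriv ℝ n f x = 0 := by
  refine eq_zero_of_forall_neg (hf.continuous_iteratedFDeriv (mod_cast le_top)) he
    (fun z hz => ?_) hx
  have : f =ᶠ[𝓝 z] fun _ => 0 := by
    filter_upwards [(isOpen_lt ℓ.continuous continuous_const).mem_nhds hz] with u hu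
    exact h u (le_of_lt hu)
  rw [(this.iteratedFDeriv ℝ n).eq_of_nhds]
  simp

variable [FiniteDimensional ℝ E]

/-- Induction on N: the derivative of f also vanishes for ℓ ≤ 0, so it is O(ℓ^N) by induction, and
the mean value theorem on the segment from x - ℓ(x) e, where f vanishes, to x gives one more power.
The statement ranges over all targets because the induction passes to derivatives. -/
theorem exists_norm_le_pow_of_flat (he : ℓ e = 1) (N : ℕ) :
    ∀ {F : Type} [NormedAddCommGroup F] [NormedSpace ℝ F] {f : E → F}, ContDiff ℝ ∞ f →
      (∀ x, ℓ x ≤ 0 → f x = 0) → ∀ R : ℝ, ∃ C : ℝ, 0 ≤ C ∧ ∀ x, ‖x‖ ≤ R → 0 ≤ ℓ x →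
        ‖f x‖ ≤ C * ℓ x ^ N := by
  have := FiniteDimensional.proper_real E
  induction N with
  | zero =>
    intro F _ _ f hf _ R
    obtain ⟨C, hC⟩ := (isCompact_closedBall (0 : E) R).exists_bound_of_continuousOn
      hf.continuous.continuousOn
    exact ⟨|C|, abs_nonneg _, fun x hx _ => by
      simpa using (hC x (by simpa using hx)).trans (le_abs_self C)⟩
  | succ N ih =>
    intro F _ _ f hf h0 R
    have hd : ContDiff ℝ ∞ (fderiv ℝ f) := hf.fderiv_right (m := ∞) (by simp)
    have hd0 : ∀ x, ℓ x ≤ 0 → fderiv ℝ f x = 0 := fun x hx =>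
      eq_zero_of_forall_neg hd.continuous he (fun z hz => by
        have : f =ᶠ[𝓝 z] fun _ => 0 := by
          filter_upwards [(isOpen_lt ℓ.continuous continuous_const).mem_nhds hz] with u hu
          exact h0 u (le_of_lt hu)
        rw [this.fderiv_eq]; simp) hx
    -- The radius is enlarged so that the projection x - ℓ(x) e of a point of the ball of radius R
    -- to the zero set of ℓ stays in the larger ball.
    obtain ⟨C, hC0, hC⟩ := ih hd hd0 (R + ‖ℓ‖ * R * ‖e‖)
    refine ⟨C * ‖e‖, by positivity, fun x hx hℓ => ?_⟩
    set s : Set E := Metric.closedBall 0 (R + ‖ℓ‖ * R * ‖e‖) ∩ ℓ ⁻¹' Icc 0 (ℓ x)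
    have hs : Convex ℝ s :=
      (convex_closedBall _ _).inter ((convex_Icc 0 (ℓ x)).linear_preimage ℓ.toLinearMap)
    have hR : 0 ≤ R := (norm_nonneg x).trans hx
    have hℓx : ℓ x ≤ ‖ℓ‖ * R := (le_abs_self _).trans ((ℓ.le_opNorm x).trans (by gcongr))
    have hb : ∀ z ∈ s, ‖fderiv ℝ f z‖ ≤ C * ℓ x ^ N := fun z hz => by
      refine (hC z (by simpa using hz.1) hz.2.1).trans ?_
      gcongr
      exacts [hz.2.1, hz.2.2]
    have hxs : x ∈ s := ⟨by simpa using hx.trans (le_add_of_nonneg_right (by positivity)),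
      ⟨hℓ, le_rfl⟩⟩
    have hx0 : ℓ (x - ℓ x • e) = 0 := by simp [he]
    have hxs' : x - ℓ x • e ∈ s := by
      refine ⟨?_, ?_⟩
      · rw [mem_closedBall_zero_iff]
        refine (norm_sub_le _ _).trans ?_
        rw [norm_smul, Real.norm_of_nonneg hℓ]
        gcongr
      · rw [mem_preimage, hx0]; exact ⟨le_rfl, hℓ⟩
    have key := hs.norm_image_sub_le_of_norm_fderiv_le (𝕜 := ℝ)
      (fun z _ => (hf.differentiable (by simp)).differentiableAt) hb hxs' hxs
    rw [h0 _ hx0.le, sub_zero, sub_sub_cancel, norm_smul, Real.norm_of_nonneg hℓ] at key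
    refine key.trans (le_of_eq ?_)
    ring

/-- Flat smooth functions: all derivatives decay to infinite order at the zero set. -/
theorem exists_norm_iteratedFDeriv_le_pow_of_flat {F : Type} [NormedAddCommGroup F]
    [NormedSpace ℝ F] {f : E → F} (hf : ContDiff ℝ ∞ f) (he : ℓ e = 1)
    (h : ∀ x, ℓ x ≤ 0 → f x = 0) (n N : ℕ) (R : ℝ) : ∃ C : ℝ, 0 ≤ C ∧ ∀ x, ‖x‖ ≤ R → 0 ≤ ℓ x →
      ‖iteratedFDeriv ℝ n f x‖ ≤ C * ℓ x ^ N :=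
  exists_norm_le_pow_of_flat he N (hf.iteratedFDeriv_right (m := ∞) (mod_cast le_top))
    (fun _ hx => iteratedFDeriv_eq_zero_of_flat hf he h n hx) R

end Flat

/-! ### Decay of the smooth part along the front face -/

section FrontDecay

variable {d : ℕ} {H : ℝ × Tan d × Amb d × ℝ → ℂ}

/-- Vanishing to order 2N at each of the two faces gives order N in the product of the defining
functions: if 0 ≤ α ≤ β, then α^(2N) ≤ (α β)^N. -/
theorem IsSmoothVanishing.exists_norm_iteratedFDeriv_le (hH : IsSmoothVanishing H) (n N : ℕ)
    (R : ℝ) : ∃ C : ℝ, 0 ≤ C ∧ ∀ q : Tan d × Amb d × ℝ, ‖q‖ ≤ R → 0 ≤ q.2.1 0 → 0 ≤ q.2.2 →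
      ‖iteratedFDeriv ℝ n (fun q : Tan d × Amb d × ℝ => H (0, q)) q‖ ≤
        C * (q.2.1 0 * q.2.2) ^ N := by
  have hf : ContDiff ℝ ∞ fun q : Tan d × Amb d × ℝ => H (0, q) := hH.1.comp (by fun_prop)
  let ℓ₁ : Tan d × Amb d × ℝ →L[ℝ] ℝ := (EuclideanSpace.proj (𝕜 := ℝ) (0 : Fin (d + 1))).comp
    ((ContinuousLinearMap.fst ℝ _ _).comp (ContinuousLinearMap.snd ℝ _ _))
  let ℓ₂ : Tan d × Amb d × ℝ →L[ℝ] ℝ :=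
    (ContinuousLinearMap.snd ℝ _ _).comp (ContinuousLinearMap.snd ℝ _ _)
  obtain ⟨C₁, hC₁, h₁⟩ := exists_norm_iteratedFDeriv_le_pow_of_flat (ℓ := ℓ₁) (e := (0, pt 1 0, 0))
    hf rfl (fun q hq => hH.2 _ _ _ _ (Or.inl hq)) n (2 * N) R
  obtain ⟨C₂, hC₂, h₂⟩ := exists_norm_iteratedFDeriv_le_pow_of_flat (ℓ := ℓ₂) (e := (0, 0, 1))
    hf rfl (fun q hq => hH.2 _ _ _ _ (Or.inr hq)) n (2 * N) R
  refine ⟨C₁ + C₂, by positivity, fun q hq hq₁ hq₂ => ?_⟩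
  have h1 : ‖_‖ ≤ C₁ * q.2.1 0 ^ (2 * N) := h₁ q hq hq₁
  have h2 : ‖_‖ ≤ C₂ * q.2.2 ^ (2 * N) := h₂ q hq hq₂
  rcases le_total (q.2.1 0) q.2.2 with hle | hle
  · refine h1.trans ?_
    rw [pow_mul, sq]
    gcongr
    linarith
  · refine h2.trans ?_
    rw [pow_mul, sq]
    gcongr
    linarith

theorem half_one_add_norm_le_bracket (v : Amb d) : (1 + ‖v‖) / 2 ≤ bracket v := by
  refine Real.le_sqrt_of_sq_le ?_
  nlinarith [sq_nonneg (1 - ‖v‖), norm_nonneg v]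

theorem norm_le_bracket (v : Amb d) : ‖v‖ ≤ bracket v :=
  Real.le_sqrt_of_sq_le (by linarith)

theorem one_le_bracket (v : Amb d) : 1 ≤ bracket v :=
  Real.le_sqrt_of_sq_le (by nlinarith [norm_nonneg v])

theorem frontFun_pt_zero (y : Tan d) (v : Amb d) :
    frontFun H (pt 0 y) v = H (0, y, (bracket v)⁻¹ • v, (bracket v)⁻¹) := by
  rw [frontFun, pt_apply_zero, zero_mul, tail_pt]

theorem IsSmoothVanishing.frontFun_eq_zero (hH : IsSmoothVanishing H) (y : Tan d) {v : Amb d}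
    (hv : v 0 ≤ 0) : frontFun H (pt 0 y) v = 0 := by
  rw [frontFun_pt_zero]
  exact hH.2 _ _ _ _ (Or.inl (mul_nonpos_of_nonneg_of_nonpos
    (inv_nonneg.2 (bracket_pos v).le) hv))

/-- On the front face x'/r = 1/⟨v⟩, so v → ∞ is the approach to rb, and infinite order vanishing
there is rapid decay in v. -/
theorem IsSmoothVanishing.exists_norm_frontFun_le (hH : IsSmoothVanishing H) (y : Tan d) (N : ℕ) :
    ∃ C : ℝ, 0 ≤ C ∧ ∀ v, ‖frontFun H (pt 0 y) v‖ ≤ C * (1 + ‖v‖) ^ (-(N : ℝ)) := by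
  obtain ⟨C, hC0, hC⟩ := hH.exists_norm_iteratedFDeriv_le 0 N (max ‖y‖ 1)
  refine ⟨C * 2 ^ N, by positivity, fun v => ?_⟩
  rcases le_or_gt (v 0) 0 with hv | hv
  · rw [hH.frontFun_eq_zero y hv, norm_zero]; positivity
  have hb := bracket_pos v
  have h1 : ‖(bracket v)⁻¹ • v‖ ≤ 1 := by
    rw [norm_smul, norm_inv, Real.norm_of_nonneg hb.le, inv_mul_le_iff₀ hb, mul_one]
    exact norm_le_bracket v
  have h2 : (bracket v)⁻¹ ≤ 1 := inv_le_one_of_one_le₀ (one_le_bracket v)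
  have h3 : ‖((y, (bracket v)⁻¹ • v, (bracket v)⁻¹) : Tan d × Amb d × ℝ)‖ ≤ max ‖y‖ 1 := by
    refine max_le (le_max_left _ _) (max_le (h1.trans (le_max_right _ _)) ?_)
    rw [Real.norm_of_nonneg (inv_nonneg.2 hb.le)]
    exact h2.trans (le_max_right _ _)
  have h4 : 0 ≤ ((bracket v)⁻¹ • v) 0 := mul_nonneg (inv_nonneg.2 hb.le) hv.le
  have := hC _ h3 h4 (inv_nonneg.2 hb.le)
  rw [norm_iteratedFDeriv_zero] at this
  rw [frontFun_pt_zero]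
  refine this.trans ?_
  rw [mul_assoc]
  refine mul_le_mul_of_nonneg_left ?_ hC0
  rw [Real.rpow_neg (by positivity), Real.rpow_natCast, ← inv_pow, ← mul_pow]
  refine pow_le_pow_left₀ (mul_nonneg h4 (inv_nonneg.2 hb.le)) ?_ N
  have h5 : ((bracket v)⁻¹ • v) 0 ≤ 1 := (le_abs_self _).trans ((abs_apply_zero_le _).trans h1)
  calc _ ≤ 1 * (bracket v)⁻¹ := by gcongr
    _ ≤ 2 * (1 + ‖v‖)⁻¹ := by
      rw [one_mul, ← div_eq_mul_inv, ← inv_div]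
      exact inv_anti₀ (by positivity) (half_one_add_norm_le_bracket v)

end FrontDecay

/-! ### Integration in the coordinates (x, y) -/

section Split

variable {d : ℕ}

/-- The coordinates `z ↦ (x, y)` as a measurable equivalence. -/
noncomputable def splitEquiv (d : ℕ) : Amb d ≃ᵐ ℝ × Tan d :=
  Homeomorph.toMeasurableEquiv
    { toFun := fun z => (z 0, tail z)
      invFun := fun p => pt p.1 p.2
      left_inv := pt_tail
      right_inv := fun p => by simp
      continuous_toFun := by fun_prop
      continuous_invFun := by fun_prop }

theorem measurePreserving_splitEquiv (d : ℕ) :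
    MeasurePreserving (splitEquiv d) volume volume := by
  have h1 := PiLp.volume_preserving_ofLp (Fin (d + 1))
  have h2 := volume_preserving_piFinSuccAbove (fun _ : Fin (d + 1) => ℝ) 0
  have h3 := (MeasurePreserving.id (volume : Measure ℝ)).prod (PiLp.volume_preserving_toLp (Fin d))
  exact h3.comp (h2.comp h1)

theorem integral_pt {F : Type*} [NormedAddCommGroup F] [NormedSpace ℝ F] (f : Amb d → F) :
    ∫ v, f v = ∫ p : ℝ × Tan d, f (pt p.1 p.2) :=
  ((measurePreserving_splitEquiv d).symm.integral_comp' f).symm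

theorem integrable_pt {f : Amb d → ℂ} (hf : Integrable f) :
    Integrable fun p : ℝ × Tan d => f (pt p.1 p.2) :=
  (measurePreserving_splitEquiv d).symm.integrable_comp_of_integrable hf

end Split

/-! ### Partial Fourier transform of the smooth part -/

section FiberHat

variable {d : ℕ}

/-- Functions on `ℝ^n` which are continuous and rapidly decaying. -/
def IsRapid (k : Amb d → ℂ) : Prop :=
  Continuous k ∧ ∀ N : ℕ, ∃ C : ℝ, 0 ≤ C ∧ ∀ v, ‖k v‖ ≤ C * (1 + ‖v‖) ^ (-(N : ℝ))

theorem norm_le_norm_pt (s : ℝ) (U : Tan d) : ‖U‖ ≤ ‖pt s U‖ := by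
  simpa using norm_tail_le (pt s U)

theorem abs_le_norm_pt (s : ℝ) (U : Tan d) : |s| ≤ ‖pt s U‖ := by
  simpa using abs_apply_zero_le (pt s U)

theorem norm_pt_le (s : ℝ) (U : Tan d) : ‖pt s U‖ ≤ |s| + ‖U‖ := by
  have := norm_pt_sq s U
  refine le_of_sq_le_sq ?_ (by positivity)
  rw [this, ← sq_abs s]
  nlinarith [abs_nonneg s, norm_nonneg U, mul_nonneg (abs_nonneg s) (norm_nonneg U)]

theorem IsRapid.exists_bound_tan {k : Amb d → ℂ} (hk : IsRapid k) : ∃ b : Tan d → ℝ,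
    Integrable b ∧ ∀ s U, ‖k (pt s U)‖ ≤ b U := by
  obtain ⟨M, hM⟩ := exists_nat_gt (Module.finrank ℝ (Tan d) : ℝ)
  obtain ⟨C, hC0, hC⟩ := hk.2 M
  refine ⟨fun U => C * (1 + ‖U‖) ^ (-(M : ℝ)),
    (integrable_one_add_norm_rpow (by linarith)).const_mul C, fun s U => (hC _).trans ?_⟩
  refine mul_le_mul_of_nonneg_left ?_ hC0
  refine Real.rpow_le_rpow_of_nonpos (by positivity) ?_ (by simp)
  linarith [norm_le_norm_pt s U]

theorem IsRapid.integrable {k : Amb d → ℂ} (hk : IsRapid k) : Integrable k :=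
  (HasMoments.of_decay hk.1 fun N => (hk.2 N).imp fun _ h => h.2).integrable

/-- The partial Fourier transform of a function `k(s, Υ)` in `Υ`. -/
noncomputable def fiberHat (k : Amb d → ℂ) (s : ℝ) (η : Tan d) : ℂ :=
  ∫ U : Tan d, k (pt s U) * Complex.exp (-Complex.I * (inner ℝ U η : ℝ))

theorem norm_exp_neg_I_mul (x : ℝ) : ‖Complex.exp (-Complex.I * x)‖ = 1 := by
  have : -Complex.I * x = Complex.I * ((-x : ℝ) : ℂ) := by push_cast; ring
  rw [this, norm_exp_I_mul]

theorem IsRapid.continuous_fiberHat {k : Amb d → ℂ} (hk : IsRapid k) :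
    Continuous fun p : ℝ × Tan d => fiberHat k p.1 p.2 := by
  obtain ⟨b, hb, hle⟩ := hk.exists_bound_tan
  have hc : Continuous fun q : (ℝ × Tan d) × Tan d =>
      k (pt q.1.1 q.2) * Complex.exp (-Complex.I * (inner ℝ q.2 q.1.2 : ℝ)) := by
    have := hk.1
    have h2 : Continuous fun q : (ℝ × Tan d) × Tan d => inner ℝ q.2 q.1.2 := by fun_prop
    exact (this.comp (by fun_prop)).mul (Complex.continuous_exp.comp (by fun_prop))
  refine continuous_of_dominated (bound := b)
    (fun p => (hc.comp (by fun_prop : Continuous fun U => (p, U))).aestronglyMeasurable)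
    (fun p => Eventually.of_forall fun U => ?_) hb
    (Eventually.of_forall fun U => hc.comp (by fun_prop : Continuous fun p => (p, U)))
  rw [norm_mul, norm_exp_neg_I_mul, mul_one]
  exact hle _ _

theorem IsRapid.integral_mul_exp {k : Amb d → ℂ} (hk : IsRapid k) {g : ℝ → ℂ} (hg : Continuous g)
    (hgb : ∃ C, ∀ s, ‖g s‖ ≤ C) (η : Tan d) :
    Integrable (fun v : Amb d => k v * (g (v 0) *
      Complex.exp (-Complex.I * (inner ℝ (tail v) η : ℝ)))) ∧
    ∫ v : Amb d, k v * (g (v 0) * Complex.exp (-Complex.I * (inner ℝ (tail v) η : ℝ))) =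
      ∫ s, fiberHat k s η * g s := by
  obtain ⟨C, hC⟩ := hgb
  have hc : Continuous fun v : Amb d => g (v 0) *
      Complex.exp (-Complex.I * (inner ℝ (tail v) η : ℝ)) := by
    have h2 : Continuous fun v : Amb d => inner ℝ (tail v) η := by fun_prop
    exact (hg.comp (by fun_prop)).mul (Complex.continuous_exp.comp (by fun_prop))
  have hint : Integrable (fun v : Amb d => k v * (g (v 0) *
      Complex.exp (-Complex.I * (inner ℝ (tail v) η : ℝ)))) := by
    refine (hk.integrable.norm.mul_const C).mono' (hk.1.mul hc).aestronglyMeasurable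
      (Eventually.of_forall fun v => ?_)
    rw [norm_mul, norm_mul, norm_exp_neg_I_mul, mul_one]
    gcongr
    exact hC _
  refine ⟨hint, ?_⟩
  rw [integral_pt, Measure.volume_eq_prod, integral_prod _ (integrable_pt hint)]
  refine integral_congr_ae (Eventually.of_forall fun s => ?_)
  simp only [pt_apply_zero, tail_pt, fiberHat]
  rw [← integral_mul_const]
  refine integral_congr_ae (Eventually.of_forall fun U => ?_)
  simp only
  ring

theorem IsSmoothVanishing.isRapid_frontFun {H : ℝ × Tan d × Amb d × ℝ → ℂ}
    (hH : IsSmoothVanishing H) (y : Tan d) : IsRapid (frontFun H (pt 0 y)) :=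
  ⟨(continuous_frontFun hH.1.continuous).comp (by fun_prop : Continuous fun v => (pt 0 y, v)),
    hH.exists_norm_frontFun_le y⟩

end FiberHat

/-! ### Partial Fourier transform of the conormal part -/

section FiberSymbol

variable {d : ℕ}

/-- The symbol with respect to the cutoff `1` which corresponds to the symbol `a` and the
cutoff `χ`. -/
noncomputable def avgSymbol (a : Amb d × Amb d → ℂ) (χ : Amb d → ℝ) (p : Amb d × Amb d) : ℂ :=
  ((2 * Real.pi : ℝ) : ℂ)⁻¹ ^ (d + 1) * symbolConv volume (oscInt fun u => (χ u : ℂ)) a p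

theorem IsSymbol.isJointSymbol {m : ℝ} {a : Amb d × Amb d → ℂ} (ha : IsSymbol m a) :
    IsJointSymbol m a :=
  IsPartialSymbol.isJointSymbol (Y := Amb d) (Z := Amb d) (F := ℂ) ha

theorem IsSymbol.avgSymbol {m : ℝ} {a : Amb d × Amb d → ℂ} (ha : IsSymbol m a) {χ : Amb d → ℝ}
    (hχ : ContDiff ℝ ∞ χ) (hs : HasCompactSupport χ) : IsJointSymbol m (avgSymbol a χ) := by
  obtain ⟨hχ', hs'⟩ := ofReal_comp_smooth hχ hs
  exact (ha.isJointSymbol.symbolConv (hasMoments_oscInt hχ' hs')).clm isOpen_univ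
    (((2 * Real.pi : ℝ) : ℂ)⁻¹ ^ (d + 1) • ContinuousLinearMap.id ℝ ℂ)

/-- Fourier inversion writes G(u₀) exp(-i Υ·η) as a superposition of plane waves of frequency -(ξ,
η). Each of them shifts the Fourier transform of χ by (ξ, η). -/
theorem oscInt_cutoff_eq {χ : Amb d → ℝ} (hχ : Continuous χ) (hs : HasCompactSupport χ)
    {G : ℝ → ℂ} (hG : ContDiff ℝ ∞ G) (hGs : HasCompactSupport G) (η : Tan d) (ζ : Amb d) :
    oscInt (fun u => (χ u : ℂ) * (G (u 0) *
        Complex.exp (-Complex.I * (inner ℝ (tail u) η : ℝ)))) ζ =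
      ((2 * Real.pi : ℝ) : ℂ)⁻¹ *
        ∫ ξ : ℝ, oscInt G ξ * oscInt (fun u => (χ u : ℂ)) (ζ - pt ξ η) := by
  have hGm := hasMoments_oscInt hG hGs
  have hχc : Continuous fun u => (χ u : ℂ) := Complex.continuous_ofReal.comp hχ
  have hχi : Integrable fun u => (χ u : ℂ) :=
    hχc.integrable_of_hasCompactSupport (hs.comp_left Complex.ofReal_zero)
  have hinv : ∀ u : Amb d, G (u 0) = ((2 * Real.pi : ℝ) : ℂ)⁻¹ *
      ∫ ξ : ℝ, Complex.exp (Complex.I * (-(inner ℝ (u 0) ξ) : ℝ)) * oscInt G ξ := fun u => by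
    rw [integral_exp_mul_oscInt hG hGs, Module.finrank_self, pow_one, ← mul_assoc,
      inv_mul_cancel₀, one_mul]
    exact_mod_cast (show (2 * Real.pi : ℝ) ≠ 0 by positivity)
  have hswap : ∫ u : Amb d, ∫ ξ : ℝ, Complex.exp (Complex.I * (inner ℝ u (ζ - pt ξ η) : ℝ)) *
      ((χ u : ℂ) * oscInt G ξ) = ∫ ξ : ℝ, ∫ u : Amb d,
        Complex.exp (Complex.I * (inner ℝ u (ζ - pt ξ η) : ℝ)) * ((χ u : ℂ) * oscInt G ξ) := by
    refine integral_integral_swap ?_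
    refine (hχi.mul_prod hGm.integrable).norm.mono' ?_ (Eventually.of_forall fun p => ?_)
    · have h1 : Continuous fun p : Amb d × ℝ => inner ℝ p.1 (ζ - pt p.2 η) := by fun_prop
      have h2 := hGm.1
      exact Continuous.aestronglyMeasurable (by unfold Function.uncurry; fun_prop)
    · change ‖_ * _‖ ≤ ‖_ * _‖
      rw [norm_mul, norm_exp_I_mul, one_mul]
  have hL : oscInt (fun u => (χ u : ℂ) * (G (u 0) *
        Complex.exp (-Complex.I * (inner ℝ (tail u) η : ℝ)))) ζ =
      ∫ u : Amb d, ((2 * Real.pi : ℝ) : ℂ)⁻¹ * ∫ ξ : ℝ,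
        Complex.exp (Complex.I * (inner ℝ u (ζ - pt ξ η) : ℝ)) * ((χ u : ℂ) * oscInt G ξ) := by
    refine integral_congr_ae (Eventually.of_forall fun u => ?_)
    simp only
    rw [hinv u, mul_assoc (_⁻¹), mul_left_comm (χ u : ℂ), mul_left_comm (Complex.exp _)]
    congr 1
    rw [← integral_mul_const, ← integral_const_mul, ← integral_const_mul]
    refine integral_congr_ae (Eventually.of_forall fun ξ => ?_)
    simp only
    have : Complex.exp (Complex.I * (inner ℝ u (ζ - pt ξ η) : ℝ)) =
        Complex.exp (Complex.I * (inner ℝ u ζ : ℝ)) *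
          Complex.exp (Complex.I * (-(inner ℝ (u 0) ξ) : ℝ)) *
          Complex.exp (-Complex.I * (inner ℝ (tail u) η : ℝ)) := by
      rw [← Complex.exp_add, ← Complex.exp_add, inner_sub_right, inner_pt_right]
      congr 1
      have : inner ℝ (u 0) ξ = u 0 * ξ := mul_comm _ _
      rw [this]
      push_cast; ring
    rw [this]; ring
  rw [hL, integral_const_mul, hswap]
  congr 1
  refine integral_congr_ae (Eventually.of_forall fun ξ => ?_)
  simp only [oscInt]
  rw [← integral_const_mul]
  refine integral_congr_ae (Eventually.of_forall fun u => ?_)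
  simp only
  ring

theorem exists_decay_oscInt {χ : Amb d → ℂ} (hχ : ContDiff ℝ ∞ χ) (hs : HasCompactSupport χ)
    (M : ℕ) : ∃ C : ℝ, 0 ≤ C ∧ ∀ v, ‖oscInt χ v‖ ≤ C * (1 + ‖v‖) ^ (-(M : ℝ)) := by
  obtain ⟨r, hr⟩ := hs.isBounded.subset_closedBall (0 : Amb d)
  obtain ⟨C, hC0, hC⟩ := exists_norm_oscInt_le (E := Amb d) r M
  obtain ⟨D, hD0, hD⟩ := hs.exists_norm_iteratedFDeriv_le hχ M
  exact ⟨C * D, by positivity, hC χ D hχ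
    (fun u hu => image_eq_zero_of_notMem_tsupport fun h => hu (hr h)) hD⟩

/-- The symbol part of the fiberwise Fourier transform. -/
theorem integral_symbol_oscInt_cutoff {m : ℝ} {a : Amb d × Amb d → ℂ} (ha : IsSymbol m a)
    {χ : Amb d → ℝ} (hχ : ContDiff ℝ ∞ χ) (hs : HasCompactSupport χ)
    {G : ℝ → ℂ} (hG : ContDiff ℝ ∞ G) (hGs : HasCompactSupport G) (w : Amb d) (η : Tan d) :
    ((2 * Real.pi : ℝ) : ℂ)⁻¹ ^ (d + 1) * (∫ ζ, a (w, ζ) * oscInt (fun u => (χ u : ℂ) *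
        (G (u 0) * Complex.exp (-Complex.I * (inner ℝ (tail u) η : ℝ)))) ζ) =
      ((2 * Real.pi : ℝ) : ℂ)⁻¹ * ∫ ξ : ℝ, avgSymbol a χ (w, pt ξ η) * oscInt G ξ := by
  obtain ⟨hχ', hs'⟩ := ofReal_comp_smooth hχ hs
  obtain ⟨M, hM⟩ := exists_nat_decay d m
  obtain ⟨Ca, hCa0, hCa⟩ := ha.exists_norm_le
  obtain ⟨C, hC0, hC⟩ := exists_decay_oscInt hχ' hs' M
  have hGm := hasMoments_oscInt hG hGs
  have hXc : Continuous (oscInt fun u => (χ u : ℂ)) := continuous_oscInt hχ'.continuous hs'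
  have hac := ha.1.continuous
  have hswap : ∫ ζ, ∫ ξ : ℝ, a (w, ζ) * (oscInt G ξ * oscInt (fun u => (χ u : ℂ)) (ζ - pt ξ η)) =
      ∫ ξ : ℝ, ∫ ζ, a (w, ζ) * (oscInt G ξ * oscInt (fun u => (χ u : ℂ)) (ζ - pt ξ η)) := by
    refine integral_integral_swap ?_
    -- The decay of the transform of χ at ζ - (ξ, η) is split by Peetre's inequality: the factor in
    -- ζ beats the symbol, and the powers of 1 + ‖ξ‖ are beaten by the transform of G.
    have hi : Integrable (fun p : Amb d × ℝ => (Ca * C * (1 + ‖p.1‖) ^ (m - M)) *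
        ((1 + ‖η‖) ^ M * ((1 + ‖p.2‖) ^ (M : ℝ) * ‖oscInt G p.2‖)))
        ((volume : Measure (Amb d)).prod (volume : Measure ℝ)) :=
      ((integrable_one_add_norm_rpow hM).const_mul _).mul_prod
        ((hGm.integrable_rpow M).const_mul _)
    refine hi.mono' ?_ (Eventually.of_forall fun p => ?_)
    · have h2 := hGm.1
      exact Continuous.aestronglyMeasurable (by unfold Function.uncurry; fun_prop)
    · obtain ⟨ζ, ξ⟩ := p
      change ‖_ * (_ * _)‖ ≤ _
      have h1 := one_add_norm_add_rpow_le (-(M : ℝ)) ζ (-pt ξ η)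
      rw [norm_neg, abs_neg, abs_of_nonneg (Nat.cast_nonneg M), ← sub_eq_add_neg,
        Real.rpow_natCast] at h1
      have h2 : (1 + ‖pt ξ η‖) ^ M ≤ (1 + ‖ξ‖) ^ M * (1 + ‖η‖) ^ M := by
        rw [← mul_pow]
        refine pow_le_pow_left₀ (by positivity) ?_ M
        have := norm_pt_le ξ η
        rw [Real.norm_eq_abs]
        nlinarith [abs_nonneg ξ, norm_nonneg η, mul_nonneg (abs_nonneg ξ) (norm_nonneg η)]
      rw [norm_mul, norm_mul]
      calc _ ≤ (Ca * (1 + ‖ζ‖) ^ m) * (‖oscInt G ξ‖ *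
            (C * (((1 + ‖ξ‖) ^ M * (1 + ‖η‖) ^ M) * (1 + ‖ζ‖) ^ (-(M : ℝ))))) := by
            gcongr
            · exact hCa (w, ζ)
            · refine (hC _).trans (mul_le_mul_of_nonneg_left (h1.trans ?_) hC0)
              gcongr
        _ = (Ca * C * ((1 + ‖ζ‖) ^ m * (1 + ‖ζ‖) ^ (-(M : ℝ)))) *
              ((1 + ‖η‖) ^ M * ((1 + ‖ξ‖) ^ M * ‖oscInt G ξ‖)) := by ring
        _ = _ := by
          rw [← Real.rpow_add (by positivity), ← sub_eq_add_neg, Real.rpow_natCast]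
  simp only [oscInt_cutoff_eq hχ.continuous hs hG hGs]
  have h3 : ∫ ζ, a (w, ζ) * (((2 * Real.pi : ℝ) : ℂ)⁻¹ * ∫ ξ : ℝ, oscInt G ξ *
      oscInt (fun u => (χ u : ℂ)) (ζ - pt ξ η)) = ((2 * Real.pi : ℝ) : ℂ)⁻¹ *
      ∫ ζ, ∫ ξ : ℝ, a (w, ζ) * (oscInt G ξ * oscInt (fun u => (χ u : ℂ)) (ζ - pt ξ η)) := by
    rw [← integral_const_mul]
    refine integral_congr_ae (Eventually.of_forall fun ζ => ?_)
    simp only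
    rw [integral_const_mul]; ring
  rw [h3, hswap, mul_left_comm, ← integral_const_mul]
  congr 1
  refine integral_congr_ae (Eventually.of_forall fun ξ => ?_)
  simp only [avgSymbol, symbolConv]
  rw [mul_assoc, ← integral_mul_const]
  congr 1
  -- The translation ζ = v + (ξ, η) turns the integral into the average of the translates of a that
  -- defines `avgSymbol`.
  rw [← integral_add_right_eq_self _ (pt ξ η)]
  refine integral_congr_ae (Eventually.of_forall fun v => ?_)
  simp only [add_sub_cancel_right]
  rw [add_comm v]
  ring

end FiberSymbol

/-! ### A cutoff in s adapted to the cutoff near the diagonal -/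

section Cutoff

variable {d : ℕ}

/-- A cutoff in `x / x' - 1` which is equal to `1` on the projection of the support of a cutoff
in `u = (x / x' - 1, (y - y') / x')`. -/
theorem exists_isRatioCutoff {χ : Amb d → ℝ} (hs : HasCompactSupport χ)
    (hsupp : tsupport χ ⊆ {u | -1 < u 0}) :
    ∃ χ₁ : ℝ → ℝ, IsRatioCutoff χ₁ ∧ ∀ u, χ u ≠ 0 → χ₁ (u 0) = 1 := by
  -- The point 0 is adjoined so that the interval [α, β] below contains 0 in its interior and the
  -- new cutoff is 1 near 0.
  have hK : IsCompact (insert 0 (tsupport χ)) := hs.isCompact.insert 0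
  obtain ⟨u₀, hu₀, hmin⟩ := hK.exists_isMinOn ⟨0, mem_insert _ _⟩
    (f := fun u : Amb d => u 0) (by fun_prop)
  obtain ⟨u₁, hu₁, hmax⟩ := hK.exists_isMaxOn ⟨0, mem_insert _ _⟩
    (f := fun u : Amb d => u 0) (by fun_prop)
  have h0 : u₀ 0 ≤ 0 := hmin (mem_insert _ _)
  have h1 : 0 ≤ u₁ 0 := hmax (mem_insert _ _)
  have h2 : -1 < u₀ 0 := by
    rcases hu₀ with rfl | h
    · change (-1 : ℝ) < 0; norm_num
    · exact hsupp h
  -- α is the midpoint of -1 and the minimum of u₀. The outer radius below exceeds the inner one by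
  -- (α + 1)/2, so the support begins at (α - 1)/2, which is still larger than -1.
  set α := (u₀ 0 - 1) / 2 with hα
  set β := u₁ 0 + 1 with hβ
  let b : ContDiffBump ((α + β) / 2) :=
    ⟨(β - α) / 2, (β - α) / 2 + (α + 1) / 2, by linarith, by linarith⟩
  have hone : ∀ x, α ≤ x → x ≤ β → x ∈ Metric.closedBall ((α + β) / 2) b.rIn := fun x h h' => by
    rw [Real.closedBall_eq_Icc]
    change x ∈ Icc ((α + β) / 2 - (β - α) / 2) ((α + β) / 2 + (β - α) / 2)
    constructor <;> linarith
  refine ⟨b, ⟨b.contDiff, b.hasCompactSupport, ?_, ?_⟩, fun u hu => ?_⟩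
  · rw [b.tsupport_eq, Real.closedBall_eq_Icc]
    intro x hx
    have : (α + β) / 2 - ((β - α) / 2 + (α + 1) / 2) ≤ x := hx.1
    change -1 < x
    linarith
  · filter_upwards [Icc_mem_nhds (show α < 0 by linarith) (show 0 < β by linarith)] with x hx
    exact b.one_of_mem_closedBall (hone x hx.1 hx.2)
  · have hu' : u ∈ insert 0 (tsupport χ) := mem_insert_of_mem _ (subset_tsupport χ hu)
    have h3 : u₀ 0 ≤ u 0 := hmin hu'
    have h4 : u 0 ≤ u₁ 0 := hmax hu'
    exact b.one_of_mem_closedBall (hone _ (by linarith) (by linarith))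

end Cutoff

/-! ### The fiberwise Fourier transform of the front face kernel -/

section FiberPairing

variable {d : ℕ}

/-- The fiberwise Fourier transform at the frequency `η` of the kernel over the boundary point
`(0, y)`, paired with a function `g(s)`. -/
noncomputable def fiberPairing (A : Amb d × Amb d → ℂ) (χ₁ : ℝ → ℝ) (k : Amb d → ℂ)
    (y η : Tan d) (g : ℝ → ℂ) : ℂ :=
  ((2 * Real.pi : ℝ) : ℂ)⁻¹ *
      (∫ ξ : ℝ, A (pt 0 y, pt ξ η) * oscInt (fun x : ℝ => (χ₁ x : ℂ) * g (1 + x)) ξ) +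
    ∫ s, fiberHat k s η * g s

theorem exists_norm_symbol_pt_le {m : ℝ} {A : Amb d × Amb d → ℂ} (hA : IsJointSymbol m A) :
    ∃ C : ℝ, 0 ≤ C ∧ ∀ (y η : Tan d) (ξ : ℝ),
      ‖A (pt 0 y, pt ξ η)‖ ≤ C * (1 + ‖η‖) ^ |m| * (1 + ‖ξ‖) ^ m := by
  obtain ⟨C, hC⟩ := hA.norm_le
  refine ⟨|C|, abs_nonneg _, fun y η ξ => (hC _ (mem_univ _)).trans ?_⟩
  have h1 := one_add_norm_add_rpow_le m (pt ξ (0 : Tan d)) (pt 0 η)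
  have h2 : pt ξ (0 : Tan d) + pt 0 η = pt ξ η := by rw [← pt_add]; simp
  have h3 : ‖pt ξ (0 : Tan d)‖ = ‖ξ‖ := by
    have := norm_pt_sq (d := d) ξ 0
    rw [← Real.sqrt_sq (norm_nonneg (pt ξ (0 : Tan d))), this, norm_zero, zero_pow two_ne_zero,
      add_zero, Real.sqrt_sq_eq_abs, Real.norm_eq_abs]
  rw [h2, h3, norm_pt_zero_left] at h1
  calc C * (1 + ‖pt ξ η‖) ^ m ≤ |C| * ((1 + ‖η‖) ^ |m| * (1 + ‖ξ‖) ^ m) :=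
        mul_le_mul (le_abs_self _) h1 (by positivity) (abs_nonneg _)
    _ = _ := by ring

theorem IsJointSymbol.contDiff {m : ℝ} {A : Amb d × Amb d → ℂ} (hA : IsJointSymbol m A) :
    ContDiff ℝ ∞ A := contDiffOn_univ.1 hA.contDiffOn

theorem exists_nat_decay_real (m : ℝ) : ∃ M : ℕ, m - (M : ℝ) < -(Module.finrank ℝ ℝ : ℝ) := by
  obtain ⟨M, hM⟩ := exists_nat_gt (m + Module.finrank ℝ ℝ)
  exact ⟨M, by linarith⟩

variable {m : ℝ} {A : Amb d × Amb d → ℂ} {χ₁ : ℝ → ℝ} {k : Amb d → ℂ}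

theorem smooth_fiberTest (hχ : IsRatioCutoff χ₁) {g : ℝ → ℂ} (hg : ContDiff ℝ ∞ g) :
    ContDiff ℝ ∞ (fun x : ℝ => (χ₁ x : ℂ) * g (1 + x)) ∧
      HasCompactSupport (fun x : ℝ => (χ₁ x : ℂ) * g (1 + x)) := by
  obtain ⟨h1, h2⟩ := ofReal_comp_smooth hχ.1 hχ.2.1
  exact ⟨h1.mul (hg.comp (by fun_prop)), h2.mul_right⟩

theorem exists_distr_fiberPairing (hA : IsJointSymbol m A) (hχ : IsRatioCutoff χ₁)
    (hk : IsRapid k) (y η : Tan d) :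
    ∃ F : CDistr posLine, ∀ g, F g = fiberPairing A χ₁ k y η g := by
  obtain ⟨hχ', hs'⟩ := ofReal_comp_smooth hχ.1 hχ.2.1
  obtain ⟨CA, hCA0, hCA⟩ := exists_norm_symbol_pt_le hA
  obtain ⟨M, hM⟩ := exists_nat_decay_real m
  obtain ⟨C, hC0, hC⟩ := exists_norm_oscInt_affine_le (W := ℝ) hχ' hs' M
  set D := (1 + ‖ContinuousLinearMap.id ℝ ℝ‖) ^ M with hD
  have hint : ∀ (f : 𝓓(posLine, ℂ)) (ξ : ℝ), Integrable fun u : ℝ =>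
      Complex.exp (Complex.I * (inner ℝ u ξ : ℝ)) * ((χ₁ u : ℂ) * f (1 + u)) := fun f ξ => by
    refine Continuous.integrable_of_hasCompactSupport ?_ (hs'.mul_right.mul_left)
    have : Continuous f := f.continuous
    have := hχ'.continuous
    have : Continuous fun u : ℝ => inner ℝ u ξ := by fun_prop
    fun_prop
  obtain ⟨F₁, hF₁⟩ := exists_distr_eq_integral (Ω := posLine) (volume : Measure ℝ)
    (fun f ξ => A (pt 0 y, pt ξ η) * oscInt (fun x : ℝ => (χ₁ x : ℂ) * f (1 + x)) ξ)
    (fun f g ξ => by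
      rw [← mul_add, oscInt, oscInt, oscInt, ← integral_add (hint f ξ) (hint g ξ)]
      refine congrArg (A _ * ·) (integral_congr_ae (Eventually.of_forall fun u => ?_))
      change _ * (_ * (f _ + g _)) = _ * _ + _ * _
      ring)
    (fun c f ξ => by
      rw [oscInt, oscInt, mul_left_comm c, ← integral_const_mul c]
      refine congrArg (A _ * ·) (integral_congr_ae (Eventually.of_forall fun u => ?_))
      change _ * (_ * (c * f _)) = c * _
      ring)
    (fun f => ((hA.contDiff.continuous.comp (by fun_prop)).mul (continuous_oscInt
      (smooth_fiberTest hχ f.contDiff).1.continuous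
        (smooth_fiberTest hχ f.contDiff).2)).aestronglyMeasurable)
    (fun K _ => ⟨M, fun ξ => CA * (1 + ‖η‖) ^ |m| * (C * D) * (1 + ‖ξ‖) ^ (m - M),
      (integrable_one_add_norm_rpow hM).const_mul _, fun f B _ hB =>
        Eventually.of_forall fun ξ => by
          rw [norm_mul]
          have hB0 : 0 ≤ B := (norm_nonneg _).trans (hB 0 (Nat.zero_le _) 0)
          calc _ ≤ (CA * (1 + ‖η‖) ^ |m| * (1 + ‖ξ‖) ^ m) *
                (C * B * D * (1 + ‖ξ‖) ^ (-(M : ℝ))) := by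
                gcongr
                · exact hCA y η ξ
                · exact hC f B f.contDiff hB 1 (ContinuousLinearMap.id ℝ ℝ) ξ
            _ = B * (CA * (1 + ‖η‖) ^ |m| * (C * D) *
                ((1 + ‖ξ‖) ^ m * (1 + ‖ξ‖) ^ (-(M : ℝ)))) := by ring
            _ = _ := by rw [← Real.rpow_add (by positivity), sub_eq_add_neg]⟩)
  obtain ⟨F₂, hF₂⟩ := exists_distr_of_continuousOn (volume : Measure ℝ) posLine
    (k := fun s => fiberHat k s η)
    (hk.continuous_fiberHat.comp (by fun_prop : Continuous fun s : ℝ => (s, η))).continuousOn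
  refine ⟨((2 * Real.pi : ℝ) : ℂ)⁻¹ • F₁ + F₂, fun g => ?_⟩
  rw [add_apply, smul_apply, (hF₁ g).2, hF₂, smul_eq_mul, fiberPairing]

/-- Continuity in the frequency is used along t ↦ t η as t → 0, where it identifies the restriction
to the b-front face. -/
theorem continuous_fiberPairing (hA : IsJointSymbol m A) (hχ : IsRatioCutoff χ₁)
    (hk : IsRapid k) (y : Tan d) {g : ℝ → ℂ} (hg : ContDiff ℝ ∞ g) (hgs : HasCompactSupport g) :
    Continuous fun η => fiberPairing A χ₁ k y η g := by
  obtain ⟨hG, hGs⟩ := smooth_fiberTest hχ hg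
  obtain ⟨CA, hCA0, hCA⟩ := exists_norm_symbol_pt_le hA
  have hGm := hasMoments_oscInt hG hGs
  refine (continuous_const.mul ?_).add ?_
  · refine continuous_iff_continuousAt.2 fun η₀ => ?_
    refine continuousAt_of_dominated (bound := fun ξ => CA * (2 + ‖η₀‖) ^ |m| *
      ((1 + ‖ξ‖) ^ m * ‖oscInt (fun x : ℝ => (χ₁ x : ℂ) * g (1 + x)) ξ‖)) ?_ ?_
      ((hGm.integrable_rpow m).const_mul _) ?_
    · exact Eventually.of_forall fun η =>
        ((hA.contDiff.continuous.comp (by fun_prop)).mul hGm.1).aestronglyMeasurable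
    · filter_upwards [Metric.ball_mem_nhds η₀ one_pos] with η hη
      refine Eventually.of_forall fun ξ => ?_
      rw [norm_mul]
      have h1 : ‖η‖ ≤ 1 + ‖η₀‖ := by
        rw [Metric.mem_ball, dist_eq_norm] at hη
        linarith [norm_le_norm_add_norm_sub' η η₀]
      calc _ ≤ (CA * (1 + ‖η‖) ^ |m| * (1 + ‖ξ‖) ^ m) * _ := by
            gcongr
            exact hCA y η ξ
        _ ≤ (CA * (2 + ‖η₀‖) ^ |m| * (1 + ‖ξ‖) ^ m) * _ := by
            gcongr ?_ * _
            refine mul_le_mul_of_nonneg_right (mul_le_mul_of_nonneg_left ?_ hCA0) (by positivity)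
            exact Real.rpow_le_rpow (by positivity) (by linarith) (abs_nonneg _)
        _ = _ := by ring
    · exact Eventually.of_forall fun ξ =>
        ((hA.contDiff.continuous.comp (by fun_prop)).mul continuous_const).continuousAt
  · have h := continuous_parametric_integral_of_continuous (μ := (volume : Measure ℝ))
      (f := fun η s => fiberHat k s η * g s)
      ((hk.continuous_fiberHat.comp (by fun_prop :
        Continuous fun p : Tan d × ℝ => (p.2, p.1))).mul (hg.continuous.comp continuous_snd))
      hgs.isCompact
    exact h.congr fun w => setIntegral_eq_integral_of_forall_compl_eq_zero fun u hu => by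
      rw [image_eq_zero_of_notMem_tsupport hu, mul_zero]

theorem norm_cutoff_bound {χ : Tan d → ℝ} (hχ : ContDiff ℝ ∞ χ) (hs : HasCompactSupport χ) :
    ∃ C : ℝ, 0 ≤ C ∧ ∀ U, ‖(χ U : ℂ)‖ ≤ C := by
  obtain ⟨C, hC⟩ := hs.exists_bound_of_continuous hχ.continuous
  exact ⟨|C|, abs_nonneg _, fun U => by
    rw [Complex.norm_real]; exact (hC U).trans (le_abs_self C)⟩

/-- The fiberwise Fourier transform of the restriction of the kernel to the front face. -/
theorem isFiberFourier_of_frontPairing {a : Amb d × Amb d → ℂ} (ha : IsSymbol m a)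
    {χ : Amb d → ℝ} (hχ : ContDiff ℝ ∞ χ) (hs : HasCompactSupport χ)
    {H : ℝ × Tan d × Amb d × ℝ → ℂ} (hH : IsSmoothVanishing H) (hχ₁ : IsRatioCutoff χ₁)
    (hone : ∀ u, χ u ≠ 0 → χ₁ (u 0) = 1) {y η : Tan d} {N : CDistr (openHalf d)}
    (hN : ∀ g, N g = frontPairing a χ H (pt 0 y) g) {F : CDistr posLine}
    (hF : ∀ g, F g = fiberPairing (avgSymbol a χ) χ₁ (frontFun H (pt 0 y)) y η g) :
    IsFiberFourier N η F := by
  intro g ψ hψ hψs hψ1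
  have hk := hH.isRapid_frontFun y
  set G : ℝ → Amb d → ℂ := fun R v => g (v 0) *
    Complex.exp (-Complex.I * (inner ℝ (tail v) η : ℝ)) * (ψ (R⁻¹ • tail v) : ℂ) with hGdef
  obtain ⟨C, hC0, hC⟩ := norm_cutoff_bound hψ hψs
  obtain ⟨Cg, hCg⟩ := g.hasCompactSupport.exists_bound_of_continuous g.continuous
  obtain ⟨r, hr⟩ := hs.isCompact.isBounded.subset_closedBall (0 : Amb d)
  obtain ⟨δ, hδ, hψδ⟩ := Metric.eventually_nhds_iff.1 hψ1
  have hsm0 : ContDiff ℝ ∞ fun v : Amb d => g (v 0) *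
      Complex.exp (-Complex.I * (inner ℝ (tail v) η : ℝ)) := by
    have h2 : ContDiff ℝ ∞ fun v : Amb d => inner ℝ (tail v) η :=
      contDiff_tail.inner ℝ contDiff_const
    exact (g.contDiff.comp contDiff_apply_zero).mul
      (contDiff_const.mul (Complex.ofRealCLM.contDiff.comp h2)).cexp
  have hsm : ∀ R, ContDiff ℝ ∞ (G R) := fun R => hsm0.mul
    (Complex.ofRealCLM.contDiff.comp (hψ.comp (by fun_prop : ContDiff ℝ ∞ fun v : Amb d => R⁻¹ • tail v)))
  have hGsupp : ∀ R > 0, HasCompactSupport (G R) ∧ tsupport (G R) ⊆ openHalf d := fun R hR => by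
    have hK : IsCompact ((fun p : ℝ × Tan d => pt p.1 (R • p.2)) ''
        (tsupport g ×ˢ tsupport ψ)) :=
      (g.hasCompactSupport.isCompact.prod hψs.isCompact).image (by fun_prop)
    have hsub : Function.support (G R) ⊆ (fun p : ℝ × Tan d => pt p.1 (R • p.2)) ''
        (tsupport g ×ˢ tsupport ψ) := fun v hv => by
      refine ⟨(v 0, R⁻¹ • tail v), ⟨subset_tsupport _ fun h => hv ?_,
        subset_tsupport _ fun h => hv ?_⟩, ?_⟩
      · simp only [hGdef, h, zero_mul]
      · simp only [hGdef, h, Complex.ofReal_zero, mul_zero]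
      · simp only
        rw [smul_smul, mul_inv_cancel₀ hR.ne', one_smul, pt_tail]
    refine ⟨HasCompactSupport.of_support_subset_isCompact hK hsub,
      (closure_minimal hsub hK.isClosed).trans ?_⟩
    rintro _ ⟨p, hp, rfl⟩
    exact g.tsupport_subset hp.1
  have hpair : ∀ R > 0, N.pair (G R) = frontPairing a χ H (pt 0 y) (G R) := fun R hR => by
    rw [CDistr.pair, dif_pos ⟨hsm R, hGsupp R hR⟩, hN]
    rfl
  obtain ⟨hG₁, hG₁s⟩ := smooth_fiberTest hχ₁ g.contDiff
  -- For R > r/δ the cutoff ψ(Υ/R) equals 1 on the support of χ, so the conormal part of the pairing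
  -- does not depend on R any more. There the cutoff χ₁(s - 1) also equals 1 and may be inserted.
  have hmain : ∀ R > max 0 (r / δ), ∀ ζ, oscInt (fun u => (χ u : ℂ) * G R (pt 1 0 + u)) ζ =
      oscInt (fun u => (χ u : ℂ) * (((χ₁ (u 0) : ℂ) * g (1 + u 0)) *
        Complex.exp (-Complex.I * (inner ℝ (tail u) η : ℝ)))) ζ := fun R hR ζ => by
    congr 1
    ext u
    by_cases hu : χ u = 0
    · rw [hu]; simp
    have hR0 : 0 < R := (le_max_left _ _).trans_lt hR
    have h1 : ‖u‖ ≤ r := by simpa using hr (subset_tsupport χ hu)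
    have h2 : ψ (R⁻¹ • tail u) = 1 := by
      refine hψδ ?_
      rw [dist_zero_right, norm_smul, norm_inv, Real.norm_of_nonneg hR0.le,
        inv_mul_lt_iff₀ hR0]
      have : r / δ < R := (le_max_right _ _).trans_lt hR
      rw [div_lt_iff₀ hδ] at this
      exact ((norm_tail_le u).trans h1).trans_lt this
    have h3 : tail (pt 1 0 + u) = tail u := by rw [tail_add, tail_pt, zero_add]
    have h4 : (pt 1 0 + u : Amb d) 0 = 1 + u 0 := rfl
    simp only [hGdef]
    rw [h3, h4, h2, hone u hu]
    push_cast; ring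
  -- The smooth part is rapidly decaying, hence integrable, and dominated convergence removes the
  -- cutoff.
  have hlim : Tendsto (fun R => ∫ v, frontFun H (pt 0 y) v * G R v) atTop
      (𝓝 (∫ s, fiberHat (frontFun H (pt 0 y)) s η * g s)) := by
    obtain ⟨hint, heq⟩ := hk.integral_mul_exp g.continuous ⟨Cg, hCg⟩ η
    rw [← heq]
    refine tendsto_integral_filter_of_dominated_convergence
      (fun v => ‖frontFun H (pt 0 y) v * (g (v 0) *
        Complex.exp (-Complex.I * (inner ℝ (tail v) η : ℝ)))‖ * C)
      (Eventually.of_forall fun R => (hk.1.mul (hsm R).continuous).aestronglyMeasurable)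
      (Eventually.of_forall fun R => Eventually.of_forall fun v => ?_) (hint.norm.mul_const C)
      (Eventually.of_forall fun v => ?_)
    · simp only [hGdef]
      rw [← mul_assoc, norm_mul _ (ψ _ : ℂ)]
      gcongr
      exact hC _
    · have h1 : Tendsto (fun R : ℝ => R⁻¹ • tail v) atTop (𝓝 0) := by
        have := (tendsto_inv_atTop_zero (𝕜 := ℝ)).smul_const (tail v)
        rwa [zero_smul] at this
      have h2 : Tendsto (fun R : ℝ => (ψ (R⁻¹ • tail v) : ℂ)) atTop (𝓝 ((1 : ℝ) : ℂ)) := by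
        refine (Complex.continuous_ofReal.tendsto 1).comp ?_
        have := (hψ.continuous.tendsto 0).comp h1
        rwa [hψ1.self_of_nhds] at this
      simpa [hGdef, mul_assoc] using h2.const_mul (frontFun H (pt 0 y) v * (g (v 0) *
        Complex.exp (-Complex.I * (inner ℝ (tail v) η : ℝ))))
  rw [hF, fiberPairing, ← integral_symbol_oscInt_cutoff ha hχ hs hG₁ hG₁s]
  refine (hlim.const_add _).congr' ?_
  filter_upwards [eventually_gt_atTop (max 0 (r / δ))] with R hR
  rw [hpair R ((le_max_left _ _).trans_lt hR), frontPairing]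
  simp only [hmain R hR]

theorem IsFiberFourier.unique {N : CDistr (openHalf d)} {η : Tan d} {F F' : CDistr posLine}
    (hF : IsFiberFourier N η F) (hF' : IsFiberFourier N η F') : F = F' := by
  ext g
  let b : ContDiffBump (0 : Tan d) := ⟨1, 2, one_pos, one_lt_two⟩
  exact tendsto_nhds_unique (hF g b b.contDiff b.hasCompactSupport b.eventuallyEq_one)
    (hF' g b b.contDiff b.hasCompactSupport b.eventuallyEq_one)

end FiberPairing

/-! ### The reduced normal operator as a quantization -/

section Quantization

variable {d : ℕ} {m : ℝ} {A : Amb d × Amb d → ℂ} {χ₁ : ℝ → ℝ} {k : Amb d → ℂ}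

/-- The full symbol `b(t, σ)` of the reduced normal operator. -/
noncomputable def reducedSymbol (A : Amb d × Amb d → ℂ) (y η : Tan d) (t σ : ℝ) : ℂ :=
  A (pt 0 y, pt ((1 + t) * σ) (t • η))

/-- The residual part of the kernel of the reduced normal operator. -/
noncomputable def reducedResidual (k : Amb d → ℂ) (η : Tan d) (t t' : ℝ) : ℂ :=
  fiberHat k (t / t') (t' • η)

theorem quadrant_eq_zero (ψ : 𝓓(quadrant, ℂ)) {q : ℝ × ℝ} (hq : q ∉ (Ioi 0 ×ˢ Ioi 0 : Set _)) :
    ψ q = 0 :=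
  image_eq_zero_of_notMem_tsupport fun h => hq (ψ.tsupport_subset h)

theorem exists_fiberTest (ψ : 𝓓(quadrant, ℂ)) {t' : ℝ} (ht : 0 < t') :
    ∃ g : 𝓓(posLine, ℂ), ∀ s, g s = ψ (s * t', t') := by
  have hsm : ContDiff ℝ ∞ fun s : ℝ => ψ (s * t', t') := ψ.contDiff.comp (by fun_prop)
  have hK : IsCompact ((fun q : ℝ × ℝ => q.1 / t') '' tsupport ψ) :=
    ψ.hasCompactSupport.isCompact.image (by fun_prop)
  have hsub : Function.support (fun s : ℝ => ψ (s * t', t')) ⊆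
      (fun q : ℝ × ℝ => q.1 / t') '' tsupport ψ := fun s hs =>
    ⟨(s * t', t'), subset_tsupport _ hs, by simp [ht.ne']⟩
  refine ⟨⟨_, hsm, HasCompactSupport.of_support_subset_isCompact hK hsub,
    (closure_minimal hsub hK.isClosed).trans ?_⟩, fun s => rfl⟩
  rintro _ ⟨q, hq, rfl⟩
  exact div_pos (ψ.tsupport_subset hq).1 ht

theorem pair_fiberTest (ψ : 𝓓(quadrant, ℂ)) {t' : ℝ} (ht : 0 < t') {F : CDistr posLine}
    {η y : Tan d} (hF : ∀ g, F g = fiberPairing A χ₁ k y η g) :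
    F.pair (fun s => ψ (s * t', t')) = fiberPairing A χ₁ k y η (fun s => ψ (s * t', t')) := by
  obtain ⟨g, hg⟩ := exists_fiberTest ψ ht
  have : (fun s => ψ (s * t', t')) = g := by ext s; exact (hg s).symm
  rw [this, CDistr.pair, dif_pos ⟨g.contDiff, g.hasCompactSupport, g.tsupport_subset⟩, ← hF]
  rfl

theorem continuousOn_reducedResidual (hk : IsRapid k) (η : Tan d) :
    ContinuousOn (fun q : ℝ × ℝ => reducedResidual k η q.1 q.2) quadrant := by
  refine hk.continuous_fiberHat.comp_continuousOn (ContinuousOn.prodMk ?_ (by fun_prop))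
  exact continuousOn_fst.div continuousOn_snd fun q hq => (show (0 : ℝ) < q.2 from hq.2).ne'

/-- The oscillatory part is constructed in the variables (t', ξ), before the rescaling ξ = (1 +
t')σ; there the double integral converges absolutely, because a test function confines t' to a
compact set and its Fourier integral decays in ξ. -/
theorem exists_distr_oscillatory (hA : IsJointSymbol m A) (hχ : IsRatioCutoff χ₁) (y η : Tan d) :
    ∃ κ : CDistr quadrant, ∀ ψ, Integrable (fun p : ℝ × ℝ => (p.1 : ℂ) *
        (A (pt 0 y, pt p.2 (p.1 • η)) *
          oscInt (fun x : ℝ => (χ₁ x : ℂ) * ψ (p.1 + p.1 * x, p.1)) p.2))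
        ((volume.restrict (Ioi 0)).prod volume) ∧
      κ ψ = ∫ p : ℝ × ℝ, (p.1 : ℂ) * (A (pt 0 y, pt p.2 (p.1 • η)) *
          oscInt (fun x : ℝ => (χ₁ x : ℂ) * ψ (p.1 + p.1 * x, p.1)) p.2)
        ∂((volume.restrict (Ioi 0)).prod volume) := by
  obtain ⟨hχ', hs'⟩ := ofReal_comp_smooth hχ.1 hχ.2.1
  obtain ⟨CA, hCA0, hCA⟩ := exists_norm_symbol_pt_le hA
  obtain ⟨M, hM⟩ := exists_nat_decay_real m
  obtain ⟨C, hC0, hC⟩ := exists_norm_oscInt_affine_le (W := ℝ × ℝ) hχ' hs' M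
  have hchi := hχ'.continuous
  have hchi' := hχ.1.continuous
  have hint : ∀ (ψ : 𝓓(quadrant, ℂ)) (p : ℝ × ℝ), Integrable fun u : ℝ =>
      Complex.exp (Complex.I * (inner ℝ u p.2 : ℝ)) *
        ((χ₁ u : ℂ) * ψ (p.1 + p.1 * u, p.1)) := fun ψ p => by
    refine Continuous.integrable_of_hasCompactSupport ?_ (hs'.mul_right.mul_left)
    have : Continuous ψ := ψ.continuous
    have : Continuous fun u : ℝ => inner ℝ u p.2 := by fun_prop
    fun_prop
  refine exists_distr_eq_integral (Ω := quadrant) ((volume.restrict (Ioi 0)).prod volume)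
    (fun ψ (p : ℝ × ℝ) => (p.1 : ℂ) * (A (pt 0 y, pt p.2 (p.1 • η)) *
      oscInt (fun x : ℝ => (χ₁ x : ℂ) * ψ (p.1 + p.1 * x, p.1)) p.2)) ?_ ?_ ?_ ?_
  · intro f g p
    rw [← mul_add, ← mul_add, oscInt, oscInt, oscInt, ← integral_add (hint f p) (hint g p)]
    refine congrArg (fun z => (p.1 : ℂ) * (A _ * z))
      (integral_congr_ae (Eventually.of_forall fun u => ?_))
    change _ * (_ * (f _ + g _)) = _ * _ + _ * _
    ring
  · intro c f p
    rw [oscInt, oscInt, mul_left_comm c, mul_left_comm c, ← integral_const_mul c]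
    refine congrArg (fun z => (p.1 : ℂ) * (A _ * z))
      (integral_congr_ae (Eventually.of_forall fun u => ?_))
    change _ * (_ * (c * f _)) = c * _
    ring
  · intro f
    have hc : Continuous fun p : ℝ × ℝ =>
        oscInt (fun x : ℝ => (χ₁ x : ℂ) * f (p.1 + p.1 * x, p.1)) p.2 := by
      have : Continuous f := f.continuous
      refine continuous_oscInt_param (V := ℝ × ℝ)
        (G := fun p x => (χ₁ x : ℂ) * f (p.1 + p.1 * x, p.1)) (by fun_prop)
        hχ.2.1.isCompact (fun p u hu => ?_) continuous_snd
      rw [image_eq_zero_of_notMem_tsupport hu]; simp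
    have := hA.contDiff.continuous
    exact Continuous.aestronglyMeasurable (by fun_prop)
  · intro K _
    obtain ⟨r, hr⟩ := K.isCompact.isBounded.subset_closedBall (0 : ℝ × ℝ)
    set r' := max r 0
    have hr'0 : 0 ≤ r' := le_max_right _ _
    -- On the support of the test function |t| ≤ r', so the frequency t η is at most r' ‖η‖ and the
    -- affine map x ↦ (t + t x, t) has linear part of norm at most r'.
    set D := r' * (CA * (1 + r' * ‖η‖) ^ |m| * (C * (1 + r') ^ M)) with hD
    refine ⟨M, fun p => (Icc (-r') r').indicator (fun _ => D) p.1 * (1 + ‖p.2‖) ^ (m - M), ?_,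
      fun f B hf hB => Eventually.of_forall fun p => ?_⟩
    · refine Integrable.mul_prod ?_ (integrable_one_add_norm_rpow hM)
      exact ((integrable_indicator_iff measurableSet_Icc).2
        (continuous_const.continuousOn.integrableOn_compact isCompact_Icc)).restrict
    · obtain ⟨t, ξ⟩ := p
      have hB0 : 0 ≤ B := (norm_nonneg _).trans (hB 0 (Nat.zero_le _) 0)
      by_cases ht : t ∈ Icc (-r') r'
      · have ht' : |t| ≤ r' := abs_le.2 ht
        simp only [indicator_of_mem ht]
        set S : ℝ →L[ℝ] ℝ × ℝ := (t • ContinuousLinearMap.id ℝ ℝ).prod 0 with hS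
        have hSn : ‖S‖ ≤ r' := by
          refine ContinuousLinearMap.opNorm_le_bound _ hr'0 fun x => ?_
          simp only [hS, ContinuousLinearMap.prod_apply, Prod.norm_mk, smul_apply,
            ContinuousLinearMap.id_apply, zero_apply, norm_zero, norm_smul]
          refine max_le ?_ (by positivity)
          rw [Real.norm_eq_abs t]
          gcongr
        have hfun : (fun x : ℝ => (χ₁ x : ℂ) * f (t + t * x, t)) =
            fun x => (χ₁ x : ℂ) * f ((t, t) + S x) := by
          ext x
          simp [hS]
        rw [norm_mul, norm_mul, Complex.norm_real, Real.norm_eq_abs, hfun]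
        have h1 : ‖t • η‖ ≤ r' * ‖η‖ := by
          rw [norm_smul, Real.norm_eq_abs]; gcongr
        calc _ ≤ r' * ((CA * (1 + r' * ‖η‖) ^ |m| * (1 + ‖ξ‖) ^ m) *
              (C * B * (1 + r') ^ M * (1 + ‖ξ‖) ^ (-(M : ℝ)))) := by
              gcongr
              · refine (hCA y (t • η) ξ).trans ?_
                gcongr
              · refine (hC f B f.contDiff hB (t, t) S ξ).trans ?_
                gcongr
          _ = B * (D * ((1 + ‖ξ‖) ^ m * (1 + ‖ξ‖) ^ (-(M : ℝ)))) := by rw [hD]; ring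
          _ = _ := by rw [← Real.rpow_add (by positivity), sub_eq_add_neg]
      · have h0 : ∀ x, f (x, t) = 0 := fun x => hf _ fun hx => ht <| by
          have := hr hx
          rw [mem_closedBall_zero_iff] at this
          have h2 : |t| ≤ r' := ((norm_snd_le (x, t)).trans this).trans (le_max_left _ _)
          exact abs_le.1 h2
        simp only [indicator_of_notMem ht, h0, zero_mul, mul_zero]
        simp [oscInt]

theorem integral_residual (hk : IsRapid k) (η : Tan d) (ψ : 𝓓(quadrant, ℂ)) :
    IntegrableOn (fun t' : ℝ => (t' : ℂ) * ∫ s, fiberHat k s (t' • η) * ψ (s * t', t')) (Ioi 0) ∧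
    ∫ q : ℝ × ℝ, reducedResidual k η q.1 q.2 * ψ q =
      ∫ t' in Ioi (0 : ℝ), (t' : ℂ) * ∫ s, fiberHat k s (t' • η) * ψ (s * t', t') := by
  have hsupp : tsupport (fun q : ℝ × ℝ => reducedResidual k η q.1 q.2 * ψ q) ⊆ tsupport ψ :=
    closure_mono fun q hq h => hq (by simp [h])
  have hcont : Continuous fun q : ℝ × ℝ => reducedResidual k η q.1 q.2 * ψ q :=
    ((continuousOn_reducedResidual hk η).mul ψ.continuous.continuousOn).continuous_of_tsupport_subset
      quadrant.isOpen (hsupp.trans ψ.tsupport_subset)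
  have hint : Integrable (fun q : ℝ × ℝ => reducedResidual k η q.1 q.2 * ψ q)
      (volume.prod volume) :=
    hcont.integrable_of_hasCompactSupport ψ.hasCompactSupport.mul_left
  have hin : ∀ t' ∈ Ioi (0 : ℝ), ∫ t, reducedResidual k η t t' * ψ (t, t') =
      (t' : ℂ) * ∫ s, fiberHat k s (t' • η) * ψ (s * t', t') := fun t' ht => by
    have ht' : (0 : ℝ) < t' := ht
    have h1 := Measure.integral_comp_mul_right
      (fun t => reducedResidual k η t t' * ψ (t, t')) t'
    have h2 : ∀ s, reducedResidual k η (s * t') t' = fiberHat k s (t' • η) := fun s => by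
      rw [reducedResidual, mul_div_cancel_right₀ _ ht'.ne']
    simp only [h2] at h1
    rw [h1, abs_of_pos (inv_pos.2 ht'), Complex.real_smul, ← mul_assoc, ← Complex.ofReal_mul,
      mul_inv_cancel₀ ht'.ne', Complex.ofReal_one, one_mul]
  refine ⟨(hint.integral_prod_right.integrableOn (s := Ioi 0)).congr_fun hin measurableSet_Ioi, ?_⟩
  rw [Measure.volume_eq_prod, integral_prod_symm _ hint, ← setIntegral_congr_fun measurableSet_Ioi hin]
  refine (setIntegral_eq_integral_of_forall_compl_eq_zero fun t' ht => ?_).symm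
  have : ∀ t, ψ (t, t') = 0 := fun t => quadrant_eq_zero ψ fun h => ht h.2
  simp [this]

/-- The distribution with kernel given by the quantization formula is the kernel
`F_{t'}(t / t')` for the fiberwise Fourier transforms `F_{t'}` at the frequencies `t' η`. -/
theorem exists_isBscQuantization_isRatioKernel (hA : IsJointSymbol m A) (hχ : IsRatioCutoff χ₁)
    (hk : IsRapid k) (y η : Tan d) :
    ∃ κ : CDistr quadrant,
      IsBscQuantization χ₁ (reducedSymbol A y η) (reducedResidual k η) κ ∧
      ∀ F : ℝ → CDistr posLine,
        (∀ t' > 0, ∀ g, F t' g = fiberPairing A χ₁ k y (t' • η) g) → IsRatioKernel F κ := by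
  obtain ⟨κ₁, hκ₁⟩ := exists_distr_oscillatory hA hχ y η
  obtain ⟨κ₂, hκ₂⟩ := exists_distr_of_continuousOn (volume : Measure (ℝ × ℝ)) quadrant
    (continuousOn_reducedResidual hk η)
  refine ⟨((2 * Real.pi : ℝ) : ℂ)⁻¹ • κ₁ + κ₂, fun ψ => ?_, fun F hF ψ => ?_⟩
  · rw [add_apply, smul_apply, (hκ₁ ψ).2, hκ₂, smul_eq_mul, integral_prod _ (hκ₁ ψ).1]
    congr 1
    · congr 1
      refine setIntegral_congr_fun measurableSet_Ioi fun t' ht => ?_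
      have ht' : (0 : ℝ) < t' := ht
      -- The substitution ξ = (1 + t')σ is the source of the factor 1 + t' in the quantization
      -- formula.
      have h1 := Measure.integral_comp_mul_left (fun ξ : ℝ => (t' : ℂ) *
        (A (pt 0 y, pt ξ (t' • η)) *
          oscInt (fun x : ℝ => (χ₁ x : ℂ) * ψ (t' + t' * x, t')) ξ)) (1 + t')
      rw [abs_of_pos (by positivity), Complex.real_smul] at h1
      have h2 : (((1 + t') : ℝ) : ℂ) * (((1 + t')⁻¹ : ℝ) : ℂ) = 1 := by
        rw [← Complex.ofReal_mul, mul_inv_cancel₀ (by positivity), Complex.ofReal_one]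
      simp only
      rw [← one_mul (∫ ξ, _), ← h2, mul_assoc, ← h1, integral_const_mul, Complex.ofReal_mul]
      rw [mul_left_comm, ← mul_assoc (t' : ℂ)]
      congr 1
      refine integral_congr_ae (Eventually.of_forall fun σ => ?_)
      simp only [reducedSymbol, oscInt]
      congr 1
      refine integral_congr_ae (Eventually.of_forall fun v => ?_)
      have h3 : inner ℝ v ((1 + t') * σ) = (1 + t') * v * σ := by
        change (1 + t') * σ * v = _
        ring
      simp only [h3]
      ring
    · exact (setIntegral_eq_integral_of_forall_compl_eq_zero fun q hq => by
        rw [quadrant_eq_zero ψ hq, mul_zero]).symm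
  · obtain ⟨hint₂, heq₂⟩ := integral_residual hk η ψ
    rw [add_apply, smul_apply, (hκ₁ ψ).2, hκ₂, smul_eq_mul, integral_prod _ (hκ₁ ψ).1, heq₂,
      ← integral_const_mul, ← integral_add ((hκ₁ ψ).1.integral_prod_left.const_mul _) hint₂]
    refine setIntegral_congr_fun measurableSet_Ioi fun t' ht => ?_
    have ht' : (0 : ℝ) < t' := ht
    simp only
    rw [pair_fiberTest ψ ht' (hF t' ht'), fiberPairing, mul_add, integral_const_mul, mul_left_comm]
    have h4 : ∀ x : ℝ, (1 + x) * t' = t' + t' * x := fun x => by ring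
    simp only [h4]

/-- Averages of the kernel over the first variable. -/
theorem pair_bFrontTest {κ : CDistr quadrant} {F : ℝ → CDistr posLine}
    (hκ : IsRatioKernel F κ) (g : 𝓓(posLine, ℂ)) {h : ℝ → ℝ} (hh : ContDiff ℝ ∞ h)
    (hhs : HasCompactSupport h) (hpos : tsupport h ⊆ Ioi 0) :
    κ.pair (fun q => g (q.1 / q.2) * (h q.2 * q.2⁻¹ : ℝ)) = ∫ t, (h t : ℂ) * F t g := by
  set f : ℝ × ℝ → ℂ := fun q => g (q.1 / q.2) * (h q.2 * q.2⁻¹ : ℝ) with hf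
  have hK : IsCompact ((fun q : ℝ × ℝ => (q.1 * q.2, q.2)) '' (tsupport g ×ˢ tsupport h)) :=
    (g.hasCompactSupport.isCompact.prod hhs.isCompact).image (by fun_prop)
  have hsub : Function.support f ⊆
      (fun q : ℝ × ℝ => (q.1 * q.2, q.2)) '' (tsupport g ×ˢ tsupport h) := fun q hq => by
    have h1 : q.2 ∈ tsupport h := subset_tsupport h fun h0 => hq (by simp [hf, h0])
    have h2 : q.1 / q.2 ∈ tsupport g := subset_tsupport g fun h0 => hq (by simp [hf, h0])
    have h3 : q.2 ≠ 0 := (show (0 : ℝ) < q.2 from hpos h1).ne'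
    exact ⟨(q.1 / q.2, q.2), ⟨h2, h1⟩, Prod.ext (div_mul_cancel₀ _ h3) rfl⟩
  have hsm : ContDiff ℝ ∞ f := contDiff_iff_contDiffAt.2 fun q => by
    by_cases hq : q.2 ∈ tsupport h
    · have h3 : q.2 ≠ 0 := (show (0 : ℝ) < q.2 from hpos hq).ne'
      have h4 : ContDiffAt ℝ ∞ (fun q : ℝ × ℝ => q.1 / q.2) q :=
        contDiff_fst.contDiffAt.div contDiff_snd.contDiffAt h3
      have h5 : ContDiffAt ℝ ∞ (fun q : ℝ × ℝ => h q.2 * q.2⁻¹) q :=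
        (hh.comp contDiff_snd).contDiffAt.mul (contDiff_snd.contDiffAt.inv h3)
      exact (g.contDiff.contDiffAt.comp q h4).mul
        (Complex.ofRealCLM.contDiff.contDiffAt.comp q h5)
    · refine contDiffAt_const (c := (0 : ℂ)) |>.congr_of_eventuallyEq ?_
      filter_upwards [continuous_snd.continuousAt.eventually
        ((isClosed_tsupport h).isOpen_compl.mem_nhds hq)] with p hp
      simp only [hf, image_eq_zero_of_notMem_tsupport hp, zero_mul, Complex.ofReal_zero, mul_zero]
  have hts : tsupport f ⊆ quadrant := (closure_minimal hsub hK.isClosed).trans <| by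
    rintro _ ⟨q, hq, rfl⟩
    have h1 : 0 < q.1 := g.tsupport_subset hq.1
    have h2 : 0 < q.2 := hpos hq.2
    exact ⟨mul_pos h1 h2, h2⟩
  have hcs := HasCompactSupport.of_support_subset_isCompact hK hsub
  rw [CDistr.pair, dif_pos ⟨hsm, hcs, hts⟩, hκ]
  rw [← setIntegral_eq_integral_of_forall_compl_eq_zero (s := Ioi (0 : ℝ))
    (f := fun t => (h t : ℂ) * F t g) fun t ht => by
      rw [image_eq_zero_of_notMem_tsupport fun h' => ht (hpos h')]; simp]
  refine setIntegral_congr_fun measurableSet_Ioi fun t ht => ?_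
  have ht' : t ≠ 0 := (show (0 : ℝ) < t from ht).ne'
  have h6 : (fun s => (⟨f, hsm, hcs, hts⟩ : 𝓓(quadrant, ℂ)) (s * t, t)) =
      ((h t * t⁻¹ : ℝ) : ℂ) • g := by
    ext s
    change g (s * t / t) * _ = _ * g s
    rw [mul_div_cancel_right₀ _ ht', mul_comm]
  have h7 : ∀ c : ℂ, (F t).pair ⇑(c • g) = c * F t g := fun c => by
    rw [CDistr.pair, dif_pos ⟨(c • g).contDiff, (c • g).hasCompactSupport,
      (c • g).tsupport_subset⟩]
    exact (F t).map_smul c g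
  change (t : ℂ) * (F t).pair _ = _
  rw [h6]
  have h8 := h7 ((h t * t⁻¹ : ℝ) : ℂ)
  rw [FunLike.coe_smul] at h8
  rw [h8, ← mul_assoc, ← Complex.ofReal_mul, mul_left_comm, mul_inv_cancel₀ ht', mul_one]

/-- Pairing with g(t/t') h(t')/t' gives the average of t' ↦ F_{t'}(g) with weight h, which tends to
the value at t' = 0 by continuity. -/
theorem isBFrontFaceRestriction_of_isRatioKernel {κ : CDistr quadrant} {F : ℝ → CDistr posLine}
    (hκ : IsRatioKernel F κ) (hc : ∀ g, Continuous fun t => F t g) :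
    IsBFrontFaceRestriction κ (F 0) := by
  intro g ε hε
  obtain ⟨δ, hδ, hclose⟩ := Metric.continuous_iff.1 (hc g) 0 (ε / 2) (half_pos hε)
  refine ⟨δ, hδ, fun h hh hhs hh0 hh1 hsupp => ?_⟩
  rw [pair_bFrontTest hκ g hh hhs fun t ht => (hsupp ht).1]
  have h1 : (1 : ℂ) = ∫ t, (h t : ℂ) := by rw [integral_complex_ofReal, hh1, Complex.ofReal_one]
  have hint : ∀ k : ℝ → ℂ, Continuous k → Integrable fun w => (h w : ℂ) * k w := fun k hk =>
    ((Complex.continuous_ofReal.comp hh.continuous).mul hk).integrable_of_hasCompactSupport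
      ((hhs.comp_left (g := fun x : ℝ => (x : ℂ)) Complex.ofReal_zero).mul_right)
  rw [← one_mul (F 0 g), h1, ← integral_mul_const,
    ← integral_sub (hint _ (hc g)) (hint _ continuous_const)]
  have hle : ∀ t, ‖(h t : ℂ) * F t g - h t * F 0 g‖ ≤ h t * (ε / 2) := fun t => by
    rw [← mul_sub, norm_mul, Complex.norm_real, Real.norm_of_nonneg (hh0 t)]
    by_cases ht : t ∈ tsupport h
    · refine mul_le_mul_of_nonneg_left ?_ (hh0 t)
      rw [← dist_eq_norm]
      refine (hclose t ?_).le
      rw [dist_zero_right, Real.norm_of_nonneg (hsupp ht).1.le]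
      exact (hsupp ht).2
    · rw [image_eq_zero_of_notMem_tsupport ht]; simp
  have := norm_integral_le_of_norm_le (μ := volume)
    ((hh.continuous.integrable_of_hasCompactSupport hhs).mul_const (ε / 2))
    (Eventually.of_forall hle)
  rw [integral_mul_const, hh1, one_mul] at this
  linarith

end Quantization

/-! ### Joint estimates imply b-scattering symbol estimates -/

section BscSymbols

variable {Θ : Type} [NormedAddCommGroup Θ] [NormedSpace ℝ Θ]

/-- The unit lengths `1`, `1 + t`, `1 + |σ|` in the variables `(θ, t, σ)`. -/
noncomputable def bscScale (x : Θ × ℝ × ℝ) : Θ × ℝ × ℝ →L[ℝ] Θ × ℝ × ℝ :=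
  (ContinuousLinearMap.id ℝ Θ).prodMap
    (((1 + x.2.1) • ContinuousLinearMap.id ℝ ℝ).prodMap
      ((1 + |x.2.2|) • ContinuousLinearMap.id ℝ ℝ))

@[simp] theorem bscScale_apply (x z : Θ × ℝ × ℝ) :
    bscScale x z = (z.1, (1 + x.2.1) * z.2.1, (1 + |x.2.2|) * z.2.2) := rfl

/-- The domain of the variables `(θ, t, σ)`. -/
def bscDomain (O : Set Θ) : Set (Θ × ℝ × ℝ) := O ×ˢ (Ioi 0 ×ˢ univ)

theorem isOpen_bscDomain {O : Set Θ} (hO : IsOpen O) : IsOpen (bscDomain O) :=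
  hO.prod (isOpen_Ioi.prod isOpen_univ)

variable {O : Set Θ} {m r : ℝ} {w : Θ × ℝ × ℝ → ℝ}

theorem hasDerivAt_slice_sigma {G : Θ × ℝ × ℝ → ℂ} {x : Θ × ℝ × ℝ} (hG : DifferentiableAt ℝ G x) :
    deriv (fun σ => G (x.1, x.2.1, σ)) x.2.2 = fderiv ℝ G x (0, 0, 1) := by
  have h1 : HasDerivAt (fun σ : ℝ => (x.1, x.2.1, σ)) ((0 : Θ), (0 : ℝ), (1 : ℝ)) x.2.2 :=
    (hasDerivAt_const _ _).prodMk ((hasDerivAt_const _ _).prodMk (hasDerivAt_id _))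
  exact (HasFDerivAt.comp_hasDerivAt x.2.2 (f := fun σ : ℝ => (x.1, x.2.1, σ)) hG.hasFDerivAt
    h1).deriv

theorem hasDerivAt_slice_t {G : Θ × ℝ × ℝ → ℂ} {x : Θ × ℝ × ℝ} (hG : DifferentiableAt ℝ G x) :
    deriv (fun t => G (x.1, t, x.2.2)) x.2.1 = fderiv ℝ G x (0, 1, 0) := by
  have h1 : HasDerivAt (fun t : ℝ => (x.1, t, x.2.2)) ((0 : Θ), (1 : ℝ), (0 : ℝ)) x.2.1 :=
    (hasDerivAt_const _ _).prodMk ((hasDerivAt_id _).prodMk (hasDerivAt_const _ _))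
  exact (HasFDerivAt.comp_hasDerivAt x.2.1 (f := fun t : ℝ => (x.1, t, x.2.2)) hG.hasFDerivAt
    h1).deriv

theorem SymbolOn.differentiableAt {F : Type*} [NormedAddCommGroup F] [NormedSpace ℝ F]
    {E : Type*} [NormedAddCommGroup E] [NormedSpace ℝ E] {U : Set E} {S : E → E →L[ℝ] E}
    {w : E → ℝ} {f : E → F} (hf : SymbolOn U S w f) (hU : IsOpen U) {x : E} (hx : x ∈ U) :
    DifferentiableAt ℝ f x :=
  (hf.contDiffOn.contDiffAt (hU.mem_nhds hx)).differentiableAt (by simp)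

theorem SymbolOn.iteratedDeriv_sigma (hO : IsOpen O) {f : Θ × ℝ × ℝ → ℂ}
    (hf : SymbolOn (bscDomain O) bscScale w f) (k : ℕ) :
    SymbolOn (bscDomain O) bscScale (fun x => w x * ((1 + |x.2.2|)⁻¹) ^ k)
      (fun x => iteratedDeriv k (fun σ => f (x.1, x.2.1, σ)) x.2.2) := by
  induction k with
  | zero => simpa using hf
  | succ k ih =>
    have hU := isOpen_bscDomain hO
    refine ((ih.fderiv_apply hU (0, 0, 1) (fun x => (1 + |x.2.2|)⁻¹) fun x _ =>
      ⟨(0, 0, (1 + |x.2.2|)⁻¹), ?_, ?_⟩).congr hU fun x hx => ?_).congr_weight fun x _ => ?_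
    · simp only [Prod.norm_mk, norm_zero]
      rw [Real.norm_of_nonneg (by positivity)]
      exact max_le (by positivity) (max_le (by positivity) le_rfl)
    · have : (1 + |x.2.2|) * (1 + |x.2.2|)⁻¹ = 1 := mul_inv_cancel₀ (by positivity)
      simp [this]
    · rw [iteratedDeriv_succ, ← hasDerivAt_slice_sigma (ih.differentiableAt hU hx)]
    · rw [pow_succ, mul_assoc]

theorem SymbolOn.iteratedDeriv_t (hO : IsOpen O) {f : Θ × ℝ × ℝ → ℂ}
    (hf : SymbolOn (bscDomain O) bscScale w f) (j : ℕ) :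
    SymbolOn (bscDomain O) bscScale (fun x => w x * ((1 + x.2.1)⁻¹) ^ j)
      (fun x => iteratedDeriv j (fun t => f (x.1, t, x.2.2)) x.2.1) := by
  induction j with
  | zero => simpa using hf
  | succ j ih =>
    have hU := isOpen_bscDomain hO
    refine ((ih.fderiv_apply hU (0, 1, 0) (fun x => (1 + x.2.1)⁻¹) fun x hx =>
      ⟨(0, (1 + x.2.1)⁻¹, 0), ?_, ?_⟩).congr hU fun x hx => ?_).congr_weight fun x _ => ?_
    · have h0 : (0 : ℝ) < x.2.1 := hx.2.1
      simp only [Prod.norm_mk, norm_zero]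
      rw [Real.norm_of_nonneg (by positivity)]
      exact max_le (by positivity) (max_le le_rfl (by positivity))
    · have h0 : (0 : ℝ) < x.2.1 := hx.2.1
      have : (1 + x.2.1) * (1 + x.2.1)⁻¹ = 1 := mul_inv_cancel₀ (by positivity)
      simp [this]
    · rw [iteratedDeriv_succ, ← hasDerivAt_slice_t (ih.differentiableAt hU hx)]
    · rw [pow_succ, mul_assoc]

/-- Derivatives are taken one variable at a time, first in σ, then in t, then in θ; each removes one
unit 1 + |σ|, 1 + t or 1 from the weight. -/
theorem SymbolOn.isBscSymbolFamily (hO : IsOpen O) {b : Θ → ℝ → ℝ → ℂ}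
    (hb : SymbolOn (bscDomain O) bscScale (fun x => (1 + x.2.1) ^ r * (1 + |x.2.2|) ^ m)
      (fun x => b x.1 x.2.1 x.2.2)) : IsBscSymbolFamily m r O b := by
  refine ⟨hb.contDiffOn, fun i j k => ?_⟩
  have hU := isOpen_bscDomain hO
  have hjk := (hb.iteratedDeriv_sigma hO k).iteratedDeriv_t hO j
  obtain ⟨C, hC⟩ := hjk.bound i
  refine ⟨C, fun θ hθ t ht σ => ?_⟩
  have hx : (θ, t, σ) ∈ bscDomain O := ⟨hθ, ht, mem_univ _⟩
  set G : Θ × ℝ × ℝ → ℂ := fun x => iteratedDeriv j (fun t' =>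
    iteratedDeriv k (fun σ' => b x.1 t' σ') x.2.2) x.2.1 with hG
  have hat : ContDiffAt ℝ i G (θ, t, σ) := hjk.contDiffOn.contDiffAt_of_isOpen hU hx i
  have h1 := iteratedFDeriv_comp_affine hat (ContinuousLinearMap.inl ℝ Θ (ℝ × ℝ))
  have h2 : iteratedFDeriv ℝ i (fun z => G ((θ, t, σ) + ContinuousLinearMap.inl ℝ Θ (ℝ × ℝ) z)) 0 =
      iteratedFDeriv ℝ i (fun θ' => G (θ', t, σ)) θ := by
    have h3 := iteratedFDeriv_comp_add_left (𝕜 := ℝ) (f := fun θ' => G (θ', t, σ)) i θ (x := 0)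
    rw [add_zero] at h3
    rw [← h3]
    congr 1
    ext z
    simp
  have h4 : (iteratedFDeriv ℝ i G (θ, t, σ)).compContinuousLinearMap
      (fun _ => ContinuousLinearMap.inl ℝ Θ (ℝ × ℝ)) =
      ((iteratedFDeriv ℝ i G (θ, t, σ)).compContinuousLinearMap
        (fun _ => bscScale (θ, t, σ))).compContinuousLinearMap
        (fun _ => ContinuousLinearMap.inl ℝ Θ (ℝ × ℝ)) := by
    ext v
    simp
    rfl
  have h5 : ‖iteratedFDeriv ℝ i (fun θ' => G (θ', t, σ)) θ‖ ≤
      C * ((1 + t) ^ r * (1 + |σ|) ^ m * ((1 + |σ|)⁻¹) ^ k * ((1 + t)⁻¹) ^ j) := by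
    rw [← h2, h1, h4]
    refine (ContinuousMultilinearMap.norm_compContinuousLinearMap_le _ _).trans ?_
    rw [Finset.prod_const]
    refine (mul_le_of_le_one_right (norm_nonneg _) (pow_le_one₀ (norm_nonneg _)
      (ContinuousLinearMap.norm_inl_le_one ℝ Θ (ℝ × ℝ)))).trans ?_
    exact hC _ hx
  have ht1 : 0 < 1 + t := by linarith
  calc _ ≤ C * ((1 + t) ^ r * (1 + |σ|) ^ m * ((1 + |σ|)⁻¹) ^ k * ((1 + t)⁻¹) ^ j) *
        (1 + t) ^ j := by
        gcongr
    _ = C * ((1 + t) ^ r * ((1 + |σ|) ^ m * ((1 + |σ|)⁻¹) ^ k)) *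
        (((1 + t)⁻¹) ^ j * (1 + t) ^ j) := by ring
    _ = _ := by
      rw [← mul_pow, inv_mul_cancel₀ ht1.ne', one_pow, mul_one, inv_pow, ← div_eq_mul_inv,
        ← Real.rpow_natCast, ← Real.rpow_sub (by positivity)]

theorem IsBscSymbolFamily.isBscSymbol {b : Θ → ℝ → ℝ → ℂ} (hb : IsBscSymbolFamily m r O b) {θ : Θ}
    (hθ : θ ∈ O) : IsBscSymbol m r (b θ) := by
  refine ⟨hb.1.comp (f := fun q : ℝ × ℝ => (θ, q.1, q.2)) (by fun_prop) fun q hq => ⟨hθ, hq⟩,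
    fun j k => ?_⟩
  obtain ⟨C, hC⟩ := hb.2 0 j k
  refine ⟨C, fun t ht σ => ?_⟩
  have := hC θ hθ t ht σ
  rwa [norm_iteratedFDeriv_zero] at this

end BscSymbols

/-! ### Symbol estimates for A((0, y), ((1 + t)σ, tη)) -/

section ReducedSymbol

variable {d : ℕ}

/-- The rescaled increment of the fiber variable `((1 + t) σ, t η)`, as a function of the increment
`z` and of bounded parameters. -/
noncomputable def scaledIncrement
    (q : ((Tan d × Tan d) × ℝ × ℝ) × ((Tan d × Tan d) × ℝ × ℝ × ℝ)) : Amb d × Amb d :=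
  (pt 0 (q.2.1.1 + q.1.1.1), pt ((1 + q.1.2.1) * (q.2.2.1 + q.1.2.2))
    ((q.2.2.2.1 * (q.2.2.2.2 + q.1.2.1)) • (q.2.1.2 + q.1.1.2)))

theorem contDiff_scaledIncrement : ContDiff ℝ ∞ (scaledIncrement (d := d)) := by
  unfold scaledIncrement
  refine ContDiff.prodMk (ContDiff.pt contDiff_const (by fun_prop)) (ContDiff.pt (by fun_prop) ?_)
  fun_prop

/-- The unit of length `(1 + t) (1 + |σ|)`. -/
noncomputable def bscLength (x : (Tan d × Tan d) × ℝ × ℝ) : ℝ := (1 + x.2.1) * (1 + |x.2.2|)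

/-- A step measured in the units 1, 1 + t, 1 + |σ| moves ζ inside l = (1 + t)(1 + |σ|) times a fixed
smooth map. That map depends on the base point only through σ/(1 + |σ|), 1/(1 + |σ|), t/(1 + t) and
(y, η), all of them bounded, and so its derivatives are bounded uniformly. -/
theorem reducedSymbol_affine (A : Amb d × Amb d → ℂ) {x : (Tan d × Tan d) × ℝ × ℝ}
    (hx : 0 < x.2.1) (z : (Tan d × Tan d) × ℝ × ℝ) :
    reducedSymbol A (x + bscScale x z).1.1 (x + bscScale x z).1.2 (x + bscScale x z).2.1
        (x + bscScale x z).2.2 =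
      A (jointScale (bscLength x) (scaledIncrement (z, x.1, x.2.2 / (1 + |x.2.2|),
        (1 + |x.2.2|)⁻¹, x.2.1 / (1 + x.2.1)))) := by
  obtain ⟨⟨y, η⟩, t, σ⟩ := x
  obtain ⟨⟨y', η'⟩, τ, s⟩ := z
  have ht : 0 < t := hx
  have h1 : (0 : ℝ) < 1 + |σ| := by positivity
  have h2 : (0 : ℝ) < 1 + t := by positivity
  have h3 : (1 + (t + (1 + t) * τ)) * (σ + (1 + |σ|) * s) =
      (1 + t) * (1 + |σ|) * ((1 + τ) * (σ / (1 + |σ|) + s)) := by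
    field_simp
    ring
  have h4 : t + (1 + t) * τ =
      (1 + t) * (1 + |σ|) * ((1 + |σ|)⁻¹ * (t / (1 + t) + τ)) := by
    field_simp
  simp only [reducedSymbol, bscScale_apply, scaledIncrement, jointScale_apply, bscLength,
    Prod.fst_add, Prod.snd_add, ← pt_smul, smul_smul]
  rw [h3, ← h4]

/-- The lower bound on ‖η‖ makes 1 + ‖ζ‖ comparable to l = (1 + t)(1 + |σ|): large σ is seen by the
first component of ζ and large t by the second. The unit of length of A at ζ is therefore comparable
to l, and the composition estimate with the scaled increment gives the weight l^m. -/
theorem IsJointSymbol.symbolOn_reducedSymbol {m : ℝ} {A : Amb d × Amb d → ℂ}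
    (hA : IsJointSymbol m A) {O : Set (Tan d × Tan d)} (hO : IsOpen O) {R : ℝ}
    (hR : ∀ θ ∈ O, ‖θ‖ ≤ R) {c : ℝ} (hc : 0 < c) (hη : ∀ θ ∈ O, c ≤ ‖θ.2‖) :
    SymbolOn (bscDomain O) bscScale (fun x => (1 + x.2.1) ^ m * (1 + |x.2.2|) ^ m)
      (fun x => reducedSymbol A x.1.1 x.1.2 x.2.1 x.2.2) := by
  have hU := isOpen_bscDomain hO
  have hsm : ContDiff ℝ ∞ fun x : (Tan d × Tan d) × ℝ × ℝ =>
      reducedSymbol A x.1.1 x.1.2 x.2.1 x.2.2 :=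
    hA.contDiff.comp ((ContDiff.pt contDiff_const (by fun_prop)).prodMk
      (ContDiff.pt (by fun_prop) (by fun_prop)))
  refine SymbolOn.of_affine hU hsm.contDiffOn fun n => ?_
  -- comparison of `1 + |ζ|` with `(1 + t) (1 + |σ|)`
  set c' := min c 1 with hc'
  have hc'0 : 0 < c' := lt_min hc one_pos
  have hlow : ∀ x ∈ bscDomain O, c' / 2 * bscLength x ≤
      1 + ‖pt ((1 + x.2.1) * x.2.2) (x.2.1 • x.1.2)‖ := by
    rintro ⟨θ, t, σ⟩ ⟨hθ, ht, -⟩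
    have ht0 : 0 < t := ht
    have h1 := abs_le_norm_pt ((1 + t) * σ) (t • θ.2)
    have h2 := norm_le_norm_pt ((1 + t) * σ) (t • θ.2)
    rw [abs_mul, abs_of_pos (by linarith)] at h1
    rw [norm_smul, Real.norm_of_nonneg ht0.le] at h2
    have h3 : c' * t ≤ t * ‖θ.2‖ := by
      rw [mul_comm]
      exact mul_le_mul_of_nonneg_left ((min_le_left _ _).trans (hη θ hθ)) ht0.le
    have h4 : c' ≤ 1 := min_le_right _ _
    have h5 : c' * ((1 + t) * |σ|) ≤ (1 + t) * |σ| :=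
      mul_le_of_le_one_left (by positivity) h4
    simp only [bscLength]
    nlinarith [abs_nonneg σ]
  have hupp : ∀ x ∈ bscDomain O, 1 + ‖pt ((1 + x.2.1) * x.2.2) (x.2.1 • x.1.2)‖ ≤
      (1 + |R|) * bscLength x := by
    rintro ⟨θ, t, σ⟩ ⟨hθ, ht, -⟩
    have ht0 : 0 < t := ht
    have h1 := norm_pt_le ((1 + t) * σ) (t • θ.2)
    rw [abs_mul, abs_of_pos (by linarith : 0 < 1 + t), norm_smul, Real.norm_of_nonneg ht0.le] at h1
    have h2 : ‖θ.2‖ ≤ |R| := ((norm_snd_le θ).trans (hR θ hθ)).trans (le_abs_self R)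
    have h3 : t * ‖θ.2‖ ≤ t * |R| := mul_le_mul_of_nonneg_left h2 ht0.le
    simp only [bscLength]
    nlinarith [abs_nonneg σ, abs_nonneg R, mul_nonneg ht0.le (abs_nonneg σ),
      mul_nonneg (abs_nonneg R) (mul_nonneg ht0.le (abs_nonneg σ)),
      mul_nonneg (abs_nonneg R) (abs_nonneg σ)]
  have hlpos : ∀ x ∈ bscDomain O, 0 < bscLength x := by
    rintro ⟨θ, t, σ⟩ ⟨hθ, ht, -⟩
    have ht0 : 0 < t := ht
    simp only [bscLength]
    positivity
  -- The upper comparison of 1 + ‖ζ‖ with l is needed for m ≥ 0, the lower one for m ≤ 0.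
  obtain ⟨Cm, hCm⟩ : ∃ Cm : ℝ, ∀ x ∈ bscDomain O,
      (1 + ‖pt ((1 + x.2.1) * x.2.2) (x.2.1 • x.1.2)‖) ^ m ≤ Cm * bscLength x ^ m := by
    refine ⟨(1 + |R|) ^ m + (c' / 2) ^ m, fun x hx => ?_⟩
    have hl := hlpos x hx
    rcases le_total 0 m with hm | hm
    · refine (Real.rpow_le_rpow (by positivity) (hupp x hx) hm).trans ?_
      rw [Real.mul_rpow (by positivity) hl.le]
      gcongr
      exact le_add_of_nonneg_right (by positivity)
    · refine (Real.rpow_le_rpow_of_nonpos (by positivity) (hlow x hx) hm).trans ?_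
      rw [Real.mul_rpow (by positivity) hl.le]
      gcongr
      exact le_add_of_nonneg_left (by positivity)
  -- derivatives of the symbol
  obtain ⟨CA, hCA⟩ : ∃ CA : ℝ, ∀ i ≤ n, ∀ p : Amb d × Amb d,
      ‖(iteratedFDeriv ℝ i A p).compContinuousLinearMap fun _ => jointScale (1 + ‖p.2‖)‖ ≤
        CA * (1 + ‖p.2‖) ^ m := by
    choose C hC using hA.bound
    refine ⟨∑ i ∈ Finset.range (n + 1), |C i|, fun i hi p => (hC i p (mem_univ _)).trans ?_⟩
    gcongr
    exact (le_abs_self _).trans (Finset.single_le_sum (f := fun j => |C j|)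
      (fun i _ => abs_nonneg _) (Finset.mem_range.2 (Nat.lt_succ_of_le hi)))
  -- derivatives of the increment
  obtain ⟨D, hD1, hD⟩ : ∃ D : ℝ, 1 ≤ D ∧ ∀ i ≤ n, ∀ q, ‖q‖ ≤ max R 1 →
      ‖iteratedFDeriv ℝ i (fun z => scaledIncrement (d := d) (z, q)) 0‖ ≤ D := by
    have hcpt : ∀ i : ℕ, ∃ D : ℝ, ∀ q ∈ Metric.closedBall
        (0 : (Tan d × Tan d) × ℝ × ℝ × ℝ) (max R 1),
        ‖iteratedFDeriv ℝ i (fun z => scaledIncrement (d := d) (z, q)) 0‖ ≤ D := fun i =>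
      (isCompact_closedBall _ _).exists_bound_of_continuousOn
        (((contDiff_iteratedFDeriv_slice contDiff_scaledIncrement i).continuous.comp
          (by fun_prop : Continuous fun q : (Tan d × Tan d) × ℝ × ℝ × ℝ =>
            ((0 : (Tan d × Tan d) × ℝ × ℝ), q))).continuousOn)
    choose D hD using hcpt
    refine ⟨1 + ∑ i ∈ Finset.range (n + 1), |D i|, le_add_of_nonneg_right
      (Finset.sum_nonneg fun i _ => abs_nonneg _), fun i hi q hq => ?_⟩
    refine (hD i q (by simpa using hq)).trans ((le_abs_self _).trans ?_)
    refine (Finset.single_le_sum (f := fun j => |D j|)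
      (fun i _ => abs_nonneg _) (Finset.mem_range.2 (Nat.lt_succ_of_le hi))).trans ?_
    linarith
  -- The factor (2/c')^n is the cost of replacing the unit 1 + ‖ζ‖ by l ≤ (2/c')(1 + ‖ζ‖) in n
  -- derivatives.
  set C₁ := |CA| * |Cm| * (max 1 (2 / c')) ^ n with hC₁
  refine ⟨n.factorial * C₁ * D ^ n, fun x hx => ?_⟩
  obtain ⟨⟨y, η⟩, t, σ⟩ := x
  have ht0 : 0 < t := hx.2.1
  set x : (Tan d × Tan d) × ℝ × ℝ := ((y, η), t, σ) with hxdef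
  set l := bscLength x with hl
  have hl0 : 0 < l := hlpos x hx
  set q : (Tan d × Tan d) × ℝ × ℝ × ℝ := (x.1, x.2.2 / (1 + |x.2.2|),
    (1 + |x.2.2|)⁻¹, x.2.1 / (1 + x.2.1)) with hq
  have hq1 : ‖q‖ ≤ max R 1 := by
    refine max_le ((hR _ hx.1).trans (le_max_left _ _)) (max_le ?_ (max_le ?_ ?_))
    · refine le_trans ?_ (le_max_right _ _)
      change ‖σ / (1 + |σ|)‖ ≤ 1
      rw [norm_div, Real.norm_eq_abs, Real.norm_of_nonneg (by positivity),
        div_le_one (by positivity)]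
      linarith
    · refine le_trans ?_ (le_max_right _ _)
      change ‖(1 + |σ|)⁻¹‖ ≤ 1
      rw [Real.norm_of_nonneg (by positivity)]
      exact inv_le_one_of_one_le₀ (by linarith [abs_nonneg σ])
    · refine le_trans ?_ (le_max_right _ _)
      change ‖t / (1 + t)‖ ≤ 1
      rw [Real.norm_of_nonneg (by positivity), div_le_one (by positivity)]
      linarith
  set h := fun z => scaledIncrement (d := d) (z, q) with hh
  have hfun : (fun z => reducedSymbol A (x + bscScale x z).1.1 (x + bscScale x z).1.2
      (x + bscScale x z).2.1 (x + bscScale x z).2.2) = (fun p => A (jointScale l p)) ∘ h := by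
    ext z
    exact reducedSymbol_affine A ht0 z
  have hg0 : jointScale l (h 0) = (pt 0 y, pt ((1 + t) * σ) (t • η)) := by
    have h6 : (1 + |σ|) ≠ 0 := by positivity
    have h7 : (1 + t) ≠ 0 := by positivity
    simp only [hh, scaledIncrement, jointScale_apply, hl, bscLength, hq, hxdef, Prod.fst_zero,
      Prod.snd_zero, add_zero, one_mul, ← pt_smul, smul_smul]
    congr 2
    · field_simp
    · congr 1
      field_simp
  set N := ‖pt ((1 + t) * σ) (t • η)‖ with hN
  have hAl : ∀ i ≤ n, ‖iteratedFDeriv ℝ i (fun p => A (jointScale l p)) (h 0)‖ ≤ C₁ * l ^ m := by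
    intro i hi
    have h8 : iteratedFDeriv ℝ i (fun p => A (jointScale l p)) (h 0) =
        (iteratedFDeriv ℝ i A (jointScale l (h 0))).compContinuousLinearMap
          fun _ => jointScale l :=
      (jointScale l).iteratedFDeriv_comp_right hA.contDiff (h 0) (mod_cast le_top)
    rw [h8, hg0]
    refine (norm_compContinuousLinearMap_jointScale_le _ l
      (l' := 1 + N) (by positivity)).trans ?_
    have h9 : |l / (1 + N)| ≤ 2 / c' := by
      rw [abs_of_nonneg (by positivity), div_le_div_iff₀ (by positivity) hc'0]
      have := hlow x hx
      change c' / 2 * l ≤ 1 + N at this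
      linarith
    calc _ ≤ (CA * (1 + N) ^ m) * (max 1 |l / (1 + N)|) ^ i := by
          gcongr
          exact hCA i hi (pt 0 y, pt ((1 + t) * σ) (t • η))
      _ ≤ (|CA| * (|Cm| * l ^ m)) * (max 1 (2 / c')) ^ n := by
          gcongr ?_ * ?_
          · refine mul_le_mul (le_abs_self _) ?_ (by positivity) (abs_nonneg _)
            refine (hCm x hx).trans ?_
            gcongr
            exact le_abs_self _
          · calc _ ≤ (max 1 (2 / c')) ^ i := by gcongr
              _ ≤ _ := pow_le_pow_right₀ (le_max_left _ _) hi
      _ = _ := by rw [hC₁]; ring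
  have hhD : ∀ i, 1 ≤ i → i ≤ n → ‖iteratedFDeriv ℝ i h 0‖ ≤ D ^ i := fun i hi1 hi =>
    (hD i hi q hq1).trans (le_self_pow₀ hD1 (by omega))
  have hhs : ContDiff ℝ ∞ h := contDiff_scaledIncrement.comp (by fun_prop)
  have key := norm_iteratedFDeriv_comp_le (𝕜 := ℝ) (N := ∞) (n := n)
    (hA.contDiff.comp (jointScale l).contDiff) hhs (mod_cast le_top) 0 hAl hhD
  rw [hfun]
  refine key.trans (le_of_eq ?_)
  change _ = (n.factorial * C₁ * D ^ n) * ((1 + t) ^ m * (1 + |σ|) ^ m)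
  rw [← Real.mul_rpow (by positivity) (by positivity)]
  change _ = (n.factorial * C₁ * D ^ n) * l ^ m
  ring

end ReducedSymbol

/-! ### Parametrices of elliptic symbols -/

section Parametrix

variable {Y Z : Type} [NormedAddCommGroup Y] [NormedSpace ℝ Y]
  [NormedAddCommGroup Z] [InnerProductSpace ℝ Z] {F : Type} [NormedAddCommGroup F]
  [NormedSpace ℝ F] {m : ℝ}

/-- Ellipticity is assumed over a single base point. Freezing the base variable there gives a symbol
that is elliptic over every base point. -/
theorem IsJointSymbol.freeze {A : Y × Z → F} (hA : IsJointSymbol m A) (y : Y) :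
    IsJointSymbol m (fun p : Y × Z => A (y, p.2)) := by
  have h1 : IsJointSymbol m (fun p : Y × Z => A (p + (y, 0))) := by
    refine ⟨hA.contDiffOn.comp (by fun_prop) fun _ _ => mem_univ _, fun n => ?_⟩
    obtain ⟨C, hC⟩ := hA.bound n
    refine ⟨C, fun p _ => ?_⟩
    have h := hC (p + (y, 0)) (mem_univ _)
    simp only [Prod.snd_add, add_zero] at h
    rwa [iteratedFDeriv_comp_add_right]
  have h2 := h1.pullback (U' := univ) (S' := fun p : Y × Z => jointScale (1 + ‖p.2‖)) isOpen_univ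
    (fun p _ => by positivity)
    ((0 : Y →L[ℝ] Y).prodMap (ContinuousLinearMap.id ℝ Z)) (fun _ _ => mem_univ _)
    ‖(0 : Y →L[ℝ] Y).prodMap (ContinuousLinearMap.id ℝ Z)‖
    (fun p _ => ⟨_, le_rfl, by ext q <;> simp⟩) isOpen_univ
  refine (h2.congr isOpen_univ fun p _ => ?_).congr_weight fun p _ => ?_
  · change A (y, p.2) = A (0 + y, p.2 + 0)
    rw [zero_add, add_zero]
  · rfl

theorem IsJointSymbol.bilinear {F' G : Type} [NormedAddCommGroup F'] [NormedSpace ℝ F']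
    [NormedAddCommGroup G] [NormedSpace ℝ G] {m' : ℝ} {A : Y × Z → F} {A' : Y × Z → F'}
    (hA : IsJointSymbol m A) (hA' : IsJointSymbol m' A') (B : F →L[ℝ] F' →L[ℝ] G) :
    IsJointSymbol (m + m') (fun p => B (A p) (A' p)) :=
  (SymbolOn.bilinear hA hA' isOpen_univ B).congr_weight fun p _ =>
    (Real.rpow_add (by positivity) m m').symm

theorem IsJointSymbol.mono {m' : ℝ} {A : Y × Z → F} (hA : IsJointSymbol m A) (h : m ≤ m') :
    IsJointSymbol m' A :=
  SymbolOn.mono hA (fun _ _ => by positivity) 1 fun p _ => by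
    rw [one_mul]
    exact Real.rpow_le_rpow_of_exponent_le (by linarith [norm_nonneg p.2]) h

theorem IsJointSymbol.rpow {A : Y × Z → ℝ} (hA : IsJointSymbol m A) {c : ℝ} (hc : 0 < c)
    (h : ∀ p : Y × Z, c * (1 + ‖p.2‖) ^ m ≤ A p) (s : ℝ) :
    IsJointSymbol (m * s) (fun p => A p ^ s) :=
  (SymbolOn.rpow hA isOpen_univ hc (fun _ _ => by positivity) (fun p _ => h p) s).congr_weight
    fun p _ => (Real.rpow_mul (by positivity) m s).symm

theorem isJointSymbol_snd : IsJointSymbol 1 (fun p : Y × Z => p.2) := by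
  refine SymbolOn.linear isOpen_univ (ContinuousLinearMap.snd ℝ Y Z) 1 (fun p _ => ?_) fun p _ => ?_
  · simp
  · refine ContinuousLinearMap.opNorm_le_bound _ (by positivity) fun q => ?_
    simp only [ContinuousLinearMap.comp_apply, jointScale_apply, ContinuousLinearMap.coe_snd',
      norm_smul, Real.rpow_one, one_mul]
    rw [Real.norm_of_nonneg (by positivity)]
    gcongr
    exact norm_snd_le q

theorem isJointSymbol_one_add_norm_sq : IsJointSymbol 2 (fun p : Y × Z => 1 + ‖p.2‖ ^ 2) := by
  have h1 := (isJointSymbol_snd (Y := Y) (Z := Z)).bilinear isJointSymbol_snd (innerSL ℝ)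
  have h2 : IsJointSymbol 2 (fun _ : Y × Z => (1 : ℝ)) :=
    SymbolOn.const isOpen_univ 1 1 fun p _ => by
      rw [one_mul, norm_one]
      exact Real.one_le_rpow (by linarith [norm_nonneg p.2]) (by norm_num)
  have h3 : (1 : ℝ) + 1 = 2 := by norm_num
  rw [h3] at h1
  refine SymbolOn.congr (SymbolOn.add h2 h1 isOpen_univ) isOpen_univ fun p _ => ?_
  exact congrArg (1 + ·) (real_inner_self_eq_norm_sq p.2).symm

theorem half_sq_one_add_le (x : ℝ) : 1 / 2 * (1 + x) ^ (2 : ℝ) ≤ 1 + x ^ 2 := by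
  rw [Real.rpow_two]
  nlinarith [sq_nonneg (x - 1)]

theorem isJointSymbol_one_add_norm_sq_rpow (s : ℝ) :
    IsJointSymbol (2 * s) (fun p : Y × Z => (1 + ‖p.2‖ ^ 2) ^ s) :=
  isJointSymbol_one_add_norm_sq.rpow (c := 1 / 2) (by norm_num)
    (fun p => half_sq_one_add_le ‖p.2‖) s

theorem exists_le_one_add_sq_rpow (s : ℝ) :
    ∃ c > (0 : ℝ), ∀ x : ℝ, 0 ≤ x → c * (1 + x) ^ (2 * s) ≤ (1 + x ^ 2) ^ s := by
  refine ⟨min 1 ((1 / 2) ^ s), lt_min one_pos (by positivity), fun x hx => ?_⟩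
  rw [Real.rpow_mul (by positivity)]
  rcases le_total 0 s with hs | hs
  · calc _ ≤ (1 / 2 : ℝ) ^ s * ((1 + x) ^ (2 : ℝ)) ^ s := by gcongr; exact min_le_right _ _
      _ = (1 / 2 * (1 + x) ^ (2 : ℝ)) ^ s := (Real.mul_rpow (by norm_num) (by positivity)).symm
      _ ≤ _ := Real.rpow_le_rpow (by positivity) (half_sq_one_add_le x) hs
  · calc _ ≤ 1 * ((1 + x) ^ (2 : ℝ)) ^ s := by gcongr; exact min_le_left _ _
      _ ≤ _ := by
        rw [one_mul]
        refine Real.rpow_le_rpow_of_nonpos (by positivity) ?_ hs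
        rw [Real.rpow_two]
        nlinarith

/-- Let A₀ be A frozen at y and J = (1 + ‖ζ‖²)^(m - 1/2), a positive symbol of order 2m - 1. Then D
= |A₀|² + J is bounded below by a multiple of (1 + ‖ζ‖)^(2m) for all ζ, so E = conj(A₀)/D is a
global symbol and no cutoff near the zeros of A₀ is needed. The error A₀ E - 1 = -J/D has order -1.
-/
theorem IsJointSymbol.exists_parametrix {A : Y × Z → ℂ} (hA : IsJointSymbol m A) (y : Y)
    {c C : ℝ} (hc : 0 < c) (hell : ∀ ζ : Z, C ≤ ‖ζ‖ → c * (1 + ‖ζ‖) ^ m ≤ ‖A (y, ζ)‖) :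
    ∃ E B : Y × Z → ℂ, IsJointSymbol (-m) E ∧ IsJointSymbol (-1) B ∧
      ∀ ζ, A (y, ζ) * E (y, ζ) - 1 = B (y, ζ) := by
  have hA₀ := hA.freeze y
  set A₀ : Y × Z → ℂ := fun p => A (y, p.2) with hA₀def
  set J : Y × Z → ℝ := fun p => (1 + ‖p.2‖ ^ 2) ^ (m - 1 / 2) with hJdef
  have hJ : IsJointSymbol (2 * m - 1) J := by
    have := isJointSymbol_one_add_norm_sq_rpow (Y := Y) (Z := Z) (m - 1 / 2)
    rwa [mul_sub, mul_one_div, div_self two_ne_zero] at this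
  set D : Y × Z → ℝ := fun p => ‖A₀ p‖ ^ 2 + J p with hDdef
  have hD : IsJointSymbol (2 * m) D := by
    have h1 := hA₀.bilinear hA₀ (innerSL ℝ)
    rw [← two_mul] at h1
    refine SymbolOn.congr (SymbolOn.add h1 (hJ.mono (by linarith)) isOpen_univ) isOpen_univ
      fun p _ => ?_
    exact congrArg (· + J p) (real_inner_self_eq_norm_sq (A₀ p)).symm
  obtain ⟨c', hc', hlow⟩ := exists_le_one_add_sq_rpow (m - 1 / 2)
  have hJpos : ∀ p, 0 < J p := fun p => by positivity
  have hDpos : ∀ p, 0 < D p := fun p => add_pos_of_nonneg_of_pos (by positivity) (hJpos p)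
  -- For ‖ζ‖ ≥ C the bound comes from |A₀|². For ‖ζ‖ ≤ C it comes from J, since there the missing
  -- factor 1 + ‖ζ‖ is at most 1 + |C|.
  have hDlow : ∀ p : Y × Z, min (c ^ 2) (c' / (1 + |C|)) * (1 + ‖p.2‖) ^ (2 * m) ≤ D p := by
    intro p
    have hp : (0 : ℝ) < 1 + ‖p.2‖ := by positivity
    rcases le_total C ‖p.2‖ with h | h
    · calc _ ≤ c ^ 2 * (1 + ‖p.2‖) ^ (2 * m) := by gcongr; exact min_le_left _ _
        _ = (c * (1 + ‖p.2‖) ^ m) ^ 2 := by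
          rw [mul_pow, ← Real.rpow_two ((1 + ‖p.2‖) ^ m), ← Real.rpow_mul hp.le, mul_comm m]
        _ ≤ ‖A₀ p‖ ^ 2 := by gcongr; exact hell p.2 h
        _ ≤ _ := le_add_of_nonneg_right (hJpos p).le
    · have h1 : 1 + ‖p.2‖ ≤ 1 + |C| := by linarith [le_abs_self C]
      calc _ ≤ c' / (1 + |C|) * (1 + ‖p.2‖) ^ (2 * m) := by gcongr; exact min_le_right _ _
        _ = c' * (1 + ‖p.2‖) ^ (2 * (m - 1 / 2)) * ((1 + ‖p.2‖) / (1 + |C|)) := by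
          have : 2 * m = 2 * (m - 1 / 2) + 1 := by ring
          rw [this, Real.rpow_add hp, Real.rpow_one]
          ring
        _ ≤ c' * (1 + ‖p.2‖) ^ (2 * (m - 1 / 2)) :=
          mul_le_of_le_one_right (by positivity) ((div_le_one (by positivity)).2 h1)
        _ ≤ J p := hlow _ (norm_nonneg _)
        _ ≤ _ := le_add_of_nonneg_left (by positivity)
  have hDi := hD.rpow (lt_min (by positivity) (by positivity)) hDlow (-1)
  refine ⟨fun p => (D p ^ (-1 : ℝ)) • (starRingEnd ℂ) (A₀ p),
    fun p => ((-(J p * D p ^ (-1 : ℝ)) : ℝ) : ℂ), ?_, ?_, fun ζ => ?_⟩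
  · have h1 : IsJointSymbol m (fun p => (starRingEnd ℂ) (A₀ p)) :=
      hA₀.clm isOpen_univ (Complex.conjCLE : ℂ →L[ℝ] ℂ)
    have h2 := hDi.bilinear h1 (ContinuousLinearMap.lsmul ℝ ℝ)
    have h3 : 2 * m * -1 + m = -m := by ring
    rw [h3] at h2
    exact h2
  · have h2 := hJ.bilinear hDi (ContinuousLinearMap.mul ℝ ℝ)
    have h3 : 2 * m - 1 + 2 * m * -1 = -1 := by ring
    rw [h3] at h2
    refine (h2.clm isOpen_univ (-Complex.ofRealCLM)).congr isOpen_univ fun p _ => ?_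
    exact Complex.ofReal_neg _
  · have h1 : D (y, ζ) ≠ 0 := (hDpos _).ne'
    have h2 : ((D (y, ζ) : ℝ) : ℂ) ≠ 0 := by exact_mod_cast h1
    have h3 : A (y, ζ) * (starRingEnd ℂ) (A (y, ζ)) = ((‖A (y, ζ)‖ ^ 2 : ℝ) : ℂ) := by
      rw [Complex.mul_conj, Complex.normSq_eq_norm_sq]
    have h4 : ((‖A (y, ζ)‖ ^ 2 : ℝ) : ℂ) = (D (y, ζ) : ℂ) - (J (y, ζ) : ℂ) := by
      simp only [hDdef, hA₀def]
      push_cast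
      ring
    change A (y, ζ) * ((D (y, ζ) ^ (-1 : ℝ)) • (starRingEnd ℂ) (A (y, ζ))) - 1 = _
    rw [Complex.real_smul, mul_left_comm, h3, h4]
    simp only [Real.rpow_neg_one]
    push_cast
    field_simp
    ring

end Parametrix

/-! ### Ellipticity survives the passage to the reduced symbol -/

section Elliptic

variable {d : ℕ} {m : ℝ}

/-- The Fourier transform of χ has total mass (2π)ⁿ χ(0) = (2π)ⁿ, so the averaged symbol differs
from a by a term of order m - 1. This term is at most half of the elliptic lower bound once ‖ζ‖ ≥
2K'/c. -/
theorem exists_le_norm_avgSymbol {a : Amb d × Amb d → ℂ} (ha : IsSymbol m a) {χ : Amb d → ℝ}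
    (hχ : ContDiff ℝ ∞ χ) (hs : HasCompactSupport χ) (h0 : χ 0 = 1) (w : Amb d)
    {c C : ℝ} (hc : 0 < c) (hell : ∀ ζ, C ≤ ‖ζ‖ → c * (1 + ‖ζ‖) ^ m ≤ ‖a (w, ζ)‖) :
    ∃ C', ∀ ζ, C' ≤ ‖ζ‖ → c / 2 * (1 + ‖ζ‖) ^ m ≤ ‖avgSymbol a χ (w, ζ)‖ := by
  obtain ⟨hχ', hs'⟩ := ofReal_comp_smooth hχ hs
  obtain ⟨K, hK⟩ := ha.isJointSymbol.symbolConv_sub (hasMoments_oscInt hχ' hs')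
  rw [integral_oscInt hχ' hs', h0, finrank_euclideanSpace_fin] at hK
  set q : ℂ := ((2 * Real.pi : ℝ) : ℂ) with hq
  have hq0 : q ≠ 0 := by
    have : (2 * Real.pi : ℝ) ≠ 0 := by positivity
    exact Complex.ofReal_ne_zero.2 this
  set K' := ‖q⁻¹ ^ (d + 1)‖ * |K| with hK'
  refine ⟨max C (2 * K' / c), fun ζ hζ => ?_⟩
  have h1 := hell ζ ((le_max_left _ _).trans hζ)
  have h2 : 2 * K' / c ≤ ‖ζ‖ := (le_max_right _ _).trans hζ
  have h3 : ‖avgSymbol a χ (w, ζ) - a (w, ζ)‖ ≤ K' * (1 + ‖ζ‖) ^ (m - 1) := by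
    have h4 : avgSymbol a χ (w, ζ) - a (w, ζ) = q⁻¹ ^ (d + 1) *
        (symbolConv volume (oscInt fun u => (χ u : ℂ)) a (w, ζ) -
          q ^ (d + 1) * ((1 : ℝ) : ℂ) * a (w, ζ)) := by
      rw [avgSymbol, mul_sub, ← mul_assoc, ← mul_assoc, ← mul_pow, inv_mul_cancel₀ hq0, one_pow,
        Complex.ofReal_one, mul_one, one_mul]
    rw [h4, norm_mul, hK', mul_assoc ‖_‖]
    refine mul_le_mul_of_nonneg_left ((hK (w, ζ)).trans ?_) (norm_nonneg _)
    gcongr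
    exact le_abs_self _
  have hp : (0 : ℝ) < 1 + ‖ζ‖ := by positivity
  have h5 : K' * (1 + ‖ζ‖) ^ (m - 1) ≤ c / 2 * (1 + ‖ζ‖) ^ m := by
    rw [div_le_iff₀ hc] at h2
    rw [Real.rpow_sub_one hp.ne', ← mul_div_assoc, div_le_iff₀ hp, mul_right_comm (c / 2)]
    refine mul_le_mul_of_nonneg_right ?_ (by positivity : (0 : ℝ) ≤ (1 + ‖ζ‖) ^ m)
    linarith
  have h6 := norm_sub_le (avgSymbol a χ (w, ζ)) (avgSymbol a χ (w, ζ) - a (w, ζ))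
  rw [sub_sub_cancel] at h6
  linarith

theorem IsJointSymbol.isBscSymbol_reducedSymbol {A : Amb d × Amb d → ℂ} (hA : IsJointSymbol m A)
    (y : Tan d) {η : Tan d} (hη : ‖η‖ = 1) : IsBscSymbol m m (reducedSymbol A y η) := by
  have hO : IsOpen (Metric.ball (y, η) (1 / 2)) := Metric.isOpen_ball
  refine ((hA.symbolOn_reducedSymbol hO (R := ‖(y, η)‖ + 1 / 2) (c := 1 / 2)
    (fun θ hθ => ?_) (by norm_num) fun θ hθ => ?_).isBscSymbolFamily (b := fun θ =>
      reducedSymbol A θ.1 θ.2) hO).isBscSymbol (Metric.mem_ball_self (by norm_num))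
  · rw [mem_ball_iff_norm] at hθ
    linarith [norm_le_norm_add_norm_sub' θ (y, η)]
  · rw [mem_ball_iff_norm] at hθ
    have h1 := norm_snd_le (θ - (y, η))
    have h2 := norm_le_norm_add_norm_sub' η θ.2
    rw [norm_sub_rev] at h2
    rw [Prod.snd_sub] at h1
    linarith

end Elliptic

/-! ### Auxiliary derivative bounds -/

section Generic

variable {E F : Type} [NormedAddCommGroup E] [NormedSpace ℝ E] [NormedAddCommGroup F]
  [NormedSpace ℝ F] {U : Set E} {w : E → ℝ}

theorem SymbolOn.exists_norm_iteratedFDeriv_le {f : E → F}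
    (hf : SymbolOn U (fun _ => ContinuousLinearMap.id ℝ E) w f) (hw : ∀ x ∈ U, 0 ≤ w x) (n : ℕ) :
    ∃ C : ℝ, 1 ≤ C ∧ ∀ i ≤ n, ∀ x ∈ U, ‖iteratedFDeriv ℝ i f x‖ ≤ C * w x := by
  choose C hC using hf.bound
  refine ⟨1 + ∑ i ∈ Finset.range (n + 1), |C i|, ?_, fun i hi x hx => ?_⟩
  · linarith [Finset.sum_nonneg fun i (_ : i ∈ Finset.range (n + 1)) => abs_nonneg (C i)]
  · have h1 := hC i x hx
    rw [compContinuousLinearMap_const_id] at h1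
    refine h1.trans (mul_le_mul_of_nonneg_right ((le_abs_self _).trans ?_) (hw x hx))
    have := Finset.single_le_sum (f := fun j => |C j|)
      (fun i _ => abs_nonneg _) (Finset.mem_range.2 (Nat.lt_succ_of_le hi))
    linarith

theorem SymbolOn.of_norm_iteratedFDeriv_le {f : E → F} (hf : ContDiffOn ℝ ∞ f U)
    (h : ∀ n : ℕ, ∃ C : ℝ, ∀ x ∈ U, ‖iteratedFDeriv ℝ n f x‖ ≤ C * w x) :
    SymbolOn U (fun _ => ContinuousLinearMap.id ℝ E) w f :=
  ⟨hf, fun n => (h n).imp fun C hC x hx => by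
    rw [compContinuousLinearMap_const_id]
    exact hC x hx⟩

theorem iteratedFDeriv_slice_left_of_contDiffAt {E' : Type} [NormedAddCommGroup E']
    [NormedSpace ℝ E'] {f : E × E' → F} {x : E} {v : E'} {n : ℕ} (hf : ContDiffAt ℝ n f (x, v)) :
    iteratedFDeriv ℝ n (fun x' => f (x', v)) x = (iteratedFDeriv ℝ n f (x, v)).compContinuousLinearMap
      fun _ => ContinuousLinearMap.inl ℝ E E' := by
  rw [← iteratedFDeriv_comp_affine hf]
  have h := iteratedFDeriv_comp_add_left (𝕜 := ℝ) (f := fun x' => f (x', v)) n x (x := 0)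
  rw [add_zero] at h
  rw [← h]
  congr 1
  ext z
  simp

theorem norm_compContinuousLinearMap_le_of_le_one {E' : Type} [NormedAddCommGroup E']
    [NormedSpace ℝ E'] {n : ℕ} (T : E [×n]→L[ℝ] F) {L : E' →L[ℝ] E} (hL : ‖L‖ ≤ 1) :
    ‖T.compContinuousLinearMap fun _ => L‖ ≤ ‖T‖ := by
  refine (ContinuousMultilinearMap.norm_compContinuousLinearMap_le _ _).trans ?_
  rw [Finset.prod_const]
  exact mul_le_of_le_one_right (norm_nonneg _) (pow_le_one₀ (norm_nonneg _) hL)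

theorem iteratedDeriv_exp_neg_I_mul (n : ℕ) :
    iteratedDeriv n (fun t : ℝ => Complex.exp (-Complex.I * (t : ℂ))) =
      fun t : ℝ => (-Complex.I) ^ n * Complex.exp (-Complex.I * (t : ℂ)) := by
  induction n with
  | zero => simp
  | succ n ih =>
    rw [iteratedDeriv_succ, ih]
    ext t
    have h1 : HasDerivAt (fun t : ℝ => -Complex.I * (t : ℂ)) (-Complex.I) t := by
      simpa using (Complex.ofRealCLM.hasDerivAt (x := t)).const_mul (-Complex.I)
    rw [((h1.cexp).const_mul _).deriv]
    ring

end Generic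

/-! ### Oscillatory integrals with flat amplitudes -/

section FlatAmplitude

variable {d : ℕ} {F G : Type} [NormedAddCommGroup F] [NormedSpace ℝ F] [NormedAddCommGroup G]
  [NormedSpace ℝ G]

/-- The parameters `((y, η), τ, ρ)`. -/
abbrev FlatParam (d : ℕ) : Type := (Tan d × Tan d) × ℝ × ℝ

/-- The domain of the parameters. -/
def flatDomain (O : Set (Tan d × Tan d)) : Set (FlatParam d) := O ×ˢ (Ioo (-1) 1 ×ˢ Ioi 0)

theorem isOpen_flatDomain {O : Set (Tan d × Tan d)} (hO : IsOpen O) : IsOpen (flatDomain O) :=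
  hO.prod (isOpen_Ioo.prod isOpen_Ioi)

/-- Amplitudes `K((y, η), τ, ρ, V)` which vanish to infinite order at `τ = ±1` and as `V → ∞`. -/
def IsFlatAmplitude (O : Set (Tan d × Tan d)) (K : FlatParam d × Tan d → F) : Prop :=
  ∀ N : ℕ, SymbolOn (flatDomain O ×ˢ univ) (fun _ => ContinuousLinearMap.id ℝ _)
    (fun p => ((1 - p.1.2.1 ^ 2) / (1 + ‖p.2‖)) ^ N) K

variable {O : Set (Tan d × Tan d)} {K : FlatParam d × Tan d → F}

theorem one_sub_sq_pos {x : FlatParam d} (hx : x ∈ flatDomain O) : 0 < 1 - x.2.1 ^ 2 := by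
  have h := hx.2.1
  nlinarith [h.1, h.2]

theorem one_sub_sq_le_one (x : FlatParam d) : 1 - x.2.1 ^ 2 ≤ 1 := by nlinarith [sq_nonneg x.2.1]

theorem rho_pos {x : FlatParam d} (hx : x ∈ flatDomain O) : 0 < x.2.2 := hx.2.2

theorem IsFlatAmplitude.add {K' : FlatParam d × Tan d → F} (hO : IsOpen O)
    (hK : IsFlatAmplitude O K) (hK' : IsFlatAmplitude O K') :
    IsFlatAmplitude O (fun p => K p + K' p) := fun N =>
  (hK N).add (hK' N) ((isOpen_flatDomain hO).prod isOpen_univ)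

theorem IsFlatAmplitude.contDiffOn (hK : IsFlatAmplitude O K) :
    ContDiffOn ℝ ∞ K (flatDomain O ×ˢ univ) := (hK 0).contDiffOn

/-- The phase function `ρ V·η`. -/
noncomputable def flatPhase (p : FlatParam d × Tan d) : ℝ := p.1.2.2 * inner ℝ p.2 p.1.1.2

theorem contDiff_flatPhase : ContDiff ℝ ∞ (flatPhase (d := d)) := by
  unfold flatPhase
  exact ContDiff.mul (by fun_prop) (ContDiff.inner ℝ (by fun_prop) (by fun_prop))

/-- The oscillating factor `exp(-i ρ V·η)`. -/
noncomputable def flatExp (p : FlatParam d × Tan d) : ℂ := Complex.exp (-Complex.I * (flatPhase p : ℂ))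

theorem contDiff_exp_neg_I_mul : ContDiff ℝ ∞ fun t : ℝ => Complex.exp (-Complex.I * (t : ℂ)) :=
  (contDiff_const.mul Complex.ofRealCLM.contDiff).cexp

theorem contDiff_flatExp : ContDiff ℝ ∞ (flatExp (d := d)) :=
  contDiff_exp_neg_I_mul.comp contDiff_flatPhase

theorem norm_flatExp (p : FlatParam d × Tan d) : ‖flatExp p‖ = 1 := norm_exp_neg_I_mul _

theorem symbolOn_eta (hO : IsOpen O) {R : ℝ} (hR : ∀ θ ∈ O, ‖θ‖ ≤ R) :
    SymbolOn (flatDomain O ×ˢ univ) (fun _ => ContinuousLinearMap.id ℝ _) (fun _ => (1 : ℝ))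
      (fun p : FlatParam d × Tan d => p.1.1.2) := by
  let L : FlatParam d × Tan d →L[ℝ] Tan d := (ContinuousLinearMap.snd ℝ _ _).comp
    ((ContinuousLinearMap.fst ℝ _ _).comp (ContinuousLinearMap.fst ℝ _ _))
  refine SymbolOn.linear ((isOpen_flatDomain hO).prod isOpen_univ) L (max R ‖L‖)
    (fun p hp => ?_) fun p _ => ?_
  · rw [mul_one]
    exact ((norm_snd_le _).trans (hR _ hp.1.1)).trans (le_max_left _ _)
  · rw [mul_one]
    exact le_max_right _ _

theorem symbolOn_V (hO : IsOpen O) :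
    SymbolOn (flatDomain O ×ˢ univ) (fun _ => ContinuousLinearMap.id ℝ _)
      (fun p => 1 + ‖p.2‖) (fun p : FlatParam d × Tan d => p.2) := by
  refine SymbolOn.linear ((isOpen_flatDomain hO).prod isOpen_univ)
    (ContinuousLinearMap.snd ℝ (FlatParam d) (Tan d)) 1 (fun p _ => ?_) fun p _ => ?_
  · simp
  · refine (ContinuousLinearMap.norm_snd_le ..).trans ?_
    linarith [norm_nonneg p.2]

theorem symbolOn_rho (hO : IsOpen O) :
    SymbolOn (flatDomain O ×ˢ univ) (fun _ => ContinuousLinearMap.id ℝ _)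
      (fun p => 1 + p.1.2.2) (fun p : FlatParam d × Tan d => p.1.2.2) := by
  let L : FlatParam d × Tan d →L[ℝ] ℝ := (ContinuousLinearMap.snd ℝ _ _).comp
    ((ContinuousLinearMap.snd ℝ _ _).comp (ContinuousLinearMap.fst ℝ _ _))
  refine SymbolOn.linear ((isOpen_flatDomain hO).prod isOpen_univ) L (max 1 ‖L‖)
    (fun p hp => ?_) fun p hp => ?_
  · have h := rho_pos hp.1
    change ‖p.1.2.2‖ ≤ _
    rw [Real.norm_of_nonneg h.le]
    nlinarith [le_max_left 1 ‖L‖]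
  · have h := rho_pos hp.1
    change ‖L‖ ≤ _
    nlinarith [le_max_left 1 ‖L‖, le_max_right 1 ‖L‖]

/-- All derivatives of the phase ρ V·η are O((1 + ρ)(1 + ‖V‖)) for bounded η, and the exponential of
an imaginary argument has bounded derivatives. Thus each derivative costs at most one such factor.
-/
theorem exists_norm_iteratedFDeriv_flatExp_le (hO : IsOpen O) {R : ℝ} (hR : ∀ θ ∈ O, ‖θ‖ ≤ R)
    (n : ℕ) : ∃ C : ℝ, 0 ≤ C ∧ ∀ i ≤ n, ∀ p ∈ (flatDomain O ×ˢ univ : Set (FlatParam d × Tan d)),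
      ‖iteratedFDeriv ℝ i flatExp p‖ ≤ C * ((1 + p.1.2.2) * (1 + ‖p.2‖)) ^ n := by
  have hU : IsOpen (flatDomain O ×ˢ univ : Set (FlatParam d × Tan d)) :=
    (isOpen_flatDomain hO).prod isOpen_univ
  have h1 : SymbolOn (flatDomain O ×ˢ univ) (fun _ => ContinuousLinearMap.id ℝ _)
      (fun p => (1 + p.1.2.2) * ((1 + ‖p.2‖) * 1)) (flatPhase (d := d)) :=
    (symbolOn_rho hO).bilinear ((symbolOn_V hO).bilinear (symbolOn_eta hO hR) hU (innerSL ℝ)) hU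
      (ContinuousLinearMap.mul ℝ ℝ)
  obtain ⟨C, hC1, hC⟩ := h1.exists_norm_iteratedFDeriv_le (fun p hp => by
    have := rho_pos hp.1
    positivity) n
  refine ⟨n.factorial * C ^ n, by positivity, fun i hi p hp => ?_⟩
  have hρ := rho_pos hp.1
  have hX : 1 ≤ (1 + p.1.2.2) * (1 + ‖p.2‖) :=
    one_le_mul_of_one_le_of_one_le (by linarith) (by linarith [norm_nonneg p.2])
  have hCX : 1 ≤ C * ((1 + p.1.2.2) * (1 + ‖p.2‖)) := one_le_mul_of_one_le_of_one_le hC1 hX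
  have key := norm_iteratedFDeriv_comp_le (𝕜 := ℝ) (N := ∞) (n := i) (C := 1)
    (D := C * ((1 + p.1.2.2) * (1 + ‖p.2‖))) contDiff_exp_neg_I_mul contDiff_flatPhase
    (mod_cast le_top) p (fun j hj => ?_) (fun j hj1 hj => ?_)
  · refine le_trans key ?_
    rw [mul_one, mul_assoc, ← mul_pow]
    refine mul_le_mul ?_ (pow_le_pow_right₀ hCX hi) (by positivity) (by positivity)
    exact_mod_cast Nat.factorial_le hi
  · rw [norm_iteratedFDeriv_eq_norm_iteratedDeriv, iteratedDeriv_exp_neg_I_mul, norm_mul, norm_pow,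
      norm_neg, Complex.norm_I, one_pow, one_mul, norm_exp_neg_I_mul]
  · refine (hC j (hj.trans hi) p hp).trans ?_
    rw [mul_one]
    exact le_self_pow₀ hCX (by omega)

variable {A : FlatParam d × Tan d → ℂ}

/-- The amplitude decays faster than any power of 1 + ‖V‖, and n spare powers absorb the growth in V
caused by differentiating the exponential. Only the growth (1 + ρ)^n remains. -/
theorem IsFlatAmplitude.exists_norm_iteratedFDeriv_mul_flatExp_le (hA : IsFlatAmplitude O A)
    (hO : IsOpen O) {R : ℝ} (hR : ∀ θ ∈ O, ‖θ‖ ≤ R) (n N : ℕ) :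
    ∃ C : ℝ, 0 ≤ C ∧ ∀ p ∈ (flatDomain O ×ˢ univ : Set (FlatParam d × Tan d)),
      ‖iteratedFDeriv ℝ n (fun p => A p * flatExp p) p‖ ≤
        C * ((1 + p.1.2.2) ^ n * ((1 - p.1.2.1 ^ 2) / (1 + ‖p.2‖)) ^ N) := by
  have hU : IsOpen (flatDomain O ×ˢ univ : Set (FlatParam d × Tan d)) :=
    (isOpen_flatDomain hO).prod isOpen_univ
  have hw : ∀ p ∈ (flatDomain O ×ˢ univ : Set (FlatParam d × Tan d)),
      0 < (1 - p.1.2.1 ^ 2) / (1 + ‖p.2‖) := fun p hp =>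
    div_pos (one_sub_sq_pos hp.1) (by positivity)
  obtain ⟨C₁, hC₁, h₁⟩ := (hA (N + n)).exists_norm_iteratedFDeriv_le
    (fun p hp => (pow_pos (hw p hp) _).le) n
  obtain ⟨C₂, hC₂, h₂⟩ := exists_norm_iteratedFDeriv_flatExp_le (d := d) hO hR n
  refine ⟨‖ContinuousLinearMap.mul ℝ ℂ‖ * ∑ i ∈ Finset.range (n + 1), (n.choose i : ℝ) * (C₁ * C₂),
    by positivity, fun p hp => ?_⟩
  have hρ := rho_pos hp.1
  have hwp := hw p hp
  set a := (1 - p.1.2.1 ^ 2) / (1 + ‖p.2‖) with ha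
  refine (norm_iteratedFDeriv_bilinear_le (ContinuousLinearMap.mul ℝ ℂ)
    (hA.contDiffOn.contDiffAt_of_isOpen hU hp n)
    (contDiff_flatExp.contDiffAt.of_le (mod_cast le_top))).trans ?_
  rw [mul_assoc, Finset.sum_mul]
  refine mul_le_mul_of_nonneg_left (Finset.sum_le_sum fun i hi => ?_) (norm_nonneg _)
  have hin : i ≤ n := Nat.lt_succ_iff.1 (Finset.mem_range.1 hi)
  rw [mul_assoc, mul_assoc]
  refine mul_le_mul_of_nonneg_left ?_ (by positivity)
  have ha1 : a ^ n * ((1 + ‖p.2‖)) ^ n ≤ 1 := by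
    rw [← mul_pow, ha, div_mul_cancel₀ _ (by positivity)]
    exact pow_le_one₀ (one_sub_sq_pos hp.1).le (one_sub_sq_le_one _)
  calc _ ≤ (C₁ * a ^ (N + n)) * (C₂ * ((1 + p.1.2.2) * (1 + ‖p.2‖)) ^ n) := by
        refine mul_le_mul (h₁ i hin p hp) (h₂ _ (Nat.sub_le _ _) p hp) (norm_nonneg _)
          (by positivity)
    _ = C₁ * C₂ * ((1 + p.1.2.2) ^ n * a ^ N) * (a ^ n * (1 + ‖p.2‖) ^ n) := by
        rw [pow_add, mul_pow]; ring
    _ ≤ C₁ * C₂ * ((1 + p.1.2.2) ^ n * a ^ N) := mul_le_of_le_one_right (by positivity) ha1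

/-- The oscillatory integral `∫ A exp(-i ρ V·η) dV`. -/
noncomputable def flatIntegral (A : FlatParam d × Tan d → ℂ) (x : FlatParam d) : ℂ :=
  ∫ V, A (x, V) * flatExp (x, V)

theorem exists_nat_integrable_one_add_norm_inv (d : ℕ) :
    ∃ M : ℕ, Integrable fun V : Tan d => ((1 + ‖V‖)⁻¹) ^ M := by
  obtain ⟨M, hM⟩ := exists_nat_gt (Module.finrank ℝ (Tan d) : ℝ)
  refine ⟨M, (integrable_one_add_norm_rpow (E := Tan d) (s := -(M : ℝ)) (by linarith)).congr
    (Eventually.of_forall fun V => ?_)⟩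
  change (1 + ‖V‖) ^ (-(M : ℝ)) = ((1 + ‖V‖)⁻¹) ^ M
  rw [Real.rpow_neg (by positivity), Real.rpow_natCast, inv_pow]

theorem IsFlatAmplitude.contDiffOn_flatIntegral (hA : IsFlatAmplitude O A)
    (hO : IsOpen O) {R : ℝ} (hR : ∀ θ ∈ O, ‖θ‖ ≤ R) :
    ContDiffOn ℝ ∞ (flatIntegral A) (flatDomain O) ∧ ∀ n N : ℕ, ∃ C : ℝ, ∀ x ∈ flatDomain O,
      ‖iteratedFDeriv ℝ n (flatIntegral A) x‖ ≤ C * ((1 + x.2.2) ^ n * (1 - x.2.1 ^ 2) ^ N) := by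
  have hUo := isOpen_flatDomain hO
  have hU : IsOpen (flatDomain O ×ˢ univ : Set (FlatParam d × Tan d)) := hUo.prod isOpen_univ
  obtain ⟨M, hM⟩ := exists_nat_integrable_one_add_norm_inv d
  have hsm : ContDiffOn ℝ ∞ (fun p => A p * flatExp p) (flatDomain O ×ˢ univ) :=
    hA.contDiffOn.mul contDiff_flatExp.contDiffOn
  have hat : ∀ x ∈ flatDomain O, ∀ V (n : ℕ), ContDiffAt ℝ n (fun p => A p * flatExp p) (x, V) :=
    fun x hx V n => hsm.contDiffAt_of_isOpen hU ⟨hx, mem_univ _⟩ n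
  have hle : ∀ n N : ℕ, ∃ C : ℝ, 0 ≤ C ∧ ∀ x ∈ flatDomain O, ∀ V,
      ‖iteratedFDeriv ℝ n (fun x => A (x, V) * flatExp (x, V)) x‖ ≤
        C * ((1 + x.2.2) ^ n * (1 - x.2.1 ^ 2) ^ N) * ((1 + ‖V‖)⁻¹) ^ M := by
    intro n N
    -- N powers are kept for the vanishing at τ = ±1, and M powers for integrability in V.
    obtain ⟨C, hC0, hC⟩ := hA.exists_norm_iteratedFDeriv_mul_flatExp_le hO hR n (N + M)
    refine ⟨C, hC0, fun x hx V => ?_⟩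
    have hρ := rho_pos hx
    have hτ := one_sub_sq_pos hx
    rw [iteratedFDeriv_slice_left_of_contDiffAt (f := fun p => A p * flatExp p) (hat x hx V n)]
    have h1 := norm_compContinuousLinearMap_le_of_le_one
      (iteratedFDeriv ℝ n (fun p => A p * flatExp p) (x, V))
      (ContinuousLinearMap.norm_inl_le_one ℝ (FlatParam d) (Tan d))
    refine h1.trans ((hC (x, V) ⟨hx, mem_univ _⟩).trans ?_)
    rw [mul_assoc, mul_assoc]
    refine mul_le_mul_of_nonneg_left (mul_le_mul_of_nonneg_left ?_ (by positivity)) hC0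
    change ((1 - x.2.1 ^ 2) / (1 + ‖V‖)) ^ (N + M) ≤ _
    rw [div_eq_mul_inv, mul_pow, pow_add, pow_add, mul_assoc]
    refine mul_le_mul_of_nonneg_left ?_ (by positivity)
    refine (mul_le_of_le_one_left (by positivity) (pow_le_one₀ hτ.le (one_sub_sq_le_one _))).trans
      (mul_le_of_le_one_left (by positivity) (pow_le_one₀ (by positivity)
        (inv_le_one_of_one_le₀ (by linarith [norm_nonneg V]))))
  obtain ⟨h1, h2⟩ := iteratedFDeriv_integral (μ := (volume : Measure (Tan d))) hUo
    (Φ := fun x V => A (x, V) * flatExp (x, V))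
    (fun V => hsm.comp (by fun_prop) fun x hx => ⟨hx, mem_univ _⟩)
    (fun n x hx => by
      refine Continuous.aestronglyMeasurable ?_
      have : (fun V => iteratedFDeriv ℝ n (fun x => A (x, V) * flatExp (x, V)) x) = fun V =>
          ContinuousMultilinearMap.compContinuousLinearMapL (F := ℂ)
            (fun _ : Fin n => ContinuousLinearMap.inl ℝ (FlatParam d) (Tan d))
            (iteratedFDeriv ℝ n (fun p => A p * flatExp p) (x, V)) := by
        ext1 V
        exact iteratedFDeriv_slice_left_of_contDiffAt (f := fun p => A p * flatExp p) (hat x hx V n)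
      rw [this]
      refine (ContinuousLinearMap.continuous _).comp ?_
      refine continuous_iff_continuousAt.2 fun V => ContinuousAt.comp (f := fun V => (x, V))
        (g := iteratedFDeriv ℝ n (fun p => A p * flatExp p)) ?_ (by fun_prop)
      exact ((hsm.contDiffAt (hU.mem_nhds ⟨hx, mem_univ _⟩)).iteratedFDeriv_right (m := 0) (i := n)
        (mod_cast le_top)).continuousAt)
    (fun n x₀ hx₀ => by
      obtain ⟨C, hC0, hC⟩ := hle n 0
      refine ⟨fun V => C * (2 + x₀.2.2) ^ n * ((1 + ‖V‖)⁻¹) ^ M, hM.const_mul _, ?_⟩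
      have hcont : ∀ᶠ x : FlatParam d in 𝓝 x₀, x.2.2 < x₀.2.2 + 1 :=
        (continuous_snd.comp continuous_snd).continuousAt.eventually_lt continuousAt_const
          (by change x₀.2.2 < _; linarith)
      filter_upwards [hcont, hUo.mem_nhds hx₀] with x hx hxU V
      have hρ := rho_pos hxU
      refine (hC x hxU V).trans ?_
      rw [pow_zero, mul_one]
      exact mul_le_mul_of_nonneg_right (mul_le_mul_of_nonneg_left
        (pow_le_pow_left₀ (by positivity) (by linarith) n) hC0) (by positivity))
  refine ⟨h1, fun n N => ?_⟩
  obtain ⟨C, hC0, hC⟩ := hle n N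
  refine ⟨C * ∫ V : Tan d, ((1 + ‖V‖)⁻¹) ^ M, fun x hx => ?_⟩
  have h3 := norm_integral_le_of_norm_le (μ := (volume : Measure (Tan d)))
    (hM.const_mul (C * ((1 + x.2.2) ^ n * (1 - x.2.1 ^ 2) ^ N)))
    (Eventually.of_forall fun V => hC x hx V)
  rw [← h2 n x hx, integral_const_mul] at h3
  refine h3.trans (le_of_eq ?_)
  ring

theorem IsFlatAmplitude.integrable (hA : IsFlatAmplitude O A) (hO : IsOpen O)
    {x : FlatParam d} (hx : x ∈ flatDomain O) :
    Integrable fun V => A (x, V) * flatExp (x, V) := by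
  obtain ⟨M, hM⟩ := exists_nat_integrable_one_add_norm_inv d
  obtain ⟨C, hC⟩ := (hA M).norm_le
  have hU : IsOpen (flatDomain O ×ˢ univ : Set (FlatParam d × Tan d)) :=
    (isOpen_flatDomain hO).prod isOpen_univ
  have hAc : Continuous fun V => A (x, V) :=
    continuous_iff_continuousAt.2 fun V => ContinuousAt.comp (f := fun V => (x, V)) (g := A)
      (hA.contDiffOn.contDiffAt (hU.mem_nhds ⟨hx, mem_univ _⟩)).continuousAt (by fun_prop)
  refine (hM.const_mul (|C|)).mono' (hAc.mul (contDiff_flatExp.continuous.comp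
    (by fun_prop))).aestronglyMeasurable (Eventually.of_forall fun V => ?_)
  rw [norm_mul, norm_flatExp, mul_one]
  have hτ := one_sub_sq_pos hx
  refine (hC _ ⟨hx, mem_univ _⟩).trans (mul_le_mul (le_abs_self _) ?_ (by positivity)
    (abs_nonneg _))
  refine pow_le_pow_left₀ (by positivity) ?_ _
  rw [div_eq_mul_inv]
  exact mul_le_of_le_one_left (by positivity) (one_sub_sq_le_one _)

end FlatAmplitude

/-! ### Decay in ρ by integration by parts -/

section IntegrationByParts

variable {d : ℕ} {O : Set (Tan d × Tan d)} {A : FlatParam d × Tan d → ℂ} {c R : ℝ}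

/-- The operator `A ↦ -i |η|⁻² (η·∂_V) A`, which acts on amplitudes like multiplication by `ρ`. -/
noncomputable def flatTranspose (A : FlatParam d × Tan d → ℂ) (p : FlatParam d × Tan d) : ℂ :=
  ((‖p.1.1.2‖ ^ 2) ^ (-1 : ℝ)) • (-Complex.I * fderiv ℝ A p (0, p.1.1.2))

/-- The lower bound on ‖η‖ keeps the factor |η|⁻² and its derivatives bounded. -/
theorem IsFlatAmplitude.flatTranspose (hA : IsFlatAmplitude O A) (hO : IsOpen O)
    (hR : ∀ θ ∈ O, ‖θ‖ ≤ R) (hc : 0 < c) (hη : ∀ θ ∈ O, c ≤ ‖θ.2‖) :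
    IsFlatAmplitude O (flatTranspose A) := by
  intro N
  have hU : IsOpen (flatDomain O ×ˢ univ : Set (FlatParam d × Tan d)) :=
    (isOpen_flatDomain hO).prod isOpen_univ
  have hη' := symbolOn_eta (d := d) hO hR
  have h1 : SymbolOn (flatDomain O ×ˢ univ) (fun _ => ContinuousLinearMap.id ℝ _)
      (fun _ => ((1 : ℝ) * 1) ^ (-1 : ℝ))
      (fun p : FlatParam d × Tan d => (‖p.1.1.2‖ ^ 2) ^ (-1 : ℝ)) := by
    refine ((hη'.bilinear hη' hU (innerSL ℝ)).congr hU fun p _ => ?_).rpow hU (c := c ^ 2)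
      (by positivity) (fun _ _ => by norm_num) (fun p hp => ?_) (-1)
    · exact (real_inner_self_eq_norm_sq p.1.1.2).symm
    · rw [mul_one, mul_one]
      exact pow_le_pow_left₀ hc.le (hη _ hp.1.1) 2
  have h2 := (((hA N).fderiv_id hU).clm hU ((ContinuousLinearMap.compL ℝ (Tan d)
    (FlatParam d × Tan d) ℂ).flip (ContinuousLinearMap.inr ℝ (FlatParam d) (Tan d)))).bilinear hη' hU
      (ContinuousLinearMap.id ℝ (Tan d →L[ℝ] ℂ))
  have h3 := h1.bilinear (h2.clm hU (ContinuousLinearMap.mul ℝ ℂ (-Complex.I))) hU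
    (ContinuousLinearMap.lsmul ℝ ℝ)
  refine (h3.congr hU fun p _ => rfl).congr_weight fun p _ => ?_
  simp

/-- Since η·∂_V exp(-i ρ V·η) = -i ρ |η|² exp(-i ρ V·η), a factor ρ is traded for a derivative along
η, which is moved to the amplitude. The boundary terms vanish because the amplitude is rapidly
decaying in V. -/
theorem rho_mul_flatIntegral (hA : IsFlatAmplitude O A) (hO : IsOpen O)
    (hR : ∀ θ ∈ O, ‖θ‖ ≤ R) (hc : 0 < c) (hη : ∀ θ ∈ O, c ≤ ‖θ.2‖) {x : FlatParam d}
    (hx : x ∈ flatDomain O) :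
    (x.2.2 : ℂ) * flatIntegral A x = flatIntegral (flatTranspose A) x := by
  have hU : IsOpen (flatDomain O ×ˢ univ : Set (FlatParam d × Tan d)) :=
    (isOpen_flatDomain hO).prod isOpen_univ
  set η := x.1.2 with hηdef
  have hη0 : ‖η‖ ≠ 0 := (hc.trans_le (hη _ hx.1)).ne'
  have hT := hA.flatTranspose hO hR hc hη
  set f : Tan d → ℂ := fun V => A (x, V) with hf
  set g : Tan d → ℂ := fun V => flatExp (x, V) with hg
  have hfd : ∀ V, HasFDerivAt f ((fderiv ℝ A (x, V)).comp
      (ContinuousLinearMap.inr ℝ (FlatParam d) (Tan d))) V := fun V =>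
    (((hA.contDiffOn.contDiffAt (hU.mem_nhds ⟨hx, mem_univ V⟩)).differentiableAt
      (by simp)).hasFDerivAt).comp V (hasFDerivAt_prodMk_right x V)
  have hfη : ∀ V, fderiv ℝ f V η = fderiv ℝ A (x, V) (0, η) := fun V => by
    rw [(hfd V).fderiv]; rfl
  have hgdiff : Differentiable ℝ g := (contDiff_flatExp.comp
    (by fun_prop : ContDiff ℝ ∞ fun V => (x, V))).differentiable (by simp)
  have hgη : ∀ V, fderiv ℝ g V η = -Complex.I * ((x.2.2 * ‖η‖ ^ 2 : ℝ) : ℂ) * g V := fun V => by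
    have h1 : HasDerivAt (fun s : ℝ => -Complex.I * ((flatPhase (x, V + s • η) : ℝ) : ℂ))
        (-Complex.I * ((x.2.2 * ‖η‖ ^ 2 : ℝ) : ℂ)) 0 := by
      have h2 : (fun s : ℝ => -Complex.I * ((flatPhase (x, V + s • η) : ℝ) : ℂ)) = fun s : ℝ =>
          -Complex.I * ((x.2.2 * inner ℝ V η : ℝ) : ℂ) +
            (-Complex.I * ((x.2.2 * ‖η‖ ^ 2 : ℝ) : ℂ)) * (s : ℂ) := by
        ext s
        simp only [flatPhase]
        rw [inner_add_left, real_inner_smul_left, real_inner_self_eq_norm_sq]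
        push_cast
        ring
      have h3 : ∀ a b : ℂ, HasDerivAt (fun s : ℝ => a + b * (s : ℂ)) b 0 := fun a b => by
        simpa using ((Complex.ofRealCLM.hasDerivAt (x := (0 : ℝ))).const_mul b).const_add a
      rw [h2]
      exact h3 _ _
    have h3 := h1.cexp
    have h4 : HasDerivAt (fun s : ℝ => g (V + s • η)) (fderiv ℝ g V η) 0 := by
      have h5 : HasDerivAt (fun s : ℝ => V + s • η) η 0 := by
        simpa using ((hasDerivAt_id (0 : ℝ)).smul_const η).const_add V
      have h6 : HasFDerivAt g (fderiv ℝ g V) (V + (0 : ℝ) • η) := by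
        simpa using (hgdiff V).hasFDerivAt
      exact h6.comp_hasDerivAt (0 : ℝ) h5
    have h7 := h4.unique h3
    rw [h7]
    simp only [zero_smul, add_zero]
    rw [mul_comm]
    rfl
  have hfg : Integrable fun V => f V * g V := hA.integrable hO hx
  have hTg : Integrable fun V => ZeroCalculus.flatTranspose A (x, V) * g V := hT.integrable hO hx
  have hsq : ((‖η‖ ^ 2 : ℝ) : ℂ) ≠ 0 := Complex.ofReal_ne_zero.2 (pow_ne_zero 2 hη0)
  have hTe : ∀ V, fderiv ℝ f V η * g V =
      (Complex.I * ((‖η‖ ^ 2 : ℝ) : ℂ)) * (ZeroCalculus.flatTranspose A (x, V) * g V) := fun V => by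
    rw [hfη, ZeroCalculus.flatTranspose, Complex.real_smul, Real.rpow_neg_one]
    change _ = (Complex.I * ((‖η‖ ^ 2 : ℝ) : ℂ)) * (((‖η‖ ^ 2)⁻¹ : ℝ) *
      (-Complex.I * fderiv ℝ A (x, V) (0, η)) * g V)
    rw [Complex.ofReal_inv]
    field_simp
    linear_combination (fderiv ℝ A (x, V) (0, η) * g V) * Complex.I_sq
  have hgi : ∀ V, f V * fderiv ℝ g V η =
      (-Complex.I * ((x.2.2 * ‖η‖ ^ 2 : ℝ) : ℂ)) * (f V * g V) := fun V => by
    rw [hgη]; ring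
  have key := integral_mul_fderiv_eq_neg_fderiv_mul_of_integrable (μ := (volume : Measure (Tan d)))
    (f := f) (g := g) (v := η)
    ((hTg.const_mul _).congr (Eventually.of_forall fun V => (hTe V).symm))
    ((hfg.const_mul _).congr (Eventually.of_forall fun V => (hgi V).symm)) hfg
    (fun V _ => (hfd V).differentiableAt) (fun V _ => hgdiff V)
  simp only [hTe, hgi] at key
  rw [integral_const_mul, integral_const_mul] at key
  change (x.2.2 : ℂ) * (∫ V, f V * g V) = ∫ V, ZeroCalculus.flatTranspose A (x, V) * g V
  have h8 : Complex.I * ((‖η‖ ^ 2 : ℝ) : ℂ) ≠ 0 := mul_ne_zero Complex.I_ne_zero hsq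
  refine mul_left_cancel₀ h8 ?_
  push_cast at key ⊢
  linear_combination -key

/-- Multiplication by 1 + ρ replaces the amplitude A by A plus its transpose, again flat. Iteration
gives decay of any order as ρ → ∞ without a singularity at ρ = 0. -/
theorem IsFlatAmplitude.exists_flatIntegral_eq (hO : IsOpen O)
    (hR : ∀ θ ∈ O, ‖θ‖ ≤ R) (hc : 0 < c) (hη : ∀ θ ∈ O, c ≤ ‖θ.2‖) (M : ℕ) :
    ∀ {A : FlatParam d × Tan d → ℂ}, IsFlatAmplitude O A → ∃ A' : FlatParam d × Tan d → ℂ,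
      IsFlatAmplitude O A' ∧ ∀ x ∈ flatDomain O,
        (1 + (x.2.2 : ℂ)) ^ M * flatIntegral A x = flatIntegral A' x := by
  induction M with
  | zero => exact fun {A} hA => ⟨A, hA, fun x _ => by simp⟩
  | succ M ih =>
    intro A hA
    have hT := hA.flatTranspose hO hR hc hη
    obtain ⟨A', hA', h⟩ := ih (hA.add hO hT)
    refine ⟨A', hA', fun x hx => ?_⟩
    rw [← h x hx, pow_succ, mul_assoc]
    congr 1
    rw [add_mul, one_mul, rho_mul_flatIntegral hA hO hR hc hη hx]
    simp only [flatIntegral, add_mul]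
    exact (integral_add (hA.integrable hO hx) (hT.integrable hO hx)).symm

end IntegrationByParts

/-! ### Residual kernels from flat amplitudes -/

section ResidualFamily

variable {d : ℕ} {O : Set (Tan d × Tan d)} {A : FlatParam d × Tan d → ℂ} {c R : ℝ}

/-- The unit of length `(1 - τ²) / (1 + ρ)`. -/
noncomputable def residualLength (x : FlatParam d) : ℝ := (1 - x.2.1 ^ 2) / (1 + x.2.2)

/-- Scalar multiplication by `residualLength`. -/
noncomputable def residualScale (x : FlatParam d) : FlatParam d →L[ℝ] FlatParam d :=
  residualLength x • ContinuousLinearMap.id ℝ _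

theorem norm_compContinuousLinearMap_smul_id {E F : Type} [NormedAddCommGroup E] [NormedSpace ℝ E]
    [NormedAddCommGroup F] [NormedSpace ℝ F] {n : ℕ} (T : E [×n]→L[ℝ] F) (l : ℝ) :
    ‖T.compContinuousLinearMap fun _ => l • ContinuousLinearMap.id ℝ E‖ = |l| ^ n * ‖T‖ := by
  have : (T.compContinuousLinearMap fun _ => l • ContinuousLinearMap.id ℝ E) = l ^ n • T := by
    ext v
    simpa using T.map_smul_univ (fun _ => l) v
  rw [this, norm_smul, norm_pow, Real.norm_eq_abs]

theorem residualLength_pos {x : FlatParam d} (hx : x ∈ flatDomain O) : 0 < residualLength x :=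
  div_pos (one_sub_sq_pos hx) (by linarith [rho_pos hx])

theorem residualLength_le {x : FlatParam d} (hx : x ∈ flatDomain O) :
    residualLength x ≤ 1 - x.2.1 ^ 2 :=
  div_le_self (one_sub_sq_pos hx).le (by linarith [rho_pos hx])

theorem symbolOn_one_sub_tau_rpow (hO : IsOpen O) (s : ℝ) :
    SymbolOn (flatDomain O) residualScale (fun x => (1 - x.2.1) ^ s) (fun x => (1 - x.2.1) ^ s) := by
  have hU := isOpen_flatDomain hO
  let L : FlatParam d →L[ℝ] ℝ := -(ContinuousLinearMap.fst ℝ _ _).comp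
    (ContinuousLinearMap.snd ℝ _ _)
  have h1 : SymbolOn (flatDomain O) residualScale (fun x => 1 - x.2.1) (fun x => 1 - x.2.1) := by
    refine (SymbolOn.affine hU 1 L (max 1 (2 * ‖L‖)) (fun x hx => ?_) fun x hx => ?_).congr hU
      fun x _ => ?_
    · have h : x.2.1 < 1 := hx.2.1.2
      have : (1 : ℝ) + L x = 1 - x.2.1 := (sub_eq_add_neg _ _).symm
      rw [this, Real.norm_of_nonneg (by linarith)]
      nlinarith [le_max_left 1 (2 * ‖L‖)]
    · have h := hx.2.1
      rw [residualScale, ContinuousLinearMap.comp_smul, ContinuousLinearMap.comp_id, norm_smul,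
        Real.norm_of_nonneg (residualLength_pos hx).le]
      calc _ ≤ (2 * (1 - x.2.1)) * ‖L‖ := by
            refine mul_le_mul_of_nonneg_right ((residualLength_le hx).trans ?_) (norm_nonneg _)
            nlinarith [h.1, h.2]
        _ = (2 * ‖L‖) * (1 - x.2.1) := by ring
        _ ≤ _ := mul_le_mul_of_nonneg_right (le_max_right _ _) (by linarith [h.2])
    · exact sub_eq_add_neg _ _
  exact h1.rpow hU one_pos (fun x hx => sub_pos.2 hx.2.1.2) (fun x _ => (one_mul _).le) s

theorem symbolOn_one_add_rho_rpow (hO : IsOpen O) (s : ℝ) :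
    SymbolOn (flatDomain O) residualScale (fun x => (1 + x.2.2) ^ s) (fun x => (1 + x.2.2) ^ s) := by
  have hU := isOpen_flatDomain hO
  let L : FlatParam d →L[ℝ] ℝ := (ContinuousLinearMap.snd ℝ _ _).comp
    (ContinuousLinearMap.snd ℝ _ _)
  have h1 : SymbolOn (flatDomain O) residualScale (fun x => 1 + x.2.2) (fun x => 1 + x.2.2) := by
    refine SymbolOn.affine hU 1 L (max 1 ‖L‖) (fun x hx => ?_) fun x hx => ?_
    · have h := rho_pos hx
      change ‖1 + x.2.2‖ ≤ _
      rw [Real.norm_of_nonneg (by linarith)]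
      nlinarith [le_max_left 1 ‖L‖]
    · have h := rho_pos hx
      rw [residualScale, ContinuousLinearMap.comp_smul, ContinuousLinearMap.comp_id, norm_smul,
        Real.norm_of_nonneg (residualLength_pos hx).le, mul_comm]
      refine mul_le_mul (le_max_right _ _) ?_ (residualLength_pos hx).le (by positivity)
      linarith [residualLength_le hx, one_sub_sq_le_one x]
  exact h1.rpow hU one_pos (fun x hx => by linarith [rho_pos hx]) (fun x _ => (one_mul _).le) s

/-- Each derivative loses a factor 1 + ρ, and the unit of length (1 - τ²)/(1 + ρ) is chosen small
enough to absorb it. In the same unit the powers of 1 - τ and of 1 + ρ are symbols, so the three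
factors can be multiplied. -/
theorem IsFlatAmplitude.symbolOn_flatIntegral (hA : IsFlatAmplitude O A)
    (hO : IsOpen O) (hR : ∀ θ ∈ O, ‖θ‖ ≤ R) (N : ℕ) :
    SymbolOn (flatDomain O) residualScale (fun x => (1 - x.2.1 ^ 2) ^ N) (flatIntegral A) := by
  obtain ⟨h1, h2⟩ := hA.contDiffOn_flatIntegral hO hR
  refine ⟨h1, fun n => ?_⟩
  obtain ⟨C, hC⟩ := h2 n N
  refine ⟨C, fun x hx => ?_⟩
  have hl := residualLength_pos hx
  have hρ := rho_pos hx
  have hτ := one_sub_sq_pos hx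
  rw [residualScale, norm_compContinuousLinearMap_smul_id, abs_of_pos hl]
  have h3 : (residualLength x * (1 + x.2.2)) ^ n ≤ 1 := by
    rw [residualLength, div_mul_cancel₀ _ (by positivity)]
    exact pow_le_one₀ hτ.le (one_sub_sq_le_one _)
  have hC0 : 0 ≤ C * (1 - x.2.1 ^ 2) ^ N := by
    have := (norm_nonneg _).trans (hC x hx)
    rw [mul_left_comm] at this
    exact nonneg_of_mul_nonneg_right this (by positivity)
  calc _ ≤ residualLength x ^ n * (C * ((1 + x.2.2) ^ n * (1 - x.2.1 ^ 2) ^ N)) :=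
        mul_le_mul_of_nonneg_left (hC x hx) (by positivity)
    _ = (residualLength x * (1 + x.2.2)) ^ n * (C * (1 - x.2.1 ^ 2) ^ N) := by rw [mul_pow]; ring
    _ ≤ _ := mul_le_of_le_one_left hC0 h3

theorem IsFlatAmplitude.isBscResidualFamily (hA : IsFlatAmplitude O A)
    (hO : IsOpen O) (hR : ∀ θ ∈ O, ‖θ‖ ≤ R) (hc : 0 < c) (hη : ∀ θ ∈ O, c ≤ ‖θ.2‖)
    {K : Tan d × Tan d → ℝ → ℝ → ℂ}
    (hK : ∀ x ∈ flatDomain O, inTauRho (K x.1) x.2.1 x.2.2 =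
      ((2 / (1 - x.2.1) : ℝ) : ℂ) ^ d * flatIntegral A x) : IsBscResidualFamily O K := by
  have hU := isOpen_flatDomain hO
  have key : ∀ M N : ℕ, SymbolOn (flatDomain O) residualScale
      (fun x => (1 - x.2.1) ^ (-(d : ℝ)) * ((1 + x.2.2) ^ (-(M : ℝ)) * (1 - x.2.1 ^ 2) ^ N))
      (fun x => inTauRho (K x.1) x.2.1 x.2.2) := by
    intro M N
    obtain ⟨A', hA', h⟩ := IsFlatAmplitude.exists_flatIntegral_eq hO hR hc hη M hA
    have h1 := ((symbolOn_one_sub_tau_rpow hO (-(d : ℝ))).bilinear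
      ((symbolOn_one_add_rho_rpow hO (-(M : ℝ))).bilinear (hA'.symbolOn_flatIntegral hO hR N) hU
        (ContinuousLinearMap.lsmul ℝ ℝ)) hU (ContinuousLinearMap.lsmul ℝ ℝ)).clm hU
        (ContinuousLinearMap.mul ℝ ℂ (2 ^ d))
    refine h1.congr hU fun x hx => ?_
    have hρ := rho_pos hx
    have hρ' : (1 + (x.2.2 : ℂ)) ≠ 0 := by
      have : ((1 + x.2.2 : ℝ) : ℂ) ≠ 0 := Complex.ofReal_ne_zero.2 (by positivity)
      rwa [Complex.ofReal_add, Complex.ofReal_one] at this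
    have hτ : (0 : ℝ) < 1 - x.2.1 := sub_pos.2 hx.2.1.2
    change inTauRho (K x.1) x.2.1 x.2.2 = 2 ^ d * (((1 - x.2.1) ^ (-(d : ℝ)) : ℝ) •
      (((1 + x.2.2) ^ (-(M : ℝ)) : ℝ) • flatIntegral A' x))
    rw [hK x hx, ← h x hx, Complex.real_smul, Complex.real_smul, Real.rpow_neg hτ.le,
      Real.rpow_neg (by positivity), Real.rpow_natCast, Real.rpow_natCast]
    push_cast
    rw [div_pow]
    field_simp
  refine ⟨(key 0 0).contDiffOn, fun j N => ?_⟩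
  -- The j extra powers of both quantities pay for returning from the unit (1 - τ²)/(1 + ρ) to the
  -- unit 1 in j derivatives; the d extra powers of 1 - τ² cancel the Jacobian (1 - τ)^(-d).
  obtain ⟨C, hC⟩ := (key (N + j) (N + d + j)).bound j
  refine ⟨|C| * 2 ^ d, fun θ hθ τ hτ ρ hρ => ?_⟩
  have hx : ((θ, τ, ρ) : FlatParam d) ∈ flatDomain O := ⟨hθ, hτ, hρ⟩
  have hρ0 : 0 < ρ := hρ
  have h1 := hC _ hx
  have hl := residualLength_pos hx
  rw [residualScale, norm_compContinuousLinearMap_smul_id, abs_of_pos hl] at h1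
  have hτ0 : 0 < 1 - τ ^ 2 := one_sub_sq_pos hx
  have hτ1 : 0 < 1 - τ := sub_pos.2 hτ.2
  have h2 : ∀ T : ℝ, residualLength ((θ, τ, ρ) : FlatParam d) ^ j * T ≤
      C * ((1 - τ) ^ (-(d : ℝ)) * ((1 + ρ) ^ (-((N + j : ℕ) : ℝ)) * (1 - τ ^ 2) ^ (N + d + j))) →
      T ≤ |C| * 2 ^ d * ((1 - τ ^ 2) / (1 + ρ)) ^ N := fun T hT => by
    refine le_of_mul_le_mul_left (hT.trans ?_) (pow_pos hl j)
    rw [Real.rpow_neg hτ1.le, Real.rpow_neg (by positivity), Real.rpow_natCast, Real.rpow_natCast]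
    have h3 : ((1 - τ) ^ d)⁻¹ * (1 - τ ^ 2) ^ d ≤ 2 ^ d := by
      have : (1 - τ ^ 2) = (1 - τ) * (1 + τ) := by ring
      rw [this, mul_pow, inv_mul_cancel_left₀ (pow_ne_zero _ hτ1.ne')]
      exact pow_le_pow_left₀ (by linarith [hτ.1]) (by linarith [hτ.2]) d
    calc _ ≤ |C| * (((1 - τ) ^ d)⁻¹ * (((1 + ρ) ^ (N + j))⁻¹ * (1 - τ ^ 2) ^ (N + d + j))) :=
          mul_le_mul_of_nonneg_right (le_abs_self C) (by positivity)
      _ = |C| * (((1 - τ) ^ d)⁻¹ * (1 - τ ^ 2) ^ d) * ((1 - τ ^ 2) / (1 + ρ)) ^ (N + j) := by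
          rw [div_pow, pow_add (1 - τ ^ 2), pow_add (1 - τ ^ 2), pow_add (1 - τ ^ 2)]
          field_simp
      _ ≤ |C| * 2 ^ d * ((1 - τ ^ 2) / (1 + ρ)) ^ (N + j) := by gcongr
      _ = _ := by
          change _ = ((1 - τ ^ 2) / (1 + ρ)) ^ j * _
          rw [pow_add]; ring
  exact h2 _ h1

end ResidualFamily

/-! ### The smooth part of the kernel as a flat amplitude -/

section FrontAmplitude

variable {d : ℕ} {O : Set (Tan d × Tan d)} {H : ℝ × Tan d × Amb d × ℝ → ℂ} {R c : ℝ}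

/-- The factor `(2 + 2 τ² + 4 |V|²)^{-1/2}`. -/
noncomputable def ratioFactor (p : FlatParam d × Tan d) : ℝ :=
  (2 + 2 * p.1.2.1 ^ 2 + 4 * ‖p.2‖ ^ 2) ^ (-(1 / 2) : ℝ)

/-- The point of the front face with coordinates `s = (1 + τ) / (1 - τ)`, `Υ = 2 V / (1 - τ)`. -/
noncomputable def ratioPoint (p : FlatParam d × Tan d) : Tan d × Amb d × ℝ :=
  (p.1.1.1, ratioFactor p • pt (1 + p.1.2.1) ((2 : ℝ) • p.2), ratioFactor p * (1 - p.1.2.1))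

theorem symbolOn_tau (hO : IsOpen O) : SymbolOn (flatDomain O ×ˢ univ)
    (fun _ => ContinuousLinearMap.id ℝ _) (fun _ => (1 : ℝ))
    (fun p : FlatParam d × Tan d => p.1.2.1) := by
  let L : FlatParam d × Tan d →L[ℝ] ℝ := (ContinuousLinearMap.fst ℝ _ _).comp
    ((ContinuousLinearMap.snd ℝ _ _).comp (ContinuousLinearMap.fst ℝ _ _))
  refine SymbolOn.linear ((isOpen_flatDomain hO).prod isOpen_univ) L (max 1 ‖L‖)
    (fun p hp => ?_) fun p hp => ?_
  · have h := hp.1.2.1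
    rw [mul_one]
    exact (abs_le.2 ⟨h.1.le, h.2.le⟩).trans (le_max_left _ _)
  · rw [mul_one]
    exact le_max_right _ _

/-- The quantity 2 + 2τ² + 4‖V‖² is comparable to (1 + ‖V‖)², and the rule for real powers applies
with exponent -1/2. -/
theorem symbolOn_ratioFactor (hO : IsOpen O) : SymbolOn (flatDomain O ×ˢ univ)
    (fun _ => ContinuousLinearMap.id ℝ _) (fun p => (1 + ‖p.2‖)⁻¹)
    (ratioFactor (d := d)) := by
  have hU : IsOpen (flatDomain O ×ˢ univ : Set (FlatParam d × Tan d)) :=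
    (isOpen_flatDomain hO).prod isOpen_univ
  have h1 := ((symbolOn_tau (d := d) hO).bilinear (symbolOn_tau hO) hU
    ((2 : ℝ) • ContinuousLinearMap.mul ℝ ℝ)).mono (fun _ _ => by norm_num) 1
    (w' := fun p => (1 + ‖p.2‖) * (1 + ‖p.2‖)) fun p _ => by nlinarith [norm_nonneg p.2]
  have h2 := (symbolOn_V (d := d) hO).bilinear (symbolOn_V hO) hU ((4 : ℝ) • innerSL ℝ)
  have h3 : SymbolOn (flatDomain O ×ˢ univ) (fun _ => ContinuousLinearMap.id ℝ _)
      (fun p : FlatParam d × Tan d => (1 + ‖p.2‖) * (1 + ‖p.2‖)) (fun _ => (2 : ℝ)) :=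
    SymbolOn.const hU 2 2 fun p _ => by
      rw [Real.norm_of_nonneg (by norm_num)]
      nlinarith [norm_nonneg p.2]
  have h4 := (((h3.add h1 hU).add h2 hU).rpow hU (c := 1) one_pos
    (fun p _ => by positivity) (fun p _ => ?_) (-(1 / 2)))
  · refine (h4.congr hU fun p _ => ?_).congr_weight fun p _ => ?_
    · have h5 : (((4 : ℝ) • innerSL ℝ) p.2) p.2 = 4 * ‖p.2‖ ^ 2 := by
        rw [← real_inner_self_eq_norm_sq p.2]
        simp
      have h6 : (((2 : ℝ) • ContinuousLinearMap.mul ℝ ℝ) p.1.2.1) p.1.2.1 = 2 * p.1.2.1 ^ 2 := by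
        simp [sq]
      rw [h5, h6, ratioFactor]
    · rw [← sq, ← Real.rpow_natCast, ← Real.rpow_mul (by positivity)]
      norm_num
      exact Real.rpow_neg_one _
  · have h5 : (((4 : ℝ) • innerSL ℝ) p.2) p.2 = 4 * ‖p.2‖ ^ 2 := by
      rw [← real_inner_self_eq_norm_sq p.2]
      simp
    have h6 : (((2 : ℝ) • ContinuousLinearMap.mul ℝ ℝ) p.1.2.1) p.1.2.1 = 2 * p.1.2.1 ^ 2 := by
      simp [sq]
    rw [h5, h6]
    nlinarith [sq_nonneg (‖p.2‖ - 1), sq_nonneg p.1.2.1]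

theorem symbolOn_ratioPoint (hO : IsOpen O) (hR : ∀ θ ∈ O, ‖θ‖ ≤ R) :
    SymbolOn (flatDomain O ×ˢ univ) (fun _ => ContinuousLinearMap.id ℝ _) (fun _ => (1 : ℝ))
      (ratioPoint (d := d)) := by
  have hU : IsOpen (flatDomain O ×ˢ univ : Set (FlatParam d × Tan d)) :=
    (isOpen_flatDomain hO).prod isOpen_univ
  have hQ := symbolOn_ratioFactor (d := d) hO
  have hy : SymbolOn (flatDomain O ×ˢ univ) (fun _ => ContinuousLinearMap.id ℝ _)
      (fun _ => (1 : ℝ)) (fun p : FlatParam d × Tan d => p.1.1.1) := by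
    let L : FlatParam d × Tan d →L[ℝ] Tan d := (ContinuousLinearMap.fst ℝ _ _).comp
      ((ContinuousLinearMap.fst ℝ _ _).comp (ContinuousLinearMap.fst ℝ _ _))
    refine SymbolOn.linear hU L (max R ‖L‖) (fun p hp => ?_) fun p _ => ?_
    · rw [mul_one]
      exact ((norm_fst_le _).trans (hR _ hp.1.1)).trans (le_max_left _ _)
    · rw [mul_one]
      exact le_max_right _ _
  have h1 : SymbolOn (flatDomain O ×ˢ univ) (fun _ => ContinuousLinearMap.id ℝ _)
      (fun _ => (1 : ℝ)) (fun _ : FlatParam d × Tan d => (1 : ℝ)) :=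
    SymbolOn.const hU 1 1 fun p _ => by simp
  have hmono : ∀ {F : Type} [NormedAddCommGroup F] [NormedSpace ℝ F]
      {f : FlatParam d × Tan d → F}, SymbolOn (flatDomain O ×ˢ univ)
      (fun _ => ContinuousLinearMap.id ℝ _) (fun _ => (1 : ℝ)) f →
      SymbolOn (flatDomain O ×ˢ univ) (fun _ => ContinuousLinearMap.id ℝ _)
        (fun p => 1 + ‖p.2‖) f := fun hf =>
    hf.mono (fun _ _ => one_pos.le) 1 fun p _ => by linarith [norm_nonneg p.2]
  have hplus := hmono (h1.add (symbolOn_tau hO) hU)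
  have hminus := hmono (h1.add ((symbolOn_tau hO).clm hU (-ContinuousLinearMap.id ℝ ℝ)) hU)
  have hw : ∀ p : FlatParam d × Tan d, (1 + ‖p.2‖)⁻¹ * (1 + ‖p.2‖) = 1 := fun p =>
    inv_mul_cancel₀ (by positivity)
  have h2 := ((hQ.bilinear (((hplus.clm hU (ContinuousLinearMap.inl ℝ ℝ (Tan d))).add
    ((symbolOn_V hO).clm hU ((2 : ℝ) • ContinuousLinearMap.inr ℝ ℝ (Tan d))) hU).clm hU (ptL d)) hU
      (ContinuousLinearMap.lsmul ℝ ℝ)).congr_weight fun p _ => hw p)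
  have h3 := ((hQ.bilinear hminus hU (ContinuousLinearMap.mul ℝ ℝ)).congr_weight fun p _ => hw p)
  refine (((hy.clm hU (ContinuousLinearMap.inl ℝ (Tan d) (Amb d × ℝ))).add
    ((h2.clm hU ((ContinuousLinearMap.inr ℝ (Tan d) (Amb d × ℝ)).comp
      (ContinuousLinearMap.inl ℝ (Amb d) ℝ))).add
      (h3.clm hU ((ContinuousLinearMap.inr ℝ (Tan d) (Amb d × ℝ)).comp
      (ContinuousLinearMap.inr ℝ (Amb d) ℝ))) hU) hU)).congr hU fun p _ => ?_
  simp [ratioPoint, sub_eq_add_neg]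

/-- The smooth function `H` on the front face as an amplitude. -/
noncomputable def frontAmplitude (H : ℝ × Tan d × Amb d × ℝ → ℂ) (p : FlatParam d × Tan d) : ℂ :=
  H (0, ratioPoint p)

theorem ratioFactor_pos (p : FlatParam d × Tan d) : 0 < ratioFactor p := by
  unfold ratioFactor
  positivity

theorem ratioFactor_eq (p : FlatParam d × Tan d) :
    ratioFactor p = (Real.sqrt (2 + 2 * p.1.2.1 ^ 2 + 4 * ‖p.2‖ ^ 2))⁻¹ := by
  rw [ratioFactor, Real.rpow_neg (by positivity), Real.sqrt_eq_rpow]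

theorem ratioFactor_sq_le (p : FlatParam d × Tan d) : ratioFactor p ^ 2 ≤ (1 + ‖p.2‖)⁻¹ := by
  rw [ratioFactor_eq, inv_pow, Real.sq_sqrt (by positivity)]
  refine inv_anti₀ (by positivity) ?_
  nlinarith [sq_nonneg (‖p.2‖ - 1), sq_nonneg p.1.2.1, sq_nonneg ‖p.2‖]

/-- At the point `ratioPoint p` the defining functions of lb and rb are Q(1 + τ) and Q(1 - τ), where
Q is `ratioFactor p`. Their product (1 - τ²) Q² is at most (1 - τ²)/(1 + ‖V‖), which is the flatness
measure of the amplitude; H and all its derivatives are bounded by every power of this product. -/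
theorem IsSmoothVanishing.isFlatAmplitude (hH : IsSmoothVanishing H) (hO : IsOpen O)
    (hR : ∀ θ ∈ O, ‖θ‖ ≤ R) : IsFlatAmplitude O (frontAmplitude H) := by
  intro N
  have hU : IsOpen (flatDomain O ×ˢ univ : Set (FlatParam d × Tan d)) :=
    (isOpen_flatDomain hO).prod isOpen_univ
  have hg := symbolOn_ratioPoint (d := d) hO hR
  have hf : ContDiff ℝ ∞ fun q : Tan d × Amb d × ℝ => H (0, q) := hH.1.comp (by fun_prop)
  obtain ⟨R', hR'⟩ := hg.norm_le
  refine SymbolOn.of_norm_iteratedFDeriv_le (hf.comp_contDiffOn hg.contDiffOn) fun n => ?_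
  obtain ⟨D, hD1, hD⟩ := hg.exists_norm_iteratedFDeriv_le (fun _ _ => one_pos.le) n
  choose C hC0 hC using fun i => hH.exists_norm_iteratedFDeriv_le i N (R' * 1)
  refine ⟨n.factorial * (∑ i ∈ Finset.range (n + 1), C i) * D ^ n, fun p hp => ?_⟩
  set W := ((1 - p.1.2.1 ^ 2) / (1 + ‖p.2‖)) ^ N with hW
  have hτ := one_sub_sq_pos hp.1
  have hτ' := hp.1.2.1
  have hQ := ratioFactor_pos p
  have hW0 : 0 ≤ W := by positivity
  have hp0 : (ratioPoint p).2.1 0 = ratioFactor p * (1 + p.1.2.1) := by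
    simp [ratioPoint]
  have hp1 : (ratioPoint p).2.2 = ratioFactor p * (1 - p.1.2.1) := rfl
  have hWle : ((ratioPoint p).2.1 0 * (ratioPoint p).2.2) ^ N ≤ W := by
    rw [hp0, hp1]
    have h1 : ratioFactor p * (1 + p.1.2.1) * (ratioFactor p * (1 - p.1.2.1)) =
        (1 - p.1.2.1 ^ 2) * ratioFactor p ^ 2 := by ring
    rw [h1, hW, div_eq_mul_inv]
    gcongr
    exact ratioFactor_sq_le p
  have hfb : ∀ i ≤ n, ‖iteratedFDeriv ℝ i (fun q : Tan d × Amb d × ℝ => H (0, q))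
      (ratioPoint p)‖ ≤ (∑ i ∈ Finset.range (n + 1), C i) * W := fun i hi => by
    refine (hC i (ratioPoint p) (hR' p hp) ?_ ?_).trans ?_
    · rw [hp0]
      exact mul_nonneg hQ.le (by linarith [hτ'.1])
    · rw [hp1]
      exact mul_nonneg hQ.le (by linarith [hτ'.2])
    · refine (mul_le_mul_of_nonneg_left hWle (hC0 i)).trans (mul_le_mul_of_nonneg_right ?_ hW0)
      exact Finset.single_le_sum (f := C) (fun i _ => hC0 i)
        (Finset.mem_range.2 (Nat.lt_succ_of_le hi))
  have hgw : ∀ i, 1 ≤ i → i ≤ n → ‖iteratedFDerivWithin ℝ i (ratioPoint (d := d))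
      (flatDomain O ×ˢ univ) p‖ ≤ D ^ i := fun i hi1 hi => by
    rw [iteratedFDerivWithin_of_isOpen i hU hp]
    refine (hD i hi p hp).trans ?_
    rw [mul_one]
    exact le_self_pow₀ hD1 (by omega)
  have key := norm_iteratedFDerivWithin_comp_le (𝕜 := ℝ) (N := ∞) (n := n) (t := univ)
    hf.contDiffOn hg.contDiffOn (mod_cast le_top) uniqueDiffOn_univ hU.uniqueDiffOn
    (mapsTo_univ _ _) hp (fun i hi => by rw [iteratedFDerivWithin_univ]; exact hfb i hi) hgw
  rw [iteratedFDerivWithin_of_isOpen n hU hp] at key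
  refine key.trans (le_of_eq ?_)
  ring

/-- Here s = t/t' = (1 + τ)/(1 - τ) and t' = ρ(1 - τ)/2. The substitution Υ = 2V/(1 - τ) turns the
phase Υ·t'η into ρ V·η, and ⟨v⟩² into (2 + 2τ² + 4‖V‖²)/(1 - τ)², so that H is evaluated at a point
which depends smoothly on (τ, V) even at τ = 1. -/
theorem inTauRho_reducedResidual {x : FlatParam d} (hx : x ∈ flatDomain O) :
    inTauRho (reducedResidual (frontFun H (pt 0 x.1.1)) x.1.2) x.2.1 x.2.2 =
      ((2 / (1 - x.2.1) : ℝ) : ℂ) ^ d * flatIntegral (frontAmplitude H) x := by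
  obtain ⟨⟨y, η⟩, τ, ρ⟩ := x
  have hρ : 0 < ρ := rho_pos hx
  have hτ : 0 < 1 - τ := sub_pos.2 hx.2.1.2
  set l := 2 / (1 - τ) with hl
  have hl0 : 0 < l := by positivity
  have hs : ρ * (1 + τ) / 2 / (ρ * (1 - τ) / 2) = (1 + τ) / (1 - τ) := by
    field_simp
  simp only [inTauRho, reducedResidual, hs, fiberHat]
  have h1 := Measure.integral_comp_smul (volume : Measure (Tan d)) (fun U : Tan d =>
    frontFun H (pt 0 y) (pt ((1 + τ) / (1 - τ)) U) *
      Complex.exp (-Complex.I * (inner ℝ U ((ρ * (1 - τ) / 2) • η) : ℝ))) l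
  rw [finrank_euclideanSpace_fin, abs_of_pos (by positivity), Complex.real_smul] at h1
  have hlc : ((l ^ d : ℝ) : ℂ) ≠ 0 := Complex.ofReal_ne_zero.2 (by positivity)
  rw [Complex.ofReal_inv, eq_inv_mul_iff_mul_eq₀ hlc, Complex.ofReal_pow] at h1
  rw [← h1]
  congr 1
  refine integral_congr_ae (Eventually.of_forall fun V => ?_)
  simp only
  set p : FlatParam d × Tan d := (((y, η), τ, ρ), V) with hp
  have hb : (bracket (pt ((1 + τ) / (1 - τ)) (l • V)))⁻¹ = ratioFactor p * (1 - τ) := by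
    have h2 : ‖pt ((1 + τ) / (1 - τ)) (l • V)‖ ^ 2 + 1 =
        (2 + 2 * τ ^ 2 + 4 * ‖V‖ ^ 2) / (1 - τ) ^ 2 := by
      rw [norm_pt_sq, norm_smul, Real.norm_of_nonneg hl0.le, hl]
      field_simp
      ring
    rw [bracket, h2, Real.sqrt_div (by positivity), Real.sqrt_sq hτ.le, inv_div, ratioFactor_eq,
      div_eq_inv_mul]
  have h3 : frontFun H (pt 0 y) (pt ((1 + τ) / (1 - τ)) (l • V)) = frontAmplitude H p := by
    rw [frontFun_pt_zero, hb, frontAmplitude, ratioPoint, ← pt_smul, ← pt_smul]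
    have h4 : ratioFactor p * (1 - τ) * ((1 + τ) / (1 - τ)) = ratioFactor p * (1 + τ) := by
      field_simp
    have h5 : (ratioFactor p * (1 - τ)) • l • V = ratioFactor p • (2 : ℝ) • V := by
      rw [smul_smul, smul_smul]
      congr 1
      rw [hl]
      field_simp
    rw [h4, h5]
  have h6 : inner ℝ (l • V) ((ρ * (1 - τ) / 2) • η) = flatPhase p := by
    rw [real_inner_smul_left, real_inner_smul_right, flatPhase, hl]
    field_simp
    rfl
  rw [h3, h6]
  rfl

theorem IsSmoothVanishing.isBscResidualFamily (hH : IsSmoothVanishing H)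
    (hO : IsOpen O) (hR : ∀ θ ∈ O, ‖θ‖ ≤ R) (hc : 0 < c) (hη : ∀ θ ∈ O, c ≤ ‖θ.2‖) :
    IsBscResidualFamily O fun θ => reducedResidual (frontFun H (pt 0 θ.1)) θ.2 :=
  (hH.isFlatAmplitude hO hR).isBscResidualFamily hO hR hc hη fun _ hx => inTauRho_reducedResidual hx

end FrontAmplitude

theorem IsBscResidualFamily.isBscResidual {Θ : Type} [NormedAddCommGroup Θ] [NormedSpace ℝ Θ]
    {O : Set Θ} (hO : IsOpen O) {K : Θ → ℝ → ℝ → ℂ} (hK : IsBscResidualFamily O K) {θ : Θ}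
    (hθ : θ ∈ O) : IsBscResidual (K θ) := by
  refine ⟨hK.1.comp (f := fun q : ℝ × ℝ => (θ, q.1, q.2)) (by fun_prop) fun q hq => ⟨hθ, hq⟩,
    fun j N => ?_⟩
  obtain ⟨C, hC⟩ := hK.2 j N
  refine ⟨C, fun τ hτ ρ hρ => ?_⟩
  set G : Θ × ℝ × ℝ → ℂ := fun q => inTauRho (K q.1) q.2.1 q.2.2 with hG
  have hU : IsOpen (O ×ˢ (Ioo (-1) 1 ×ˢ Ioi 0) : Set (Θ × ℝ × ℝ)) :=
    hO.prod (isOpen_Ioo.prod isOpen_Ioi)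
  have hat : ContDiffAt ℝ j G (θ, τ, ρ) :=
    hK.1.contDiffAt_of_isOpen hU (x := (θ, τ, ρ)) ⟨hθ, hτ, hρ⟩ j
  have h1 := iteratedFDeriv_comp_affine hat (ContinuousLinearMap.inr ℝ Θ (ℝ × ℝ))
  have h2 := iteratedFDeriv_comp_add_left (𝕜 := ℝ)
    (f := fun q : ℝ × ℝ => inTauRho (K θ) q.1 q.2) j (τ, ρ) (x := 0)
  have h3 : (fun z => G ((θ, τ, ρ) + ContinuousLinearMap.inr ℝ Θ (ℝ × ℝ) z)) =
      fun z : ℝ × ℝ => (fun q : ℝ × ℝ => inTauRho (K θ) q.1 q.2) ((τ, ρ) + z) := by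
    ext z
    simp [hG]
  rw [add_zero] at h2
  rw [← h2, ← h3, h1]
  exact (norm_compContinuousLinearMap_le_of_le_one _
    (ContinuousLinearMap.norm_inr_le_one ℝ Θ (ℝ × ℝ))).trans (hC θ hθ τ hτ ρ hρ)

/-! ### Symbol and residual part attached to a conormal representation -/

section FrontData

variable {d : ℕ} {m : ℝ}

/-- The data in the representation of a conormal distribution near a diagonal point, with a
cutoff in `s` adapted to the cutoff near the diagonal. -/
structure FrontData {Ω : TopologicalSpace.Opens (Amb d × Amb d)} (T : CDistr Ω) (m : ℝ)
    (w₀ : Amb d) where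
  a : Amb d × Amb d → ℂ
  isSymbol : IsSymbol m a
  ε : ℝ
  ε_pos : 0 < ε
  χ : Amb d → ℝ
  contDiff : ContDiff ℝ ∞ χ
  hasCompactSupport : HasCompactSupport χ
  eq_one : χ 0 = 1
  H : ℝ × Tan d × Amb d × ℝ → ℂ
  isSmoothVanishing : IsSmoothVanishing H
  formula : IsConormalFormula T w₀ ε a χ H
  χ₁ : ℝ → ℝ
  isRatioCutoff : IsRatioCutoff χ₁
  eq_one_of_ne : ∀ u, χ u ≠ 0 → χ₁ (u 0) = 1

theorem IsConormalNear.exists_frontData {Ω : TopologicalSpace.Opens (Amb d × Amb d)} {T : CDistr Ω}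
    {w₀ : Amb d} {a : Amb d × Amb d → ℂ} (h : IsConormalNear m T w₀ a) :
    ∃ D : FrontData T m w₀, D.a = a := by
  obtain ⟨ha, ε, hε, χ, H, ⟨hχ, hs, hsupp, h1⟩, hH, hf⟩ := h
  obtain ⟨χ₁, hχ₁, hone⟩ := exists_isRatioCutoff hs hsupp
  exact ⟨⟨a, ha, ε, hε, χ, hχ, hs, h1.self_of_nhds, H, hH, hf, χ₁, hχ₁, hone⟩, rfl⟩

namespace FrontData

variable {Ω : TopologicalSpace.Opens (Amb d × Amb d)} {T : CDistr Ω} {w₀ : Amb d}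

/-- The symbol with respect to the cutoff `1`. -/
noncomputable def symbol (D : FrontData T m w₀) : Amb d × Amb d → ℂ := avgSymbol D.a D.χ

theorem isJointSymbol (D : FrontData T m w₀) : IsJointSymbol m D.symbol :=
  D.isSymbol.avgSymbol D.contDiff D.hasCompactSupport

/-- The full symbol of the reduced normal operator. -/
noncomputable def bscSymbol (D : FrontData T m w₀) (θ : Tan d × Tan d) : ℝ → ℝ → ℂ :=
  reducedSymbol D.symbol θ.1 θ.2

/-- The residual part of the reduced normal operator. -/
noncomputable def bscResidual (D : FrontData T m w₀) (θ : Tan d × Tan d) : ℝ → ℝ → ℂ :=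
  reducedResidual (frontFun D.H (pt 0 θ.1)) θ.2

theorem half_le_norm_snd {θ θ₀ : Tan d × Tan d} {r : ℝ} (hr : r ≤ 1 / 2) (h₀ : ‖θ₀.2‖ = 1)
    (hθ : θ ∈ Metric.ball θ₀ r) : 1 / 2 ≤ ‖θ.2‖ := by
  rw [mem_ball_iff_norm] at hθ
  have h1 := norm_snd_le (θ - θ₀)
  have h2 := norm_le_norm_add_norm_sub' θ₀.2 θ.2
  rw [norm_sub_rev] at h2
  rw [Prod.snd_sub] at h1
  linarith

theorem norm_le_of_mem_ball {θ θ₀ : Tan d × Tan d} {r : ℝ} (hθ : θ ∈ Metric.ball θ₀ r) :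
    ‖θ‖ ≤ ‖θ₀‖ + r := by
  rw [mem_ball_iff_norm] at hθ
  linarith [norm_le_norm_add_norm_sub' θ θ₀]

theorem isBscSymbolFamily (D : FrontData T m w₀) {θ₀ : Tan d × Tan d} (h₀ : ‖θ₀.2‖ = 1) {r : ℝ}
    (hr : r ≤ 1 / 2) : IsBscSymbolFamily m m (Metric.ball θ₀ r) D.bscSymbol :=
  (D.isJointSymbol.symbolOn_reducedSymbol Metric.isOpen_ball (fun _ hθ => norm_le_of_mem_ball hθ)
    one_half_pos fun _ hθ => half_le_norm_snd hr h₀ hθ).isBscSymbolFamily Metric.isOpen_ball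

theorem isBscResidualFamily (D : FrontData T m w₀) {θ₀ : Tan d × Tan d} (h₀ : ‖θ₀.2‖ = 1) {r : ℝ}
    (hr : r ≤ 1 / 2) : IsBscResidualFamily (Metric.ball θ₀ r) D.bscResidual :=
  D.isSmoothVanishing.isBscResidualFamily Metric.isOpen_ball
    (fun _ hθ => norm_le_of_mem_ball hθ) one_half_pos fun _ hθ => half_le_norm_snd hr h₀ hθ

theorem hasBscSymbol (D : FrontData T m w₀) {θ : Tan d × Tan d} (hθ : ‖θ.2‖ = 1)
    {κ : CDistr quadrant} (hκ : IsBscQuantization D.χ₁ (D.bscSymbol θ) (D.bscResidual θ) κ) :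
    HasBscSymbol m m κ (D.bscSymbol θ) :=
  ⟨(D.isBscSymbolFamily hθ le_rfl).isBscSymbol (Metric.mem_ball_self one_half_pos), D.χ₁,
    D.bscResidual θ, D.isRatioCutoff, (D.isBscResidualFamily hθ le_rfl).isBscResidual
      Metric.isOpen_ball (Metric.mem_ball_self one_half_pos), hκ⟩

end FrontData

end FrontData

/-! ### Existence, uniqueness, ellipticity and indicial operator -/

section ReducedNormalOperator

variable {d : ℕ} {X : Type*} [TopologicalSpace X] [ChartedSpace (EuclideanHalfSpace (d + 1)) X]
  {m : ℝ} {P : ZeroKernel d X} {φ : Coords d X} {w₀ : Amb d}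

theorem IsReducedNormalOperator.unique {y η : Tan d} {κ κ' : CDistr quadrant}
    (h : IsReducedNormalOperator P φ y η κ) (h' : IsReducedNormalOperator P φ y η κ') : κ = κ' := by
  obtain ⟨N, hN, F, hF, hκ⟩ := h
  obtain ⟨N', hN', F', hF', hκ'⟩ := h'
  obtain rfl := hN.unique hN'
  ext ψ
  rw [hκ ψ, hκ' ψ]
  refine setIntegral_congr_fun measurableSet_Ioi fun t ht => ?_
  rw [(hF t ht).unique (hF' t ht)]

/-- One set of data serves all boundary points within ε of w₀. The symbol, the residual part and the
cutoff therefore come from a single formula in (y, η), which is the source of the smooth dependence.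
-/
theorem FrontData.exists_isReducedNormalOperator (D : FrontData (P.dist φ φ) m w₀) {y : Tan d}
    (hy : y ∈ φ.bdry) (hyε : pt 0 y ∈ Metric.ball w₀ D.ε) (η : Tan d) :
    ∃ κ : CDistr quadrant, IsReducedNormalOperator P φ y η κ ∧
      IsBscQuantization D.χ₁ (D.bscSymbol (y, η)) (D.bscResidual (y, η)) κ ∧
      ∃ F : ℝ → CDistr posLine, IsRatioKernel F κ ∧ ∀ t g, F t g =
        fiberPairing D.symbol D.χ₁ (frontFun D.H (pt 0 y)) y (t • η) g := by
  have hk := D.isSmoothVanishing.isRapid_frontFun y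
  obtain ⟨N, hN⟩ := exists_distr_frontPairing D.isSymbol D.contDiff D.hasCompactSupport
    D.isSmoothVanishing.1.continuous (pt 0 y)
  obtain ⟨κ, hκ, hκF⟩ := exists_isBscQuantization_isRatioKernel D.isJointSymbol D.isRatioCutoff
    hk y η
  choose F hF using fun t : ℝ =>
    exists_distr_fiberPairing D.isJointSymbol D.isRatioCutoff hk y (t • η)
  have hFκ := hκF F fun t _ g => hF t g
  exact ⟨κ, ⟨N, isNormalKernel_of_frontPairing hy hyε D.isSymbol D.contDiff D.hasCompactSupport
    D.isSmoothVanishing.1.continuous D.formula hN, F, fun t _ =>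
      isFiberFourier_of_frontPairing D.isSymbol D.contDiff D.hasCompactSupport D.isSmoothVanishing
        D.isRatioCutoff D.eq_one_of_ne hN (hF t), hFκ⟩, hκ, F, hFκ, hF⟩

/-- The substitution ζ = ((1 + t)σ, tη) is compatible with products, so it carries the identity AE -
1 = B over (0, y) to the reduced symbols, and the orders -m and -1 become the orders and the weights
at t = ∞. -/
theorem FrontData.isBscElliptic {y η : Tan d} (D : FrontData (P.dist φ φ) m (pt 0 y))
    (hη : ‖η‖ = 1) {c C : ℝ} (hc : 0 < c)
    (hell : ∀ ζ : Amb d, C ≤ ‖ζ‖ → c * (1 + ‖ζ‖) ^ m ≤ ‖D.a (pt 0 y, ζ)‖) {κ : CDistr quadrant}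
    (hκ : HasBscSymbol m m κ (D.bscSymbol (y, η))) : IsBscElliptic m m κ := by
  obtain ⟨C', hC'⟩ := exists_le_norm_avgSymbol D.isSymbol D.contDiff D.hasCompactSupport D.eq_one
    (pt 0 y) hc hell
  obtain ⟨E, B, hE, hB, hEB⟩ := D.isJointSymbol.exists_parametrix (pt 0 y) (half_pos hc) hC'
  refine ⟨_, hκ, reducedSymbol E y η, hE.isBscSymbol_reducedSymbol y hη, ?_⟩
  convert hB.isBscSymbol_reducedSymbol y hη using 1
  ext t σ
  exact hEB _

/-- The restriction to t' = 0 is the fiberwise Fourier transform at the frequency 0·η = 0. The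
operator I is built from this single distribution before η is chosen. -/
theorem FrontData.exists_isIndicialOperator {y : Tan d} (D : FrontData (P.dist φ φ) m (pt 0 y)) :
    ∃ I : CDistr quadrant, ∀ (η : Tan d) (κ : CDistr quadrant) (F : ℝ → CDistr posLine),
      IsRatioKernel F κ → (∀ t g, F t g =
        fiberPairing D.symbol D.χ₁ (frontFun D.H (pt 0 y)) y (t • η) g) →
      IsIndicialOperator κ I := by
  have hk := D.isSmoothVanishing.isRapid_frontFun y
  obtain ⟨J, hJ⟩ := exists_distr_fiberPairing D.isJointSymbol D.isRatioCutoff hk y 0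
  obtain ⟨I, -, hI⟩ := exists_isBscQuantization_isRatioKernel D.isJointSymbol D.isRatioCutoff hk y 0
  refine ⟨I, fun η κ F hF hFg => ⟨J, ?_, hI _ fun t _ g => by rw [smul_zero, hJ]⟩⟩
  have hF0 : F 0 = J := by
    ext g
    rw [hFg, hJ, zero_smul]
  rw [← hF0]
  refine isBFrontFaceRestriction_of_isRatioKernel hF fun g => ?_
  simp only [hFg]
  exact (continuous_fiberPairing D.isJointSymbol D.isRatioCutoff hk y g.contDiff
    g.hasCompactSupport).comp (by fun_prop)

end ReducedNormalOperator

end ZeroCalculus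

/-! ### The proposition -/

theorem proposition2p9 (d : ℕ) {X : Type*} [TopologicalSpace X] [T2Space X]
    [SecondCountableTopology X] [ChartedSpace (EuclideanHalfSpace (d + 1)) X]
    [IsManifold (𝓡∂ (d + 1)) ∞ X] (m : ℝ) (P : ZeroKernel d X) (hP : P.IsZeroPsdo m)
    (φ : Coords d X) :
    ∃ Nhat : Tan d → Tan d → CDistr quadrant,
      (∀ y₀ ∈ φ.bdry, ∀ η : Tan d, ‖η‖ = 1 →
        IsReducedNormalOperator P φ y₀ η (Nhat y₀ η) ∧
        (∀ κ, IsReducedNormalOperator P φ y₀ η κ → κ = Nhat y₀ η) ∧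
        IsBscPsdo m m (Nhat y₀ η)) ∧
      IsSmoothBscFamily m m {θ : Tan d × Tan d | θ.1 ∈ φ.bdry ∧ ‖θ.2‖ = 1}
        (fun θ => Nhat θ.1 θ.2) ∧
      (∀ y₀ ∈ φ.bdry, P.IsEllipticAt m φ y₀ →
        ∀ η : Tan d, ‖η‖ = 1 → IsBscElliptic m m (Nhat y₀ η)) ∧
      (∀ y₀ ∈ φ.bdry, ∃ I : CDistr quadrant,
        ∀ η : Tan d, ‖η‖ = 1 → IsIndicialOperator (Nhat y₀ η) I) := by
  have hD : ∀ y ∈ φ.bdry, Nonempty (FrontData (P.dist φ φ) m (pt 0 y)) := fun y hy => by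
    obtain ⟨a, ha⟩ := hP.1 φ (pt 0 y) hy
    exact ha.exists_frontData.nonempty
  have hex : ∀ y ∈ φ.bdry, ∀ η, ∃ κ, IsReducedNormalOperator P φ y η κ := fun y hy η => by
    obtain ⟨D⟩ := hD y hy
    obtain ⟨κ, hκ, -⟩ := D.exists_isReducedNormalOperator hy (Metric.mem_ball_self D.ε_pos) η
    exact ⟨κ, hκ⟩
  -- At points outside `φ.bdry` the values of `Nhat` are arbitrary.
  choose! Nhat hN using hex
  -- `Nhat` was chosen point by point; uniqueness shows that it is nevertheless given by the formula
  -- for any local data near the point.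
  have hquant : ∀ {w₀ : Amb d} (D : FrontData (P.dist φ φ) m w₀) {y : Tan d}, y ∈ φ.bdry →
      pt 0 y ∈ Metric.ball w₀ D.ε → ∀ η,
      IsBscQuantization D.χ₁ (D.bscSymbol (y, η)) (D.bscResidual (y, η)) (Nhat y η) :=
    fun D y hy hyε η => by
      obtain ⟨κ, hκ, hq, -⟩ := D.exists_isReducedNormalOperator hy hyε η
      rwa [hκ.unique (hN y hy η)] at hq
  refine ⟨Nhat, fun y hy η hη => ⟨hN y hy η, fun κ hκ => hκ.unique (hN y hy η), ?_⟩, ?_, ?_, ?_⟩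
  · obtain ⟨D⟩ := hD y hy
    exact ⟨_, D.hasBscSymbol (θ := (y, η)) hη (hquant D hy (Metric.mem_ball_self D.ε_pos) η)⟩
  · rintro θ₀ ⟨hy, hη⟩
    obtain ⟨D⟩ := hD θ₀.1 hy
    -- The radius 1/2 keeps ‖η‖ ≥ 1/2 for all parameters in the ball, including those off the unit
    -- sphere; the radius ε keeps (0, y) where the conormal representation is valid.
    refine ⟨Metric.ball θ₀ (min (1 / 2) D.ε), Metric.isOpen_ball,
      Metric.mem_ball_self (lt_min one_half_pos D.ε_pos), D.χ₁, D.bscSymbol, D.bscResidual,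
      D.isRatioCutoff, D.isBscSymbolFamily hη (min_le_left _ _),
      D.isBscResidualFamily hη (min_le_left _ _), fun θ hθ => ?_⟩
    refine hquant D hθ.2.1 ?_ θ.2
    have h1 := mem_ball_iff_norm.1 hθ.1
    have h2 : pt 0 θ.1 - pt 0 θ₀.1 = pt 0 (θ.1 - θ₀.1) := by
      rw [sub_eq_iff_eq_add, ← pt_add]
      simp
    rw [mem_ball_iff_norm, h2, norm_pt_zero_left]
    exact (norm_fst_le (θ - θ₀)).trans_lt (h1.trans_le (min_le_right _ _))
  · rintro y hy ⟨a, ha, c, hc, C, hell⟩ η hη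
    -- The data are built from the representation whose symbol is assumed to be elliptic, so the
    -- lower bound concerns the symbol of D itself.
    obtain ⟨D, rfl⟩ := ha.exists_frontData
    exact D.isBscElliptic hη hc hell (D.hasBscSymbol (θ := (y, η)) hη
      (hquant D hy (Metric.mem_ball_self D.ε_pos) η))
  · intro y hy
    obtain ⟨D⟩ := hD y hy
    obtain ⟨I, hI⟩ := D.exists_isIndicialOperator
    refine ⟨I, fun η hη => ?_⟩
    obtain ⟨κ, hκ, -, F, hF, hFg⟩ :=
      D.exists_isReducedNormalOperator hy (Metric.mem_ball_self D.ε_pos) η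
    rw [← hκ.unique (hN y hy η)]
    exact hI η κ F hF hFg
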